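/- Let $k\ge 1$ be an integer and let $T,R>0$. Coordinates on $[0,T]\times[0,\tfrac1R]\times S^2$ are $(\tau,z,x)$; put $\Omega_T=(0,T)\times(0,\tfrac1R)\times S^2$, $\Sigma_0=\{\tau=0,\ 0\le z\le\tfrac1R\}$, $\mathcal T=\{z=\tfrac1R,\ 0\le\tau\le T\}$, $S_{0,\mu}=\{\tau=0,\ z=\mu\}$. Let $g$ be a Lorentzian metric of the form $$g=-z^2V\,d\tau^2+2\,d\tau\,dz+e^{-2\eta}h_{AB}(dx^A-U^Ad\tau)(dx^B-U^Bd\tau),$$ whose coefficients $z^2V,\eta,U,h$ are of class $C^{2k-1}$ up to the boundary (including $z=0$), where $h$ is a Riemannian metric on $S^2$ (depending on $\tau,z$) with the area element of the round metric, and where, for some $\Lambda<0$, as $z\to0$: $z^2V\to-\Lambda/3$, $U/z\to0$, $\eta\to0$ and $h\to g_{S^2}$ (this is the conformal metric of an asymptotically anti-de Sitter spacetime in Bondi–Sachs coordinates, $z=1/r$). Let $\omega$ be a function of class $C^{2k-2}$ up to the boundary. Assume that $\mathcal T$ is timelike, i.e. $z^2V>0$ on $\mathcal T$. For $0\le\mu<\tfrac1R$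 let $H_\mu$ be the ingoing null cone generated by the null geodesics $\gamma$ with $\gamma(0)\in S_{0,\mu}$ and $\dot\gamma(0)=N_2:=-(\partial_\tau+\tfrac12z^2V\partial_z+U^A\partial_A)$. Put $\mathcal H=H_0$ and $\mathcal M_1=\bigcup_{0<\mu<1/R}H_\mu$. Assume that $\mathcal H$ is a regular null hypersurface, nowhere tangent to $\partial_z$, that bounds $\mathcal M_1$ in $\Omega_T$: it is a $C^1$ graph $z=Z(\tau,x)$ with null conormal, and $\mathcal M_1\cap\Omega_T=\{(\tau,z,x)\in\Omega_T: z>Z(\tau,x)\}$. Let $\varphi$ (a function of $(z,x)$ on $\Sigma_0$) and $\psi_1$ (a function of $(\tau,x)$ on $\mathcal T$) be of class $C^{2k}$ in the interior of $\Sigma_0$ and of $\mathcal T$, and let $v$, of class $C^{2k}$ on $\overline{\mathcal M_1\cap\Omega_T}\setminus\mathcal H$, satisfy $$\Box_g v+\omega v=0\ \text{ in }\mathcal M_1\cap\Omega_T,\qquad v=\varphi \text{ on }\Sigma_0,\qquad v=\psi_1\text{ on }\mathcal T$$ (on the parts of $\Sigma_0$ and $\mathcal T$ that lie in $\overline{\mathcal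 M_1\cap\Omega_T}\setminus\mathcal H$). Then, in $[0,\infty]$, $$\|v\|_{H^k(\mathcal M_1\cap\Omega_T)}\le C\left(\|\varphi\|_{H^{2k}(\Sigma_0)}+\|\psi_1\|_{H^{2k}(\mathcal T)}\right).$$ Here $C$ depends only on $k$, $T$, $R$, an upper bound for $|g^{ij}|_{C^{2k-1}(\Omega_T)}$ and $|\omega|_{C^{2k-2}(\Omega_T)}$, and a positive lower bound for the non-degeneracy of the metric, namely for $e^{2\eta}$ on $[0,T]\times[0,\tfrac1R]\times S^2$ and for $z^2V$ on $\mathcal T$. -/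

import Mathlib

open MeasureTheory Set Filter Topology
open scoped NNReal ENNReal

noncomputable section

namespace NullTimelike

/-! ### Calculus on `P × S²`

Functions on `P × S²` (with `P = ℝ` or `P = ℝ × ℝ`) are given by their values at the pairs `(a, x)`
with `x` a unit vector of `ℝ³`; they are differentiated after being extended to `P × (ℝ³ \ {0})` as
functions that are homogeneous of degree `0` in the second variable. For such an extension the
ambient gradient at a unit vector is the gradient on the sphere, and the ambient divergence of an
extended tangent field is its divergence on the round sphere. -/

/-- Euclidean three-space, in which `S²` is the unit sphere. -/
abbrev E3 : Type := EuclideanSpace ℝ (Fin 3)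

/-- The radial projection `(a, y) ↦ (a, y / |y|)`. -/
def radial {P : Type*} (q : P × E3) : P × E3 := (q.1, ‖q.2‖⁻¹ • q.2)

/-- The cone `{(a, y) : y ≠ 0, (a, y / |y|) ∈ S}` over a subset `S` of `P × S²`. -/
def cone {P : Type*} (S : Set (P × E3)) : Set (P × E3) := {q | q.2 ≠ 0 ∧ radial q ∈ S}

section

variable {P : Type*} [NormedAddCommGroup P] [NormedSpace ℝ P]
variable {W : Type*} [NormedAddCommGroup W] [NormedSpace ℝ W]

/-- `f` is of class `C^n` on the subset `S` of `P × S²` (one-sided at boundary points). -/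
def SmoothOn (n : ℕ) (f : P × E3 → W) (S : Set (P × E3)) : Prop :=
  ContDiffOn ℝ n (f ∘ radial) (cone S)

/-- The `C^n` norm of `f` on an open subset `S` of `P × S²`. -/
def ckNorm (n : ℕ) (f : P × E3 → W) (S : Set (P × E3)) : ℝ≥0∞ :=
  ⨆ j ∈ Finset.range (n + 1), ⨆ q ∈ S, ‖iteratedFDeriv ℝ j (f ∘ radial) q‖ₑ

/-- The product of Lebesgue measure on `P` and the surface measure of `S²`. -/
def cylMeasure (P : Type*) [MeasureSpace P] : Measure (P × E3) :=
  ((volume : Measure P).prod (volume : Measure E3).toSphere).map (Prod.map id Subtype.val)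

/-- The Sobolev norm `∑_{j ≤ n} ‖∇^j f‖_{L²(S)}`, with values in `[0, ∞]`, of a function which is of
class `C^n` on the open subset `S` of `P × S²`. -/
def sobolevNorm [MeasureSpace P] (n : ℕ) (f : P × E3 → W) (S : Set (P × E3)) : ℝ≥0∞ :=
  ∑ j ∈ Finset.range (n + 1),
    eLpNorm (fun q => iteratedFDeriv ℝ j (f ∘ radial) q) 2 ((cylMeasure P).restrict S)

end

/-! ### The spacetime and its distinguished subsets -/

/-- Points `((τ, z), x)`; `x` is a unit vector. -/
abbrev Spacetime : Type := (ℝ × ℝ) × E3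

/-- The closed slab `[0, T] × [0, 1/R] × S²`. -/
def slab (T R : ℝ) : Set Spacetime :=
  {q | q.1.1 ∈ Icc 0 T ∧ q.1.2 ∈ Icc 0 (1 / R) ∧ ‖q.2‖ = 1}

/-- The open domain `Ω_T = (0, T) × (0, 1/R) × S²`. -/
def domainT (T R : ℝ) : Set Spacetime :=
  {q | q.1.1 ∈ Ioo 0 T ∧ q.1.2 ∈ Ioo 0 (1 / R) ∧ ‖q.2‖ = 1}

/-- The cylinder `(0, a) × S²`. -/
def cyl (a : ℝ) : Set (ℝ × E3) := {q | q.1 ∈ Ioo 0 a ∧ ‖q.2‖ = 1}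

/-! ### The conformal metric -/

/-- The coefficients of the metric
`g = - W dτ² + 2 dτ dz + e^{-2η} h_{AB} (dx^A - U^A dτ) (dx^B - U^B dτ)`, where `W = z² V`.
At the unit vector `x`, `U` is a vector of `ℝ³` tangent to the sphere, and `h` is the Gram matrix
of a symmetric bilinear form on `ℝ³` which has `x` in its kernel. -/
structure BondiMetric where
  W : Spacetime → ℝ
  η : Spacetime → ℝ
  U : Spacetime → E3
  h : Spacetime → Matrix (Fin 3) (Fin 3) ℝ

/-- The covectors `p` at a point. -/
abbrev Covector : Type := Spacetime →L[ℝ] ℝ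

/-- The matrix `x xᵀ`, the orthogonal projection to the normal of the sphere. -/
def normalProj (x : E3) : Matrix (Fin 3) (Fin 3) ℝ := Matrix.vecMulVec x.ofLp x.ofLp

namespace BondiMetric

variable (g : BondiMetric)

/-- The angular components `g^{AB} = e^{2η} h^{AB}` of the inverse metric; `h^{AB}` is the inverse of
`h` on the tangent plane of the sphere, extended by zero on the normal. -/
def invAng (q : Spacetime) : Matrix (Fin 3) (Fin 3) ℝ :=
  Real.exp (2 * g.η q) • ((g.h q + normalProj q.2)⁻¹ - normalProj q.2)

/-- Raising an index with `g`: the inverse metric has components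
`g^{ττ} = 0`, `g^{τz} = 1`, `g^{τA} = 0`, `g^{zz} = W`, `g^{zA} = U^A`, `g^{AB} = e^{2η} h^{AB}`. -/
def sharp (q : Spacetime) (p : Covector) : Spacetime :=
  ((p ((0, 1), 0),
    p ((1, 0), 0) + g.W q * p ((0, 1), 0) + p ((0, 0), g.U q)),
   p ((0, 1), 0) • g.U q +
    WithLp.toLp 2 (Matrix.mulVec (g.invAng q) fun i => p ((0, 0), EuclideanSpace.single i 1)))

/-- The wave operator `□ v = κ⁻¹ ∂_i (κ g^{ij} ∂_j v)`. Relative to `dτ dz` and the round area element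
the volume density of `g` is `κ = e^{-2η}`. The divergence is the trace of the derivative. -/
def box (v : Spacetime → ℝ) (q : Spacetime) : ℝ :=
  Real.exp (2 * g.η q) *
    LinearMap.trace ℝ Spacetime
      (fderiv ℝ
        ((fun q' => Real.exp (-2 * g.η q') • g.sharp q' (fderiv ℝ (v ∘ radial) q')) ∘ radial)
        q).toLinearMap

/-- The hypotheses on the metric on `[0, T] × [0, 1/R] × S²`: its components are `C^n` up to the
boundary, in particular up to conformal infinity `z = 0`; `h` is a Riemannian metric on `S²` with the
area element of the round metric; and, as `z = 1/r → 0`, `z² V → -Λ/3`, `r U → 0`, `η → 0` and `h`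
tends to the round metric. -/
structure IsAsymptoticallyAdS (Λ T R : ℝ) (n : ℕ) : Prop where
  smooth_W : SmoothOn n g.W (slab T R)
  smooth_η : SmoothOn n g.η (slab T R)
  smooth_U : SmoothOn n g.U (slab T R)
  smooth_h : ∀ i j, SmoothOn n (fun q => g.h q i j) (slab T R)
  tangent_U : ∀ q ∈ slab T R, inner ℝ q.2 (g.U q) = 0
  tangent_h : ∀ q ∈ slab T R, Matrix.mulVec (g.h q) q.2.ofLp = 0
  posDef_h : ∀ q ∈ slab T R, (g.h q + normalProj q.2).PosDef
  det_h : ∀ q ∈ slab T R, (g.h q + normalProj q.2).det = 1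
  W_infty : ∀ q ∈ slab T R, q.1.2 = 0 → g.W q = -Λ / 3
  η_infty : ∀ q ∈ slab T R, q.1.2 = 0 → g.η q = 0
  U_infty : ∀ q ∈ slab T R,
    Tendsto (fun z : ℝ => z⁻¹ • g.U ((q.1.1, z), q.2)) (𝓝[>] 0) (𝓝 0)
  h_infty : ∀ q ∈ slab T R, q.1.2 = 0 → g.h q = 1 - normalProj q.2

/-- The `C^n` norm on `S` of the components `g^{ij}` of the inverse metric (those that are not
constant). -/
def invNorm (n : ℕ) (S : Set Spacetime) : ℝ≥0∞ :=
  max (ckNorm n g.W S) (max (ckNorm n g.U S) (⨆ i, ⨆ j, ckNorm n (fun q => g.invAng q i j) S))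

/-! ### Null geodesics, the ingoing null cones and the region `M₁` -/

/-- The null vector field `N₂ = -(∂_τ + (1/2) W ∂_z + U^A ∂_A)`. -/
def N₂ (q : Spacetime) : Spacetime := ((-1, -(1 / 2) * g.W q), -g.U q)

/-- `γ` is a geodesic of `g` in the slab, defined on the interval `I`, and `p` is its velocity
covector: `γ'^i = g^{ij} p_j` and `p_i' = -(1/2) ∂_i g^{jl} p_j p_l`, which is the geodesic equation
`d/dt (g_{ij} γ'^j) = (1/2) ∂_i g_{jl} γ'^j γ'^l`. The component of `p` that is normal to the sphere
has no influence on `γ`. -/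
structure IsGeodesic (T R : ℝ) (I : Set ℝ) (γ : ℝ → Spacetime) (p : ℝ → Covector) : Prop where
  ordConnected : I.OrdConnected
  mem_slab : ∀ t ∈ I, γ t ∈ slab T R
  velocity : ∀ t ∈ I, HasDerivWithinAt γ (g.sharp (γ t) (p t)) I t
  momentum : ∀ t ∈ I, HasDerivWithinAt p
    (-(1 / 2 : ℝ) •
      fderivWithin ℝ ((fun q => p t (g.sharp q (p t))) ∘ radial) (cone (slab T R)) (γ t)) I t

/-- The ingoing null cone `H_μ` in the slab: all points on geodesics `γ` that start with `γ(0)` on the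
sphere `S_{0,μ} = {τ = 0, z = μ}` and `γ'(0) = N₂`. (`N₂` points to decreasing `τ`, so that the
part in `τ > 0` belongs to negative parameters.) -/
def nullCone (T R μ : ℝ) : Set Spacetime :=
  {q | ∃ (I : Set ℝ) (γ : ℝ → Spacetime) (p : ℝ → Covector) (x : E3) (t : ℝ),
    g.IsGeodesic T R I γ p ∧ 0 ∈ I ∧ γ 0 = ((0, μ), x) ∧
      g.sharp (γ 0) (p 0) = g.N₂ (γ 0) ∧ t ∈ I ∧ γ t = q}

/-- The hypersurface `ℋ = H_0`, in the slab. -/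
def horizon (T R : ℝ) : Set Spacetime := g.nullCone T R 0

/-- The domain `M₁ ∩ Ω_T`, where `M₁` is the union of the `H_μ` with `0 < μ < 1/R`. -/
def region (T R : ℝ) : Set Spacetime :=
  (⋃ μ ∈ Ioo 0 (1 / R), g.nullCone T R μ) ∩ domainT T R

/-- `ℋ` is a regular null hypersurface that is nowhere tangent to `N₁ = ∂_z`, and it is the boundary
of `M₁` in `Ω_T`: it is a `C¹` graph `z = Z(τ, x)` with null conormal `dz - dZ`, and `M₁ ∩ Ω_T` is the
set of the points of `Ω_T` on the side `z > Z(τ, x)`. -/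
def HasRegularHorizon (T R : ℝ) : Prop :=
  ∃ Z : ℝ × E3 → ℝ,
    SmoothOn 1 Z {a | a.1 ∈ Icc 0 T ∧ ‖a.2‖ = 1} ∧
    (∀ q ∈ slab T R, q ∈ g.horizon T R ↔ q.1.2 = Z (q.1.1, q.2)) ∧
    (∀ q ∈ domainT T R, q ∈ g.region T R ↔ Z (q.1.1, q.2) < q.1.2) ∧
    ∀ q ∈ g.horizon T R, ∀ p : Covector,
      p = fderivWithin ℝ ((fun q' : Spacetime => q'.1.2 - Z (q'.1.1, q'.2)) ∘ radial)
        (cone (slab T R)) q →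
      p (g.sharp q p) = 0

/-- The closure of `M₁ ∩ Ω_T` without `ℋ`; it contains the parts of `Σ_0` and of `{z = 1/R}` that
bound `M₁ ∩ Ω_T`. -/
def regionBar (T R : ℝ) : Set Spacetime := closure (g.region T R) \ g.horizon T R

end BondiMetric

/-- `v` is a classical solution, of class `C^n` up to the boundary parts on `Σ_0 = {τ = 0}` and on
`{z = 1/R}`, of `□ v + ω v = 0` in `M₁ ∩ Ω_T` with `v = φ` on `Σ_0` and `v = ψ` on `{z = 1/R}`. -/
structure IsSolution (g : BondiMetric) (T R : ℝ) (n : ℕ) (ω : Spacetime → ℝ) (φ ψ : ℝ × E3 → ℝ)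
    (v : Spacetime → ℝ) : Prop where
  smooth : SmoothOn n v (g.regionBar T R)
  equation : ∀ q ∈ g.region T R, g.box v q + ω q * v q = 0
  initial : ∀ q ∈ g.regionBar T R, q.1.1 = 0 → v q = φ (q.1.2, q.2)
  boundary : ∀ q ∈ g.regionBar T R, q.1.2 = 1 / R → v q = ψ (q.1.1, q.2)

end NullTimelike

end

open MeasureTheory Set Filter Topology
open scoped NNReal ENNReal Pointwise
noncomputable section
set_option linter.unusedSectionVars false
namespace NullTimelike

section

/-! ### The frame of vector fields -/

/-- The closed slab `[0, T] × [0, b] × (ℝ³ \ {0})`. -/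
def slabCone (T b : ℝ) : Set Spacetime := {q | q.1.1 ∈ Icc 0 T ∧ q.1.2 ∈ Icc 0 b ∧ q.2 ≠ 0}

/-- The matrix of the cross product with the `k`-th basis vector. -/
def crossMatrix : Fin 3 → Matrix (Fin 3) (Fin 3) ℝ :=
  ![!![0, 0, 0; 0, 0, -1; 0, 1, 0], !![0, 0, 1; 0, 0, 0; -1, 0, 0], !![0, -1, 0; 1, 0, 0; 0, 0, 0]]

/-- The rotation field `y ↦ e_k × y`. -/
def rotField (k : Fin 3) : E3 →L[ℝ] E3 :=
  LinearMap.toContinuousLinearMap (Matrix.toEuclideanLin (crossMatrix k))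

lemma rotField_apply (k i : Fin 3) (y : E3) :
    rotField k y i = ∑ j, crossMatrix k i j * y j := by
  simp [rotField, Matrix.toEuclideanLin, Matrix.toLpLin_apply, Matrix.mulVec, dotProduct]

/-- The linear parts of the frame. -/
def frameLin : Fin 5 → Spacetime →L[ℝ] Spacetime :=
  ![0, 0,
    (ContinuousLinearMap.inr ℝ (ℝ × ℝ) E3).comp
      ((rotField 0).comp (ContinuousLinearMap.snd ℝ (ℝ × ℝ) E3)),
    (ContinuousLinearMap.inr ℝ (ℝ × ℝ) E3).comp
      ((rotField 1).comp (ContinuousLinearMap.snd ℝ (ℝ × ℝ) E3)),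
    (ContinuousLinearMap.inr ℝ (ℝ × ℝ) E3).comp
      ((rotField 2).comp (ContinuousLinearMap.snd ℝ (ℝ × ℝ) E3))]

/-- The constant parts of the frame. -/
def frameConst : Fin 5 → Spacetime := ![((1, 0), 0), ((0, 1), 0), 0, 0, 0]

/-- The frame `∂_τ`, `∂_z` and the three rotation fields. -/
def frame (i : Fin 5) (q : Spacetime) : Spacetime := frameConst i + frameLin i q

/-- The structure constants of the frame. -/
def structConst (i j k : Fin 5) : ℝ :=
  if (i : ℕ) < 2 ∨ (j : ℕ) < 2 ∨ (k : ℕ) < 2 then 0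
  else (((i : ℕ) : ℝ) - (j : ℕ)) * (((k : ℕ) : ℝ) - (i : ℕ)) * (((k : ℕ) : ℝ) - (j : ℕ)) / 2

lemma frame_zero (q : Spacetime) : frame 0 q = ((1, 0), 0) := by
  simp [frame, frameConst, frameLin]

lemma frame_one (q : Spacetime) : frame 1 q = ((0, 1), 0) := by
  simp [frame, frameConst, frameLin]

lemma frame_two (q : Spacetime) : frame 2 q = (0, rotField 0 q.2) := by
  simp [frame, frameConst, frameLin]

lemma frame_three (q : Spacetime) : frame 3 q = (0, rotField 1 q.2) := by
  simp [frame, frameConst, frameLin]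

lemma frame_four (q : Spacetime) : frame 4 q = (0, rotField 2 q.2) := by
  simp [frame, frameConst, frameLin]

lemma frameLin_eq (i : Fin 5) (q : Spacetime) :
    frameLin i q = ![0, 0, (0, rotField 0 q.2), (0, rotField 1 q.2), (0, rotField 2 q.2)] i := by
  fin_cases i <;> simp [frameLin]

lemma frame_eq (i : Fin 5) (q : Spacetime) :
    frame i q = ![((1, 0), 0), ((0, 1), 0), (0, rotField 0 q.2), (0, rotField 1 q.2),
      (0, rotField 2 q.2)] i := by
  fin_cases i
  exacts [frame_zero q, frame_one q, frame_two q, frame_three q, frame_four q]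

lemma rotField_coord (k : Fin 3) (y : E3) :
    rotField k y = ![!₂[0, -y 2, y 1], !₂[y 2, 0, -y 0], !₂[-y 1, y 0, 0]] k := by
  ext m
  rw [rotField_apply, Fin.sum_univ_three]
  fin_cases k <;> fin_cases m <;> simp [crossMatrix]

lemma frame_bracket (i j : Fin 5) (q : Spacetime) :
    frameLin j (frame i q) - frameLin i (frame j q) = ∑ k, structConst i j k • frame k q := by
  simp only [frameLin_eq, frame_eq, Fin.sum_univ_five, rotField_coord]
  refine Prod.ext ?_ ?_
  · fin_cases i <;> fin_cases j <;> simp [structConst]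
  · ext m
    fin_cases i <;> fin_cases j <;> simp [structConst] <;> fin_cases m <;> simp <;> norm_num

lemma contDiff_frame (i : Fin 5) {n : WithTop ℕ∞} : ContDiff ℝ n (frame i) :=
  contDiff_const.add (frameLin i).contDiff

variable {T b : ℝ}

lemma slabCone_eq : slabCone T b = (Icc 0 T ×ˢ Icc 0 b) ×ˢ ({0}ᶜ : Set E3) := by
  ext q; simp only [slabCone, mem_ofPred_eq, mem_prod, mem_compl_iff, mem_singleton_iff, and_assoc]

variable [hT : Fact (0 < T)] [hb : Fact (0 < b)]

lemma uniqueDiffOn_slabCone : UniqueDiffOn ℝ (slabCone T b) := by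
  rw [slabCone_eq]
  exact ((uniqueDiffOn_Icc hT.out).prod (uniqueDiffOn_Icc hb.out)).prod
    isOpen_compl_singleton.uniqueDiffOn

lemma slabCone_subset_closure : slabCone T b ⊆ closure (interior (slabCone T b)) := by
  rw [slabCone_eq, interior_prod_eq, interior_prod_eq, interior_Icc, interior_Icc,
    isOpen_compl_singleton.interior_eq, closure_prod_eq, closure_prod_eq,
    closure_Ioo hT.out.ne, closure_Ioo hb.out.ne]
  exact prod_mono le_rfl subset_closure

variable (T b) in
/-- Relatively open subsets of the slab. -/
def RelOpen (S : Set Spacetime) : Prop := ∃ O, IsOpen O ∧ S = slabCone T b ∩ O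

lemma relOpen_slabCone : RelOpen T b (slabCone T b) := ⟨univ, isOpen_univ, by simp⟩

lemma RelOpen.subset {S : Set Spacetime} (h : RelOpen T b S) : S ⊆ slabCone T b := by
  obtain ⟨O, -, rfl⟩ := h; exact inter_subset_left

lemma RelOpen.mem_nhdsWithin {S : Set Spacetime} (h : RelOpen T b S) {q} (hq : q ∈ S) :
    S ∈ 𝓝[slabCone T b] q := by
  obtain ⟨O, hO, rfl⟩ := h
  exact inter_mem_nhdsWithin _ (hO.mem_nhds hq.2)

lemma RelOpen.inter {S S' : Set Spacetime} (h : RelOpen T b S) (h' : RelOpen T b S') :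
    RelOpen T b (S ∩ S') := by
  obtain ⟨O, hO, rfl⟩ := h
  obtain ⟨O', hO', rfl⟩ := h'
  exact ⟨O ∩ O', hO.inter hO', by ext; simp; tauto⟩

lemma RelOpen.uniqueDiffOn {S : Set Spacetime} (h : RelOpen T b S) : UniqueDiffOn ℝ S := by
  obtain ⟨O, hO, rfl⟩ := h
  exact uniqueDiffOn_slabCone.inter hO

lemma RelOpen.fderivWithin_eq {S : Set Spacetime} (h : RelOpen T b S) {q} (hq : q ∈ S)
    {F : Type*} [NormedAddCommGroup F] [NormedSpace ℝ F] (f : Spacetime → F) :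
    fderivWithin ℝ f S q = fderivWithin ℝ f (slabCone T b) q := by
  obtain ⟨O, hO, rfl⟩ := h
  exact fderivWithin_inter (hO.mem_nhds hq.2)

variable (T b) in
/-- The derivative along the `i`-th vector field of the frame. -/
def D (i : Fin 5) (f : Spacetime → ℝ) (q : Spacetime) : ℝ :=
  fderivWithin ℝ f (slabCone T b) q (frame i q)

variable (T b) in
/-- Iterated derivatives along the frame. -/
def Dw : List (Fin 5) → (Spacetime → ℝ) → Spacetime → ℝ
  | [], f => f
  | i :: w, f => D T b i (Dw w f)

@[simp] lemma Dw_nil (f : Spacetime → ℝ) : Dw T b [] f = f := rfl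
@[simp] lemma Dw_cons (i : Fin 5) (w) (f : Spacetime → ℝ) :
    Dw T b (i :: w) f = D T b i (Dw T b w f) := rfl

lemma Dw_append (w w') (f : Spacetime → ℝ) : Dw T b (w ++ w') f = Dw T b w (Dw T b w' f) := by
  induction w with
  | nil => rfl
  | cons i w ih => simp [ih]

section Rules

variable {S : Set Spacetime} {f g : Spacetime → ℝ} {q : Spacetime}

lemma diffWithin_of_contDiffOn {n : ℕ} (hf : ContDiffOn ℝ n f S) (hS : RelOpen T b S) (hn : n ≠ 0)
    (hq : q ∈ S) : DifferentiableWithinAt ℝ f (slabCone T b) q :=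
  ((hf.differentiableOn (by exact_mod_cast hn)) q hq).mono_of_mem_nhdsWithin
    (hS.mem_nhdsWithin hq)

lemma D_congr (hS : RelOpen T b S) (h : EqOn f g S) (hq : q ∈ S) (i : Fin 5) :
    D T b i f q = D T b i g q := by
  unfold D
  rw [Filter.EventuallyEq.fderivWithin_eq (f := g) (f₁ := f) _ (h hq)]
  exact h.eventuallyEq_of_mem (hS.mem_nhdsWithin hq)

lemma D_add (hf : DifferentiableWithinAt ℝ f (slabCone T b) q)
    (hg : DifferentiableWithinAt ℝ g (slabCone T b) q) (hq : q ∈ slabCone T b) (i : Fin 5) :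
    D T b i (fun q => f q + g q) q = D T b i f q + D T b i g q := by
  unfold D
  rw [fderivWithin_fun_add (uniqueDiffOn_slabCone q hq) hf hg]
  rfl

lemma D_sub (hf : DifferentiableWithinAt ℝ f (slabCone T b) q)
    (hg : DifferentiableWithinAt ℝ g (slabCone T b) q) (hq : q ∈ slabCone T b) (i : Fin 5) :
    D T b i (fun q => f q - g q) q = D T b i f q - D T b i g q := by
  unfold D
  rw [fderivWithin_fun_sub (uniqueDiffOn_slabCone q hq) hf hg]
  rfl

lemma D_mul (hf : DifferentiableWithinAt ℝ f (slabCone T b) q)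
    (hg : DifferentiableWithinAt ℝ g (slabCone T b) q) (hq : q ∈ slabCone T b) (i : Fin 5) :
    D T b i (fun q => f q * g q) q = f q * D T b i g q + D T b i f q * g q := by
  unfold D
  rw [fderivWithin_fun_mul (uniqueDiffOn_slabCone q hq) hf hg]
  simp; ring

lemma D_sum {κ : Type*} (s : Finset κ) (F : κ → Spacetime → ℝ)
    (hf : ∀ j ∈ s, DifferentiableWithinAt ℝ (F j) (slabCone T b) q) (hq : q ∈ slabCone T b)
    (i : Fin 5) :
    D T b i (fun q => ∑ j ∈ s, F j q) q = ∑ j ∈ s, D T b i (F j) q := by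
  unfold D
  rw [fderivWithin_fun_sum (uniqueDiffOn_slabCone q hq) hf]
  simp

lemma D_const (c : ℝ) (i : Fin 5) : D T b i (fun _ => c) q = 0 := by
  simp [D]

lemma D_comp {h : ℝ → ℝ} {h' : ℝ} (hh : HasDerivAt h h' (f q))
    (hf : DifferentiableWithinAt ℝ f (slabCone T b) q) (hq : q ∈ slabCone T b) (i : Fin 5) :
    D T b i (fun q => h (f q)) q = h' * D T b i f q := by
  unfold D
  have := (hh.comp_hasFDerivWithinAt q hf.hasFDerivWithinAt).fderivWithin
    (uniqueDiffOn_slabCone q hq)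
  rw [show (fun q => h (f q)) = h ∘ f from rfl, this]
  simp

lemma contDiffOn_D (hS : RelOpen T b S) {n : ℕ} (hf : ContDiffOn ℝ (n + 1 : ℕ) f S) (i : Fin 5) :
    ContDiffOn ℝ n (D T b i f) S := by
  have h1 : ContDiffOn ℝ n (fderivWithin ℝ f S) S :=
    hf.fderivWithin hS.uniqueDiffOn (by exact_mod_cast le_rfl)
  have h2 := h1.clm_apply (contDiff_frame i (n := n)).contDiffOn
  exact h2.congr fun q hq => by simp only [D, hS.fderivWithin_eq hq]

lemma contDiffOn_Dw (hS : RelOpen T b S) (w : List (Fin 5)) {n : ℕ} :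
    ∀ {f : Spacetime → ℝ}, ContDiffOn ℝ (n + w.length : ℕ) f S → ContDiffOn ℝ n (Dw T b w f) S := by
  induction w generalizing n with
  | nil => intro f hf; simpa using hf
  | cons i w ih =>
    intro f hf
    refine contDiffOn_D hS (ih (n := n + 1) ?_) i
    convert hf using 2
    simp; ring

lemma D_comm (hS : RelOpen T b S) (hf : ContDiffOn ℝ (2 : ℕ) f S) (hq : q ∈ S) (i j : Fin 5) :
    D T b i (D T b j f) q =
      D T b j (D T b i f) q + ∑ k, structConst i j k * D T b k f q := by
  have hK := hS.subset hq
  have hu := uniqueDiffOn_slabCone (T := T) (b := b) q hK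
  have hfw : ContDiffWithinAt ℝ 2 f (slabCone T b) q :=
    (hf q hq).mono_of_mem_nhdsWithin (hS.mem_nhdsWithin hq)
  have hsymm : IsSymmSndFDerivWithinAt ℝ f (slabCone T b) q :=
    hfw.isSymmSndFDerivWithinAt (by simp) uniqueDiffOn_slabCone (slabCone_subset_closure hK) hK
  have hd : DifferentiableWithinAt ℝ (fderivWithin ℝ f (slabCone T b)) (slabCone T b) q :=
    (hfw.fderivWithin_right (m := 1) uniqueDiffOn_slabCone le_rfl hK).differentiableWithinAt
      one_ne_zero
  have key : ∀ i j : Fin 5, D T b i (D T b j f) q =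
      fderivWithin ℝ (fderivWithin ℝ f (slabCone T b)) (slabCone T b) q (frame i q) (frame j q) +
        fderivWithin ℝ f (slabCone T b) q (frameLin j (frame i q)) := by
    intro i j
    have hfr : HasFDerivWithinAt (frame j) (frameLin j) (slabCone T b) q :=
      ((frameLin j).hasFDerivWithinAt).const_add _
    have := (hd.hasFDerivWithinAt.clm_apply hfr).fderivWithin hu
    change fderivWithin ℝ (fun q' => fderivWithin ℝ f (slabCone T b) q' (frame j q'))
      (slabCone T b) q (frame i q) = _
    rw [this]
    simp [add_comm]
  rw [key i j, key j i, hsymm.eq (frame i q) (frame j q)]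
  have hbr := congrArg (fderivWithin ℝ f (slabCone T b) q) (frame_bracket i j q)
  rw [map_sub, map_sum] at hbr
  simp only [map_smul, smul_eq_mul] at hbr
  simp only [D]
  linarith

lemma structConst_eq_zero_left {i : Fin 5} (hi : (i : ℕ) < 2) (j k : Fin 5) :
    structConst i j k = 0 := by simp [structConst, hi]

lemma structConst_eq_zero_third {i : Fin 5} (hi : (i : ℕ) < 2) (j k : Fin 5) :
    structConst j k i = 0 := by simp [structConst, hi]

lemma D_comm_of_lt (hS : RelOpen T b S) (hf : ContDiffOn ℝ (2 : ℕ) f S) (hq : q ∈ S) {i : Fin 5}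
    (hi : (i : ℕ) < 2) (j : Fin 5) :
    D T b i (D T b j f) q = D T b j (D T b i f) q := by
  rw [D_comm hS hf hq]
  simp [structConst_eq_zero_left hi]

/-- Derivatives in `τ` and `z` may be moved to the front. -/
lemma Dw_erase (hS : RelOpen T b S) {a : Fin 5} (ha : (a : ℕ) < 2) (w : List (Fin 5)) (haw : a ∈ w)
    (hf : ContDiffOn ℝ w.length f S) : EqOn (Dw T b w f) (D T b a (Dw T b (w.erase a) f)) S := by
  induction w with
  | nil => simp at haw
  | cons j w ih =>
    by_cases hja : j = a
    · subst hja; simp [EqOn]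
    · have haw' : a ∈ w := by simpa [Ne.symm hja] using haw
      have hl : (w.erase a).length + 1 = w.length := by
        rw [List.length_erase_of_mem haw']
        have := List.length_pos_of_mem haw'
        omega
      intro q hq
      rw [Dw_cons, D_congr hS (ih haw' (hf.of_le (by simp))) hq, List.erase_cons_tail (by simpa using hja),
        Dw_cons, D_comm_of_lt hS _ hq ha]
      apply contDiffOn_Dw hS
      convert hf using 2
      simp; omega

end Rules

end

section

variable {T b : ℝ} [hT : Fact (0 < T)] [hb : Fact (0 < b)]

/-! ### Uniformly dominated families -/

section Dominated

variable {ι : Type*}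

variable (T b) in
/-- `Dom S wt J n m F`: the functions `F i` are of class `C^n` on `S i`, and, on the unit sphere and
uniformly in `i`, each derivative of order at most `n` along the frame is dominated by `J m'`,
where `m'` is `m` plus the weight of that derivative. -/
def Dom (S : ι → Set Spacetime) (wt : Fin 5 → ℕ) (J : ℕ → ι → Spacetime → ℝ) :
    ℕ → ℕ → (ι → Spacetime → ℝ) → Prop
  | 0, m, F => (∀ i, ContDiffOn ℝ (0 : ℕ) (F i) (S i)) ∧
      ∃ C : ℝ, 0 ≤ C ∧ ∀ i, ∀ q ∈ S i, ‖q.2‖ = 1 → |F i q| ≤ C * J m i q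
  | n + 1, m, F => ((∀ i, ContDiffOn ℝ (n + 1 : ℕ) (F i) (S i)) ∧
      ∃ C : ℝ, 0 ≤ C ∧ ∀ i, ∀ q ∈ S i, ‖q.2‖ = 1 → |F i q| ≤ C * J m i q) ∧
      ∀ k, Dom S wt J n (m + wt k) fun i => D T b k (F i)

variable (T b) in
/-- Families that are bounded in `C^n`, uniformly. -/
def UB (S : ι → Set Spacetime) (n : ℕ) (F : ι → Spacetime → ℝ) : Prop :=
  Dom T b S (fun _ => 0) (fun _ _ _ => 1) n 0 F

/-- A nonnegative monotone gauge. -/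
structure IsGauge (S : ι → Set Spacetime) (J : ℕ → ι → Spacetime → ℝ) : Prop where
  nonneg : ∀ m i q, 0 ≤ J m i q
  mono : ∀ m i q, J m i q ≤ J (m + 1) i q

lemma isGauge_one (S : ι → Set Spacetime) : IsGauge S (fun _ _ _ => (1 : ℝ)) :=
  ⟨fun _ _ _ => zero_le_one, fun _ _ _ => le_rfl⟩

variable {S : ι → Set Spacetime} {wt : Fin 5 → ℕ} {J : ℕ → ι → Spacetime → ℝ}

lemma Dom.contDiffOn {n m : ℕ} {F : ι → Spacetime → ℝ} (h : Dom T b S wt J n m F) (i : ι) :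
    ContDiffOn ℝ n (F i) (S i) := by
  cases n with
  | zero => exact h.1 i
  | succ n => exact h.1.1 i

lemma Dom.bound {n m : ℕ} {F : ι → Spacetime → ℝ} (h : Dom T b S wt J n m F) :
    ∃ C : ℝ, 0 ≤ C ∧ ∀ i, ∀ q ∈ S i, ‖q.2‖ = 1 → |F i q| ≤ C * J m i q := by
  cases n with
  | zero => exact h.2
  | succ n => exact h.1.2

lemma Dom.D {n m : ℕ} {F : ι → Spacetime → ℝ} (h : Dom T b S wt J (n + 1) m F) (k : Fin 5) :
    Dom T b S wt J n (m + wt k) fun i => D T b k (F i) := h.2 k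

lemma Dom.congr (hS : ∀ i, RelOpen T b (S i)) {n m : ℕ} {F H : ι → Spacetime → ℝ}
    (h : Dom T b S wt J n m F) (hFH : ∀ i, EqOn (F i) (H i) (S i)) : Dom T b S wt J n m H := by
  induction n generalizing m F H with
  | zero =>
    obtain ⟨h1, C, hC, h2⟩ := h
    exact ⟨fun i => (h1 i).congr fun q hq => (hFH i hq).symm, C, hC,
      fun i q hq hu => by rw [← hFH i hq]; exact h2 i q hq hu⟩
  | succ n ih =>
    obtain ⟨⟨h1, C, hC, h2⟩, h3⟩ := h
    exact ⟨⟨fun i => (h1 i).congr fun q hq => (hFH i hq).symm, C, hC,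
      fun i q hq hu => by rw [← hFH i hq]; exact h2 i q hq hu⟩,
      fun k => ih (h3 k) fun i q hq => D_congr (hS i) (hFH i) hq k⟩

lemma Dom.of_succ {n m : ℕ} {F : ι → Spacetime → ℝ} (h : Dom T b S wt J (n + 1) m F) :
    Dom T b S wt J n m F := by
  induction n generalizing m F with
  | zero => exact ⟨fun i => (h.1.1 i).of_le (by simp), h.1.2⟩
  | succ n ih =>
    exact ⟨⟨fun i => (h.1.1 i).of_le (by exact_mod_cast Nat.le_succ _), h.1.2⟩, fun k => ih (h.2 k)⟩

lemma Dom.of_le {n n' m : ℕ} {F : ι → Spacetime → ℝ} (h : Dom T b S wt J n m F) (hn : n' ≤ n) :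
    Dom T b S wt J n' m F := by
  induction n, hn using Nat.le_induction with
  | base => exact h
  | succ n _ ih => exact ih h.of_succ

lemma Dom.mono_succ (hJ : IsGauge S J) {n m : ℕ} {F : ι → Spacetime → ℝ}
    (h : Dom T b S wt J n m F) : Dom T b S wt J n (m + 1) F := by
  induction n generalizing m F with
  | zero =>
    obtain ⟨h1, C, hC, h2⟩ := h
    exact ⟨h1, C, hC, fun i q hq hu =>
      (h2 i q hq hu).trans (mul_le_mul_of_nonneg_left (hJ.mono m i q) hC)⟩
  | succ n ih =>
    obtain ⟨⟨h1, C, hC, h2⟩, h3⟩ := h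
    exact ⟨⟨h1, C, hC, fun i q hq hu =>
      (h2 i q hq hu).trans (mul_le_mul_of_nonneg_left (hJ.mono m i q) hC)⟩,
      fun k => by rw [add_right_comm]; exact ih (h3 k)⟩

lemma Dom.mono (hJ : IsGauge S J) {n m m' : ℕ} {F : ι → Spacetime → ℝ}
    (h : Dom T b S wt J n m F) (hm : m ≤ m') : Dom T b S wt J n m' F := by
  induction m', hm using Nat.le_induction with
  | base => exact h
  | succ n _ ih => exact ih.mono_succ hJ

lemma Dom.diff (hS : ∀ i, RelOpen T b (S i)) {n m : ℕ} {F : ι → Spacetime → ℝ}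
    (h : Dom T b S wt J (n + 1) m F) {i : ι} {q : Spacetime} (hq : q ∈ S i) :
    DifferentiableWithinAt ℝ (F i) (slabCone T b) q :=
  diffWithin_of_contDiffOn (h.contDiffOn i) (hS i) n.succ_ne_zero hq

lemma Dom.add (hS : ∀ i, RelOpen T b (S i)) {n m : ℕ} {F H : ι → Spacetime → ℝ}
    (h : Dom T b S wt J n m F) (h' : Dom T b S wt J n m H) :
    Dom T b S wt J n m fun i q => F i q + H i q := by
  have key : ∃ C : ℝ, 0 ≤ C ∧ ∀ i, ∀ q ∈ S i, ‖q.2‖ = 1 → |F i q + H i q| ≤ C * J m i q := by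
    obtain ⟨C, hC, h1⟩ := h.bound
    obtain ⟨C', hC', h1'⟩ := h'.bound
    exact ⟨C + C', by positivity, fun i q hq hu => (abs_add_le _ _).trans
      (by linarith [h1 i q hq hu, h1' i q hq hu])⟩
  induction n generalizing m F H with
  | zero => exact ⟨fun i => (h.1 i).add (h'.1 i), key⟩
  | succ n ih =>
    refine ⟨⟨fun i => (h.1.1 i).add (h'.1.1 i), key⟩, fun k => ?_⟩
    have hk := ih (h.2 k) (h'.2 k) (by
      obtain ⟨C, hC, h1⟩ := (h.2 k).bound
      obtain ⟨C', hC', h1'⟩ := (h'.2 k).bound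
      exact ⟨C + C', by positivity, fun i q hq hu => (abs_add_le _ _).trans
        (by linarith [h1 i q hq hu, h1' i q hq hu])⟩)
    exact hk.congr hS fun i q hq =>
      (D_add (h.diff hS hq) (h'.diff hS hq) ((hS i).subset hq) k).symm

lemma Dom.zero (hS : ∀ i, RelOpen T b (S i)) {n m : ℕ} :
    Dom T b S wt J n m fun _ _ => 0 := by
  have key : ∀ m, ∃ C : ℝ, 0 ≤ C ∧ ∀ i, ∀ q ∈ S i, ‖q.2‖ = 1 → |(0 : ℝ)| ≤ C * J m i q :=
    fun m => ⟨0, le_rfl, by simp⟩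
  induction n generalizing m with
  | zero => exact ⟨fun i => contDiffOn_const, key m⟩
  | succ n ih =>
    exact ⟨⟨fun i => contDiffOn_const, key m⟩, fun k => (ih (m := m + wt k)).congr hS
      fun i q hq => (D_const 0 k).symm⟩

lemma Dom.sum (hS : ∀ i, RelOpen T b (S i)) {n m : ℕ} {κ : Type*}
    (s : Finset κ) {F : κ → ι → Spacetime → ℝ} (h : ∀ j ∈ s, Dom T b S wt J n m (F j)) :
    Dom T b S wt J n m fun i q => ∑ j ∈ s, F j i q := by
  classical
  induction s using Finset.induction_on with
  | empty => simpa using Dom.zero hS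
  | insert a s ha ih =>
    simp only [Finset.sum_insert ha]
    exact (h a (by simp)).add hS (ih fun j hj => h j (by simp [hj]))

lemma Dom.mul (hS : ∀ i, RelOpen T b (S i)) (hJ : IsGauge S J) {n m : ℕ}
    {F H : ι → Spacetime → ℝ} (h : UB T b S n F) (h' : Dom T b S wt J n m H) :
    Dom T b S wt J n m fun i q => F i q * H i q := by
  have key : ∀ {n m} {F H : ι → Spacetime → ℝ}, UB T b S n F → Dom T b S wt J n m H →
      ∃ C : ℝ, 0 ≤ C ∧ ∀ i, ∀ q ∈ S i, ‖q.2‖ = 1 → |F i q * H i q| ≤ C * J m i q := by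
    intro n m F H h h'
    obtain ⟨C, hC, h1⟩ := h.bound
    obtain ⟨C', hC', h1'⟩ := h'.bound
    refine ⟨C * C', by positivity, fun i q hq hu => ?_⟩
    rw [abs_mul, mul_assoc]
    exact mul_le_mul (by simpa using h1 i q hq hu) (h1' i q hq hu) (abs_nonneg _) hC
  induction n generalizing m F H with
  | zero => exact ⟨fun i => (h.1 i).mul (h'.1 i), key h h'⟩
  | succ n ih =>
    refine ⟨⟨fun i => (h.1.1 i).mul (h'.1.1 i), key h h'⟩, fun k => ?_⟩
    have h1 := ih (Dom.of_succ h) (h'.2 k)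
    have h2 := ih (h.2 k) ((Dom.of_succ h').mono hJ (Nat.le_add_right m (wt k)))
    exact (h1.add hS h2).congr hS fun i q hq =>
      (D_mul (Dom.diff hS h hq) (h'.diff hS hq) ((hS i).subset hq) k).symm

lemma Dom.const_mul (hS : ∀ i, RelOpen T b (S i)) {n m : ℕ} (c : ℝ) {H : ι → Spacetime → ℝ}
    (hJ : IsGauge S J) (h' : Dom T b S wt J n m H) :
    Dom T b S wt J n m fun i q => c * H i q := by
  refine Dom.mul hS hJ (F := fun _ _ => c) ?_ h'
  have key : ∀ m, ∃ C : ℝ, 0 ≤ C ∧ ∀ i, ∀ q ∈ S i, ‖q.2‖ = 1 →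
      |c| ≤ C * (fun _ _ _ => 1 : ℕ → ι → Spacetime → ℝ) m i q :=
    fun m => ⟨|c|, abs_nonneg c, by simp⟩
  cases n with
  | zero => exact ⟨fun i => contDiffOn_const, key 0⟩
  | succ n =>
    exact ⟨⟨fun i => contDiffOn_const, key 0⟩, fun k =>
      (Dom.zero hS).congr hS fun i q hq => (D_const c k).symm⟩

lemma UB.const (hS : ∀ i, RelOpen T b (S i)) (n : ℕ) (c : ℝ) : UB T b S n fun _ _ => c := by
  have key : ∀ m, ∃ C : ℝ, 0 ≤ C ∧ ∀ i, ∀ q ∈ S i, ‖q.2‖ = 1 →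
      |c| ≤ C * (fun _ _ _ => 1 : ℕ → ι → Spacetime → ℝ) m i q :=
    fun m => ⟨|c|, abs_nonneg c, by simp⟩
  cases n with
  | zero => exact ⟨fun i => contDiffOn_const, key 0⟩
  | succ n =>
    exact ⟨⟨fun i => contDiffOn_const, key 0⟩, fun k =>
      (Dom.zero hS).congr hS fun i q hq => (D_const c k).symm⟩

lemma UB.mul (hS : ∀ i, RelOpen T b (S i)) {n : ℕ} {F H : ι → Spacetime → ℝ}
    (h : UB T b S n F) (h' : UB T b S n H) : UB T b S n fun i q => F i q * H i q :=
  Dom.mul hS (isGauge_one S) h h'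

lemma UB.add (hS : ∀ i, RelOpen T b (S i)) {n : ℕ} {F H : ι → Spacetime → ℝ}
    (h : UB T b S n F) (h' : UB T b S n H) : UB T b S n fun i q => F i q + H i q :=
  Dom.add hS h h'

lemma UB.sum (hS : ∀ i, RelOpen T b (S i)) {n : ℕ} {κ : Type*}
    (s : Finset κ) {F : κ → ι → Spacetime → ℝ} (h : ∀ j ∈ s, UB T b S n (F j)) :
    UB T b S n fun i q => ∑ j ∈ s, F j i q :=
  Dom.sum hS s h

lemma UB.const_mul (hS : ∀ i, RelOpen T b (S i)) {n : ℕ} (c : ℝ) {H : ι → Spacetime → ℝ}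
    (h : UB T b S n H) : UB T b S n fun i q => c * H i q :=
  Dom.const_mul hS c (isGauge_one S) h

lemma UB.of_le {n n' : ℕ} {F : ι → Spacetime → ℝ} (h : UB T b S n F) (hn : n' ≤ n) :
    UB T b S n' F := Dom.of_le h hn

lemma UB.D {n : ℕ} {F : ι → Spacetime → ℝ} (h : UB T b S (n + 1) F) (k : Fin 5) :
    UB T b S n fun i => D T b k (F i) := Dom.D h k

lemma UB.bound {n : ℕ} {F : ι → Spacetime → ℝ} (h : UB T b S n F) :
    ∃ C : ℝ, 0 ≤ C ∧ ∀ i, ∀ q ∈ S i, ‖q.2‖ = 1 → |F i q| ≤ C := by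
  simpa using Dom.bound h

lemma UB.congr (hS : ∀ i, RelOpen T b (S i)) {n : ℕ} {F H : ι → Spacetime → ℝ}
    (h : UB T b S n F) (hFH : ∀ i, EqOn (F i) (H i) (S i)) : UB T b S n H :=
  Dom.congr hS h hFH

lemma Dom.restrict {n m : ℕ} {F : ι → Spacetime → ℝ}
    {S' : ι → Set Spacetime} (h : Dom T b S wt J n m F) (hSS : ∀ i, S' i ⊆ S i) :
    Dom T b S' wt J n m F := by
  induction n generalizing m F with
  | zero => exact ⟨fun i => (h.1 i).mono (hSS i), h.2.imp fun C hC =>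
      ⟨hC.1, fun i q hq hu => hC.2 i q (hSS i hq) hu⟩⟩
  | succ n ih =>
    exact ⟨⟨fun i => (h.1.1 i).mono (hSS i), h.1.2.imp fun C hC =>
      ⟨hC.1, fun i q hq hu => hC.2 i q (hSS i hq) hu⟩⟩, fun k => ih (h.2 k)⟩

lemma UB.restrict {n : ℕ} {F : ι → Spacetime → ℝ}
    {S' : ι → Set Spacetime} (h : UB T b S n F) (hSS : ∀ i, S' i ⊆ S i) : UB T b S' n F :=
  Dom.restrict h hSS

/-- Inverses of families that are bounded below. -/
lemma UB.inv (hS : ∀ i, RelOpen T b (S i)) {n : ℕ} {F : ι → Spacetime → ℝ} (h : UB T b S n F)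
    {c : ℝ} (hc : 0 < c) (hF : ∀ i, ∀ q ∈ S i, c ≤ F i q) : UB T b S n fun i q => (F i q)⁻¹ := by
  have hne : ∀ i, ∀ q ∈ S i, F i q ≠ 0 := fun i q hq => (hc.trans_le (hF i q hq)).ne'
  have key : ∃ C : ℝ, 0 ≤ C ∧ ∀ i, ∀ q ∈ S i, ‖q.2‖ = 1 →
      |(F i q)⁻¹| ≤ C * (fun _ _ _ => 1 : ℕ → ι → Spacetime → ℝ) 0 i q := by
    refine ⟨c⁻¹, by positivity, fun i q hq _ => ?_⟩
    rw [abs_of_pos (inv_pos.2 (hc.trans_le (hF i q hq))), mul_one]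
    exact inv_anti₀ hc (hF i q hq)
  induction n with
  | zero => exact ⟨fun i => (h.1 i).inv (hne i), key⟩
  | succ n ih =>
    refine ⟨⟨fun i => (h.1.1 i).inv (hne i), key⟩, fun k => ?_⟩
    have h1 := ih (h.of_le n.le_succ)
    have h2 := UB.const_mul hS (-1) (UB.mul hS (UB.mul hS h1 h1) (UB.D h k))
    refine UB.congr hS h2 fun i q hq => ?_
    have := D_comp (hasDerivAt_inv (hne i q hq)) (Dom.diff hS h hq) ((hS i).subset hq) k
    rw [this]
    field_simp

end Dominated

/-! ### Words and their weights -/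

/-- The words of length at most `n` in the frame. -/
def words : ℕ → Finset (List (Fin 5))
  | 0 => {[]}
  | n + 1 => insert [] ((Finset.univ ×ˢ words n).image fun p => p.1 :: p.2)

lemma mem_words {n : ℕ} {w : List (Fin 5)} : w ∈ words n ↔ w.length ≤ n := by
  induction n generalizing w with
  | zero => simp [words]
  | succ n ih =>
    cases w with
    | nil => simp [words]
    | cons i w => simp [words, ih]

/-- The weight of a word. -/
def weight (wt : Fin 5 → ℕ) (w : List (Fin 5)) : ℕ := (w.map wt).sum

@[simp] lemma weight_nil (wt : Fin 5 → ℕ) : weight wt [] = 0 := rfl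
@[simp] lemma weight_cons (wt : Fin 5 → ℕ) (i w) : weight wt (i :: w) = wt i + weight wt w := rfl

lemma length_le_weight {wt : Fin 5 → ℕ} (hwt : ∀ i, 1 ≤ wt i) (w : List (Fin 5)) :
    w.length ≤ weight wt w := by
  induction w with
  | nil => simp
  | cons i w ih => simp; have := hwt i; omega

lemma weight_one (w : List (Fin 5)) : weight (fun _ => 1) w = w.length := by
  induction w with
  | nil => simp
  | cons i w ih => simp [ih, add_comm]

lemma weight_erase (wt : Fin 5 → ℕ) {a : Fin 5} {w : List (Fin 5)} (h : a ∈ w) :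
    weight wt w = wt a + weight wt (w.erase a) := by
  induction w with
  | nil => simp at h
  | cons j w ih =>
    by_cases hj : j = a
    · subst hj; simp
    · rw [List.erase_cons_tail (by simpa using hj)]
      have : a ∈ w := by simpa [Ne.symm hj] using h
      simp [ih this]; ring

variable (T b) in
/-- The sum of the absolute values of the derivatives of weight at most `m`. -/
def jet (wt : Fin 5 → ℕ) (m : ℕ) (v : Spacetime → ℝ) (q : Spacetime) : ℝ :=
  ∑ w ∈ (words m).filter (fun w => weight wt w ≤ m), |Dw T b w v q|

lemma abs_Dw_le_jet {wt : Fin 5 → ℕ} (hwt : ∀ i, 1 ≤ wt i) {m : ℕ} {w : List (Fin 5)}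
    (hw : weight wt w ≤ m) (v : Spacetime → ℝ) (q : Spacetime) :
    |Dw T b w v q| ≤ jet T b wt m v q := by
  refine Finset.single_le_sum (f := fun w => |Dw T b w v q|) (fun _ _ => abs_nonneg _) ?_
  simp [mem_words, hw, (length_le_weight hwt w).trans hw]

lemma isGauge_jet {ι : Type*} (S : ι → Set Spacetime) (wt : Fin 5 → ℕ) (v : ι → Spacetime → ℝ) :
    IsGauge S fun m i => jet T b wt m (v i) := by
  refine ⟨fun m i q => Finset.sum_nonneg fun _ _ => abs_nonneg _, fun m i q => ?_⟩
  refine Finset.sum_le_sum_of_subset_of_nonneg (fun w hw => ?_) fun _ _ _ => abs_nonneg _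
  simp only [Finset.mem_filter, mem_words] at hw ⊢
  omega

lemma dom_Dw {ι : Type*} {S : ι → Set Spacetime} (hS : ∀ i, RelOpen T b (S i)) {wt : Fin 5 → ℕ}
    (hwt : ∀ i, 1 ≤ wt i) {v : ι → Spacetime → ℝ} {N : ℕ} (hv : ∀ i, ContDiffOn ℝ N (v i) (S i))
    (n : ℕ) (w : List (Fin 5)) (hn : n + w.length ≤ N) :
    Dom T b S wt (fun m i => jet T b wt m (v i)) n (weight wt w) fun i => Dw T b w (v i) := by
  have key : ∀ w : List (Fin 5), ∃ C : ℝ, 0 ≤ C ∧ ∀ i, ∀ q ∈ S i, ‖q.2‖ = 1 →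
      |Dw T b w (v i) q| ≤ C * jet T b wt (weight wt w) (v i) q :=
    fun w => ⟨1, zero_le_one, fun i q _ _ => by
      rw [one_mul]; exact abs_Dw_le_jet hwt le_rfl _ _⟩
  induction n generalizing w with
  | zero =>
    exact ⟨fun i => contDiffOn_Dw (hS i) w ((hv i).of_le (by exact_mod_cast hn)), key w⟩
  | succ n ih =>
    refine ⟨⟨fun i => contDiffOn_Dw (hS i) w ((hv i).of_le (by exact_mod_cast hn)), key w⟩,
      fun k => ?_⟩
    have := ih (k :: w) (by simp; omega)
    rwa [weight_cons, add_comm] at this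

end

section

variable {T b : ℝ} [hT : Fact (0 < T)] [hb : Fact (0 < b)]

/-! ### Families of wave equations -/

variable (T b) in
/-- The second order operator `∑ G_ij X_i X_j + ∑ β_j X_j`. -/
def waveOp (G : Fin 5 → Fin 5 → Spacetime → ℝ) (β : Fin 5 → Spacetime → ℝ) (u : Spacetime → ℝ)
    (q : Spacetime) : ℝ :=
  ∑ i, ∑ j, G i j q * D T b i (D T b j u) q + ∑ j, β j q * D T b j u q

/-- The surface measure of the unit sphere. -/
abbrev sphereMeasure : Measure (Metric.sphere (0 : E3) 1) := (volume : Measure E3).toSphere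

/-- A family of solutions of wave equations on parts `{ρ > 0}` of the slab, with uniform bounds for
the coefficients, and with data that are bounded by `A`. -/
structure WaveFamily (ι : Type*) (T b : ℝ) (m : ℕ) where
  ρ : ι → Spacetime → ℝ
  G : Fin 5 → Fin 5 → ι → Spacetime → ℝ
  β : Fin 5 → ι → Spacetime → ℝ
  ω : ι → Spacetime → ℝ
  v : ι → Spacetime → ℝ
  Φ : ι → Spacetime → ℝ
  Ψ : ι → Spacetime → ℝ
  A : ι → ℝ
  ρ_smooth : ∀ i, ContDiffOn ℝ (1 : ℕ) (ρ i) (slabCone T b)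
  ρ_z : ∀ i, ∀ q ∈ slabCone T b, 0 < ρ i q → 0 < D T b 1 (ρ i) q
  ρ_causal : ∀ i, ∀ q ∈ slabCone T b, ‖q.2‖ = 1 → 0 < ρ i q →
    ∑ k, ∑ l, G k l i q * D T b k (ρ i) q * D T b l (ρ i) q ≤ 0
  ρ_bot : ∀ i, ∀ q ∈ slabCone T b, q.1.2 = 0 → ρ i q ≤ 0
  ρ_init : ∀ i, ∀ q ∈ slabCone T b, q.1.1 = 0 → 0 < q.1.2 → 0 < ρ i q
  G_ub : ∀ k l, UB T b (fun _ => slabCone T b) (2 * m + 1) (G k l)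
  β_ub : ∀ k, UB T b (fun _ => slabCone T b) (2 * m) (β k)
  ω_ub : UB T b (fun _ => slabCone T b) (2 * m) ω
  G_symm : ∀ k l i, ∀ q ∈ slabCone T b, G k l i q = G l k i q
  G_zero_zero : ∀ i, ∀ q ∈ slabCone T b, G 0 0 i q = 0
  G_zero_one : ∀ i, ∀ q ∈ slabCone T b, G 0 1 i q = 1
  G_zero_ang : ∀ (k : Fin 3) i, ∀ q ∈ slabCone T b, G 0 k.succ.succ i q = 0
  G_ang : ∃ c : ℝ, 0 < c ∧ ∀ i, ∀ q ∈ slabCone T b, ‖q.2‖ = 1 → ∀ ξ : Fin 3 → ℝ,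
    ∑ k, q.2 k * ξ k = 0 →
      c * ∑ k, ξ k ^ 2 ≤ ∑ k, ∑ l, G k.succ.succ l.succ.succ i q * ξ k * ξ l
  G_bdry : ∃ c : ℝ, 0 < c ∧ ∀ i, ∀ q ∈ slabCone T b, ‖q.2‖ = 1 → q.1.2 = b → c ≤ G 1 1 i q
  v_smooth : ∀ i, ContDiffOn ℝ (2 * m + 2 : ℕ) (v i) {q | q ∈ slabCone T b ∧ 0 < ρ i q}
  v_eq : ∀ i, ∀ q ∈ slabCone T b, 0 < ρ i q →
    waveOp T b (fun k l => G k l i) (fun k => β k i) (v i) q + ω i q * v i q = 0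
  Φ_smooth : ∀ i, ContDiffOn ℝ (2 * m + 2 : ℕ) (Φ i) {q | q ∈ slabCone T b ∧ q.1.2 ∈ Ioo 0 b}
  Ψ_smooth : ∀ i, ContDiffOn ℝ (2 * m + 2 : ℕ) (Ψ i) {q | q ∈ slabCone T b ∧ q.1.1 ∈ Ioo 0 T}
  v_init : ∀ i, ∀ q ∈ slabCone T b, 0 < ρ i q → q.1.1 = 0 → v i q = Φ i q
  v_bdry : ∀ i, ∀ q ∈ slabCone T b, 0 < ρ i q → q.1.2 = b → v i q = Ψ i q
  Φ_bound : ∀ w : List (Fin 5), w.length ≤ 2 * m + 2 → ∃ C : ℝ, 0 ≤ C ∧ ∀ i,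
    ∫⁻ p, ENNReal.ofReal (Dw T b w (Φ i) ((0, p.1), p.2.1) ^ 2)
      ∂((volume.restrict (Ioo 0 b)).prod sphereMeasure) ≤ ENNReal.ofReal (C * A i ^ 2)
  Ψ_bound : ∀ w : List (Fin 5), w.length ≤ 2 * m + 2 → ∃ C : ℝ, 0 ≤ C ∧ ∀ i,
    ∫⁻ p, ENNReal.ofReal (Dw T b w (Ψ i) ((p.1, b), p.2.1) ^ 2)
      ∂((volume.restrict (Ioo 0 T)).prod sphereMeasure) ≤ ENNReal.ofReal (C * A i ^ 2)

namespace WaveFamily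

variable {ι : Type*} {m : ℕ} (F : WaveFamily ι T b m)

/-- The region where the solution is considered. -/
def S (i : ι) : Set Spacetime := {q | q ∈ slabCone T b ∧ 0 < F.ρ i q}

lemma S_relOpen (i : ι) : RelOpen T b (F.S i) := by
  obtain ⟨O, hO, h⟩ := (continuousOn_iff'.1 (F.ρ_smooth i).continuousOn) (Ioi 0) isOpen_Ioi
  refine ⟨O, hO, ?_⟩
  ext q
  have := Set.ext_iff.1 h q
  simp only [mem_inter_iff, mem_preimage, mem_Ioi, S, mem_ofPred_eq] at this ⊢
  tauto

lemma S_sub (i : ι) : F.S i ⊆ slabCone T b := fun _ h => h.1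

/-- The operator of the family. -/
def L (i : ι) (u : Spacetime → ℝ) : Spacetime → ℝ :=
  waveOp T b (fun k l => F.G k l i) (fun k => F.β k i) u

/-- The derivative of the sum of a product. -/
lemma D_waveOp {i : ι} {u : Spacetime → ℝ} (hu : ContDiffOn ℝ (3 : ℕ) u (F.S i)) (hm : 1 ≤ m)
    {q : Spacetime} (hq : q ∈ F.S i) (k : Fin 5) :
    D T b k (F.L i u) q =
      ∑ a, ∑ c, (F.G a c i q * D T b k (D T b a (D T b c u)) q +
        D T b k (F.G a c i) q * D T b a (D T b c u) q) +
      ∑ c, (F.β c i q * D T b k (D T b c u) q + D T b k (F.β c i) q * D T b c u q) := by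
  have hK := F.S_sub i hq
  have hS := F.S_relOpen i
  have d1 : ∀ c, DifferentiableWithinAt ℝ (D T b c u) (slabCone T b) q := fun c =>
    diffWithin_of_contDiffOn (contDiffOn_D hS hu c) hS (by norm_num) hq
  have d2 : ∀ a c, DifferentiableWithinAt ℝ (D T b a (D T b c u)) (slabCone T b) q := fun a c =>
    diffWithin_of_contDiffOn (contDiffOn_D hS (contDiffOn_D hS hu c) a) hS (by norm_num) hq
  have dG : ∀ a c, DifferentiableWithinAt ℝ (F.G a c i) (slabCone T b) q := fun a c =>
    diffWithin_of_contDiffOn (Dom.contDiffOn (F.G_ub a c) i) relOpen_slabCone (by omega) hK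
  have dβ : ∀ c, DifferentiableWithinAt ℝ (F.β c i) (slabCone T b) q := fun c =>
    diffWithin_of_contDiffOn (Dom.contDiffOn (F.β_ub c) i) relOpen_slabCone (by omega) hK
  change D T b k (fun q => ∑ a, ∑ c, F.G a c i q * D T b a (D T b c u) q +
    ∑ c, F.β c i q * D T b c u q) q = _
  rw [D_add _ _ hK, D_sum _ _ _ hK, D_sum _ _ _ hK]
  · congr 1
    · refine Finset.sum_congr rfl fun a _ => ?_
      rw [D_sum _ _ (fun c _ => (dG a c).fun_mul (d2 a c)) hK]
      exact Finset.sum_congr rfl fun c _ => D_mul (dG a c) (d2 a c) hK k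
    · exact Finset.sum_congr rfl fun c _ => D_mul (dβ c) (d1 c) hK k
  · exact fun c _ => (dβ c).fun_mul (d1 c)
  · exact fun a _ => DifferentiableWithinAt.fun_sum fun c _ => (dG a c).fun_mul (d2 a c)
  · exact DifferentiableWithinAt.fun_sum fun a _ =>
      DifferentiableWithinAt.fun_sum fun c _ => (dG a c).fun_mul (d2 a c)
  · exact DifferentiableWithinAt.fun_sum fun c _ => (dβ c).fun_mul (d1 c)

/-- The commutator of the wave operator with a vector field of the frame. -/
lemma L_D {i : ι} {u : Spacetime → ℝ} (hu : ContDiffOn ℝ (3 : ℕ) u (F.S i)) (hm : 1 ≤ m)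
    {q : Spacetime} (hq : q ∈ F.S i) (k : Fin 5) :
    F.L i (D T b k u) q = D T b k (F.L i u) q +
      (∑ a, ∑ c, ∑ l, (structConst c k l * (F.G a c i q * D T b a (D T b l u) q) +
        structConst a k l * (F.G a c i q * D T b l (D T b c u) q)) +
      ∑ c, ∑ l, structConst c k l * (F.β c i q * D T b l u q) +
      ∑ a, ∑ c, -1 * (D T b k (F.G a c i) q * D T b a (D T b c u) q) +
      ∑ c, -1 * (D T b k (F.β c i) q * D T b c u q)) := by
  have hK := F.S_sub i hq
  have hS := F.S_relOpen i
  rw [F.D_waveOp hu hm hq k]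
  have hu2 : ContDiffOn ℝ (2 : ℕ) u (F.S i) := hu.of_le (by norm_num)
  have dl : ∀ l, DifferentiableWithinAt ℝ (D T b l u) (slabCone T b) q := fun c =>
    diffWithin_of_contDiffOn (contDiffOn_D hS hu c) hS (by norm_num) hq
  have c1 : ∀ c, D T b c (D T b k u) q = D T b k (D T b c u) q +
      ∑ l, structConst c k l * D T b l u q := fun c => D_comm hS hu2 hq c k
  have c2 : ∀ a c, D T b a (D T b c (D T b k u)) q = D T b k (D T b a (D T b c u)) q +
      ∑ l, (structConst c k l * D T b a (D T b l u) q +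
        structConst a k l * D T b l (D T b c u) q) := by
    intro a c
    have e1 : D T b a (D T b c (D T b k u)) q =
        D T b a (fun q => D T b k (D T b c u) q + ∑ l, structConst c k l * D T b l u q) q :=
      D_congr hS (fun q hq => D_comm hS hu2 hq c k) hq a
    have d2 : DifferentiableWithinAt ℝ (D T b k (D T b c u)) (slabCone T b) q :=
      diffWithin_of_contDiffOn (contDiffOn_D hS (contDiffOn_D hS hu c) k) hS (by norm_num) hq
    rw [e1, D_add d2 (DifferentiableWithinAt.fun_sum fun l _ => (dl l).const_mul _) hK,
      D_sum _ _ (fun l _ => (dl l).const_mul _) hK,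
      D_comm hS (contDiffOn_D hS hu c) hq a k, Finset.sum_add_distrib]
    have e2 : ∀ l, D T b a (fun q => structConst c k l * D T b l u q) q =
        structConst c k l * D T b a (D T b l u) q := by
      intro l
      rw [D_mul (differentiableWithinAt_const _) (dl l) hK, D_const]; ring
    simp only [e2]
    ring
  unfold L waveOp
  simp only [c1, c2, mul_add, Finset.sum_add_distrib, Finset.mul_sum]
  have r1 : ∀ x y z : ℝ, x * (y * z) = y * (x * z) := fun x y z => by ring
  simp only [r1 (structConst _ _ _)]
  simp only [neg_mul, one_mul, Finset.sum_neg_distrib]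
  ring

/-- The admissible weights: `∂_τ` has weight `1` or `2`, the other fields have weight `1`. -/
structure IsWeight (wt : Fin 5 → ℕ) : Prop where
  one_le : ∀ i, 1 ≤ wt i
  le_two : wt 0 ≤ 2
  eq_one : ∀ i, i ≠ 0 → wt i = 1

lemma G_zero {k : Fin 5} (hk : k ≠ 1) {i : ι} {q} (hq : q ∈ slabCone T b) : F.G 0 k i q = 0 := by
  fin_cases k
  exacts [F.G_zero_zero i q hq, absurd rfl hk, F.G_zero_ang 0 i q hq, F.G_zero_ang 1 i q hq,
    F.G_zero_ang 2 i q hq]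

lemma D_G_zero (k l : Fin 5) {i : ι} {q} (hq : q ∈ slabCone T b) :
    D T b k (F.G 0 l i) q = 0 := by
  by_cases hl : l = 1
  · subst hl
    rw [D_congr (relOpen_slabCone) (g := fun _ => 1) (fun q hq => F.G_zero_one i q hq) hq, D_const]
  · rw [D_congr (relOpen_slabCone) (g := fun _ => 0) (fun q hq => F.G_zero hl hq) hq, D_const]

/-- The wave operator applied to a derivative of the solution is of lower order. -/
lemma dom_L_Dw {wt : Fin 5 → ℕ} (hwt : IsWeight wt) (n : ℕ) (w : List (Fin 5))
    (hn : n + w.length ≤ 2 * m) :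
    Dom T b F.S wt (fun j i => jet T b wt j (F.v i)) n (weight wt w + 1)
      fun i => F.L i (Dw T b w (F.v i)) := by
  have hS := F.S_relOpen
  have hJ := isGauge_jet (T := T) (b := b) F.S wt F.v
  have hv := dom_Dw hS hwt.one_le (N := 2 * m + 2) (v := F.v) F.v_smooth
  have hG : ∀ k l, UB T b F.S (2 * m + 1) (F.G k l) := fun k l => (F.G_ub k l).restrict F.S_sub
  have hβ : ∀ k, UB T b F.S (2 * m) (F.β k) := fun k => (F.β_ub k).restrict F.S_sub
  have hω : UB T b F.S (2 * m) F.ω := F.ω_ub.restrict F.S_sub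
  induction w generalizing n with
  | nil =>
    have h1 := Dom.mul hS hJ (hω.of_le (by simpa using hn)) (hv n [] (by simp at hn ⊢; omega))
    have h2 := (h1.const_mul hS (-1) hJ).mono hJ (m' := weight wt [] + 1) (by omega)
    refine h2.congr hS fun i q hq => ?_
    have := F.v_eq i q hq.1 hq.2
    simp only [Dw_nil]
    unfold L
    linarith
  | cons k w ih =>
    simp only [List.length_cons] at hn
    have ih1 := (ih (n + 1) (by omega)).D k
    have hwk : weight wt (k :: w) + 1 = weight wt w + 1 + wt k := by simp; ring
    rw [hwk]
    have hw2 : ∀ {a c : Fin 5}, a ≠ 0 → c ≠ 0 → Dom T b F.S wt (fun j i => jet T b wt j (F.v i)) n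
        (weight wt w + 1 + wt k) fun i => D T b a (D T b c (Dw T b w (F.v i))) := by
      intro a c ha hc
      refine (hv n (a :: c :: w) (by simp; omega)).mono hJ ?_
      have := hwt.one_le k
      simp [hwt.eq_one a ha, hwt.eq_one c hc]; omega
    have hw1 : ∀ c : Fin 5, Dom T b F.S wt (fun j i => jet T b wt j (F.v i)) n
        (weight wt w + 1 + wt k) fun i => D T b c (Dw T b w (F.v i)) := by
      intro c
      refine (hv n (c :: w) (by simp; omega)).mono hJ ?_
      have := hwt.one_le k
      have : wt c ≤ 2 := by
        by_cases hc : c = 0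
        · rw [hc]; exact hwt.le_two
        · rw [hwt.eq_one c hc]; norm_num
      simp; omega
    have hsum2 : ∀ {H : Fin 5 → ι → Spacetime → ℝ}, (∀ a, Dom T b F.S wt
        (fun j i => jet T b wt j (F.v i)) n (weight wt w + 1 + wt k) (H a)) →
        Dom T b F.S wt (fun j i => jet T b wt j (F.v i)) n (weight wt w + 1 + wt k)
          fun i q => ∑ a, H a i q := fun h => Dom.sum hS _ fun a _ => h a
    have htot := ih1.add hS ((((hsum2 fun a => hsum2 fun c => hsum2 fun l =>
      Dom.add hS
        (F := fun i q => structConst c k l *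
          (F.G a c i q * D T b a (D T b l (Dw T b w (F.v i))) q))
        (H := fun i q => structConst a k l *
          (F.G a c i q * D T b l (D T b c (Dw T b w (F.v i))) q)) ?_ ?_).add hS
      (hsum2 fun c => hsum2 fun l =>
        Dom.const_mul hS (structConst c k l) hJ (Dom.mul hS hJ ((hβ c).of_le (by omega)) (hw1 l)))).add
      hS (hsum2 fun a => hsum2 fun c => Dom.const_mul hS (-1) hJ
        (H := fun i q => D T b k (F.G a c i) q * D T b a (D T b c (Dw T b w (F.v i))) q) ?_)).add hS
      (hsum2 fun c => Dom.const_mul hS (-1) hJ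
        (Dom.mul hS hJ (((hβ c).of_le (n' := n + 1) (by omega)).D k) (hw1 c))))
    · refine htot.congr hS fun i q hq => ?_
      refine (F.L_D ?_ (by omega) hq k).symm
      exact contDiffOn_Dw (hS i) w ((F.v_smooth i).of_le (by norm_cast; omega))
    · by_cases hc : (c : ℕ) < 2
      · exact (Dom.zero hS).congr hS fun i q hq => by simp [structConst_eq_zero_left hc]
      by_cases hl : l = 0
      · exact (Dom.zero hS).congr hS fun i q hq => by
          simp [hl, structConst_eq_zero_third (show ((0 : Fin 5) : ℕ) < 2 by norm_num)]
      by_cases ha : a = 0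
      · refine (Dom.zero hS).congr hS fun i q hq => ?_
        subst ha
        rw [F.G_zero (by rintro rfl; simp at hc) (F.S_sub i hq)]; simp
      · exact Dom.const_mul hS _ hJ (Dom.mul hS hJ ((hG a c).of_le (by omega)) (hw2 ha hl))
    · by_cases ha : (a : ℕ) < 2
      · exact (Dom.zero hS).congr hS fun i q hq => by simp [structConst_eq_zero_left ha]
      by_cases hl : l = 0
      · exact (Dom.zero hS).congr hS fun i q hq => by
          simp [hl, structConst_eq_zero_third (show ((0 : Fin 5) : ℕ) < 2 by norm_num)]
      by_cases hc : c = 0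
      · refine (Dom.zero hS).congr hS fun i q hq => ?_
        subst hc
        rw [F.G_symm _ _ _ _ (F.S_sub i hq),
          F.G_zero (by rintro rfl; simp at ha) (F.S_sub i hq)]; simp
      · exact Dom.const_mul hS _ hJ (Dom.mul hS hJ ((hG a c).of_le (by omega)) (hw2 hl hc))
    · by_cases ha : a = 0
      · refine (Dom.zero hS).congr hS fun i q hq => ?_
        subst ha
        rw [F.D_G_zero k c (F.S_sub i hq), zero_mul]
      by_cases hc : c = 0
      · refine (Dom.zero hS).congr hS fun i q hq => ?_
        subst hc
        rw [D_congr relOpen_slabCone (fun q hq => F.G_symm a 0 i q hq) (F.S_sub i hq),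
          F.D_G_zero k a (F.S_sub i hq), zero_mul]
      · exact Dom.mul hS hJ (((hG a c).of_le (n' := n + 1) (by omega)).D k) (hw2 ha hc)

end WaveFamily

end

section

variable {T b : ℝ} [hT : Fact (0 < T)] [hb : Fact (0 < b)]

/-! ### Derivatives along the coordinate lines and along rotations -/

lemma hasDerivWithinAt_tau {f : Spacetime → ℝ} {τ z : ℝ} {y : E3}
    (hq : ((τ, z), y) ∈ slabCone T b)
    (hf : DifferentiableWithinAt ℝ f (slabCone T b) ((τ, z), y)) :
    HasDerivWithinAt (fun t => f ((t, z), y)) (D T b 0 f ((τ, z), y)) (Icc 0 T) τ := by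
  have h1 : HasDerivWithinAt (fun t : ℝ => (((t, z), y) : Spacetime)) ((1, 0), 0) (Icc 0 T) τ :=
    ((hasDerivWithinAt_id τ _).prodMk (hasDerivWithinAt_const τ _ z)).prodMk
      (hasDerivWithinAt_const τ _ y)
  have h2 := hf.hasFDerivWithinAt.comp_hasDerivWithinAt τ h1
    (fun t ht => (⟨ht, hq.2.1, hq.2.2⟩ : ((t, z), y) ∈ slabCone T b))
  rw [D, frame_zero]
  exact h2

lemma hasDerivWithinAt_z {f : Spacetime → ℝ} {τ z : ℝ} {y : E3}
    (hq : ((τ, z), y) ∈ slabCone T b)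
    (hf : DifferentiableWithinAt ℝ f (slabCone T b) ((τ, z), y)) :
    HasDerivWithinAt (fun t => f ((τ, t), y)) (D T b 1 f ((τ, z), y)) (Icc 0 b) z := by
  have h1 : HasDerivWithinAt (fun t : ℝ => (((τ, t), y) : Spacetime)) ((0, 1), 0) (Icc 0 b) z :=
    ((hasDerivWithinAt_const z _ τ).prodMk (hasDerivWithinAt_id z _)).prodMk
      (hasDerivWithinAt_const z _ y)
  have h2 := hf.hasFDerivWithinAt.comp_hasDerivWithinAt z h1
    (fun t ht => (⟨hq.1, ht, hq.2.2⟩ : ((τ, t), y) ∈ slabCone T b))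
  rw [D, frame_one]
  exact h2

lemma rotField_inner_self (k : Fin 3) (y : E3) : inner ℝ y (rotField k y) = 0 := by
  rw [rotField_coord]
  fin_cases k <;> simp [PiLp.inner_apply, Fin.sum_univ_three, mul_comm]

lemma rotField_cube (k : Fin 3) (y : E3) :
    rotField k (rotField k (rotField k y)) = -rotField k y := by
  simp only [rotField_coord]
  ext m
  fin_cases k <;> fin_cases m <;> simp

lemma norm_rotField_sq (k : Fin 3) (y : E3) :
    inner ℝ y (rotField k (rotField k y)) = -(inner ℝ (rotField k y) (rotField k y) : ℝ) ∧
    inner ℝ (rotField k y) (rotField k (rotField k y)) = (0 : ℝ) ∧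
    inner ℝ (rotField k (rotField k y)) (rotField k (rotField k y)) =
      (inner ℝ (rotField k y) (rotField k y) : ℝ) := by
  simp only [rotField_coord, PiLp.inner_apply, Fin.sum_univ_three]
  refine ⟨?_, ?_, ?_⟩ <;> fin_cases k <;> simp <;> ring

/-- Rotation about the `k`-th axis (Rodrigues' formula). -/
def rotFlow (k : Fin 3) (θ : ℝ) : E3 →ₗᵢ[ℝ] E3 where
  toLinearMap := (ContinuousLinearMap.id ℝ E3 + Real.sin θ • rotField k +
    (1 - Real.cos θ) • (rotField k).comp (rotField k)).toLinearMap
  norm_map' y := by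
    obtain ⟨h1, h2, h3⟩ := norm_rotField_sq k y
    have h0 := rotField_inner_self k y
    have : ‖y + Real.sin θ • rotField k y + (1 - Real.cos θ) • rotField k (rotField k y)‖ ^ 2 =
        ‖y‖ ^ 2 := by
      simp only [← real_inner_self_eq_norm_sq, inner_add_left, inner_add_right, inner_smul_left,
        inner_smul_right, h1, h2, h3, h0, real_inner_comm y (rotField k y),
        real_inner_comm y (rotField k (rotField k y)),
        real_inner_comm (rotField k y) (rotField k (rotField k y))]
      simp only [conj_trivial]
      linear_combination (inner ℝ (rotField k y) (rotField k y)) * Real.sin_sq_add_cos_sq θ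
    have h4 := (sq_eq_sq₀ (norm_nonneg _) (norm_nonneg _)).1 this
    simpa using h4

lemma rotFlow_apply (k : Fin 3) (θ : ℝ) (y : E3) : rotFlow k θ y =
    y + Real.sin θ • rotField k y + (1 - Real.cos θ) • rotField k (rotField k y) := by
  rfl

lemma rotFlow_zero (k : Fin 3) (y : E3) : rotFlow k 0 y = y := by simp [rotFlow_apply]

lemma hasDerivAt_rotFlow (k : Fin 3) (y : E3) (θ : ℝ) :
    HasDerivAt (fun θ => rotFlow k θ y) (rotField k (rotFlow k θ y)) θ := by
  simp only [rotFlow_apply]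
  have h := (((Real.hasDerivAt_sin θ).smul_const (rotField k y)).const_add y).add
    (((Real.hasDerivAt_cos θ).const_sub 1).smul_const (rotField k (rotField k y)))
  refine (h.congr_deriv ?_)
  simp only [map_add, map_smul, rotField_cube]
  module

lemma frame_rot (k : Fin 3) (q : Spacetime) : frame k.succ.succ q = (0, rotField k q.2) := by
  fin_cases k
  exacts [frame_two q, frame_three q, frame_four q]

lemma rotFlow_mem {p : ℝ × ℝ} {y : E3} (hq : (p, y) ∈ slabCone T b) (k : Fin 3) (θ : ℝ) :
    (p, rotFlow k θ y) ∈ slabCone T b := by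
  refine ⟨hq.1, hq.2.1, ?_⟩
  have h : y ≠ 0 := hq.2.2
  rwa [← norm_ne_zero_iff, (rotFlow k θ).norm_map, norm_ne_zero_iff]

lemma hasDerivAt_rot {f : Spacetime → ℝ} {p : ℝ × ℝ} {y : E3} (k : Fin 3) (θ : ℝ)
    (hq : (p, y) ∈ slabCone T b)
    (hf : DifferentiableWithinAt ℝ f (slabCone T b) (p, rotFlow k θ y)) :
    HasDerivAt (fun θ => f (p, rotFlow k θ y)) (D T b k.succ.succ f (p, rotFlow k θ y)) θ := by
  have h1 : HasDerivWithinAt (fun θ : ℝ => ((p, rotFlow k θ y) : Spacetime))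
      (0, rotField k (rotFlow k θ y)) univ θ :=
    (hasDerivWithinAt_const θ _ p).prodMk (hasDerivAt_rotFlow k y θ).hasDerivWithinAt
  have h2 := hf.hasFDerivWithinAt.comp_hasDerivWithinAt θ h1
    (fun t _ => rotFlow_mem hq k t)
  rw [D, frame_rot]
  exact hasDerivWithinAt_univ.1 h2

/-! ### Integration over the slab -/

/-- The unit sphere. -/
abbrev Sph : Type := Metric.sphere (0 : E3) 1

lemma Sph.norm (x : Sph) : ‖(x : E3)‖ = 1 := by simp

lemma Sph.ne_zero (x : Sph) : (x : E3) ≠ 0 := by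
  intro h; have := x.norm; simp [h] at this

/-- The action of a linear isometry on the sphere. -/
def sphMap (R : E3 →ₗᵢ[ℝ] E3) (x : Sph) : Sph := ⟨R x, by simp⟩

lemma measurePreserving_sphMap (R : E3 →ₗᵢ[ℝ] E3) :
    MeasurePreserving (sphMap R) sphereMeasure sphereMeasure := by
  have hc : Continuous (sphMap R) := by unfold sphMap; fun_prop
  refine ⟨hc.measurable, ?_⟩
  ext s hs
  rw [Measure.map_apply hc.measurable hs, Measure.toSphere_apply' _ hs,
    Measure.toSphere_apply' _ (hc.measurable hs)]
  congr 1
  let R' : E3 ≃ₗᵢ[ℝ] E3 := R.toLinearIsometryEquiv rfl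
  have hR' : ∀ x, R' x = R x := fun x => rfl
  rw [← R'.measurePreserving.measure_preimage_emb R'.toHomeomorph.measurableEmbedding
    (Ioo (0 : ℝ) 1 • ((↑) '' s : Set E3))]
  congr 1
  ext y
  constructor
  · rintro ⟨r, hr, _, ⟨x, hx, rfl⟩, h⟩
    exact ⟨r, hr, _, ⟨sphMap R x, hx, rfl⟩, by
      rw [← h]; exact (map_smul R r (x : E3)).symm⟩
  · rintro ⟨r, hr, _, ⟨x, hx, rfl⟩, h⟩
    obtain ⟨x', hx'⟩ := R'.surjective x
    have hxs : x' ∈ Metric.sphere (0 : E3) 1 := by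
      rw [mem_sphere_zero_iff_norm, ← R'.norm_map, hx', x.norm]
    refine ⟨r, hr, x', ⟨⟨x', hxs⟩, ?_, rfl⟩, ?_⟩
    · have : sphMap R ⟨x', hxs⟩ = x := Subtype.ext hx'
      rwa [mem_preimage, this]
    · apply R'.injective
      change R' (r • x') = R' y
      rw [map_smul, hx']; exact h

end

section

variable {T b : ℝ} [hT : Fact (0 < T)] [hb : Fact (0 < b)]

/-- The product measure on `(a, c) × S²`. -/
abbrev stripMeasure (a c : ℝ) : Measure (ℝ × Sph) := (volume.restrict (Ioo a c)).prod sphereMeasure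

variable (T b) in
/-- The product measure on `(0, T) × (0, b) × S²`. -/
abbrev slabMeasure : Measure ((ℝ × ℝ) × Sph) :=
  ((volume.restrict (Ioo 0 T)).prod (volume.restrict (Ioo 0 b))).prod sphereMeasure

/-- The inclusion of `ℝ² × S²` into the spacetime. -/
def inj (p : (ℝ × ℝ) × Sph) : Spacetime := (p.1, p.2)

lemma continuous_inj : Continuous inj := by unfold inj; fun_prop

lemma inj_mem {p : (ℝ × ℝ) × Sph} (h : p ∈ (Icc 0 T ×ˢ Icc 0 b) ×ˢ (univ : Set Sph)) :
    inj p ∈ slabCone T b := ⟨h.1.1, h.1.2, p.2.ne_zero⟩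

lemma ae_strip (a c : ℝ) : ∀ᵐ p ∂stripMeasure a c, p.1 ∈ Ioo a c := by
  have : stripMeasure a c = ((volume : Measure ℝ).prod sphereMeasure).restrict (Ioo a c ×ˢ univ) := by
    rw [← Measure.prod_restrict, Measure.restrict_univ]
  rw [this]
  filter_upwards [ae_restrict_mem (measurableSet_Ioo.prod MeasurableSet.univ)] with p hp using hp.1

lemma ae_slab : ∀ᵐ p ∂slabMeasure T b, p.1.1 ∈ Ioo 0 T ∧ p.1.2 ∈ Ioo 0 b := by
  have : slabMeasure T b = (((volume : Measure ℝ).prod (volume : Measure ℝ)).prod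
      sphereMeasure).restrict ((Ioo 0 T ×ˢ Ioo 0 b) ×ˢ univ) := by
    rw [← Measure.prod_restrict, Measure.restrict_univ, ← Measure.prod_restrict]
  rw [this]
  filter_upwards [ae_restrict_mem ((measurableSet_Ioo.prod measurableSet_Ioo).prod
    MeasurableSet.univ)] with p hp using hp.1

lemma integrable_strip {a c : ℝ} {f : ℝ × Sph → ℝ} (hf : ContinuousOn f (Icc a c ×ˢ univ)) :
    Integrable f (stripMeasure a c) := by
  have h := hf.integrableOn_compact (μ := (volume : Measure ℝ).prod sphereMeasure)
    (isCompact_Icc.prod isCompact_univ)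
  have h2 := h.mono_set (prod_mono_left (t := univ) (Ioo_subset_Icc_self (a := a) (b := c)))
  rwa [IntegrableOn, ← Measure.prod_restrict, Measure.restrict_univ] at h2

lemma integrable_slab {f : (ℝ × ℝ) × Sph → ℝ}
    (hf : ContinuousOn f ((Icc 0 T ×ˢ Icc 0 b) ×ˢ univ)) :
    Integrable f (slabMeasure T b) := by
  have h := hf.integrableOn_compact
    (μ := ((volume : Measure ℝ).prod (volume : Measure ℝ)).prod sphereMeasure)
    ((isCompact_Icc.prod isCompact_Icc).prod isCompact_univ)
  have h2 := h.mono_set (prod_mono_left (t := univ) (prod_mono (Ioo_subset_Icc_self (a := 0) (b := T))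
    (Ioo_subset_Icc_self (a := 0) (b := b))))
  rwa [IntegrableOn, ← Measure.prod_restrict, Measure.restrict_univ, ← Measure.prod_restrict] at h2

lemma ContinuousOn.comp_inj {f : Spacetime → ℝ} (hf : ContinuousOn f (slabCone T b)) :
    ContinuousOn (fun p => f (inj p)) ((Icc 0 T ×ˢ Icc 0 b) ×ˢ univ) :=
  hf.comp continuous_inj.continuousOn fun _ hp => inj_mem hp

lemma continuousOn_D {f : Spacetime → ℝ} (hf : ContDiffOn ℝ (1 : ℕ) f (slabCone T b)) (i : Fin 5) :
    ContinuousOn (D T b i f) (slabCone T b) :=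
  (contDiffOn_D (n := 0) relOpen_slabCone hf i).continuousOn

/-- Rotation fields are divergence free. -/
lemma integral_D_rot {f : Spacetime → ℝ} (hf : ContDiffOn ℝ (1 : ℕ) f (slabCone T b)) (k : Fin 3)
    {p : ℝ × ℝ} (hp : p ∈ Icc 0 T ×ˢ Icc 0 b) :
    ∫ x : Sph, D T b k.succ.succ f (p, x) ∂sphereMeasure = 0 := by
  have hmem : ∀ x : Sph, (p, (x : E3)) ∈ slabCone T b := fun x => ⟨hp.1, hp.2, x.ne_zero⟩
  have hmem' : ∀ (θ : ℝ) (x : Sph), (p, rotFlow k θ x) ∈ slabCone T b :=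
    fun θ x => rotFlow_mem (hmem x) k θ
  have hc : Continuous fun a : ℝ × Sph => D T b k.succ.succ f (p, rotFlow k a.1 a.2) := by
    refine (continuousOn_D hf _).comp_continuous ?_ fun a => hmem' a.1 a.2
    simp only [rotFlow_apply]
    fun_prop
  have hcf : Continuous fun x : Sph => f (p, x) :=
    hf.continuousOn.comp_continuous (by fun_prop) hmem
  have hint : ∀ {g : Sph → ℝ}, Continuous g → Integrable g sphereMeasure := fun {g} hg =>
    hg.integrable_of_hasCompactSupport (HasCompactSupport.of_compactSpace g)
  have hinv : ∀ θ (g : Sph → ℝ), ∫ x, g (sphMap (rotFlow k θ) x) ∂sphereMeasure =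
      ∫ x, g x ∂sphereMeasure := by
    intro θ g
    refine (measurePreserving_sphMap (rotFlow k θ)).integral_comp ?_ g
    refine Continuous.measurableEmbedding ?_ ?_
    · unfold sphMap; fun_prop
    · intro x y h
      exact Subtype.ext ((rotFlow k θ).injective (congrArg Subtype.val h))
  have hftc : ∀ x : Sph, ∫ θ in Ioo (0 : ℝ) 1, D T b k.succ.succ f (p, rotFlow k θ x) =
      f (p, rotFlow k 1 x) - f (p, x) := by
    intro x
    rw [← integral_Ioc_eq_integral_Ioo, ← intervalIntegral.integral_of_le zero_le_one,
      intervalIntegral.integral_eq_sub_of_hasDerivAt (f := fun θ => f (p, rotFlow k θ x))]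
    · simp [rotFlow_zero]
    · intro θ _
      exact hasDerivAt_rot k θ (hmem x)
        (diffWithin_of_contDiffOn hf relOpen_slabCone one_ne_zero (hmem' θ x))
    · exact (hc.comp (by fun_prop : Continuous fun θ : ℝ => (θ, x))).intervalIntegrable _ _
  have hswap := integral_integral_swap (μ := volume.restrict (Ioo (0 : ℝ) 1)) (ν := sphereMeasure)
    (f := fun θ x => D T b k.succ.succ f (p, rotFlow k θ x)) (integrable_strip hc.continuousOn)
  simp only [hftc] at hswap
  have h1 : ∀ θ : ℝ, ∫ x : Sph, D T b k.succ.succ f (p, rotFlow k θ x) ∂sphereMeasure =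
      ∫ x : Sph, D T b k.succ.succ f (p, x) ∂sphereMeasure :=
    fun θ => hinv θ fun x => D T b k.succ.succ f (p, x)
  have h2 : ∫ x : Sph, f (p, rotFlow k 1 x) ∂sphereMeasure = ∫ x : Sph, f (p, x) ∂sphereMeasure :=
    hinv 1 fun x => f (p, x)
  rw [integral_sub (hint _) (hint hcf), h2, sub_self] at hswap
  · simpa [h1] using hswap
  · refine hf.continuousOn.comp_continuous ?_ fun x => hmem' 1 x
    fun_prop

lemma integral_slab_tau {f : (ℝ × ℝ) × Sph → ℝ}
    (hf : ContinuousOn f ((Icc 0 T ×ˢ Icc 0 b) ×ˢ univ)) :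
    ∫ p, f p ∂slabMeasure T b =
      ∫ p, (∫ τ in Ioo 0 T, f ((τ, p.1), p.2)) ∂stripMeasure 0 b := by
  have hi := integrable_slab hf
  have hi2 : Integrable (fun p : ℝ × Sph => ∫ τ in Ioo 0 T, f ((τ, p.1), p.2))
      (stripMeasure 0 b) := by
    refine (Integrable.integral_prod_right (μ := volume.restrict (Ioo 0 T))
      (f := fun q : ℝ × (ℝ × Sph) => f ((q.1, q.2.1), q.2.2)) ?_)
    have := (measurePreserving_prodAssoc (volume.restrict (Ioo 0 T)) (volume.restrict (Ioo 0 b))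
      sphereMeasure)
    exact (this.integrable_comp_emb (MeasurableEquiv.measurableEmbedding _)).1 hi
  rw [integral_prod_symm _ hi, integral_prod_symm _ hi2]
  refine integral_congr_ae ?_
  filter_upwards [hi.prod_left_ae] with x hx
  exact integral_prod_symm _ hx

lemma integral_slab_z {f : (ℝ × ℝ) × Sph → ℝ}
    (hf : ContinuousOn f ((Icc 0 T ×ˢ Icc 0 b) ×ˢ univ)) :
    ∫ p, f p ∂slabMeasure T b =
      ∫ p, (∫ z in Ioo 0 b, f ((p.1, z), p.2)) ∂stripMeasure 0 T := by
  have hf' : ContinuousOn (fun p : (ℝ × ℝ) × Sph => f ((p.1.2, p.1.1), p.2))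
      ((Icc 0 b ×ˢ Icc 0 T) ×ˢ univ) :=
    hf.comp (by fun_prop) fun p hp => ⟨⟨hp.1.2, hp.1.1⟩, trivial⟩
  rw [← integral_slab_tau hf']
  have h := ((Measure.measurePreserving_swap (μ := volume.restrict (Ioo 0 T))
    (ν := volume.restrict (Ioo 0 b))).prod (MeasurePreserving.id sphereMeasure))
  exact (h.integral_comp (MeasurableEquiv.prodCongr MeasurableEquiv.prodComm
    (MeasurableEquiv.refl Sph)).measurableEmbedding
    (fun p : (ℝ × ℝ) × Sph => f ((p.1.2, p.1.1), p.2)))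

/-- The divergence theorem on the slab. -/
theorem integral_div {f : Fin 5 → Spacetime → ℝ}
    (hf : ∀ i, ContDiffOn ℝ (1 : ℕ) (f i) (slabCone T b)) :
    ∫ p, ∑ i, D T b i (f i) (inj p) ∂slabMeasure T b =
      ∫ p, (f 0 ((T, p.1), p.2) - f 0 ((0, p.1), p.2)) ∂stripMeasure 0 b +
      ∫ p, (f 1 ((p.1, b), p.2) - f 1 ((p.1, 0), p.2)) ∂stripMeasure 0 T := by
  have hc : ∀ i, ContinuousOn (fun p => D T b i (f i) (inj p))
      ((Icc 0 T ×ˢ Icc 0 b) ×ˢ univ) := fun i => ContinuousOn.comp_inj (continuousOn_D (hf i) i)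
  have hd : ∀ i q, q ∈ slabCone T b → DifferentiableWithinAt ℝ (f i) (slabCone T b) q :=
    fun i q hq => diffWithin_of_contDiffOn (hf i) relOpen_slabCone one_ne_zero hq
  rw [integral_finsetSum _ fun i _ => integrable_slab (hc i), Fin.sum_univ_succ,
    Fin.sum_univ_succ]
  have hrot : ∀ k : Fin 3, ∫ p, D T b k.succ.succ (f k.succ.succ) (inj p) ∂slabMeasure T b = 0 := by
    intro k
    rw [integral_prod _ (integrable_slab (hc _))]
    rw [Measure.prod_restrict]
    refine (setIntegral_congr_fun (measurableSet_Ioo.prod measurableSet_Ioo) (g := fun _ => 0)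
      fun p hp => ?_).trans (by simp)
    exact integral_D_rot (hf _) k ⟨Ioo_subset_Icc_self hp.1, Ioo_subset_Icc_self hp.2⟩
  rw [Finset.sum_eq_zero (fun k _ => hrot k), add_zero]
  congr 1
  · rw [integral_slab_tau (hc 0)]
    refine integral_congr_ae ?_
    filter_upwards [ae_strip _ _] with p hp
    have hz := Ioo_subset_Icc_self hp
    simp only [inj]
    rw [← integral_Ioc_eq_integral_Ioo, ← intervalIntegral.integral_of_le hT.out.le]
    have hmem : ∀ t ∈ Icc 0 T, ((t, p.1), (p.2 : E3)) ∈ slabCone T b :=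
      fun t ht => ⟨ht, hz, p.2.ne_zero⟩
    refine intervalIntegral.integral_eq_sub_of_hasDeriv_right (f := fun t => f 0 ((t, p.1), p.2)) ?_ ?_ ?_
    · rw [uIcc_of_le hT.out.le]
      exact fun t ht => (hasDerivWithinAt_tau (hmem t ht) (hd _ _ (hmem t ht))).continuousWithinAt
    · rw [min_eq_left hT.out.le, max_eq_right hT.out.le]
      intro t ht
      have h1 := hasDerivWithinAt_tau (hmem t (Ioo_subset_Icc_self ht))
        (hd 0 _ (hmem t (Ioo_subset_Icc_self ht)))
      exact (h1.hasDerivAt (Icc_mem_nhds ht.1 ht.2)).hasDerivWithinAt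
    · refine ContinuousOn.intervalIntegrable ?_
      rw [uIcc_of_le hT.out.le]
      exact (continuousOn_D (hf 0) 0).comp (by fun_prop) hmem
  · rw [Fin.succ_zero_eq_one, integral_slab_z (hc 1)]
    refine integral_congr_ae ?_
    filter_upwards [ae_strip _ _] with p hp
    have hz := Ioo_subset_Icc_self hp
    simp only [inj]
    rw [← integral_Ioc_eq_integral_Ioo, ← intervalIntegral.integral_of_le hb.out.le]
    have hmem : ∀ t ∈ Icc 0 b, ((p.1, t), (p.2 : E3)) ∈ slabCone T b :=
      fun t ht => ⟨hz, ht, p.2.ne_zero⟩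
    refine intervalIntegral.integral_eq_sub_of_hasDeriv_right (f := fun t => f 1 ((p.1, t), p.2)) ?_ ?_ ?_
    · rw [uIcc_of_le hb.out.le]
      exact fun t ht => (hasDerivWithinAt_z (hmem t ht) (hd _ _ (hmem t ht))).continuousWithinAt
    · rw [min_eq_left hb.out.le, max_eq_right hb.out.le]
      intro t ht
      have h1 := hasDerivWithinAt_z (hmem t (Ioo_subset_Icc_self ht))
        (hd 1 _ (hmem t (Ioo_subset_Icc_self ht)))
      exact (h1.hasDerivAt (Icc_mem_nhds ht.1 ht.2)).hasDerivWithinAt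
    · refine ContinuousOn.intervalIntegrable ?_
      rw [uIcc_of_le hb.out.le]
      exact (continuousOn_D (hf 1) 1).comp (by fun_prop) hmem

end

section

variable {T b : ℝ} [hT : Fact (0 < T)] [hb : Fact (0 < b)]

/-! ### The energy momentum tensor -/

/-- The algebra behind the divergence of the energy current. -/
lemma div_algebra {Y d β : Fin 5 → ℝ} {G H dY : Fin 5 → Fin 5 → ℝ} {dG c : Fin 5 → Fin 5 → Fin 5 → ℝ}
    (hG : ∀ i j, G i j = G j i) (hH : ∀ i l, H i l = H l i + ∑ k, c i l k * d k) :
    ∑ i, ((∑ l, (Y l * H i l + dY i l * d l)) * (∑ j, G i j * d j) +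
        (∑ l, Y l * d l) * (∑ j, (G i j * H i j + dG i i j * d j)) -
        1 / 2 * (dY i i * (∑ j, ∑ l, G j l * d j * d l) +
          Y i * ∑ j, ∑ l, (G j l * (H i j * d l + d j * H i l) + dG i j l * d j * d l))) =
      (∑ l, Y l * d l) * (∑ i, ∑ j, G i j * H i j + ∑ j, β j * d j) +
      ((∑ i, (∑ l, dY i l * d l) * ∑ j, G i j * d j) +
        (∑ l, Y l * d l) * ((∑ i, ∑ j, dG i i j * d j) + ∑ j, -β j * d j) +
        (∑ i, -1 / 2 * dY i i * ∑ j, ∑ l, G j l * d j * d l) +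
        (∑ i, -1 / 2 * Y i * ∑ j, ∑ l, dG i j l * d j * d l) +
        ∑ i, (∑ r, Y r * ∑ k, c i r k * d k) * ∑ j, G i j * d j) := by
  have e1 : ∀ i, ∑ j, ∑ l, G j l * (H i j * d l + d j * H i l) =
      2 * ∑ j, H i j * ∑ l, G j l * d l := by
    intro i
    simp only [mul_add, Finset.sum_add_distrib, two_mul]
    congr 1
    · simp only [Finset.mul_sum]
      exact Finset.sum_congr rfl fun j _ => Finset.sum_congr rfl fun l _ => by ring
    · rw [Finset.sum_comm]
      simp only [Finset.mul_sum]
      exact Finset.sum_congr rfl fun j _ => Finset.sum_congr rfl fun l _ => by rw [hG l j]; ring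
  have e2 : ∑ i, (∑ l, Y l * H i l) * (∑ j, G i j * d j) =
      ∑ i, Y i * ∑ j, H i j * ∑ l, G j l * d l +
        ∑ i, (∑ r, Y r * ∑ k, c i r k * d k) * ∑ j, G i j * d j := by
    have e3 : ∀ i, ∑ l, Y l * H i l = ∑ l, Y l * H l i + ∑ l, Y l * ∑ k, c i l k * d k := by
      intro i
      rw [← Finset.sum_add_distrib]
      exact Finset.sum_congr rfl fun l _ => by rw [hH i l]; ring
    simp only [e3, add_mul, Finset.sum_add_distrib]
    congr 1
    simp only [Finset.sum_mul (s := (Finset.univ : Finset (Fin 5))) (f := fun l => Y l * H l _)]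
    rw [Finset.sum_comm]
    refine Finset.sum_congr rfl fun l _ => ?_
    rw [Finset.mul_sum]
    exact Finset.sum_congr rfl fun i _ => by ring
  have e3 : ∀ i, (∑ l, (Y l * H i l + dY i l * d l)) * (∑ j, G i j * d j) +
        (∑ l, Y l * d l) * (∑ j, (G i j * H i j + dG i i j * d j)) -
        1 / 2 * (dY i i * (∑ j, ∑ l, G j l * d j * d l) +
          Y i * ∑ j, ∑ l, (G j l * (H i j * d l + d j * H i l) + dG i j l * d j * d l)) =
      (∑ l, Y l * H i l) * (∑ j, G i j * d j) - Y i * ∑ j, H i j * ∑ l, G j l * d l +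
      ((∑ l, dY i l * d l) * (∑ j, G i j * d j) +
      (∑ l, Y l * d l) * (∑ j, G i j * H i j) + (∑ l, Y l * d l) * (∑ j, dG i i j * d j) +
      -1 / 2 * dY i i * (∑ j, ∑ l, G j l * d j * d l) +
      -1 / 2 * Y i * ∑ j, ∑ l, dG i j l * d j * d l) := by
    intro i
    have e4 : ∑ j, ∑ l, (G j l * (H i j * d l + d j * H i l) + dG i j l * d j * d l) =
        2 * (∑ j, H i j * ∑ l, G j l * d l) + ∑ j, ∑ l, dG i j l * d j * d l := by
      rw [← e1]; simp only [Finset.sum_add_distrib]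
    rw [e4, Finset.sum_add_distrib, Finset.sum_add_distrib]
    ring
  rw [Finset.sum_congr rfl fun i _ => e3 i, Finset.sum_add_distrib, Finset.sum_sub_distrib, e2]
  rw [Finset.sum_add_distrib, Finset.sum_add_distrib, Finset.sum_add_distrib,
    Finset.sum_add_distrib, ← Finset.mul_sum, ← Finset.mul_sum]
  simp only [neg_mul (β _), Finset.sum_neg_distrib]
  ring

namespace WaveFamily

variable {ι : Type*} {m : ℕ} (F : WaveFamily ι T b m)

/-- The inverse metric as a bilinear form in the frame. -/
def bil (i : ι) (q : Spacetime) (x y : Fin 5 → ℝ) : ℝ := ∑ k, ∑ l, F.G k l i q * x k * y l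

/-- The angular part of the inverse metric. -/
def ang (i : ι) (q : Spacetime) (ξ ν : Fin 3 → ℝ) : ℝ :=
  ∑ k, ∑ l, F.G k.succ.succ l.succ.succ i q * ξ k * ν l

/-- The component along `N₂`. -/
def nul (i : ι) (q : Spacetime) (x : Fin 5 → ℝ) : ℝ :=
  -x 0 - 1 / 2 * F.G 1 1 i q * x 1 - ∑ k : Fin 3, F.G 1 k.succ.succ i q * x k.succ.succ

/-- The angular components. -/
def angPart (x : Fin 5 → ℝ) (k : Fin 3) : ℝ := x k.succ.succ

lemma bil_eq {i : ι} {q : Spacetime} (hq : q ∈ slabCone T b) (x y : Fin 5 → ℝ) :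
    F.bil i q x y = -x 1 * F.nul i q y - y 1 * F.nul i q x +
      F.ang i q (angPart x) (angPart y) := by
  have h1 := F.G_zero_zero i q hq
  have h2 := F.G_zero_one i q hq
  have h3 := F.G_symm 1 0 i q hq
  have h4 := fun k => F.G_zero_ang k i q hq
  have h5 : ∀ k : Fin 3, F.G k.succ.succ 0 i q = 0 := fun k => by rw [F.G_symm _ _ _ _ hq, h4]
  have h6 : ∀ k : Fin 3, F.G k.succ.succ 1 i q = F.G 1 k.succ.succ i q :=
    fun k => F.G_symm _ _ _ _ hq
  unfold bil ang nul angPart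
  simp only [Fin.sum_univ_succ (n := 4), Fin.sum_univ_succ (n := 3), Fin.succ_zero_eq_one, h1, h2,
    h3, h4, h5, h6, Finset.sum_add_distrib]
  have e1 : ∑ k : Fin 3, F.G 1 k.succ.succ i q * x k.succ.succ * y 1 =
      (∑ k : Fin 3, F.G 1 k.succ.succ i q * x k.succ.succ) * y 1 := by rw [Finset.sum_mul]
  have e2 : ∑ k : Fin 3, F.G 1 k.succ.succ i q * x 1 * y k.succ.succ =
      x 1 * ∑ k : Fin 3, F.G 1 k.succ.succ i q * y k.succ.succ := by
    rw [Finset.mul_sum]; exact Finset.sum_congr rfl fun _ _ => by ring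
  rw [e1, e2]
  simp only [zero_mul, Finset.sum_const_zero]
  ring

/-- Covectors which annihilate the trivial combination of the rotation fields. -/
def Perp (q : Spacetime) (x : Fin 5 → ℝ) : Prop := ∑ k : Fin 3, q.2 k * x k.succ.succ = 0

lemma perp_D (f : Spacetime → ℝ) (q : Spacetime) : Perp q fun k => D T b k f q := by
  have h : ∑ k : Fin 3, q.2 k • frame k.succ.succ q = 0 := by
    simp only [frame_rot, Fin.sum_univ_three, rotField_coord]
    refine Prod.ext (by simp) ?_
    ext m
    fin_cases m <;> simp <;> ring
  have := congrArg (fderivWithin ℝ f (slabCone T b) q) h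
  simpa [map_sum, Perp, D] using this

/-- The multiplier `a ∂_z + N₂` applied to a covector. -/
def mult (a : ℝ) (i : ι) (q : Spacetime) (x : Fin 5 → ℝ) : ℝ := a * x 1 + F.nul i q x

/-- The energy momentum tensor. -/
def energy (a : ℝ) (i : ι) (q : Spacetime) (n d : Fin 5 → ℝ) : ℝ :=
  F.mult a i q d * F.bil i q n d - 1 / 2 * F.mult a i q n * F.bil i q d d

section pointwise

variable {i : ι} {q : Spacetime} (hq : q ∈ slabCone T b) (hu : ‖q.2‖ = 1)
include hq

lemma ang_comm (ξ ν : Fin 3 → ℝ) : F.ang i q ξ ν = F.ang i q ν ξ := by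
  unfold ang
  rw [Finset.sum_comm]
  exact Finset.sum_congr rfl fun k _ => Finset.sum_congr rfl fun l _ => by
    rw [F.G_symm _ _ _ _ hq]; ring

lemma energy_eq (a : ℝ) (n d : Fin 5 → ℝ) : F.energy a i q n d =
    -(a * (d 1 ^ 2 * F.nul i q n - d 1 * F.ang i q (angPart d) (angPart n) +
      1 / 2 * n 1 * F.ang i q (angPart d) (angPart d)) +
    (F.nul i q d ^ 2 * n 1 - F.nul i q d * F.ang i q (angPart d) (angPart n) +
      1 / 2 * F.nul i q n * F.ang i q (angPart d) (angPart d))) := by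
  unfold energy mult
  rw [F.bil_eq hq, F.bil_eq hq, F.ang_comm hq (angPart n)]
  ring

include hu

lemma ang_nonneg {x : Fin 5 → ℝ} (hx : Perp q x) : 0 ≤ F.ang i q (angPart x) (angPart x) := by
  obtain ⟨c, hc, h⟩ := F.G_ang
  exact (by positivity : 0 ≤ c * ∑ k, angPart x k ^ 2).trans (h i q hq hu (angPart x) hx)

lemma ang_cauchySchwarz {x y : Fin 5 → ℝ} (hx : Perp q x) (hy : Perp q y) :
    F.ang i q (angPart x) (angPart y) ^ 2 ≤
      F.ang i q (angPart x) (angPart x) * F.ang i q (angPart y) (angPart y) := by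
  have key : ∀ t : ℝ, 0 ≤ F.ang i q (angPart x) (angPart x) * (t * t) +
      2 * F.ang i q (angPart x) (angPart y) * t + F.ang i q (angPart y) (angPart y) := by
    intro t
    have hp : Perp q (fun k => t * x k + y k) := by
      unfold Perp at hx hy ⊢
      simp only [mul_add, Finset.sum_add_distrib, hy, add_zero]
      rw [← mul_zero t, ← hx, Finset.mul_sum]
      exact Finset.sum_congr rfl fun _ _ => by ring
    have := F.ang_nonneg hq hu (i := i) hp
    have e : F.ang i q (angPart fun k => t * x k + y k) (angPart fun k => t * x k + y k) =
        F.ang i q (angPart x) (angPart x) * (t * t) +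
        (F.ang i q (angPart x) (angPart y) + F.ang i q (angPart y) (angPart x)) * t +
        F.ang i q (angPart y) (angPart y) := by
      unfold ang angPart
      simp only [Finset.sum_mul, ← Finset.sum_add_distrib]
      exact Finset.sum_congr rfl fun _ _ => Finset.sum_congr rfl fun _ _ => by ring
    rw [e, F.ang_comm hq (angPart y) (angPart x)] at this
    linarith
  have := discrim_le_zero key
  unfold discrim at this
  linarith

/-- The dominant energy condition. -/
lemma energy_nonpos {a : ℝ} (ha : 0 ≤ a) {n d : Fin 5 → ℝ} (hn : Perp q n) (hd : Perp q d)
    (h1 : 0 < n 1) (h2 : F.bil i q n n ≤ 0) : F.energy a i q n d ≤ 0 := by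
  rw [F.energy_eq hq]
  rw [F.bil_eq hq] at h2
  have hcs := F.ang_cauchySchwarz hq hu (i := i) hd hn
  have hα := F.ang_nonneg hq hu (i := i) hd
  have hκ := F.ang_nonneg hq hu (i := i) hn
  set α := F.ang i q (angPart d) (angPart d)
  set γ := F.ang i q (angPart d) (angPart n)
  set κ := F.ang i q (angPart n) (angPart n)
  set n2 := F.nul i q n
  set s := F.nul i q d
  have e1 : 0 ≤ d 1 ^ 2 * n2 - d 1 * γ + 1 / 2 * n 1 * α := by
    have h3 : 0 ≤ κ * d 1 ^ 2 - 2 * n 1 * d 1 * γ + n 1 ^ 2 * α := by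
      rcases hκ.eq_or_lt with h | h
      · rw [← h] at hcs ⊢
        have : γ = 0 := by nlinarith
        rw [this]; nlinarith [mul_nonneg (sq_nonneg (n 1)) hα]
      · have : 0 ≤ κ * (κ * d 1 ^ 2 - 2 * n 1 * d 1 * γ + n 1 ^ 2 * α) := by
          nlinarith [sq_nonneg (κ * d 1 - n 1 * γ), mul_nonneg (sq_nonneg (n 1)) (sub_nonneg.2 hcs)]
        exact nonneg_of_mul_nonneg_right this h
    have h4 : 0 ≤ 2 * n 1 * (d 1 ^ 2 * n2 - d 1 * γ + 1 / 2 * n 1 * α) := by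
      nlinarith [mul_nonneg (sq_nonneg (d 1)) (show 0 ≤ 2 * n 1 * n2 - κ by linarith)]
    exact nonneg_of_mul_nonneg_right h4 (by linarith)
  have e2 : 0 ≤ s ^ 2 * n 1 - s * γ + 1 / 2 * n2 * α := by
    have h4 : 0 ≤ 4 * n 1 * (s ^ 2 * n 1 - s * γ + 1 / 2 * n2 * α) := by
      nlinarith [sq_nonneg (2 * n 1 * s - γ),
        mul_nonneg hα (show 0 ≤ 2 * n 1 * n2 - κ by linarith)]
    exact nonneg_of_mul_nonneg_right h4 (by linarith)
  nlinarith [mul_nonneg ha e1]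

end pointwise

lemma G_bound : ∃ C : ℝ, 1 ≤ C ∧ ∀ i, ∀ q ∈ slabCone T b, ‖q.2‖ = 1 → ∀ k l, |F.G k l i q| ≤ C := by
  choose C hC using fun k l => (F.G_ub k l).bound
  refine ⟨1 + ∑ k, ∑ l, C k l, ?_, fun i q hq hu k l => ?_⟩
  · have : 0 ≤ ∑ k, ∑ l, C k l := Finset.sum_nonneg fun k _ => Finset.sum_nonneg fun l _ => (hC k l).1
    linarith
  · have h1 := (hC k l).2 i q hq hu
    have h2 : C k l ≤ ∑ l, C k l :=
      Finset.single_le_sum (f := fun l => C k l) (fun l _ => (hC k l).1) (Finset.mem_univ l)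
    have h3 : ∑ l, C k l ≤ ∑ k, ∑ l, C k l := Finset.single_le_sum (f := fun k => ∑ l, C k l)
      (fun k _ => Finset.sum_nonneg fun l _ => (hC k l).1) (Finset.mem_univ k)
    linarith

/-- A bound for the components of the inverse metric. -/
def Gbd : ℝ := F.G_bound.choose

lemma one_le_Gbd : 1 ≤ F.Gbd := F.G_bound.choose_spec.1

lemma abs_G_le (i : ι) {q : Spacetime} (hq : q ∈ slabCone T b) (hu : ‖q.2‖ = 1) (k l : Fin 5) :
    |F.G k l i q| ≤ F.Gbd := F.G_bound.choose_spec.2 i q hq hu k l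

lemma sq_shift_le (i : ι) {q : Spacetime} (hq : q ∈ slabCone T b) (hu : ‖q.2‖ = 1)
    (x : Fin 5 → ℝ) : (∑ k : Fin 3, F.G 1 k.succ.succ i q * x k.succ.succ) ^ 2 ≤
      3 * F.Gbd ^ 2 * ∑ k, angPart x k ^ 2 := by
  refine (Finset.sum_mul_sq_le_sq_mul_sq _ _ _).trans
    (mul_le_mul_of_nonneg_right ?_ (by positivity))
  refine (Finset.sum_le_sum fun k _ => sq_le_sq' (abs_le.1 (F.abs_G_le i hq hu 1 _)).1
    (abs_le.1 (F.abs_G_le i hq hu 1 _)).2).trans ?_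
  simp

lemma ang_le (i : ι) {q : Spacetime} (hq : q ∈ slabCone T b) (hu : ‖q.2‖ = 1)
    (x : Fin 5 → ℝ) : F.ang i q (angPart x) (angPart x) ≤ 3 * F.Gbd * ∑ k, angPart x k ^ 2 := by
  have h0 : 0 ≤ F.Gbd := zero_le_one.trans F.one_le_Gbd
  have h : ∀ k l, F.G (Fin.succ (Fin.succ k)) (Fin.succ (Fin.succ l)) i q * angPart x k * angPart x l ≤
      F.Gbd / 2 * angPart x k ^ 2 + F.Gbd / 2 * angPart x l ^ 2 := by
    intro k l
    have h1 := abs_le.1 (F.abs_G_le i hq hu k.succ.succ l.succ.succ)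
    nlinarith [sq_nonneg (angPart x k - angPart x l), sq_nonneg (angPart x k + angPart x l),
      mul_nonneg (sub_nonneg.2 h1.2) (sq_nonneg (angPart x k + angPart x l)),
      mul_nonneg (show 0 ≤ F.G k.succ.succ l.succ.succ i q + F.Gbd by linarith)
        (sq_nonneg (angPart x k - angPart x l))]
  refine (Finset.sum_le_sum fun k _ => Finset.sum_le_sum fun l _ => h k l).trans (le_of_eq ?_)
  simp only [Fin.sum_univ_three]
  ring

/-- The multiplier constant. -/
def mulC : ℝ := F.Gbd + 1

/-- Covectors of the coordinate functions and of the weight. -/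
def covTau : Fin 5 → ℝ := ![1, 0, 0, 0, 0]

/-- The covector `dz`. -/
def covZ : Fin 5 → ℝ := ![0, 1, 0, 0, 0]

/-- The covector of `z - A τ`. -/
def covWeight : Fin 5 → ℝ := ![-F.mulC, 1, 0, 0, 0]

lemma angPart_vec (x y : ℝ) : angPart ![x, y, 0, 0, 0] = 0 := by
  ext k; fin_cases k <;> rfl

lemma ang_zero (i : ι) (q : Spacetime) (ξ : Fin 3 → ℝ) : F.ang i q ξ 0 = 0 := by simp [ang]

lemma nul_vec (i : ι) (q : Spacetime) (x y : ℝ) :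
    F.nul i q ![x, y, 0, 0, 0] = -x - 1 / 2 * F.G 1 1 i q * y := by
  have := angPart_vec x y
  have h : ∀ k : Fin 3, (![x, y, 0, 0, 0] : Fin 5 → ℝ) k.succ.succ = 0 := fun k => congrFun this k
  simp only [nul, h]
  simp

/-- Sum of squares of the components. -/
lemma sum_sq_eq (d : Fin 5 → ℝ) :
    ∑ k, d k ^ 2 = d 0 ^ 2 + d 1 ^ 2 + ∑ k, angPart d k ^ 2 := by
  rw [Fin.sum_univ_succ, Fin.sum_univ_succ]
  simp [angPart, add_assoc]

lemma sq_nul_le (i : ι) {q : Spacetime} (hq : q ∈ slabCone T b) (hu : ‖q.2‖ = 1)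
    (d : Fin 5 → ℝ) : F.nul i q d ^ 2 ≤
      1 / 2 * F.G 1 1 i q ^ 2 * d 1 ^ 2 + 4 * d 0 ^ 2 + 12 * F.Gbd ^ 2 * ∑ k, angPart d k ^ 2 := by
  have hs := F.sq_shift_le i hq hu d
  unfold nul
  set t := ∑ k : Fin 3, F.G 1 k.succ.succ i q * d k.succ.succ
  set W := F.G 1 1 i q
  nlinarith [sq_nonneg (1 / 2 * W * d 1 - (d 0 + t)), sq_nonneg (d 0 - t)]

lemma sq_tau_le (i : ι) {q : Spacetime} (hq : q ∈ slabCone T b) (hu : ‖q.2‖ = 1)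
    (d : Fin 5 → ℝ) : d 0 ^ 2 ≤ 3 * F.nul i q d ^ 2 + F.Gbd ^ 2 * d 1 ^ 2 +
      9 * F.Gbd ^ 2 * ∑ k, angPart d k ^ 2 := by
  have hs := F.sq_shift_le i hq hu d
  have hW := sq_le_sq' (abs_le.1 (F.abs_G_le i hq hu 1 1)).1 (abs_le.1 (F.abs_G_le i hq hu 1 1)).2
  have e : d 0 = -F.nul i q d - 1 / 2 * F.G 1 1 i q * d 1 -
      ∑ k : Fin 3, F.G 1 k.succ.succ i q * d k.succ.succ := by unfold nul; ring
  set t := ∑ k : Fin 3, F.G 1 k.succ.succ i q * d k.succ.succ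
  set W := F.G 1 1 i q
  set s := F.nul i q d
  rw [e]
  have h2 : (W * d 1) ^ 2 ≤ F.Gbd ^ 2 * d 1 ^ 2 := by
    rw [mul_pow]; exact mul_le_mul_of_nonneg_right hW (sq_nonneg _)
  nlinarith [sq_nonneg (s - 1 / 2 * W * d 1), sq_nonneg (s - t), sq_nonneg (1 / 2 * W * d 1 - t),
    sq_nonneg (W * d 1)]

lemma energy_weight : ∃ c : ℝ, 0 < c ∧ ∀ i, ∀ q ∈ slabCone T b, ‖q.2‖ = 1 → ∀ d, Perp q d →
    F.energy F.mulC i q F.covWeight d ≤ -c * ∑ k, d k ^ 2 := by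
  obtain ⟨c, hc, hang⟩ := F.G_ang
  have hG := F.one_le_Gbd
  set B := F.Gbd with hB
  set M := 4 + B ^ 2 + (9 * B ^ 2 + 1) / c with hM
  have hM0 : 0 < M := by positivity
  refine ⟨1 / M, by positivity, fun i q hq hu d hd => ?_⟩
  rw [F.energy_eq hq, sum_sq_eq]
  have e1 : F.nul i q F.covWeight = F.mulC - 1 / 2 * F.G 1 1 i q := by
    rw [covWeight, nul_vec]; ring
  have e2 : angPart F.covWeight = 0 := angPart_vec _ _
  have e3 : F.covWeight 1 = 1 := rfl
  have hW := abs_le.1 (F.abs_G_le i hq hu 1 1)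
  have hα := hang i q hq hu (angPart d) hd
  change c * _ ≤ F.ang i q (angPart d) (angPart d) at hα
  have hd0 := F.sq_tau_le i hq hu d
  rw [e1, e2, e3, ang_zero, mulC, ← hB]
  rw [← hB] at hd0 hW
  set W := F.G 1 1 i q
  set X := ∑ k, angPart d k ^ 2
  set α := F.ang i q (angPart d) (angPart d)
  set s := F.nul i q d
  have hX : 0 ≤ X := Finset.sum_nonneg fun _ _ => sq_nonneg _
  have hα0 : 0 ≤ α := le_trans (by positivity) hα
  have hXα : X ≤ α / c := by rw [le_div_iff₀ hc]; linarith
  have h1 : d 0 ^ 2 + d 1 ^ 2 + X ≤ M * (d 1 ^ 2 + s ^ 2 + α) := by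
    have h2 : (9 * B ^ 2 + 1) * X ≤ (9 * B ^ 2 + 1) * (α / c) :=
      mul_le_mul_of_nonneg_left hXα (by positivity)
    have h3 : (9 * B ^ 2 + 1) * (α / c) = (9 * B ^ 2 + 1) / c * α := by ring
    have h4 : 0 ≤ (9 * B ^ 2 + 1) / c * (d 1 ^ 2 + s ^ 2) := by positivity
    have h5 : 0 ≤ B ^ 2 * (s ^ 2 + α) := by positivity
    rw [hM]
    nlinarith [sq_nonneg s, sq_nonneg (d 1)]
  have h2 : d 1 ^ 2 + s ^ 2 + α ≥ (1 / M) * (d 0 ^ 2 + d 1 ^ 2 + X) := by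
    rw [ge_iff_le, one_div, inv_mul_le_iff₀ hM0]; exact h1
  have h3 : d 1 ^ 2 + s ^ 2 + α ≤ (B + 1) * (d 1 ^ 2 * (B + 1 - 1 / 2 * W) - d 1 * 0 + 1 / 2 * 1 * α) +
      (s ^ 2 * 1 - s * 0 + 1 / 2 * (B + 1 - 1 / 2 * W) * α) := by
    have h4 : 1 ≤ B + 1 - 1 / 2 * W := by linarith
    have h5 : 1 ≤ (B + 1) * (B + 1 - 1 / 2 * W) := by nlinarith
    nlinarith [mul_nonneg (sub_nonneg.2 h5) (sq_nonneg (d 1)), mul_nonneg (sub_nonneg.2 h4) hα0,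
      mul_nonneg (sub_nonneg.2 hG) hα0]
  linarith

lemma energy_tau : ∃ C : ℝ, 0 ≤ C ∧ ∀ i, ∀ q ∈ slabCone T b, ‖q.2‖ = 1 → ∀ d, Perp q d →
    0 ≤ F.energy F.mulC i q covTau d ∧
    F.energy F.mulC i q covTau d ≤ C * (d 1 ^ 2 + ∑ k, angPart d k ^ 2) := by
  have hG := F.one_le_Gbd
  refine ⟨2 * F.Gbd + 1, by positivity, fun i q hq hu d hd => ?_⟩
  have h1 := F.ang_nonneg hq hu (i := i) hd
  have h2 := F.ang_le i hq hu d
  rw [F.energy_eq hq, covTau, nul_vec, angPart_vec, ang_zero, mulC]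
  have hX : 0 ≤ ∑ k, angPart d k ^ 2 := Finset.sum_nonneg fun _ _ => sq_nonneg _
  simp only [Matrix.cons_val_one, Matrix.cons_val_zero]
  constructor <;> nlinarith [sq_nonneg (d 1), mul_nonneg (by linarith : 0 ≤ F.Gbd) (sq_nonneg (d 1)),
    mul_nonneg (by linarith : 0 ≤ F.Gbd) hX]

lemma energy_bdry : ∃ c C : ℝ, 0 < c ∧ 0 ≤ C ∧ ∀ i, ∀ q ∈ slabCone T b, ‖q.2‖ = 1 → q.1.2 = b →
    ∀ d, Perp q d →
    c * d 1 ^ 2 - C * (d 0 ^ 2 + ∑ k, angPart d k ^ 2) ≤ F.energy F.mulC i q covZ d := by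
  have hG := F.one_le_Gbd
  obtain ⟨δ, hδ, hW⟩ := F.G_bdry
  set B := F.Gbd with hB
  refine ⟨δ / 2, 4 + 12 * B ^ 2 + 3 * B * (B + 1), by positivity, by positivity,
    fun i q hq hu hz d hd => ?_⟩
  have h1 := F.ang_nonneg hq hu (i := i) hd
  have h2 := F.ang_le i hq hu d
  have h3 := F.sq_nul_le i hq hu d
  have h4 := hW i q hq hu hz
  have h5 := (abs_le.1 (F.abs_G_le i hq hu 1 1)).2
  rw [F.energy_eq hq, covZ, nul_vec, angPart_vec, ang_zero, mulC]
  have hX : 0 ≤ ∑ k, angPart d k ^ 2 := Finset.sum_nonneg fun _ _ => sq_nonneg _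
  simp only [Matrix.cons_val_one, Matrix.cons_val_zero]
  rw [← hB] at h2 h3 h5 ⊢
  set W := F.G 1 1 i q
  set X := ∑ k, angPart d k ^ 2
  set α := F.ang i q (angPart d) (angPart d)
  set s := F.nul i q d
  have h6 : δ * d 1 ^ 2 ≤ W * (B + 1 - W) * d 1 ^ 2 :=
    mul_le_mul_of_nonneg_right (by nlinarith) (sq_nonneg _)
  have h7 : (B + 1) * α ≤ (B + 1) * (3 * B * X) := mul_le_mul_of_nonneg_left h2 (by linarith)
  have h8 : 0 ≤ W * α := mul_nonneg (by linarith) h1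
  have h9 : 0 ≤ (12 * B ^ 2 + 3 * B * (B + 1)) * d 0 ^ 2 := by positivity
  have h10 : 0 ≤ B * (B + 1) * X := by positivity
  nlinarith

lemma energy_bdry_abs : ∃ C : ℝ, 0 ≤ C ∧ ∀ i, ∀ q ∈ slabCone T b, ‖q.2‖ = 1 →
    ∀ d, Perp q d → |F.energy F.mulC i q covZ d| ≤ C * ∑ k, d k ^ 2 := by
  have hG := F.one_le_Gbd
  set B := F.Gbd with hB
  refine ⟨4 + 20 * B ^ 2 + 3 * B, by positivity, fun i q hq hu d hd => ?_⟩
  have h1 := F.ang_nonneg hq hu (i := i) hd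
  have h2 := F.ang_le i hq hu d
  have h3 := F.sq_nul_le i hq hu d
  have h5 := abs_le.1 (F.abs_G_le i hq hu 1 1)
  have h55 := sq_le_sq' h5.1 h5.2
  rw [sum_sq_eq, F.energy_eq hq, covZ, nul_vec, angPart_vec, ang_zero, mulC]
  have hX : 0 ≤ ∑ k, angPart d k ^ 2 := Finset.sum_nonneg fun _ _ => sq_nonneg _
  simp only [Matrix.cons_val_one, Matrix.cons_val_zero]
  rw [← hB] at h2 h3 h5 h55 ⊢
  set W := F.G 1 1 i q
  set X := ∑ k, angPart d k ^ 2
  set α := F.ang i q (angPart d) (angPart d)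
  set s := F.nul i q d
  have k1 : (B + 1) * α ≤ (B + 1) * (3 * B * X) := mul_le_mul_of_nonneg_left h2 (by linarith)
  have k2 : W ^ 2 * d 1 ^ 2 ≤ B ^ 2 * d 1 ^ 2 := mul_le_mul_of_nonneg_right h55 (sq_nonneg _)
  have k3 : |W * (B + 1) * d 1 ^ 2| ≤ B * (B + 1) * d 1 ^ 2 := by
    rw [abs_mul, abs_mul, abs_of_nonneg (sq_nonneg (d 1)), abs_of_pos (by linarith : 0 < B + 1)]
    exact mul_le_mul_of_nonneg_right (mul_le_mul_of_nonneg_right (abs_le.2 h5) (by linarith))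
      (sq_nonneg _)
  have k4 : |W * α| ≤ B * (3 * B * X) := by
    rw [abs_mul, abs_of_nonneg h1]
    exact mul_le_mul (abs_le.2 h5) h2 h1 (by linarith)
  have k3 := abs_le.1 k3
  have k4 := abs_le.1 k4
  have k5 : 0 ≤ B * X := by positivity
  have k6 : 0 ≤ B ^ 2 * X := by positivity
  have k7 : 0 ≤ B * d 0 ^ 2 := by positivity
  have k8 : 0 ≤ B ^ 2 * d 0 ^ 2 := by positivity
  have k9 : 0 ≤ B * d 1 ^ 2 := by positivity
  have k10 : 0 ≤ B ^ 2 * d 1 ^ 2 := by positivity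
  have k11 : B * d 1 ^ 2 ≤ B ^ 2 * d 1 ^ 2 := mul_le_mul_of_nonneg_right (by nlinarith) (sq_nonneg _)
  have k12 : B * X ≤ B ^ 2 * X := mul_le_mul_of_nonneg_right (by nlinarith) hX
  have k13 := sq_nonneg s
  have k14 := sq_nonneg (d 0)
  have k15 := sq_nonneg (d 1)
  have k16 : 0 ≤ (B + 1) * α := mul_nonneg (by linarith) h1
  rw [abs_le]
  constructor <;> linarith

end WaveFamily

end

section

variable {T b : ℝ} [hT : Fact (0 < T)] [hb : Fact (0 < b)]

namespace WaveFamily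

variable {ι : Type*} {m : ℕ} (F : WaveFamily ι T b m)

/-- The components of the multiplier `a ∂_z + N₂`. -/
def multC : Fin 5 → ι → Spacetime → ℝ :=
  ![fun _ _ => -1, fun i q => F.mulC + -1 / 2 * F.G 1 1 i q, fun i q => -1 * F.G 1 2 i q,
    fun i q => -1 * F.G 1 3 i q, fun i q => -1 * F.G 1 4 i q]

lemma mult_eq (i : ι) (q : Spacetime) (x : Fin 5 → ℝ) :
    F.mult F.mulC i q x = ∑ k, F.multC k i q * x k := by
  simp [mult, nul, multC, Fin.sum_univ_five, Fin.sum_univ_three]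
  ring

lemma multC_ub (k : Fin 5) : UB T b (fun _ : ι => slabCone T b) (2 * m + 1) (F.multC k) := by
  have h : ∀ _ : ι, RelOpen T b (slabCone T b) := fun _ => relOpen_slabCone
  fin_cases k
  exacts [UB.const h _ _, (UB.const h _ _).add h (UB.const_mul h _ (F.G_ub 1 1)),
    UB.const_mul h _ (F.G_ub 1 2), UB.const_mul h _ (F.G_ub 1 3), UB.const_mul h _ (F.G_ub 1 4)]

/-- The energy current. -/
def flux (i : ι) (u : Spacetime → ℝ) (k : Fin 5) (q : Spacetime) : ℝ :=
  (∑ l, F.multC l i q * D T b l u q) * (∑ j, F.G k j i q * D T b j u q) -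
    1 / 2 * (F.multC k i q * ∑ j, ∑ l, F.G j l i q * D T b j u q * D T b l u q)

lemma sum_flux (i : ι) (u : Spacetime → ℝ) (n : Fin 5 → ℝ) (q : Spacetime) :
    ∑ k, n k * F.flux i u k q = F.energy F.mulC i q n fun k => D T b k u q := by
  unfold energy flux
  rw [mult_eq, mult_eq]
  unfold bil
  simp only [mul_sub, Finset.sum_sub_distrib]
  congr 1
  · rw [Finset.mul_sum]
    refine Finset.sum_congr rfl fun k _ => ?_
    rw [show ∑ l, F.G k l i q * n k * D T b l u q = n k * ∑ l, F.G k l i q * D T b l u q by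
      rw [Finset.mul_sum]; exact Finset.sum_congr rfl fun _ _ => by ring]
    ring
  · rw [mul_assoc, Finset.sum_mul, Finset.mul_sum]
    exact Finset.sum_congr rfl fun k _ => by ring

lemma flux_contDiffOn {i : ι} {u : Spacetime → ℝ} (hu : ContDiffOn ℝ (2 : ℕ) u (F.S i))
    (k : Fin 5) : ContDiffOn ℝ (1 : ℕ) (F.flux i u k) (F.S i) := by
  have hS := F.S_relOpen i
  have d1 : ∀ c, ContDiffOn ℝ (1 : ℕ) (D T b c u) (F.S i) := fun c => contDiffOn_D hS hu c
  have dG : ∀ a c, ContDiffOn ℝ (1 : ℕ) (F.G a c i) (F.S i) := fun a c =>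
    ((Dom.contDiffOn (F.G_ub a c) i).of_le (by norm_cast; omega)).mono (F.S_sub i)
  have dY : ∀ c, ContDiffOn ℝ (1 : ℕ) (F.multC c i) (F.S i) := fun c =>
    ((Dom.contDiffOn (F.multC_ub c) i).of_le (by norm_cast; omega)).mono (F.S_sub i)
  exact ((ContDiffOn.sum fun l _ => (dY l).mul (d1 l)).mul
    (ContDiffOn.sum fun l _ => (dG k l).mul (d1 l))).sub (contDiffOn_const.mul
    ((dY k).mul (ContDiffOn.sum fun j _ => ContDiffOn.sum fun l _ =>
      ((dG j l).mul (d1 j)).mul (d1 l))))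

/-- The error terms of the energy identity. -/
def divErr (i : ι) (u : Spacetime → ℝ) (q : Spacetime) : ℝ :=
  ((∑ k, (∑ l, D T b k (F.multC l i) q * D T b l u q) * ∑ j, F.G k j i q * D T b j u q) +
    (∑ l, F.multC l i q * D T b l u q) *
      ((∑ k, ∑ j, D T b k (F.G k j i) q * D T b j u q) + ∑ j, -F.β j i q * D T b j u q) +
    (∑ k, -1 / 2 * D T b k (F.multC k i) q * ∑ j, ∑ l, F.G j l i q * D T b j u q * D T b l u q) +
    (∑ k, -1 / 2 * F.multC k i q *
      ∑ j, ∑ l, D T b k (F.G j l i) q * D T b j u q * D T b l u q) +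
    ∑ k, (∑ r, F.multC r i q * ∑ l, structConst k r l * D T b l u q) *
      ∑ j, F.G k j i q * D T b j u q)

lemma div_flux {i : ι} {u : Spacetime → ℝ} (hu : ContDiffOn ℝ (2 : ℕ) u (F.S i))
    {q : Spacetime} (hq : q ∈ F.S i) :
    ∑ k, D T b k (F.flux i u k) q =
      (∑ l, F.multC l i q * D T b l u q) * F.L i u q + F.divErr i u q := by
  have hS := F.S_relOpen i
  have hK := F.S_sub i hq
  have d1 : ∀ c, DifferentiableWithinAt ℝ (D T b c u) (slabCone T b) q := fun c =>
    diffWithin_of_contDiffOn (contDiffOn_D hS hu c) hS (by norm_num) hq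
  have dG : ∀ a c, DifferentiableWithinAt ℝ (F.G a c i) (slabCone T b) q := fun a c =>
    diffWithin_of_contDiffOn (Dom.contDiffOn (F.G_ub a c) i) relOpen_slabCone (by omega) hK
  have dY : ∀ c, DifferentiableWithinAt ℝ (F.multC c i) (slabCone T b) q := fun c =>
    diffWithin_of_contDiffOn (Dom.contDiffOn (F.multC_ub c) i) relOpen_slabCone (by omega) hK
  have e1 : ∀ k, D T b k (fun q => ∑ l, F.multC l i q * D T b l u q) q =
      ∑ l, (F.multC l i q * D T b k (D T b l u) q + D T b k (F.multC l i) q * D T b l u q) := by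
    intro k
    rw [D_sum _ _ (fun c _ => (dY c).fun_mul (d1 c)) hK]
    exact Finset.sum_congr rfl fun c _ => D_mul (dY c) (d1 c) hK k
  have e2 : ∀ k, D T b k (fun q => ∑ j, F.G k j i q * D T b j u q) q =
      ∑ j, (F.G k j i q * D T b k (D T b j u) q + D T b k (F.G k j i) q * D T b j u q) := by
    intro k
    rw [D_sum _ _ (fun c _ => (dG k c).fun_mul (d1 c)) hK]
    exact Finset.sum_congr rfl fun c _ => D_mul (dG k c) (d1 c) hK k
  have e3 : ∀ k, D T b k (fun q => ∑ j, ∑ l, F.G j l i q * D T b j u q * D T b l u q) q =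
      ∑ j, ∑ l, (F.G j l i q * (D T b k (D T b j u) q * D T b l u q +
        D T b j u q * D T b k (D T b l u) q) +
        D T b k (F.G j l i) q * D T b j u q * D T b l u q) := by
    intro k
    rw [D_sum _ _ (fun j _ => DifferentiableWithinAt.fun_sum fun l _ =>
      ((dG j l).fun_mul (d1 j)).fun_mul (d1 l)) hK]
    refine Finset.sum_congr rfl fun j _ => ?_
    rw [D_sum _ _ (fun l _ => ((dG j l).fun_mul (d1 j)).fun_mul (d1 l)) hK]
    refine Finset.sum_congr rfl fun l _ => ?_
    rw [D_mul ((dG j l).fun_mul (d1 j)) (d1 l) hK, D_mul (dG j l) (d1 j) hK]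
    ring
  have f1 : DifferentiableWithinAt ℝ (fun q => ∑ l, F.multC l i q * D T b l u q) (slabCone T b) q :=
    DifferentiableWithinAt.fun_sum fun l _ => (dY l).fun_mul (d1 l)
  have f2 : ∀ k, DifferentiableWithinAt ℝ (fun q => ∑ j, F.G k j i q * D T b j u q)
      (slabCone T b) q := fun k => DifferentiableWithinAt.fun_sum fun l _ => (dG k l).fun_mul (d1 l)
  have f3 : DifferentiableWithinAt ℝ
      (fun q => ∑ j, ∑ l, F.G j l i q * D T b j u q * D T b l u q) (slabCone T b) q :=
    DifferentiableWithinAt.fun_sum fun j _ => DifferentiableWithinAt.fun_sum fun l _ =>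
      ((dG j l).fun_mul (d1 j)).fun_mul (d1 l)
  have key := div_algebra (Y := fun k => F.multC k i q) (d := fun k => D T b k u q)
    (β := fun k => F.β k i q) (G := fun k l => F.G k l i q)
    (H := fun k l => D T b k (D T b l u) q) (dY := fun k l => D T b k (F.multC l i) q)
    (dG := fun k j l => D T b k (F.G j l i) q) (c := structConst)
    (fun k l => F.G_symm k l i q hK) (fun k l => D_comm hS hu hq k l)
  unfold L waveOp divErr
  rw [← key]
  refine Finset.sum_congr rfl fun k _ => ?_
  unfold flux
  rw [D_sub (f1.fun_mul (f2 k)) (((dY k).fun_mul f3).const_mul _) hK, D_mul f1 (f2 k) hK,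
    D_mul (differentiableWithinAt_const _) ((dY k).fun_mul f3) hK, D_const, D_mul (dY k) f3 hK,
    e1, e2, e3]
  ring

lemma ub_bigO {n : ℕ} {H : ι → Spacetime → ℝ} (h : UB T b (fun _ => slabCone T b) n H)
    {P : ι × (Spacetime → ℝ) × Spacetime → Prop}
    (hP : ∀ x, P x → x.2.2 ∈ slabCone T b ∧ ‖x.2.2.2‖ = 1) :
    (fun x : ι × (Spacetime → ℝ) × Spacetime => H x.1 x.2.2) =O[𝓟 {x | P x}]
      fun _ => (1 : ℝ) := by
  obtain ⟨C, -, hC⟩ := h.bound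
  rw [Asymptotics.isBigO_principal]
  exact ⟨C, fun x hx => by simpa using hC x.1 x.2.2 (hP x hx).1 (hP x hx).2⟩

/-- The divergence of the energy current is quadratic in the first derivatives and the source. -/
lemma abs_div_flux_le : ∃ C : ℝ, 0 ≤ C ∧ ∀ i (u : Spacetime → ℝ), ContDiffOn ℝ (2 : ℕ) u (F.S i) →
    ∀ q ∈ F.S i, ‖q.2‖ = 1 → |∑ k, D T b k (F.flux i u k) q| ≤
      C * (∑ k, D T b k u q ^ 2 + F.L i u q ^ 2) := by
  let P : ι × (Spacetime → ℝ) × Spacetime → Prop := fun x =>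
    x.2.2 ∈ slabCone T b ∧ ‖x.2.2.2‖ = 1
  have hP : ∀ x, P x → x.2.2 ∈ slabCone T b ∧ ‖x.2.2.2‖ = 1 := fun x h => h
  let s : ι × (Spacetime → ℝ) × Spacetime → ℝ := fun x => √(∑ k, D T b k x.2.1 x.2.2 ^ 2)
  have hd : ∀ k, (fun x : ι × (Spacetime → ℝ) × Spacetime => D T b k x.2.1 x.2.2)
      =O[𝓟 {x | P x}] s := by
    intro k
    rw [Asymptotics.isBigO_principal]
    refine ⟨1, fun x _ => ?_⟩
    rw [one_mul, Real.norm_eq_abs, Real.norm_of_nonneg (Real.sqrt_nonneg _)]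
    refine Real.abs_le_sqrt ?_
    exact Finset.single_le_sum (f := fun k => D T b k x.2.1 x.2.2 ^ 2) (fun _ _ => sq_nonneg _)
      (Finset.mem_univ k)
  have hG : ∀ k l, _ := fun k l => ub_bigO (F.G_ub k l) hP
  have hdG : ∀ j k l, _ := fun j k l => ub_bigO ((F.G_ub k l).D j) hP
  have hY : ∀ k, _ := fun k => ub_bigO (F.multC_ub k) hP
  have hdY : ∀ j k, _ := fun j k => ub_bigO ((F.multC_ub k).D j) hP
  have hβ : ∀ k, _ := fun k => ub_bigO (F.β_ub k) hP
  have lin : ∀ {f g : ι × (Spacetime → ℝ) × Spacetime → ℝ}, f =O[𝓟 {x | P x}] (fun _ => (1 : ℝ)) →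
      g =O[𝓟 {x | P x}] s → (fun x => f x * g x) =O[𝓟 {x | P x}] s := fun hf hg => by
    simpa using hf.mul hg
  have quad : ∀ {f g : ι × (Spacetime → ℝ) × Spacetime → ℝ}, f =O[𝓟 {x | P x}] s →
      g =O[𝓟 {x | P x}] s → (fun x => f x * g x) =O[𝓟 {x | P x}] (fun x => s x * s x) :=
    fun hf hg => hf.mul hg
  have quad' : ∀ {f g : ι × (Spacetime → ℝ) × Spacetime → ℝ},
      f =O[𝓟 {x | P x}] (fun _ => (1 : ℝ)) → g =O[𝓟 {x | P x}] (fun x => s x * s x) →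
      (fun x => f x * g x) =O[𝓟 {x | P x}] (fun x => s x * s x) := fun hf hg => by
    simpa using hf.mul hg
  have herr : (fun x : ι × (Spacetime → ℝ) × Spacetime => F.divErr x.1 x.2.1 x.2.2)
      =O[𝓟 {x | P x}] fun x => s x * s x := by
    unfold divErr
    refine ((((Asymptotics.IsBigO.fun_sum fun k _ => quad
      (Asymptotics.IsBigO.fun_sum fun l _ => lin (hdY k l) (hd l))
      (Asymptotics.IsBigO.fun_sum fun l _ => lin (hG k l) (hd l))).add
      (quad (Asymptotics.IsBigO.fun_sum fun l _ => lin (hY l) (hd l))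
        ((Asymptotics.IsBigO.fun_sum fun k _ => Asymptotics.IsBigO.fun_sum fun j _ =>
          lin (hdG k k j) (hd j)).add
        (Asymptotics.IsBigO.fun_sum fun l _ => lin (hβ l).neg_left (hd l))))).add
      (Asymptotics.IsBigO.fun_sum fun k _ => quad' ((hdY k k).const_mul_left _)
        (Asymptotics.IsBigO.fun_sum fun j _ => Asymptotics.IsBigO.fun_sum fun l _ =>
          quad (lin (hG j l) (hd j)) (hd l)))).add
      (Asymptotics.IsBigO.fun_sum fun k _ => quad' ((hY k).const_mul_left _)
        (Asymptotics.IsBigO.fun_sum fun j _ => Asymptotics.IsBigO.fun_sum fun l _ =>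
          quad (lin (hdG k j l) (hd j)) (hd l)))).add
      (Asymptotics.IsBigO.fun_sum fun k _ => quad
        (Asymptotics.IsBigO.fun_sum fun r _ => lin (hY r)
          (Asymptotics.IsBigO.fun_sum fun l _ => (hd l).const_mul_left _))
        (Asymptotics.IsBigO.fun_sum fun l _ => lin (hG k l) (hd l)))
  have hmul : (fun x : ι × (Spacetime → ℝ) × Spacetime =>
      ∑ l, F.multC l x.1 x.2.2 * D T b l x.2.1 x.2.2) =O[𝓟 {x | P x}] s :=
    Asymptotics.IsBigO.fun_sum fun l _ => lin (hY l) (hd l)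
  rw [Asymptotics.isBigO_principal] at herr hmul
  obtain ⟨C1, h1⟩ := herr
  obtain ⟨C2, h2⟩ := hmul
  refine ⟨|C1| + |C2|, by positivity, fun i u hu q hq hun => ?_⟩
  rw [F.div_flux hu hq]
  have k1 := h1 (i, u, q) ⟨F.S_sub i hq, hun⟩
  have k2 := h2 (i, u, q) ⟨F.S_sub i hq, hun⟩
  have hs : s (i, u, q) * s (i, u, q) = ∑ k, D T b k u q ^ 2 :=
    Real.mul_self_sqrt (Finset.sum_nonneg fun _ _ => sq_nonneg _)
  have hs0 : 0 ≤ s (i, u, q) := Real.sqrt_nonneg _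
  rw [Real.norm_eq_abs, hs, Real.norm_of_nonneg (Finset.sum_nonneg fun _ _ => sq_nonneg _)] at k1
  rw [Real.norm_eq_abs, Real.norm_of_nonneg hs0] at k2
  simp only at k1 k2
  set e := ∑ k, D T b k u q ^ 2
  set t := s (i, u, q)
  have he : 0 ≤ e := Finset.sum_nonneg fun _ _ => sq_nonneg _
  have k3 : |(∑ l, F.multC l i q * D T b l u q) * F.L i u q| ≤ |C2| * (e + F.L i u q ^ 2) := by
    rw [abs_mul]
    have k4 : C2 * t ≤ |C2| * t := mul_le_mul_of_nonneg_right (le_abs_self _) hs0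
    calc _ ≤ (|C2| * t) * |F.L i u q| := mul_le_mul_of_nonneg_right (k2.trans k4) (abs_nonneg _)
      _ = |C2| * (t * |F.L i u q|) := by ring
      _ ≤ _ := by
        refine mul_le_mul_of_nonneg_left ?_ (abs_nonneg _)
        rw [← hs, ← sq_abs (F.L i u q)]
        nlinarith [sq_nonneg (t - |F.L i u q|), sq_nonneg t, sq_nonneg (|F.L i u q|)]
  have k5 : C1 * e ≤ |C1| * (e + F.L i u q ^ 2) :=
    (mul_le_mul_of_nonneg_right (le_abs_self _) he).trans
      (mul_le_mul_of_nonneg_left (by nlinarith [sq_nonneg (F.L i u q)]) (abs_nonneg _))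
  calc _ ≤ _ := abs_add_le _ _
    _ ≤ |C2| * (e + F.L i u q ^ 2) + |C1| * (e + F.L i u q ^ 2) := add_le_add k3 (k1.trans k5)
    _ = _ := by ring

end WaveFamily

end

section

variable {T b : ℝ} [hT : Fact (0 < T)] [hb : Fact (0 < b)]

namespace WaveFamily

variable {ι : Type*} {m : ℕ} (F : WaveFamily ι T b m)

/-- The exponential weight. -/
def expWeight (lam : ℝ) (q : Spacetime) : ℝ := Real.exp (lam * (q.1.2 - F.mulC * q.1.1))

/-- The cutoff away from the set `{ρ ≤ 0}`. -/
def cutoff (s : ℝ) (i : ι) (q : Spacetime) : ℝ := Real.smoothTransition ((F.ρ i q - s) / s)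

/-- The localized weight. -/
def wgt (s lam : ℝ) (i : ι) (q : Spacetime) : ℝ := F.cutoff s i q * F.expWeight lam q

lemma expWeight_pos (lam : ℝ) (q : Spacetime) : 0 < F.expWeight lam q := Real.exp_pos _

lemma wgt_nonneg (s lam : ℝ) (i : ι) (q : Spacetime) : 0 ≤ F.wgt s lam i q :=
  mul_nonneg (Real.smoothTransition.nonneg _) (F.expWeight_pos lam q).le

lemma wgt_le (s lam : ℝ) (i : ι) (q : Spacetime) : F.wgt s lam i q ≤ F.expWeight lam q :=
  mul_le_of_le_one_left (F.expWeight_pos lam q).le (Real.smoothTransition.le_one _)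

lemma wgt_eq_zero {s : ℝ} (hs : 0 < s) (lam : ℝ) {i : ι} {q : Spacetime} (h : F.ρ i q ≤ s) :
    F.wgt s lam i q = 0 := by
  rw [wgt, cutoff, Real.smoothTransition.zero_of_nonpos, zero_mul]
  exact div_nonpos_of_nonpos_of_nonneg (by linarith) hs.le

lemma wgt_eq_exp {s : ℝ} (hs : 0 < s) (lam : ℝ) {i : ι} {q : Spacetime} (h : 2 * s ≤ F.ρ i q) :
    F.wgt s lam i q = F.expWeight lam q := by
  rw [wgt, cutoff, Real.smoothTransition.one_of_one_le, one_mul]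
  rw [le_div_iff₀ hs]; linarith

lemma expWeight_contDiff (lam : ℝ) {n : WithTop ℕ∞} : ContDiff ℝ n (F.expWeight lam) := by
  unfold expWeight; fun_prop

lemma cutoff_contDiffOn (s : ℝ) (i : ι) :
    ContDiffOn ℝ (1 : ℕ) (F.cutoff s i) (slabCone T b) :=
  (Real.smoothTransition.contDiff (n := 1)).comp_contDiffOn
    (((F.ρ_smooth i).sub contDiffOn_const).div_const s)

lemma wgt_contDiffOn (s lam : ℝ) (i : ι) :
    ContDiffOn ℝ (1 : ℕ) (F.wgt s lam i) (slabCone T b) :=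
  (F.cutoff_contDiffOn s i).mul (F.expWeight_contDiff lam).contDiffOn

/-- Functions that are multiplied by the weight extend by zero. -/
lemma wgt_mul_contDiffOn {s : ℝ} (hs : 0 < s) (lam : ℝ) {i : ι} {n : ℕ} (hn : n ≤ 1)
    {f : Spacetime → ℝ} (hf : ContDiffOn ℝ n f (F.S i)) :
    ContDiffOn ℝ n (fun q => F.wgt s lam i q * f q) (slabCone T b) := by
  intro q hq
  by_cases h : 0 < F.ρ i q
  · have hqS : q ∈ F.S i := ⟨hq, h⟩
    refine ContDiffWithinAt.mul (((F.wgt_contDiffOn s lam i).of_le (by exact_mod_cast hn)) q hq) ?_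
    exact (hf q hqS).mono_of_mem_nhdsWithin ((F.S_relOpen i).mem_nhdsWithin hqS)
  · have hev : ∀ᶠ q' in 𝓝[slabCone T b] q, F.ρ i q' < s :=
      ((F.ρ_smooth i).continuousOn q hq).eventually (gt_mem_nhds (by linarith))
    refine (contDiffWithinAt_const (c := (0 : ℝ))).congr_of_eventuallyEq ?_ ?_
    · filter_upwards [hev] with q' hq'
      rw [F.wgt_eq_zero hs lam hq'.le, zero_mul]
    · rw [F.wgt_eq_zero hs lam (by linarith), zero_mul]

lemma D_expWeight (lam : ℝ) {q : Spacetime} (hq : q ∈ slabCone T b) (k : Fin 5) :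
    D T b k (F.expWeight lam) q = lam * F.expWeight lam q * F.covWeight k := by
  let ℓ : Spacetime →L[ℝ] ℝ := ((ContinuousLinearMap.snd ℝ ℝ ℝ).comp
    (ContinuousLinearMap.fst ℝ (ℝ × ℝ) E3)) - F.mulC • ((ContinuousLinearMap.fst ℝ ℝ ℝ).comp
    (ContinuousLinearMap.fst ℝ (ℝ × ℝ) E3))
  have h1 : D T b k (fun q => ℓ q) q = F.covWeight k := by
    unfold D
    rw [ℓ.fderivWithin (uniqueDiffOn_slabCone q hq), frame_eq]
    fin_cases k <;> simp [ℓ, covWeight]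
  have h2 : HasDerivAt (fun x => Real.exp (lam * x)) (lam * F.expWeight lam q) (ℓ q) := by
    have := ((hasDerivAt_id (ℓ q)).const_mul lam).exp
    refine this.congr_deriv ?_
    simp [expWeight, ℓ]; ring
  have := D_comp (f := fun q => ℓ q) h2 ℓ.differentiableAt.differentiableWithinAt hq k
  rw [h1] at this
  exact this

lemma D_wgt {s : ℝ} (hs : 0 < s) (lam : ℝ) {i : ι} {q : Spacetime} (hq : q ∈ slabCone T b) :
    ∃ e : ℝ, 0 ≤ e ∧ ∀ k, D T b k (F.wgt s lam i) q =
      e * D T b k (F.ρ i) q + lam * F.wgt s lam i q * F.covWeight k := by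
  have hρ := diffWithin_of_contDiffOn (F.ρ_smooth i) relOpen_slabCone one_ne_zero hq
  have hh : HasDerivAt (fun x => Real.smoothTransition ((x - s) / s))
      (deriv Real.smoothTransition ((F.ρ i q - s) / s) * (1 / s)) (F.ρ i q) := by
    have h1 : HasDerivAt Real.smoothTransition
        (deriv Real.smoothTransition ((F.ρ i q - s) / s)) ((F.ρ i q - s) / s) :=
      ((Real.smoothTransition.contDiff (n := 1)).differentiable one_ne_zero _).hasDerivAt
    exact h1.comp (F.ρ i q) (((hasDerivAt_id _).sub_const s).div_const s)
  refine ⟨deriv Real.smoothTransition ((F.ρ i q - s) / s) * (1 / s) * F.expWeight lam q, ?_,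
    fun k => ?_⟩
  · have := Real.smoothTransition.monotone.deriv_nonneg (x := (F.ρ i q - s) / s)
    have := (F.expWeight_pos lam q).le
    positivity
  · have h3 := D_comp hh hρ hq k
    have h4 := D_mul (f := F.cutoff s i) (g := F.expWeight lam)
      (diffWithin_of_contDiffOn (F.cutoff_contDiffOn s i) relOpen_slabCone one_ne_zero hq)
      ((F.expWeight_contDiff lam (n := 1)).differentiable one_ne_zero q).differentiableWithinAt hq k
    rw [F.D_expWeight lam hq] at h4
    change D T b k (F.cutoff s i) q = _ at h3
    rw [h3] at h4
    change D T b k (F.wgt s lam i) q = _ at h4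
    rw [h4, wgt]
    ring

lemma D_wgt_mul {s : ℝ} (lam : ℝ) {i : ι} {f : Spacetime → ℝ}
    (hf : ContDiffOn ℝ (1 : ℕ) f (F.S i)) {q : Spacetime} (hq : q ∈ F.S i) (k : Fin 5) :
    D T b k (fun q => F.wgt s lam i q * f q) q =
      F.wgt s lam i q * D T b k f q + D T b k (F.wgt s lam i) q * f q :=
  D_mul (diffWithin_of_contDiffOn (F.wgt_contDiffOn s lam i) relOpen_slabCone one_ne_zero
    (F.S_sub i hq)) (diffWithin_of_contDiffOn hf (F.S_relOpen i) one_ne_zero hq) (F.S_sub i hq) k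

lemma D_wgt_mul_zero {s : ℝ} (hs : 0 < s) (lam : ℝ) {i : ι} {f : Spacetime → ℝ}
    {q : Spacetime} (hq : q ∈ slabCone T b) (hqS : q ∉ F.S i) (k : Fin 5) :
    D T b k (fun q => F.wgt s lam i q * f q) q = 0 := by
  have h : ¬ 0 < F.ρ i q := fun h => hqS ⟨hq, h⟩
  have hev : ∀ᶠ q' in 𝓝[slabCone T b] q, F.ρ i q' < s :=
    ((F.ρ_smooth i).continuousOn q hq).eventually (gt_mem_nhds (by linarith))
  have : (fun q => F.wgt s lam i q * f q) =ᶠ[𝓝[slabCone T b] q] fun _ => 0 := by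
    filter_upwards [hev] with q' hq'
    rw [F.wgt_eq_zero hs lam hq'.le, zero_mul]
  unfold D
  rw [this.fderivWithin_eq (by rw [F.wgt_eq_zero hs lam (by linarith), zero_mul])]
  simp

/-- The weighted integral over the slab. -/
def bulk (s lam : ℝ) (i : ι) (f : Spacetime → ℝ) : ℝ :=
  ∫ p, F.wgt s lam i (inj p) * f (inj p) ∂slabMeasure T b

/-- The weighted integral over the part `z = b` of the boundary. -/
def bdry (s lam : ℝ) (i : ι) (f : Spacetime → ℝ) : ℝ :=
  ∫ p, F.wgt s lam i ((p.1, b), p.2) * f ((p.1, b), p.2) ∂stripMeasure 0 T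

/-- The weighted integral over the part `τ = 0` of the boundary. -/
def init (s lam : ℝ) (i : ι) (f : Spacetime → ℝ) : ℝ :=
  ∫ p, F.wgt s lam i ((0, p.1), p.2) * f ((0, p.1), p.2) ∂stripMeasure 0 b

section integrability

variable {s : ℝ} (hs : 0 < s) (lam : ℝ) {i : ι} {f : Spacetime → ℝ} (hf : ContinuousOn f (F.S i))
include hs hf

lemma wgt_mul_continuousOn : ContinuousOn (fun q => F.wgt s lam i q * f q) (slabCone T b) :=
  (F.wgt_mul_contDiffOn hs lam zero_le_one (contDiffOn_zero.2 hf)).continuousOn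

lemma integrable_bulk :
    Integrable (fun p => F.wgt s lam i (inj p) * f (inj p)) (slabMeasure T b) :=
  integrable_slab (ContinuousOn.comp_inj (F.wgt_mul_continuousOn hs lam hf))

lemma integrable_bdry {τ₀ : ℝ} (h0 : τ₀ ∈ Icc 0 b) :
    Integrable (fun p => F.wgt s lam i ((p.1, τ₀), p.2) * f ((p.1, τ₀), p.2)) (stripMeasure 0 T) :=
  integrable_strip ((F.wgt_mul_continuousOn hs lam hf).comp (by fun_prop)
    fun p hp => ⟨hp.1, h0, p.2.ne_zero⟩)

lemma integrable_init {τ₀ : ℝ} (h0 : τ₀ ∈ Icc 0 T) :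
    Integrable (fun p => F.wgt s lam i ((τ₀, p.1), p.2) * f ((τ₀, p.1), p.2)) (stripMeasure 0 b) :=
  integrable_strip ((F.wgt_mul_continuousOn hs lam hf).comp (by fun_prop)
    fun p hp => ⟨h0, hp.1, p.2.ne_zero⟩)

end integrability

lemma L_continuousOn {i : ι} {u : Spacetime → ℝ} (hu : ContDiffOn ℝ (2 : ℕ) u (F.S i)) :
    ContinuousOn (F.L i u) (F.S i) := by
  have hS := F.S_relOpen i
  have d1 : ∀ c, ContDiffOn ℝ (1 : ℕ) (D T b c u) (F.S i) := fun c => contDiffOn_D hS hu c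
  have d2 : ∀ a c, ContinuousOn (D T b a (D T b c u)) (F.S i) := fun a c =>
    (contDiffOn_D hS (d1 c) a (n := 0)).continuousOn
  have dG : ∀ a c, ContinuousOn (F.G a c i) (F.S i) := fun a c =>
    (Dom.contDiffOn (F.G_ub a c) i).continuousOn.mono (F.S_sub i)
  have dβ : ∀ c, ContinuousOn (F.β c i) (F.S i) := fun c =>
    (Dom.contDiffOn (F.β_ub c) i).continuousOn.mono (F.S_sub i)
  unfold L waveOp
  exact (continuousOn_finsetSum _ fun a _ => continuousOn_finsetSum _ fun c _ =>
    (dG a c).mul (d2 a c)).add (continuousOn_finsetSum _ fun c _ =>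
      (dβ c).mul (d1 c).continuousOn)

/-- The weighted energy inequality. -/
theorem energy_ineq : ∃ c C : ℝ, 0 < c ∧ 0 ≤ C ∧ ∀ (i : ι) (s lam : ℝ) (u : Spacetime → ℝ), 0 < s →
    0 ≤ lam → ContDiffOn ℝ (2 : ℕ) u (F.S i) →
    (lam * c - C) * F.bulk s lam i (fun q => ∑ k, D T b k u q ^ 2) +
      F.bdry s lam i (F.flux i u 1) ≤
    C * F.bulk s lam i (fun q => F.L i u q ^ 2) + F.init s lam i (F.flux i u 0) := by
  obtain ⟨c, hc, hw⟩ := F.energy_weight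
  obtain ⟨C, hC, hdiv⟩ := F.abs_div_flux_le
  obtain ⟨C₀, -, htau⟩ := F.energy_tau
  refine ⟨c, C, hc, hC, fun i s lam u hs hlam hu => ?_⟩
  have hS := F.S_relOpen i
  have hflux := F.flux_contDiffOn hu
  have d1 : ∀ c, ContinuousOn (D T b c u) (F.S i) := fun c => (contDiffOn_D hS hu c).continuousOn
  have hsq : ContinuousOn (fun q => ∑ k, D T b k u q ^ 2) (F.S i) :=
    continuousOn_finsetSum _ fun k _ => (d1 k).pow 2
  have hL2 : ContinuousOn (fun q => F.L i u q ^ 2) (F.S i) := (F.L_continuousOn hu).pow 2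
  have hdivthm := integral_div (T := T) (b := b)
    (f := fun k q => F.wgt s lam i q * F.flux i u k q)
    (fun k => F.wgt_mul_contDiffOn hs lam le_rfl (hflux k))
  -- the pointwise inequality
  have hpt : ∀ q ∈ slabCone T b, ‖q.2‖ = 1 →
      ∑ k, D T b k (fun q => F.wgt s lam i q * F.flux i u k q) q ≤
      (C - lam * c) * (F.wgt s lam i q * ∑ k, D T b k u q ^ 2) +
        C * (F.wgt s lam i q * F.L i u q ^ 2) := by
    intro q hq hun
    by_cases hqS : q ∈ F.S i
    · obtain ⟨e, he, hD⟩ := F.D_wgt hs lam (i := i) hq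
      have h1 : ∑ k, D T b k (fun q => F.wgt s lam i q * F.flux i u k q) q =
          F.wgt s lam i q * ∑ k, D T b k (F.flux i u k) q +
          (e * F.energy F.mulC i q (fun k => D T b k (F.ρ i) q) (fun k => D T b k u q) +
          lam * F.wgt s lam i q * F.energy F.mulC i q F.covWeight (fun k => D T b k u q)) := by
        rw [← sum_flux, ← sum_flux, Finset.mul_sum, Finset.mul_sum, Finset.mul_sum,
          ← Finset.sum_add_distrib, ← Finset.sum_add_distrib]
        refine Finset.sum_congr rfl fun k _ => ?_
        rw [F.D_wgt_mul lam (hflux k) hqS, hD k]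
        ring
      have h2 := F.energy_nonpos hq hun (i := i) (a := F.mulC)
        (by have := F.one_le_Gbd; unfold mulC; linarith) (perp_D (T := T) (b := b) (F.ρ i) q) (perp_D (T := T) (b := b) u q)
        (F.ρ_z i q hq hqS.2) (F.ρ_causal i q hq hun hqS.2)
      have h3 := hw i q hq hun _ (perp_D (T := T) (b := b) u q)
      have h4 := (le_abs_self _).trans (hdiv i u hu q hqS hun)
      have h5 := F.wgt_nonneg s lam i q
      rw [h1]
      have h6 := mul_le_mul_of_nonneg_left h4 h5
      have h7 := mul_le_mul_of_nonneg_left h3 (mul_nonneg hlam h5)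
      have h8 := mul_nonpos_of_nonneg_of_nonpos he h2
      nlinarith
    · rw [Finset.sum_eq_zero fun k _ => F.D_wgt_mul_zero hs lam hq hqS k]
      rw [F.wgt_eq_zero hs lam (le_of_not_gt fun h => hqS ⟨hq, hs.trans h⟩)]
      simp
  have hub : ∫ p, ∑ k, D T b k (fun q => F.wgt s lam i q * F.flux i u k q) (inj p) ∂slabMeasure T b
      ≤ (C - lam * c) * F.bulk s lam i (fun q => ∑ k, D T b k u q ^ 2) +
        C * F.bulk s lam i (fun q => F.L i u q ^ 2) := by
    unfold bulk
    rw [← integral_const_mul, ← integral_const_mul, ← integral_add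
      ((F.integrable_bulk hs lam hsq).const_mul _) ((F.integrable_bulk hs lam hL2).const_mul _)]
    refine integral_mono_ae ?_ (((F.integrable_bulk hs lam hsq).const_mul _).add
      ((F.integrable_bulk hs lam hL2).const_mul _)) ?_
    · exact integrable_finsetSum _ fun k _ => integrable_slab (ContinuousOn.comp_inj
        (continuousOn_D (F.wgt_mul_contDiffOn hs lam le_rfl (hflux k)) k))
    · filter_upwards [ae_slab (T := T) (b := b)] with p hp
      exact hpt (inj p) ⟨Ioo_subset_Icc_self hp.1, Ioo_subset_Icc_self hp.2, p.2.ne_zero⟩ p.2.norm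
  have hTmem : T ∈ Icc 0 T := right_mem_Icc.2 hT.out.le
  have h0mem : (0 : ℝ) ∈ Icc 0 T := left_mem_Icc.2 hT.out.le
  have hbmem : b ∈ Icc 0 b := right_mem_Icc.2 hb.out.le
  have h0mem' : (0 : ℝ) ∈ Icc 0 b := left_mem_Icc.2 hb.out.le
  have i1 := fun k => F.integrable_init hs lam (hflux k).continuousOn hTmem
  have i2 := fun k => F.integrable_init hs lam (hflux k).continuousOn h0mem
  have i3 := fun k => F.integrable_bdry hs lam (hflux k).continuousOn hbmem
  have i4 := fun k => F.integrable_bdry hs lam (hflux k).continuousOn h0mem'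
  rw [integral_sub (i1 0) (i2 0), integral_sub (i3 1) (i4 1)] at hdivthm
  have htop : 0 ≤ ∫ p : ℝ × Sph, F.wgt s lam i ((T, p.1), p.2) * F.flux i u 0 ((T, p.1), p.2)
      ∂stripMeasure 0 b := by
    refine integral_nonneg_of_ae ?_
    filter_upwards [ae_strip 0 b] with p hp
    refine mul_nonneg (F.wgt_nonneg _ _ _ _) ?_
    have hq : ((T, p.1), (p.2 : E3)) ∈ slabCone T b :=
      ⟨hTmem, Ioo_subset_Icc_self hp, p.2.ne_zero⟩
    have h1 := (htau i _ hq p.2.norm _ (perp_D (T := T) (b := b) u _)).1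
    rw [← sum_flux] at h1
    simpa [Fin.sum_univ_five, covTau] using h1
  have hbot : ∫ p : ℝ × Sph, F.wgt s lam i ((p.1, 0), p.2) * F.flux i u 1 ((p.1, 0), p.2)
      ∂stripMeasure 0 T = 0 := by
    refine integral_eq_zero_of_ae ?_
    filter_upwards [ae_strip 0 T] with p hp
    have hq : ((p.1, 0), (p.2 : E3)) ∈ slabCone T b :=
      ⟨Ioo_subset_Icc_self hp, h0mem', p.2.ne_zero⟩
    rw [F.wgt_eq_zero hs lam ((F.ρ_bot i _ hq rfl).trans hs.le), zero_mul]; rfl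
  rw [hbot] at hdivthm
  unfold bdry init
  linarith

/-- The weighted estimate of a function by its `z`-derivative. -/
theorem zero_order_ineq (i : ι) {s lam : ℝ} (hs : 0 < s) {u : Spacetime → ℝ}
    (hu : ContDiffOn ℝ (1 : ℕ) u (F.S i)) :
    (lam - 1) * F.bulk s lam i (fun q => u q ^ 2) ≤
      F.bulk s lam i (fun q => D T b 1 u q ^ 2) + F.bdry s lam i (fun q => u q ^ 2) := by
  have hS := F.S_relOpen i
  have hu2 : ContDiffOn ℝ (1 : ℕ) (fun q => u q ^ 2) (F.S i) := hu.pow 2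
  have hd : ContinuousOn (fun q => D T b 1 u q ^ 2) (F.S i) :=
    (contDiffOn_D hS hu 1 (n := 0)).continuousOn.pow 2
  let f : Fin 5 → Spacetime → ℝ := fun k => if k = 1 then fun q => F.wgt s lam i q * u q ^ 2 else 0
  have hf : ∀ k, ContDiffOn ℝ (1 : ℕ) (f k) (slabCone T b) := by
    intro k
    by_cases hk : k = 1
    · simp only [f, hk, if_true]
      exact F.wgt_mul_contDiffOn hs lam le_rfl hu2
    · simp only [f, hk, if_false]
      exact contDiffOn_const
  have hdivthm := integral_div (T := T) (b := b) hf
  have e0 : ∀ q, ∑ k, D T b k (f k) q = D T b 1 (fun q => F.wgt s lam i q * u q ^ 2) q := by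
    intro q
    rw [Finset.sum_eq_single 1]
    · simp [f]
    · intro k _ hk
      simp only [f, hk, if_false]
      exact D_const 0 k
    · simp
  simp only [e0] at hdivthm
  simp only [f, Fin.reduceEq, if_false, if_true, Pi.zero_apply, sub_zero, integral_zero, zero_add]
    at hdivthm
  have h0mem' : (0 : ℝ) ∈ Icc 0 b := left_mem_Icc.2 hb.out.le
  have hbmem : b ∈ Icc 0 b := right_mem_Icc.2 hb.out.le
  have i3 := F.integrable_bdry hs lam hu2.continuousOn hbmem
  have i4 := F.integrable_bdry hs lam hu2.continuousOn h0mem'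
  rw [integral_sub i3 i4] at hdivthm
  have hbot : ∫ p : ℝ × Sph, F.wgt s lam i ((p.1, 0), p.2) * u ((p.1, 0), p.2) ^ 2
      ∂stripMeasure 0 T = 0 := by
    refine integral_eq_zero_of_ae ?_
    filter_upwards [ae_strip 0 T] with p hp
    have hq : ((p.1, 0), (p.2 : E3)) ∈ slabCone T b :=
      ⟨Ioo_subset_Icc_self hp, h0mem', p.2.ne_zero⟩
    rw [F.wgt_eq_zero hs lam ((F.ρ_bot i _ hq rfl).trans hs.le), zero_mul]; rfl
  rw [hbot, sub_zero] at hdivthm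
  have hpt : ∀ q ∈ slabCone T b,
      (lam - 1) * (F.wgt s lam i q * u q ^ 2) - F.wgt s lam i q * D T b 1 u q ^ 2 ≤
        D T b 1 (fun q => F.wgt s lam i q * u q ^ 2) q := by
    intro q hq
    by_cases hqS : q ∈ F.S i
    · obtain ⟨e, he, hD⟩ := F.D_wgt hs lam (i := i) hq
      have hdu := diffWithin_of_contDiffOn hu hS one_ne_zero hqS
      have e1 : D T b 1 (fun q => u q ^ 2) q = 2 * u q * D T b 1 u q := by
        have := D_mul hdu hdu hq 1
        simp only [pow_two]
        rw [this]; ring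
      rw [F.D_wgt_mul lam hu2 hqS, hD 1, e1]
      have h5 := F.wgt_nonneg s lam i q
      have h6 := mul_nonneg (mul_nonneg he (F.ρ_z i q hq hqS.2).le) (sq_nonneg (u q))
      have h7 : F.covWeight 1 = 1 := rfl
      rw [h7]
      nlinarith [mul_nonneg h5 (sq_nonneg (u q + D T b 1 u q))]
    · rw [F.D_wgt_mul_zero hs lam hq hqS 1,
        F.wgt_eq_zero hs lam (le_of_not_gt fun h => hqS ⟨hq, hs.trans h⟩)]
      simp
  have hub : (lam - 1) * F.bulk s lam i (fun q => u q ^ 2) -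
      F.bulk s lam i (fun q => D T b 1 u q ^ 2) ≤
      ∫ p, D T b 1 (fun q => F.wgt s lam i q * u q ^ 2) (inj p) ∂slabMeasure T b := by
    unfold bulk
    have j1 := (F.integrable_bulk hs lam hu2.continuousOn).const_mul (lam - 1)
    have j2 := F.integrable_bulk hs lam hd
    rw [← integral_const_mul, ← integral_sub j1 j2]
    refine integral_mono_ae (j1.sub j2) ?_ ?_
    · exact integrable_slab (ContinuousOn.comp_inj
        (continuousOn_D (F.wgt_mul_contDiffOn hs lam le_rfl hu2) 1))
    · filter_upwards [ae_slab (T := T) (b := b)] with p hp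
      exact hpt (inj p) ⟨Ioo_subset_Icc_self hp.1, Ioo_subset_Icc_self hp.2, p.2.ne_zero⟩
  unfold bdry
  linarith

end WaveFamily

end

section

variable {T b : ℝ} [hT : Fact (0 < T)] [hb : Fact (0 < b)]

/-! ### Tangential derivatives on the boundary -/

/-- Each vector field of the frame is the velocity of a curve in the slab, along which only the
corresponding coordinate changes. -/
lemma exists_curve {q : Spacetime} (hq : q ∈ slabCone T b) (i : Fin 5) :
    ∃ (c : ℝ → Spacetime) (I : Set ℝ) (t : ℝ), t ∈ I ∧ UniqueDiffWithinAt ℝ I t ∧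
      ContinuousWithinAt c I t ∧ c t = q ∧ MapsTo c I (slabCone T b) ∧
      (i ≠ 0 → ∀ r, (c r).1.1 = q.1.1) ∧ (i ≠ 1 → ∀ r, (c r).1.2 = q.1.2) ∧
      ∀ f : Spacetime → ℝ, DifferentiableWithinAt ℝ f (slabCone T b) q →
        HasDerivWithinAt (fun r => f (c r)) (D T b i f q) I t := by
  obtain ⟨⟨τ, z⟩, y⟩ := q
  have rot : ∀ k : Fin 3, ∃ (c : ℝ → Spacetime) (I : Set ℝ) (t : ℝ), t ∈ I ∧
      UniqueDiffWithinAt ℝ I t ∧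
      ContinuousWithinAt c I t ∧ c t = ((τ, z), y) ∧ MapsTo c I (slabCone T b) ∧
      (∀ r, (c r).1.1 = τ) ∧ (∀ r, (c r).1.2 = z) ∧
      ∀ f : Spacetime → ℝ, DifferentiableWithinAt ℝ f (slabCone T b) ((τ, z), y) →
        HasDerivWithinAt (fun r => f (c r)) (D T b k.succ.succ f ((τ, z), y)) I t := by
    intro k
    refine ⟨fun θ => ((τ, z), rotFlow k θ y), univ, 0, mem_univ _, uniqueDiffWithinAt_univ, ?_,
      by simp [rotFlow_zero], fun θ _ => rotFlow_mem hq k θ, fun _ => rfl, fun _ => rfl,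
      fun f hf => ?_⟩
    · exact (continuousAt_const.prodMk (hasDerivAt_rotFlow k y 0).continuousAt).continuousWithinAt
    · have := hasDerivAt_rot (f := f) k 0 hq (by rwa [rotFlow_zero])
      rw [rotFlow_zero] at this
      exact this.hasDerivWithinAt
  fin_cases i
  · exact ⟨fun t => ((t, z), y), Icc 0 T, τ, hq.1, uniqueDiffOn_Icc hT.out _ hq.1,
      by fun_prop, rfl, fun t ht => ⟨ht, hq.2.1, hq.2.2⟩, fun h => absurd rfl h, fun _ _ => rfl,
      fun f hf => hasDerivWithinAt_tau hq hf⟩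
  · exact ⟨fun t => ((τ, t), y), Icc 0 b, z, hq.2.1, uniqueDiffOn_Icc hb.out _ hq.2.1,
      by fun_prop, rfl, fun t ht => ⟨hq.1, ht, hq.2.2⟩, fun _ _ => rfl, fun h => absurd rfl h,
      fun f hf => hasDerivWithinAt_z hq hf⟩
  · obtain ⟨c, I, t, h1, h2, h3, h4, h5, h6, h7, h8⟩ := rot 0
    exact ⟨c, I, t, h1, h2, h3, h4, h5, fun _ => h6, fun _ => h7, h8⟩
  · obtain ⟨c, I, t, h1, h2, h3, h4, h5, h6, h7, h8⟩ := rot 1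
    exact ⟨c, I, t, h1, h2, h3, h4, h5, fun _ => h6, fun _ => h7, h8⟩
  · obtain ⟨c, I, t, h1, h2, h3, h4, h5, h6, h7, h8⟩ := rot 2
    exact ⟨c, I, t, h1, h2, h3, h4, h5, fun _ => h6, fun _ => h7, h8⟩

lemma D_eq_of_tangent {S : Set Spacetime} (hS : RelOpen T b S) {E : Set Spacetime} {i : Fin 5}
    (hE : (i ≠ 0 ∧ E = {q | q.1.1 = 0}) ∨ (i ≠ 1 ∧ E = {q | q.1.2 = b})) {f g : Spacetime → ℝ}
    (hf : ContDiffOn ℝ (1 : ℕ) f S) (hg : ContDiffOn ℝ (1 : ℕ) g S) (h : EqOn f g (S ∩ E)) :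
    EqOn (D T b i f) (D T b i g) (S ∩ E) := by
  rintro q ⟨hq, hqE⟩
  obtain ⟨c, I, t, h1, h2, h3, h4, h5, h6, h7, h8⟩ := exists_curve (hS.subset hq) i
  have hcE : ∀ r, c r ∈ E := by
    intro r
    rcases hE with ⟨hi, rfl⟩ | ⟨hi, rfl⟩
    · exact (h6 hi r).trans hqE
    · exact (h7 hi r).trans hqE
  have hev : ∀ᶠ r in 𝓝[I] t, c r ∈ S := by
    have : Tendsto c (𝓝[I] t) (𝓝[slabCone T b] q) := by
      rw [← h4]; exact h3.tendsto_nhdsWithin h5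
    exact this.eventually (hS.mem_nhdsWithin hq)
  have e1 := h8 f (diffWithin_of_contDiffOn hf hS one_ne_zero hq)
  have e2 := h8 g (diffWithin_of_contDiffOn hg hS one_ne_zero hq)
  refine UniqueDiffWithinAt.eq_deriv I h2 (e1.congr_of_eventuallyEq ?_ ?_) e2
  · filter_upwards [hev] with r hr using (h ⟨hr, hcE r⟩).symm
  · rw [h4]; exact (h ⟨hq, hqE⟩).symm

lemma Dw_eq_of_tangent {S : Set Spacetime} (hS : RelOpen T b S) {E : Set Spacetime}
    {w : List (Fin 5)} (hE : (0 ∉ w ∧ E = {q | q.1.1 = 0}) ∨ (1 ∉ w ∧ E = {q | q.1.2 = b}))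
    {f g : Spacetime → ℝ} {n : ℕ} (hn : w.length ≤ n) (hf : ContDiffOn ℝ n f S)
    (hg : ContDiffOn ℝ n g S) (h : EqOn f g (S ∩ E)) :
    EqOn (Dw T b w f) (Dw T b w g) (S ∩ E) := by
  induction w with
  | nil => exact h
  | cons i w ih =>
    simp only [List.length_cons] at hn
    simp only [List.mem_cons, not_or] at hE
    refine D_eq_of_tangent hS (hE.imp (fun h => ⟨Ne.symm h.1.1, h.2⟩) (fun h => ⟨Ne.symm h.1.1, h.2⟩))
      (contDiffOn_Dw hS w (hf.of_le ?_)) (contDiffOn_Dw hS w (hg.of_le ?_))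
      (ih (hE.imp (fun h => ⟨h.1.2, h.2⟩) (fun h => ⟨h.1.2, h.2⟩)) (by omega))
    all_goals norm_cast; omega

/-! ### One-dimensional estimates -/

/-- A Gronwall type estimate in `L²`. -/
lemma integral_sq_le_of_deriv {a c M : ℝ} (ha : 0 ≤ a) (hac : a ≤ c) (hM : 0 ≤ M) {f f' h : ℝ → ℝ}
    (hf : ∀ t ∈ Icc a c, HasDerivWithinAt f (f' t) (Icc a c) t) (hf' : ContinuousOn f' (Icc a c))
    (hh : ContinuousOn h (Icc a c)) (hle : ∀ t ∈ Icc a c, |f' t| ≤ M * |f t| + h t) :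
    ∫ t in Ioo a c, f t ^ 2 ≤
      Real.exp ((2 * M + 2) * c) * (f c ^ 2 + ∫ t in Ioo a c, h t ^ 2) := by
  set lam := 2 * M + 2 with hlam
  have hfc : ContinuousOn f (Icc a c) := fun t ht => (hf t ht).continuousWithinAt
  set E : ℝ → ℝ := fun t => Real.exp (lam * t)
  have hE : Continuous E := by fun_prop
  have hder : ∀ t ∈ Ioo a c, HasDerivWithinAt (fun t => E t * f t ^ 2)
      (lam * E t * f t ^ 2 + E t * (2 * f t * f' t)) (Ioi t) t := by
    intro t ht
    have h1 : HasDerivAt f (f' t) t := (hf t (Ioo_subset_Icc_self ht)).hasDerivAt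
      (Icc_mem_nhds ht.1 ht.2)
    have h2 : HasDerivAt E (lam * E t) t := by
      have := ((hasDerivAt_id t).const_mul lam).exp
      refine this.congr_deriv ?_
      simp [E]; ring
    have h3 := h2.mul (h1.pow 2)
    refine (h3.congr_deriv ?_).hasDerivWithinAt
    simp
  have hcont : ContinuousOn (fun t => lam * E t * f t ^ 2 + E t * (2 * f t * f' t)) (Icc a c) := by
    fun_prop
  have key : ∫ t in Ioo a c, (lam * E t * f t ^ 2 + E t * (2 * f t * f' t)) =
      E c * f c ^ 2 - E a * f a ^ 2 := by
    rw [← integral_Ioc_eq_integral_Ioo, ← intervalIntegral.integral_of_le hac]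
    refine intervalIntegral.integral_eq_sub_of_hasDeriv_right (f := fun t => E t * f t ^ 2) ?_ ?_ ?_
    · rw [uIcc_of_le hac]; fun_prop
    · rwa [min_eq_left hac, max_eq_right hac]
    · refine ContinuousOn.intervalIntegrable ?_
      rwa [uIcc_of_le hac]
  have int : ∀ {g : ℝ → ℝ}, ContinuousOn g (Icc a c) → IntegrableOn g (Ioo a c) := fun hg =>
    (hg.integrableOn_Icc).mono_set Ioo_subset_Icc_self
  have hmono : ∫ t in Ioo a c, (f t ^ 2 - E c * h t ^ 2) ≤
      ∫ t in Ioo a c, (lam * E t * f t ^ 2 + E t * (2 * f t * f' t)) := by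
    refine setIntegral_mono_on (int (by fun_prop)) (int hcont) measurableSet_Ioo fun t ht => ?_
    have h1 := hle t (Ioo_subset_Icc_self ht)
    have h2 : 1 ≤ E t := Real.one_le_exp (mul_nonneg (by positivity) (ha.trans ht.1.le))
    have h3 : E t ≤ E c := Real.exp_le_exp.2 (mul_le_mul_of_nonneg_left ht.2.le (by positivity))
    have h4 : -(2 * f t * f' t) ≤ 2 * M * f t ^ 2 + f t ^ 2 + h t ^ 2 := by
      have h5 : -(2 * f t * f' t) ≤ 2 * (|f t| * |f' t|) := by
        rw [← abs_mul]; have := neg_le_abs (f t * f' t); linarith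
      have h6 : |f t| * |f' t| ≤ |f t| * (M * |f t| + h t) :=
        mul_le_mul_of_nonneg_left h1 (abs_nonneg _)
      have h7 : |f t| * |f t| = f t ^ 2 := by rw [← abs_mul, ← sq, abs_sq]
      nlinarith [sq_nonneg (|f t| - h t)]
    have h8 : f t ^ 2 - h t ^ 2 ≤ lam * f t ^ 2 + 2 * f t * f' t := by rw [hlam]; linarith
    have h9 : lam * E t * f t ^ 2 + E t * (2 * f t * f' t) =
      E t * (lam * f t ^ 2 + 2 * f t * f' t) := by ring
    rw [h9]
    have h10 := mul_le_mul_of_nonneg_left h8 (zero_le_one.trans h2)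
    nlinarith [mul_le_mul_of_nonneg_right h2 (sq_nonneg (f t)),
      mul_le_mul_of_nonneg_right h3 (sq_nonneg (h t))]
  rw [key, integral_sub (int (by fun_prop)) (int (by fun_prop)), integral_const_mul] at hmono
  have h1 : 0 ≤ E a * f a ^ 2 := mul_nonneg (Real.exp_pos _).le (sq_nonneg _)
  change _ ≤ E c * _
  linarith

/-- A trace estimate in one dimension. -/
lemma sq_le_lintegral {g g' : ℝ → ℝ} (hg : ∀ t ∈ Ioo 0 T, HasDerivAt g (g' t) t)
    (hg' : ContinuousOn g' (Ioo 0 T)) {t₀ : ℝ} (ht₀ : t₀ ∈ Ioo 0 T) :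
    ENNReal.ofReal (g t₀ ^ 2) ≤ ENNReal.ofReal (1 / T + 1) *
      ∫⁻ t in Ioo 0 T, (ENNReal.ofReal (g t ^ 2) + ENNReal.ofReal (g' t ^ 2)) := by
  set N := ∫⁻ t in Ioo 0 T, (ENNReal.ofReal (g t ^ 2) + ENNReal.ofReal (g' t ^ 2)) with hN
  have hgc : ContinuousOn g (Ioo 0 T) := fun t ht => (hg t ht).continuousAt.continuousWithinAt
  have h1 : ∀ t ∈ Ioo 0 T, ENNReal.ofReal (g t₀ ^ 2) ≤ ENNReal.ofReal (g t ^ 2) + N := by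
    intro t ht
    have hsub : uIcc t t₀ ⊆ Ioo 0 T := by
      have : OrdConnected (Ioo (0 : ℝ) T) := ordConnected_Ioo
      exact this.uIcc_subset ht ht₀
    have h2 : ∫ r in t..t₀, 2 * g r * g' r = g t₀ ^ 2 - g t ^ 2 := by
      refine intervalIntegral.integral_eq_sub_of_hasDerivAt (f := fun r => g r ^ 2) ?_ ?_
      · intro r hr
        exact ((hg r (hsub hr)).pow 2).congr_deriv (by simp)
      · exact ((continuousOn_const.mul (hgc.mono hsub)).mul
          (hg'.mono hsub)).intervalIntegrable
    have hcont : ContinuousOn (fun r => g r ^ 2 + g' r ^ 2) (uIcc t t₀) :=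
      ((hgc.mono hsub).pow 2).add ((hg'.mono hsub).pow 2)
    have h3 : g t₀ ^ 2 - g t ^ 2 ≤ ∫ r in uIoc t t₀, (g r ^ 2 + g' r ^ 2) := by
      rw [← h2]
      refine (le_abs_self _).trans ?_
      rw [intervalIntegral.abs_intervalIntegral_eq]
      refine (abs_integral_le_integral_abs).trans ?_
      refine setIntegral_mono_on ?_ ?_ measurableSet_uIoc fun r _ => ?_
      · refine IntegrableOn.mono_set (ContinuousOn.integrableOn_uIcc ?_) uIoc_subset_uIcc
        exact ((continuousOn_const.mul (hgc.mono hsub)).mul (hg'.mono hsub)).abs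
      · exact hcont.integrableOn_uIcc.mono_set uIoc_subset_uIcc
      · rw [mul_assoc, abs_mul, abs_mul, abs_two]
        nlinarith [sq_nonneg (|g r| - |g' r|), sq_abs (g r), sq_abs (g' r)]
    have h4 : ENNReal.ofReal (∫ r in uIoc t t₀, (g r ^ 2 + g' r ^ 2)) ≤ N := by
      rw [ofReal_integral_eq_lintegral_ofReal
        (hcont.integrableOn_uIcc.mono_set uIoc_subset_uIcc)
        (ae_of_all _ fun r => by positivity)]
      refine (lintegral_mono_set (uIoc_subset_uIcc.trans hsub)).trans (le_of_eq ?_)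
      refine lintegral_congr fun r => ?_
      rw [ENNReal.ofReal_add (sq_nonneg _) (sq_nonneg _)]
    calc ENNReal.ofReal (g t₀ ^ 2) ≤ ENNReal.ofReal (g t ^ 2 + ∫ r in uIoc t t₀, (g r ^ 2 + g' r ^ 2)) :=
          ENNReal.ofReal_le_ofReal (by linarith)
      _ ≤ _ := ENNReal.ofReal_add_le
      _ ≤ _ := by gcongr
  have h5 : ENNReal.ofReal T * ENNReal.ofReal (g t₀ ^ 2) ≤ N + ENNReal.ofReal T * N := by
    have h6 : ∫⁻ _ in Ioo 0 T, ENNReal.ofReal (g t₀ ^ 2) ≤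
        ∫⁻ t in Ioo 0 T, (ENNReal.ofReal (g t ^ 2) + N) := setLIntegral_mono' measurableSet_Ioo h1
    rw [lintegral_add_right _ measurable_const] at h6
    simp only [lintegral_const, Measure.restrict_apply MeasurableSet.univ, univ_inter,
      Real.volume_Ioo, sub_zero] at h6
    calc _ = ENNReal.ofReal (g t₀ ^ 2) * ENNReal.ofReal T := mul_comm _ _
      _ ≤ _ := h6
      _ ≤ N + N * ENNReal.ofReal T := by
        gcongr
        exact lintegral_mono fun t => le_self_add (b := ENNReal.ofReal (g' t ^ 2))
      _ = _ := by rw [mul_comm N]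
  have hT' := hT.out
  have h7 : ENNReal.ofReal (1 / T) * ENNReal.ofReal T = 1 := by
    rw [← ENNReal.ofReal_mul (by positivity), one_div_mul_cancel hT'.ne', ENNReal.ofReal_one]
  calc ENNReal.ofReal (g t₀ ^ 2) =
        ENNReal.ofReal (1 / T) * (ENNReal.ofReal T * ENNReal.ofReal (g t₀ ^ 2)) := by
        rw [← mul_assoc, h7, one_mul]
    _ ≤ ENNReal.ofReal (1 / T) * (N + ENNReal.ofReal T * N) := by gcongr
    _ = _ := by
      rw [mul_add, ← mul_assoc, h7, ENNReal.ofReal_add (by positivity) zero_le_one, add_mul,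
        ENNReal.ofReal_one]

end

section

variable {T b : ℝ} [hT : Fact (0 < T)] [hb : Fact (0 < b)]

namespace WaveFamily

variable {ι : Type*} {m : ℕ} (F : WaveFamily ι T b m)

/-! ### Pointwise domination by derivatives of the solution -/

/-- On `E`, the functions `H i` are dominated by finitely many derivatives of the solutions,
along words in `W`. -/
def Span (E : ι → Set Spacetime) (W : Set (List (Fin 5))) (H : ι → Spacetime → ℝ) : Prop :=
  ∃ s : Finset (List (Fin 5)), (∀ w ∈ s, w ∈ W) ∧ ∃ C : ℝ, 0 ≤ C ∧ ∀ i, ∀ q ∈ E i, ‖q.2‖ = 1 →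
    |H i q| ≤ C * ∑ w ∈ s, |Dw T b w (F.v i) q|

variable {F} {E : ι → Set Spacetime} {W : Set (List (Fin 5))} {H K : ι → Spacetime → ℝ}

lemma Span.congr (h : F.Span E W H) (hHK : ∀ i, ∀ q ∈ E i, H i q = K i q) : F.Span E W K := by
  obtain ⟨s, hs, C, hC, h⟩ := h
  exact ⟨s, hs, C, hC, fun i q hq hu => by rw [← hHK i q hq]; exact h i q hq hu⟩

lemma span_of_mem {w : List (Fin 5)} (hw : w ∈ W) : F.Span E W fun i => Dw T b w (F.v i) :=
  ⟨{w}, by simpa using hw, 1, zero_le_one, fun i q _ _ => by simp⟩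

lemma Span.add (h : F.Span E W H) (h' : F.Span E W K) :
    F.Span E W fun i q => H i q + K i q := by
  classical
  obtain ⟨s, hs, C, hC, h⟩ := h
  obtain ⟨s', hs', C', hC', h'⟩ := h'
  refine ⟨s ∪ s', fun w hw => (Finset.mem_union.1 hw).elim (hs w) (hs' w), C + C',
    add_nonneg hC hC', fun i q hq hu => (abs_add_le _ _).trans ?_⟩
  rw [add_mul]
  refine add_le_add ((h i q hq hu).trans ?_) ((h' i q hq hu).trans ?_)
  · exact mul_le_mul_of_nonneg_left (Finset.sum_le_sum_of_subset_of_nonneg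
      Finset.subset_union_left fun _ _ _ => abs_nonneg _) hC
  · exact mul_le_mul_of_nonneg_left (Finset.sum_le_sum_of_subset_of_nonneg
      Finset.subset_union_right fun _ _ _ => abs_nonneg _) hC'

lemma span_zero : F.Span E W fun _ _ => 0 :=
  ⟨∅, by simp, 0, le_rfl, fun i q _ _ => by simp⟩

lemma Span.sum {κ : Type*} (s : Finset κ) {H : κ → ι → Spacetime → ℝ}
    (h : ∀ k ∈ s, F.Span E W (H k)) : F.Span E W fun i q => ∑ k ∈ s, H k i q := by
  classical
  induction s using Finset.induction_on with
  | empty => simpa using span_zero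
  | insert k s hk ih =>
    refine Span.congr ((h k (Finset.mem_insert_self _ _)).add
      (ih fun j hj => h j (Finset.mem_insert_of_mem hj))) fun i q _ => ?_
    rw [Finset.sum_insert hk]

lemma Span.mul (hK : ∃ C : ℝ, 0 ≤ C ∧ ∀ i, ∀ q ∈ E i, ‖q.2‖ = 1 → |K i q| ≤ C)
    (h : F.Span E W H) : F.Span E W fun i q => K i q * H i q := by
  obtain ⟨s, hs, C, hC, h⟩ := h
  obtain ⟨C', hC', hK⟩ := hK
  refine ⟨s, hs, C' * C, mul_nonneg hC' hC, fun i q hq hu => ?_⟩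
  rw [abs_mul, mul_assoc]
  exact mul_le_mul (hK i q hq hu) (h i q hq hu) (abs_nonneg _) hC'

lemma Span.trans {W' : Set (List (Fin 5))} (h : F.Span E W H)
    (hW : ∀ w ∈ W, F.Span E W' fun i => Dw T b w (F.v i)) : F.Span E W' H := by
  obtain ⟨s, hs, C, hC, h⟩ := h
  have h1 := Span.sum (F := F) (E := E) (W := W') s
    (H := fun w i q => |Dw T b w (F.v i) q|) fun w hw => by
      obtain ⟨s, hs, C, hC, h⟩ := hW w (hs w hw)
      exact ⟨s, hs, C, hC, fun i q hq hu => by rw [abs_abs]; exact h i q hq hu⟩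
  obtain ⟨s', hs', C', hC', h'⟩ := h1
  refine ⟨s', hs', C * C', mul_nonneg hC hC', fun i q hq hu => (h i q hq hu).trans ?_⟩
  rw [mul_assoc]
  exact mul_le_mul_of_nonneg_left ((le_abs_self _).trans (h' i q hq hu)) hC

lemma Span.restrict {E' : ι → Set Spacetime} (h : F.Span E W H) (hE : ∀ i, E' i ⊆ E i) :
    F.Span E' W H := by
  obtain ⟨s, hs, C, hC, h⟩ := h
  exact ⟨s, hs, C, hC, fun i q hq hu => h i q (hE i hq) hu⟩

variable (F)

lemma span_L {wt : Fin 5 → ℕ} (hwt : IsWeight wt) {w : List (Fin 5)} (hw : w.length ≤ 2 * m)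
    (hW : ∀ w', weight wt w' ≤ weight wt w + 1 → w' ∈ W) :
    F.Span F.S W fun i => F.L i (Dw T b w (F.v i)) := by
  obtain ⟨C, hC, h⟩ := (F.dom_L_Dw hwt 0 w (by omega)).bound
  exact ⟨_, fun w' hw' => hW w' (Finset.mem_filter.1 hw').2, C, hC, h⟩

lemma G_bdd (hE : ∀ i, E i ⊆ F.S i) (k l : Fin 5) :
    ∃ C : ℝ, 0 ≤ C ∧ ∀ i, ∀ q ∈ E i, ‖q.2‖ = 1 → |F.G k l i q| ≤ C := by
  obtain ⟨C, hC, h⟩ := (F.G_ub k l).bound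
  exact ⟨C, hC, fun i q hq => h i q (hE i hq).1⟩

lemma β_bdd (hE : ∀ i, E i ⊆ F.S i) (k : Fin 5) :
    ∃ C : ℝ, 0 ≤ C ∧ ∀ i, ∀ q ∈ E i, ‖q.2‖ = 1 → |F.β k i q| ≤ C := by
  obtain ⟨C, hC, h⟩ := (F.β_ub k).bound
  exact ⟨C, hC, fun i q hq => h i q (hE i hq).1⟩

lemma v_smooth_Dw {w : List (Fin 5)} {n : ℕ} (hw : n + w.length ≤ 2 * m + 2) (i : ι) :
    ContDiffOn ℝ n (Dw T b w (F.v i)) (F.S i) :=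
  contDiffOn_Dw (F.S_relOpen i) w ((F.v_smooth i).of_le (by exact_mod_cast hw))

/-- The wave equation as an equation for `∂_z ∂_τ`. -/
lemma span_D_one_D_zero {wt : Fin 5 → ℕ} (hwt : IsWeight wt) {w : List (Fin 5)}
    (hw : w.length ≤ 2 * m) (hW : ∀ w', weight wt w' ≤ weight wt w + 1 → w' ∈ W)
    (h0 : 0 :: w ∈ W) (h2 : ∀ a c : Fin 5, a ≠ 0 → c ≠ 0 → a :: c :: w ∈ W) :
    F.Span F.S W fun i => Dw T b (1 :: 0 :: w) (F.v i) := by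
  have hc : ∀ c : ℝ, ∃ C : ℝ, 0 ≤ C ∧ ∀ i : ι, ∀ q ∈ F.S i, ‖q.2‖ = 1 →
      |(fun _ _ => c : ι → Spacetime → ℝ) i q| ≤ C :=
    fun c => ⟨|c|, abs_nonneg _, fun _ _ _ _ => le_rfl⟩
  have e : F.Span F.S W fun i q => 1 / 2 * (F.L i (Dw T b w (F.v i)) q +
      -1 * (∑ a : Fin 4, ∑ c : Fin 4, F.G a.succ c.succ i q *
        Dw T b (a.succ :: c.succ :: w) (F.v i) q + ∑ c, F.β c i q * Dw T b (c :: w) (F.v i) q)) := by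
    refine Span.mul (hc _) ((F.span_L hwt hw hW).add (Span.mul (hc _) (Span.add ?_ ?_)))
    · exact Span.sum _ fun a _ => Span.sum _ fun c _ => Span.mul (F.G_bdd (fun i => le_rfl) _ _)
        (span_of_mem (h2 _ _ (Fin.succ_ne_zero _) (Fin.succ_ne_zero _)))
    · refine Span.sum _ fun c _ => Span.mul (F.β_bdd (fun i => le_rfl) _) (span_of_mem ?_)
      by_cases hc : c = 0
      · rwa [hc]
      · exact hW _ (by simp [hwt.eq_one c hc]; omega)
  refine e.congr fun i q hq => ?_
  have hK := F.S_sub i hq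
  have h01 := F.G_zero_one i q hK
  have h10 : F.G 1 0 i q = 1 := by rw [F.G_symm _ _ _ _ hK, h01]
  have hz : ∀ k : Fin 5, k ≠ 1 → F.G 0 k i q = 0 := fun k hk => F.G_zero hk hK
  have hz' : ∀ k : Fin 5, k ≠ 1 → F.G k 0 i q = 0 := fun k hk => by
    rw [F.G_symm _ _ _ _ hK, hz k hk]
  have hcomm : D T b 0 (D T b 1 (Dw T b w (F.v i))) q = D T b 1 (D T b 0 (Dw T b w (F.v i))) q :=
    D_comm_of_lt (F.S_relOpen i) (F.v_smooth_Dw (by omega) i) hq (by norm_num) 1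
  simp only [Dw_cons, L, waveOp, Fin.sum_univ_succ (n := 4)]
  have s1 : ∑ c : Fin 4, F.G 0 c.succ i q * D T b 0 (D T b c.succ (Dw T b w (F.v i))) q =
      D T b 1 (D T b 0 (Dw T b w (F.v i))) q := by
    rw [Finset.sum_eq_single 0]
    · rw [← hcomm]; change F.G 0 1 i q * D T b 0 (D T b 1 _) q = _; rw [h01, one_mul]
    · intro c _ hc
      rw [hz _ (fun h => hc (Fin.succ_injective _ (by simpa using h))), zero_mul]
    · simp
  have s2 : ∑ c : Fin 4, F.G c.succ 0 i q * D T b c.succ (D T b 0 (Dw T b w (F.v i))) q =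
      D T b 1 (D T b 0 (Dw T b w (F.v i))) q := by
    rw [Finset.sum_eq_single 0]
    · change F.G 1 0 i q * D T b 1 (D T b 0 _) q = _; rw [h10, one_mul]
    · intro c _ hc
      rw [hz' _ (fun h => hc (Fin.succ_injective _ (by simpa using h))), zero_mul]
    · simp
  rw [Finset.sum_add_distrib, s1, s2, F.G_zero_zero i q hK]
  ring

/-- The wave equation on `z = b` as an equation for `∂_z²`. -/
lemma span_D_one_D_one {w : List (Fin 5)} (hw : w.length ≤ 2 * m)
    (hW : ∀ w', w'.length ≤ w.length + 1 → w' ∈ W)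
    (h2 : ∀ a c : Fin 5, ¬ (a = 1 ∧ c = 1) → a :: c :: w ∈ W) :
    F.Span (fun i => F.S i ∩ {q | q.1.2 = b}) W fun i => Dw T b (1 :: 1 :: w) (F.v i) := by
  have hE : ∀ i, F.S i ∩ {q | q.1.2 = b} ⊆ F.S i := fun i => inter_subset_left
  have hwt : IsWeight fun _ => 1 := ⟨fun _ => le_rfl, by norm_num, fun _ _ => rfl⟩
  obtain ⟨c, hc, hG⟩ := F.G_bdry
  have hinv : ∃ C : ℝ, 0 ≤ C ∧ ∀ i : ι, ∀ q ∈ F.S i ∩ {q | q.1.2 = b}, ‖q.2‖ = 1 →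
      |(fun i q => (F.G 1 1 i q)⁻¹) i q| ≤ C := by
    refine ⟨c⁻¹, by positivity, fun i q hq hu => ?_⟩
    have := hG i q (hE i hq).1 hu hq.2
    simp only
    rw [abs_of_pos (inv_pos.2 (hc.trans_le this))]
    exact inv_anti₀ hc this
  have e : F.Span (fun i => F.S i ∩ {q | q.1.2 = b}) W fun i q => (F.G 1 1 i q)⁻¹ *
      (F.L i (Dw T b w (F.v i)) q + (∑ a, ∑ c, (if a = 1 ∧ c = 1 then 0 else -F.G a c i q) *
        (if a = 1 ∧ c = 1 then 0 else Dw T b (a :: c :: w) (F.v i) q) +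
        ∑ c, -F.β c i q * Dw T b (c :: w) (F.v i) q)) := by
    refine Span.mul hinv (Span.add ?_ (Span.add ?_ ?_))
    · exact (F.span_L hwt hw fun w' h => hW w' (by simpa [weight_one] using h)).restrict hE
    · refine Span.sum _ fun a _ => Span.sum _ fun c _ => ?_
      by_cases h : a = 1 ∧ c = 1
      · simpa [h] using span_zero
      · simp only [h, if_false]
        refine Span.mul ?_ (span_of_mem (h2 a c h))
        simpa using F.G_bdd hE a c
    · refine Span.sum _ fun c _ => Span.mul ?_ (span_of_mem (hW _ (by simp)))
      simpa using F.β_bdd hE c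
  obtain ⟨s, hs, C, hC, h⟩ := e
  refine ⟨s, hs, C, hC, fun i q hq hu => (le_of_eq ?_).trans (h i q hq hu)⟩
  have h11 : F.G 1 1 i q ≠ 0 := (hc.trans_le (hG i q (hE i hq).1 hu hq.2)).ne'
  congr 1
  rw [eq_inv_mul_iff_mul_eq₀ h11]
  simp only [Dw_cons, L, waveOp]
  have s1 : ∑ a, ∑ c, (if a = 1 ∧ c = 1 then 0 else -F.G a c i q) *
      (if a = 1 ∧ c = 1 then 0 else D T b a (D T b c (Dw T b w (F.v i))) q) =
      F.G 1 1 i q * D T b 1 (D T b 1 (Dw T b w (F.v i))) q -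
      ∑ a, ∑ c, F.G a c i q * D T b a (D T b c (Dw T b w (F.v i))) q := by
    have : ∀ a c : Fin 5, (if a = 1 ∧ c = 1 then 0 else -F.G a c i q) *
        (if a = 1 ∧ c = 1 then 0 else D T b a (D T b c (Dw T b w (F.v i))) q) =
        (if a = 1 then if c = 1 then F.G 1 1 i q * D T b 1 (D T b 1 (Dw T b w (F.v i))) q else 0
          else 0) - F.G a c i q * D T b a (D T b c (Dw T b w (F.v i))) q := by
      intro a c
      by_cases ha : a = 1 <;> by_cases hc : c = 1 <;> simp [ha, hc]
    simp only [this, Finset.sum_sub_distrib]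
    simp
  rw [s1]
  simp only [neg_mul, Finset.sum_neg_distrib]
  ring

end WaveFamily

end

section

variable {T b : ℝ} [hT : Fact (0 < T)] [hb : Fact (0 < b)]

/-! ### Uniform bounds in `L²` -/

/-- The functions `H i` are bounded in `L²` by a multiple of `A i`. -/
def L2Bound {ι X : Type*} [MeasurableSpace X] (μ : Measure X) (A : ι → ℝ) (H : ι → X → ℝ) : Prop :=
  (∀ i, AEMeasurable (H i) μ) ∧ ∃ C : ℝ, 0 ≤ C ∧ ∀ i,
    ∫⁻ p, ENNReal.ofReal (H i p ^ 2) ∂μ ≤ ENNReal.ofReal (C * A i ^ 2)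

section

variable {ι X : Type*} [MeasurableSpace X] {μ : Measure X} {A : ι → ℝ} {H K : ι → X → ℝ}

lemma L2Bound.of_abs_le (h : L2Bound μ A H) (hK : ∀ i, AEMeasurable (K i) μ)
    (hle : ∀ i, ∀ᵐ p ∂μ, |K i p| ≤ |H i p|) : L2Bound μ A K := by
  obtain ⟨-, C, hC, h⟩ := h
  refine ⟨hK, C, hC, fun i => le_trans (lintegral_mono_ae ?_) (h i)⟩
  filter_upwards [hle i] with p hp using ENNReal.ofReal_le_ofReal (sq_le_sq.2 hp)

lemma L2Bound.abs (h : L2Bound μ A H) : L2Bound μ A fun i p => |H i p| :=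
  h.of_abs_le (fun i => (h.1 i).abs) fun i => ae_of_all _ fun p => by simp

lemma L2Bound.add (h : L2Bound μ A H) (h' : L2Bound μ A K) :
    L2Bound μ A fun i p => H i p + K i p := by
  obtain ⟨hm, C, hC, h⟩ := h
  obtain ⟨hm', C', hC', h'⟩ := h'
  refine ⟨fun i => (hm i).add (hm' i), 2 * (C + C'), by positivity, fun i => ?_⟩
  have h1 : ∀ p, ENNReal.ofReal ((H i p + K i p) ^ 2) ≤
      2 * (ENNReal.ofReal (H i p ^ 2) + ENNReal.ofReal (K i p ^ 2)) := by
    intro p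
    rw [← ENNReal.ofReal_add (sq_nonneg _) (sq_nonneg _), ← ENNReal.ofReal_ofNat 2,
      ← ENNReal.ofReal_mul (by norm_num)]
    exact ENNReal.ofReal_le_ofReal (by nlinarith [sq_nonneg (H i p - K i p)])
  calc _ ≤ ∫⁻ p, 2 * (ENNReal.ofReal (H i p ^ 2) + ENNReal.ofReal (K i p ^ 2)) ∂μ :=
        lintegral_mono h1
    _ = 2 * (∫⁻ p, ENNReal.ofReal (H i p ^ 2) ∂μ + ∫⁻ p, ENNReal.ofReal (K i p ^ 2) ∂μ) := by
        rw [lintegral_const_mul' _ _ (by simp), lintegral_add_left' ((hm i).pow_const 2).ennreal_ofReal]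
    _ ≤ 2 * (ENNReal.ofReal (C * A i ^ 2) + ENNReal.ofReal (C' * A i ^ 2)) := by
        gcongr
        exacts [h i, h' i]
    _ = _ := by
        rw [← ENNReal.ofReal_add (by positivity) (by positivity), ← ENNReal.ofReal_ofNat 2,
          ← ENNReal.ofReal_mul (by norm_num)]
        congr 1; ring

lemma L2Bound.const_mul (h : L2Bound μ A H) (c : ℝ) : L2Bound μ A fun i p => c * H i p := by
  obtain ⟨hm, C, hC, h⟩ := h
  refine ⟨fun i => (hm i).const_mul c, c ^ 2 * C, by positivity, fun i => ?_⟩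
  simp only [mul_pow, mul_assoc]
  rw [ENNReal.ofReal_mul (sq_nonneg _)]
  refine le_trans (le_of_eq ?_) (mul_le_mul_right (h i) _)
  simp only [ENNReal.ofReal_mul (sq_nonneg c)]
  exact lintegral_const_mul' _ _ ENNReal.ofReal_ne_top

lemma L2Bound.sum {κ : Type*} (s : Finset κ) {H : κ → ι → X → ℝ}
    (h : ∀ k ∈ s, L2Bound μ A (H k)) : L2Bound μ A fun i p => ∑ k ∈ s, H k i p := by
  classical
  induction s using Finset.induction_on with
  | empty => exact ⟨fun i => by simp, 0, le_rfl, fun i => by simp⟩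
  | insert k s hk ih =>
    simp only [Finset.sum_insert hk]
    exact (h k (Finset.mem_insert_self _ _)).add (ih fun j hj => h j (Finset.mem_insert_of_mem hj))

end

namespace WaveFamily

variable {ι : Type*} {m : ℕ} (F : WaveFamily ι T b m)

/-! ### Estimates on the initial hypersurface -/

lemma init_mem (i : ι) {z : ℝ} (hz : z ∈ Ioc 0 b) (x : Sph) : ((0, z), (x : E3)) ∈ F.S i := by
  have h : ((0, z), (x : E3)) ∈ slabCone T b :=
    ⟨⟨le_rfl, hT.out.le⟩, ⟨hz.1.le, hz.2⟩, x.ne_zero⟩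
  exact ⟨h, F.ρ_init i _ h rfl hz.1⟩

lemma aemeasurable_strip {a c : ℝ} {f : ℝ × Sph → ℝ} (hf : ContinuousOn f (Ioo a c ×ˢ univ)) :
    AEMeasurable f (stripMeasure a c) := by
  have : stripMeasure a c = ((volume : Measure ℝ).prod sphereMeasure).restrict (Ioo a c ×ˢ univ) := by
    rw [← Measure.prod_restrict, Measure.restrict_univ]
  rw [this]
  exact hf.aemeasurable (measurableSet_Ioo.prod MeasurableSet.univ)

/-- The trace on `τ = 0` of the derivative along `w` is bounded in `L²`. -/
def InitBound (w : List (Fin 5)) : Prop :=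
  L2Bound (stripMeasure 0 b) F.A fun i p => Dw T b w (F.v i) ((0, p.1), p.2)

lemma continuousOn_init {i : ι} {f : Spacetime → ℝ} (hf : ContinuousOn f (F.S i)) :
    ContinuousOn (fun p : ℝ × Sph => f ((0, p.1), p.2)) (Ioc 0 b ×ˢ univ) :=
  hf.comp (by fun_prop) fun p hp => F.init_mem i hp.1 p.2

lemma aemeasurable_init {i : ι} {f : Spacetime → ℝ} (hf : ContinuousOn f (F.S i)) :
    AEMeasurable (fun p : ℝ × Sph => f ((0, p.1), p.2)) (stripMeasure 0 b) :=
  aemeasurable_strip ((F.continuousOn_init hf).mono (prod_mono_left Ioo_subset_Ioc_self))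

lemma continuousOn_Dw {w : List (Fin 5)} (hw : w.length ≤ 2 * m + 2) (i : ι) :
    ContinuousOn (Dw T b w (F.v i)) (F.S i) :=
  (F.v_smooth_Dw (n := 0) (by omega) i).continuousOn

lemma relOpen_z : RelOpen T b {q | q ∈ slabCone T b ∧ q.1.2 ∈ Ioo 0 b} :=
  ⟨{q | q.1.2 ∈ Ioo 0 b}, isOpen_Ioo.preimage (by fun_prop), rfl⟩

lemma relOpen_tau : RelOpen T b {q | q ∈ slabCone T b ∧ q.1.1 ∈ Ioo 0 T} :=
  ⟨{q | q.1.1 ∈ Ioo 0 T}, isOpen_Ioo.preimage (by fun_prop), rfl⟩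

lemma initBound_of_tangent {w : List (Fin 5)} (hw : 0 ∉ w) (hl : w.length ≤ 2 * m + 2) :
    F.InitBound w := by
  obtain ⟨C, hC, h⟩ := F.Φ_bound w hl
  refine ⟨fun i => F.aemeasurable_init (F.continuousOn_Dw hl i), C, hC, fun i => ?_⟩
  refine le_trans (le_of_eq (lintegral_congr_ae ?_)) (h i)
  filter_upwards [ae_strip 0 b] with p hp
  have hS := (F.S_relOpen i).inter (relOpen_z (T := T) (b := b))
  have := Dw_eq_of_tangent hS (Or.inl ⟨hw, rfl⟩) hl ((F.v_smooth i).mono inter_subset_left)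
    ((F.Φ_smooth i).mono inter_subset_right) (fun q hq => F.v_init i q hq.1.1.1 hq.1.1.2 hq.2)
  have hmem := F.init_mem i (Ioo_subset_Ioc_self hp) p.2
  rw [this (x := ((0, p.1), p.2)) ⟨⟨hmem, hmem.1, hp⟩, rfl⟩]

lemma initBound_of_span {w : List (Fin 5)} (hl : w.length ≤ 2 * m + 2) {W : Set (List (Fin 5))}
    (h : F.Span F.S W fun i => Dw T b w (F.v i)) (hW : ∀ w' ∈ W, F.InitBound w') :
    F.InitBound w := by
  obtain ⟨s, hs, C, hC, h⟩ := h
  refine ((L2Bound.sum s fun w' hw' => (hW w' (hs w' hw')).abs).const_mul C).of_abs_le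
    (fun i => F.aemeasurable_init (F.continuousOn_Dw hl i)) fun i => ?_
  filter_upwards [ae_strip 0 b] with p hp
  exact (h i _ (F.init_mem i (Ioo_subset_Ioc_self hp) p.2) p.2.norm).trans (le_abs_self _)

/-- Traces on the corner `τ = 0`, `z = b`. -/
lemma corner_bound {w : List (Fin 5)} (hw : 1 ∉ w) (hl : w.length ≤ 2 * m + 1) :
    L2Bound sphereMeasure F.A fun i x => Dw T b w (F.v i) ((0, b), x) := by
  obtain ⟨C, hC, h⟩ := F.Ψ_bound w (by omega)
  obtain ⟨C', hC', h'⟩ := F.Ψ_bound (0 :: w) (by simp; omega)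
  have hcont : ∀ i, Continuous fun x : Sph => Dw T b w (F.v i) ((0, b), x) := fun i =>
    (F.continuousOn_Dw (by omega) i).comp_continuous (by fun_prop)
      fun x => F.init_mem i ⟨hb.out, le_rfl⟩ x
  have hΨc : ∀ (i : ι) {w : List (Fin 5)}, w.length ≤ 2 * m + 2 →
      ContinuousOn (Dw T b w (F.Ψ i)) {q | q ∈ slabCone T b ∧ q.1.1 ∈ Ioo 0 T} := fun i w hw =>
    (contDiffOn_Dw (n := 0) relOpen_tau w
      ((F.Ψ_smooth i).of_le (by exact_mod_cast (by omega)))).continuousOn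
  have hmem : ∀ (t : ℝ) (x : Sph), t ∈ Ioo 0 T →
      (((t, b), (x : E3)) : Spacetime) ∈ {q : Spacetime | q ∈ slabCone T b ∧ q.1.1 ∈ Ioo 0 T} :=
    fun t x ht => ⟨⟨Ioo_subset_Icc_self ht, ⟨hb.out.le, le_rfl⟩, x.ne_zero⟩, ht⟩
  have hmeas : ∀ (i : ι) {w : List (Fin 5)}, w.length ≤ 2 * m + 2 →
      AEMeasurable (fun p : ℝ × Sph => ENNReal.ofReal (Dw T b w (F.Ψ i) ((p.1, b), p.2) ^ 2))
        (stripMeasure 0 T) := fun i w hw =>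
    ((aemeasurable_strip ((hΨc i hw).comp (by fun_prop)
      fun p hp => hmem p.1 p.2 hp.1)).pow_const 2).ennreal_ofReal
  set K := 1 / T + 1 with hK
  have hT' := hT.out
  have hKp : 0 ≤ K := by positivity
  refine ⟨fun i => (hcont i).measurable.aemeasurable, K * (C + C'), by positivity, fun i => ?_⟩
  have key : ∀ x : Sph, ENNReal.ofReal (Dw T b w (F.v i) ((0, b), x) ^ 2) ≤
      ENNReal.ofReal K * ∫⁻ t in Ioo 0 T, (ENNReal.ofReal (Dw T b w (F.Ψ i) ((t, b), x) ^ 2) +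
        ENNReal.ofReal (Dw T b (0 :: w) (F.Ψ i) ((t, b), x) ^ 2)) := by
    intro x
    have h0 := F.init_mem i (z := b) ⟨hb.out, le_rfl⟩ x
    have hmap : ContinuousWithinAt (fun t : ℝ => (((t, b), (x : E3)) : Spacetime)) (Ioo 0 T) 0 := by
      fun_prop
    have hmaps : MapsTo (fun t : ℝ => (((t, b), (x : E3)) : Spacetime)) (Ioo 0 T) (slabCone T b) :=
      fun t ht => (hmem t x ht).1
    have hne : (𝓝[Ioo 0 T] (0 : ℝ)).NeBot := by
      rw [← mem_closure_iff_nhdsWithin_neBot, closure_Ioo hT.out.ne]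
      exact ⟨le_rfl, hT.out.le⟩
    have hlim : Tendsto (fun t => ENNReal.ofReal (Dw T b w (F.v i) ((t, b), x) ^ 2))
        (𝓝[Ioo 0 T] 0) (𝓝 (ENNReal.ofReal (Dw T b w (F.v i) ((0, b), x) ^ 2))) := by
      have hcw : ContinuousWithinAt (Dw T b w (F.v i)) (slabCone T b) ((0, b), x) :=
        (F.continuousOn_Dw (by omega) i _ h0).mono_of_mem_nhdsWithin ((F.S_relOpen i).mem_nhdsWithin h0)
      have h1 := ContinuousWithinAt.comp (t := slabCone T b) (x := (0 : ℝ)) hcw hmap hmaps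
      exact (ENNReal.continuous_ofReal.tendsto _).comp (h1.tendsto.pow 2)
    refine le_of_tendsto hlim ?_
    have hev : ∀ᶠ t in 𝓝[Ioo 0 T] (0 : ℝ), (((t, b), (x : E3)) : Spacetime) ∈ F.S i :=
      (hmap.tendsto_nhdsWithin hmaps).eventually ((F.S_relOpen i).mem_nhdsWithin h0)
    filter_upwards [hev, self_mem_nhdsWithin] with t ht htT
    have hS := (F.S_relOpen i).inter (relOpen_tau (T := T) (b := b))
    have := Dw_eq_of_tangent hS (Or.inr ⟨hw, rfl⟩) (n := 2 * m + 2) (by omega)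
      ((F.v_smooth i).mono inter_subset_left)
      ((F.Ψ_smooth i).mono inter_subset_right) (fun q hq => F.v_bdry i q hq.1.1.1 hq.1.1.2 hq.2)
    rw [this (x := ((t, b), x)) ⟨⟨ht, hmem t x htT⟩, rfl⟩]
    refine sq_le_lintegral (g := fun t => Dw T b w (F.Ψ i) ((t, b), x)) ?_ ?_ htT
    · intro r hr
      have hr' := hmem r x hr
      have hd : ContDiffOn ℝ (1 : ℕ) (Dw T b w (F.Ψ i)) {q | q ∈ slabCone T b ∧ q.1.1 ∈ Ioo 0 T} :=
        contDiffOn_Dw relOpen_tau w ((F.Ψ_smooth i).of_le (by exact_mod_cast (by omega)))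
      exact (hasDerivWithinAt_tau hr'.1
        (diffWithin_of_contDiffOn hd relOpen_tau one_ne_zero hr')).hasDerivAt (Icc_mem_nhds hr.1 hr.2)
    · exact (hΨc i (w := 0 :: w) (by simp; omega)).comp (by fun_prop) fun t ht => hmem t x ht
  have m1 := hmeas i (w := w) (by omega)
  have m2 := hmeas i (w := 0 :: w) (by simp; omega)
  calc _ ≤ ∫⁻ x : Sph, ENNReal.ofReal K * (∫⁻ t in Ioo 0 T,
        (ENNReal.ofReal (Dw T b w (F.Ψ i) ((t, b), x) ^ 2) +
        ENNReal.ofReal (Dw T b (0 :: w) (F.Ψ i) ((t, b), x) ^ 2))) ∂sphereMeasure :=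
        lintegral_mono key
    _ = ENNReal.ofReal K * ∫⁻ p, (ENNReal.ofReal (Dw T b w (F.Ψ i) ((p.1, b), p.2) ^ 2) +
        ENNReal.ofReal (Dw T b (0 :: w) (F.Ψ i) ((p.1, b), p.2) ^ 2)) ∂stripMeasure 0 T := by
        rw [lintegral_const_mul' _ _ ENNReal.ofReal_ne_top]
        exact congrArg _ (lintegral_prod_symm _ (m1.add m2)).symm
    _ ≤ ENNReal.ofReal K * (ENNReal.ofReal (C * F.A i ^ 2) + ENNReal.ofReal (C' * F.A i ^ 2)) := by
        rw [lintegral_add_left' m1]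
        exact mul_le_mul_right (add_le_add (h i) (h' i)) _
    _ = _ := by
        rw [← ENNReal.ofReal_add (by positivity) (by positivity), ← ENNReal.ofReal_mul hKp]
        congr 1; ring

/-- Transport of the bounds along the generators of the initial hypersurface. -/
lemma initBound_of_transport {w : List (Fin 5)} (hw : 1 ∉ w) (hl : w.length ≤ 2 * m + 1)
    {W : Set (List (Fin 5))} (hW : ∀ w' ∈ W, w' ≠ w → F.InitBound w')
    (hWl : ∀ w' ∈ W, w'.length ≤ 2 * m + 2)
    (h : F.Span F.S W fun i => Dw T b (1 :: w) (F.v i)) : F.InitBound w := by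
  classical
  obtain ⟨s, hs, C, hC, h⟩ := h
  obtain ⟨hm1, C₁, hC₁, h1⟩ := F.corner_bound hw hl
  obtain ⟨hm2, C₂, hC₂, h2⟩ := L2Bound.const_mul (L2Bound.sum (s.erase w) fun w' hw' =>
    (hW w' (hs w' (Finset.mem_of_mem_erase hw')) (Finset.ne_of_mem_erase hw')).abs) C
  set e := Real.exp ((2 * C + 2) * b) with he
  have he0 : 0 < e := Real.exp_pos _
  refine ⟨fun i => F.aemeasurable_init (F.continuousOn_Dw (by omega) i), e * (C₁ + C₂),
    by positivity, fun i => ?_⟩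
  let f : Sph → ℝ → ℝ := fun x z => Dw T b w (F.v i) ((0, z), x)
  let g : Sph → ℝ → ℝ := fun x z => C * ∑ w' ∈ s.erase w, |Dw T b w' (F.v i) ((0, z), x)|
  have hline : ∀ {w : List (Fin 5)} (x : Sph), w.length ≤ 2 * m + 2 →
      ContinuousOn (fun z : ℝ => Dw T b w (F.v i) ((0, z), x)) (Ioc 0 b) := fun x hw =>
    (F.continuousOn_Dw hw i).comp (by fun_prop) fun z hz => F.init_mem i hz x
  have hg : ∀ x, ContinuousOn (g x) (Ioc 0 b) := fun x =>
    continuousOn_const.mul (continuousOn_finsetSum _ fun w' hw' =>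
      (hline x (hWl w' (hs w' (Finset.mem_of_mem_erase hw')))).abs)
  have key : ∀ x : Sph, ∫⁻ z in Ioo 0 b, ENNReal.ofReal (f x z ^ 2) ≤
      ENNReal.ofReal e * (ENNReal.ofReal (f x b ^ 2) + ∫⁻ z in Ioo 0 b, ENNReal.ofReal (g x z ^ 2)) := by
    intro x
    have hz0 : ∀ z₀ ∈ Ioo 0 b, ∫⁻ z in Ioo z₀ b, ENNReal.ofReal (f x z ^ 2) ≤
        ENNReal.ofReal e * (ENNReal.ofReal (f x b ^ 2) +
          ∫⁻ z in Ioo 0 b, ENNReal.ofReal (g x z ^ 2)) := by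
      intro z₀ hz₀
      have hsub : Icc z₀ b ⊆ Ioc 0 b := fun z hz => ⟨hz₀.1.trans_le hz.1, hz.2⟩
      have hint : ∀ {k : ℝ → ℝ}, ContinuousOn k (Ioc 0 b) → IntegrableOn k (Ioo z₀ b) := fun hk =>
        ((hk.mono hsub).integrableOn_Icc).mono_set Ioo_subset_Icc_self
      have hd : ContDiffOn ℝ (1 : ℕ) (Dw T b w (F.v i)) (F.S i) := F.v_smooth_Dw (by omega) i
      have hgr := integral_sq_le_of_deriv hz₀.1.le hz₀.2.le hC (f := f x)
        (f' := fun z => Dw T b (1 :: w) (F.v i) ((0, z), x)) (h := g x) ?_ ?_ ((hg x).mono hsub) ?_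
      · rw [← ofReal_integral_eq_lintegral_ofReal (hint (k := fun z => f x z ^ 2) ((hline (w := w) x (by omega)).pow 2))
          (ae_of_all _ fun z => sq_nonneg _)]
        refine (ENNReal.ofReal_le_ofReal hgr).trans ?_
        rw [ENNReal.ofReal_mul he0.le, ENNReal.ofReal_add (sq_nonneg _)
          (integral_nonneg fun z => sq_nonneg _), ofReal_integral_eq_lintegral_ofReal
            (hint (k := fun z => g x z ^ 2) ((hg x).pow 2)) (ae_of_all _ fun z => sq_nonneg _)]
        gcongr
        exact hz₀.1.le
      · intro z hz
        have hmem := F.init_mem i (hsub hz) x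
        exact (hasDerivWithinAt_z hmem.1 (diffWithin_of_contDiffOn hd (F.S_relOpen i) one_ne_zero
          hmem)).mono (Icc_subset_Icc_left hz₀.1.le)
      · exact (hline x (by simp; omega)).mono hsub
      · intro z hz
        have hmem := F.init_mem i (hsub hz) x
        refine (h i _ hmem x.norm).trans ?_
        change _ ≤ C * |Dw T b w (F.v i) ((0, z), x)| + C * _
        rw [← mul_add]
        refine mul_le_mul_of_nonneg_left ?_ hC
        by_cases hws : w ∈ s
        · rw [← Finset.add_sum_erase _ _ hws]
        · rw [Finset.erase_eq_of_notMem hws]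
          exact le_add_of_nonneg_left (abs_nonneg _)
    have hU : (⋃ n : ℕ, Ioo (b / (n + 2)) b) = Ioo 0 b := by
      ext z
      simp only [mem_iUnion, mem_Ioo]
      constructor
      · rintro ⟨n, h1, h2⟩
        exact ⟨(div_pos hb.out (by positivity)).trans h1, h2⟩
      · rintro ⟨h1, h2⟩
        obtain ⟨n, hn⟩ := exists_nat_gt (b / z)
        refine ⟨n, ?_, h2⟩
        rw [div_lt_iff₀ h1] at hn
        rw [div_lt_iff₀ (by positivity)]
        nlinarith
    rw [← hU, setLIntegral_iUnion_of_directed]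
    · rw [hU]
      refine iSup_le fun n => hz0 _ ⟨div_pos hb.out (by positivity), ?_⟩
      exact div_lt_self hb.out (by linarith [n.cast_nonneg (α := ℝ)])
    · refine Monotone.directed_le fun n k hnk => Ioo_subset_Ioo_left ?_
      have := hb.out.le
      gcongr
  have hmf := ((F.aemeasurable_init (F.continuousOn_Dw (w := w) (by omega) i)).pow_const 2).ennreal_ofReal
  have hmg := ((hm2 i).pow_const 2).ennreal_ofReal
  rw [lintegral_prod_symm _ hmf]
  calc _ ≤ ∫⁻ x : Sph, ENNReal.ofReal e * (ENNReal.ofReal (f x b ^ 2) +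
        ∫⁻ z in Ioo 0 b, ENNReal.ofReal (g x z ^ 2)) ∂sphereMeasure := lintegral_mono key
    _ = ENNReal.ofReal e * (∫⁻ x : Sph, ENNReal.ofReal (f x b ^ 2) ∂sphereMeasure +
        ∫⁻ p, ENNReal.ofReal (g p.2 p.1 ^ 2) ∂stripMeasure 0 b) := by
        rw [lintegral_const_mul' _ _ ENNReal.ofReal_ne_top,
          lintegral_add_left' ((hm1 i).pow_const 2).ennreal_ofReal, lintegral_prod_symm _ hmg]
    _ ≤ ENNReal.ofReal e * (ENNReal.ofReal (C₁ * F.A i ^ 2) + ENNReal.ofReal (C₂ * F.A i ^ 2)) :=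
        mul_le_mul_right (add_le_add (h1 i) (h2 i)) _
    _ = _ := by
        rw [← ENNReal.ofReal_add (by positivity) (by positivity), ← ENNReal.ofReal_mul he0.le]
        congr 1; ring

/-- The weights that count derivatives in `τ` twice. -/
def wt₂ : Fin 5 → ℕ := fun i => if i = 0 then 2 else 1

lemma isWeight_wt₂ : IsWeight wt₂ :=
  ⟨fun i => by unfold wt₂; split_ifs <;> norm_num, by simp [wt₂], fun i hi => by simp [wt₂, hi]⟩

lemma isWeight_one : IsWeight fun _ => 1 := ⟨fun _ => le_rfl, by norm_num, fun _ _ => rfl⟩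

theorem initBound {w : List (Fin 5)} (hw : weight wt₂ w ≤ 2 * m + 1) : F.InitBound w := by
  generalize hn : weight wt₂ w = n at hw
  induction n using Nat.strong_induction_on generalizing w with
  | _ n ih =>
  generalize hc : w.count 0 = c
  induction c using Nat.strong_induction_on generalizing w with
  | _ c ihc =>
  have hlen : ∀ w', w'.length ≤ weight wt₂ w' := length_le_weight isWeight_wt₂.one_le
  have hlw := hlen w
  by_cases h0 : 0 ∈ w
  swap
  · exact F.initBound_of_tangent h0 (by omega)
  have hwt0 : wt₂ 0 = 2 := rfl
  have hwt1 : ∀ {a : Fin 5}, a ≠ 0 → wt₂ a = 1 := fun ha => isWeight_wt₂.eq_one _ ha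
  have e0 := weight_erase wt₂ h0
  have c0 : (w.erase 0).count 0 + 1 = w.count 0 := by
    rw [List.count_erase_self]
    have := List.count_pos_iff.2 h0
    omega
  set u := w.erase 0 with hu
  have hlu := hlen u
  have hDw : ∀ i, EqOn (Dw T b w (F.v i)) (Dw T b (0 :: u) (F.v i)) (F.S i) := fun i =>
    Dw_erase (F.S_relOpen i) (by norm_num) w h0 ((F.v_smooth i).of_le (by exact_mod_cast (by omega)))
  have hred : F.InitBound (0 :: u) → F.InitBound w := by
    intro h
    refine h.of_abs_le (fun i => F.aemeasurable_init (F.continuousOn_Dw (by omega) i)) fun i => ?_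
    filter_upwards [ae_strip 0 b] with p hp
    rw [hDw i (F.init_mem i (Ioo_subset_Ioc_self hp) p.2)]
  by_cases h1 : 1 ∈ u
  · have e1 := weight_erase wt₂ h1
    rw [hwt1 (by norm_num)] at e1
    set u' := u.erase 1 with hu'
    have hlu' := hlen u'
    have hspan : F.Span F.S {w' | weight wt₂ w' < n} fun i => Dw T b (1 :: 0 :: u') (F.v i) := by
      refine F.span_D_one_D_zero isWeight_wt₂ (by omega) (fun w' hw' => ?_) ?_ fun a d ha hd => ?_
      · simp only [mem_ofPred_eq]; omega
      · simp only [mem_ofPred_eq, weight_cons]; omega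
      · simp only [mem_ofPred_eq, weight_cons, hwt1 ha, hwt1 hd]; omega
    refine hred (F.initBound_of_span (by simp; omega) (hspan.congr fun i q hq => ?_)
      fun w' hw' => ih _ hw' rfl ?_)
    · have h3 : EqOn (Dw T b u (F.v i)) (Dw T b (1 :: u') (F.v i)) (F.S i) :=
        Dw_erase (F.S_relOpen i) (by norm_num) u h1
          ((F.v_smooth i).of_le (by exact_mod_cast (by omega)))
      simp only [Dw_cons]
      rw [D_congr (F.S_relOpen i) h3 hq 0]
      exact (D_comm_of_lt (F.S_relOpen i) (F.v_smooth_Dw (by omega) i) hq (by norm_num) 0)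
    · have : weight wt₂ w' < n := hw'
      omega
  · have hspan : F.Span F.S ({w' | weight wt₂ w' < n} ∪ {w' | weight wt₂ w' = n ∧ w'.count 0 < c} ∪
        {0 :: u}) fun i => Dw T b (1 :: 0 :: u) (F.v i) := by
      refine F.span_D_one_D_zero isWeight_wt₂ (by omega) (fun w' hw' => ?_) (Or.inr rfl)
        fun a d ha hd => Or.inl (Or.inr ⟨?_, ?_⟩)
      · refine Or.inl (Or.inl ?_); simp only [mem_ofPred_eq]; omega
      · simp only [weight_cons, hwt1 ha, hwt1 hd]; omega
      · rw [List.count_cons_of_ne ha, List.count_cons_of_ne hd]; omega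
    refine hred (F.initBound_of_transport (by simpa using h1) (by simp; omega) ?_ ?_ hspan)
    · rintro w' ((h | h) | h) hne
      · exact ih _ h rfl (by have : weight wt₂ w' < n := h; omega)
      · exact ihc _ h.2 h.1 rfl
      · exact absurd h hne
    · have := hlen
      rintro w' ((h | h) | h)
      · have h' : weight wt₂ w' < n := h
        have := hlen w'; omega
      · have := hlen w'; have := h.1; omega
      · rw [mem_singleton_iff.1 h]; simp; omega

end WaveFamily

end

section

variable {T b : ℝ} [hT : Fact (0 < T)] [hb : Fact (0 < b)]

namespace WaveFamily

variable {ι : Type*} {m : ℕ} (F : WaveFamily ι T b m)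

/-! ### Derivatives on the timelike boundary -/

/-- On `z = b` all derivatives are controlled by tangential derivatives and by the `z`-derivatives of
tangential derivatives. -/
theorem span_bdry {w : List (Fin 5)} (hw : w.length ≤ m + 1) :
    F.Span (fun i => F.S i ∩ {q | q.1.2 = b})
      ({w | ∃ w', w = 1 :: w' ∧ 1 ∉ w' ∧ w'.length ≤ m} ∪ {w | 1 ∉ w ∧ w.length ≤ m + 1})
      fun i => Dw T b w (F.v i) := by
  generalize hn : w.length = n at hw
  induction n using Nat.strong_induction_on generalizing w with
  | _ n ih =>
  generalize hc : w.count 1 = c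
  induction c using Nat.strong_induction_on generalizing w with
  | _ c ihc =>
  by_cases h1 : 1 ∈ w
  swap
  · exact span_of_mem (Or.inr ⟨h1, by omega⟩)
  have hEr : ∀ {w : List (Fin 5)}, 1 ∈ w → w.length ≤ m + 1 → ∀ i,
      EqOn (Dw T b w (F.v i)) (D T b 1 (Dw T b (w.erase 1) (F.v i))) (F.S i) := fun {w} h hl i =>
    Dw_erase (F.S_relOpen i) (by norm_num) w h
      ((F.v_smooth i).of_le (by exact_mod_cast (by omega)))
  have c0 : (w.erase 1).count 1 + 1 = w.count 1 := by
    rw [List.count_erase_self]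
    have := List.count_pos_iff.2 h1
    omega
  have l0 : (w.erase 1).length + 1 = w.length := by
    rw [List.length_erase_of_mem h1]
    have := List.length_pos_of_mem h1
    omega
  have e0 := hEr h1 (by omega)
  set u := w.erase 1
  by_cases h2 : 1 ∈ u
  swap
  · refine Span.congr (span_of_mem (w := 1 :: u) (Or.inl ⟨u, rfl, h2, by omega⟩)) fun i q hq => ?_
    exact (e0 i hq.1).symm
  have c1 : (u.erase 1).count 1 + 1 = u.count 1 := by
    rw [List.count_erase_self]
    have := List.count_pos_iff.2 h2
    omega
  have l1 : (u.erase 1).length + 1 = u.length := by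
    rw [List.length_erase_of_mem h2]
    have := List.length_pos_of_mem h2
    omega
  have e1 := hEr h2 (by omega)
  set u' := u.erase 1
  have hspan : F.Span (fun i => F.S i ∩ {q | q.1.2 = b})
      ({w' | w'.length < n} ∪ {w' | w'.length = n ∧ w'.count 1 < c})
      fun i => Dw T b (1 :: 1 :: u') (F.v i) := by
    refine F.span_D_one_D_one (by omega) (fun w' hw' => Or.inl ?_) fun a d had => Or.inr ⟨?_, ?_⟩
    · simp only [mem_ofPred_eq]; omega
    · simp only [List.length_cons]; omega
    · rw [List.count_cons, List.count_cons]
      by_cases ha : a = 1 <;> by_cases hd : d = 1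
      · exact absurd ⟨ha, hd⟩ had
      all_goals simp [ha, hd]; omega
  refine (hspan.congr fun i q hq => ?_).trans fun w' hw' => ?_
  · rw [e0 i hq.1, D_congr (F.S_relOpen i) (e1 i) hq.1 1]; rfl
  · rcases hw' with h | h
    · exact ih _ h rfl (by have : w'.length < n := h; omega)
    · exact ihc _ h.2 h.1 rfl

lemma Span.sq {F : WaveFamily ι T b m} {E : ι → Set Spacetime} {W : Set (List (Fin 5))}
    {H : ι → Spacetime → ℝ} (h : F.Span E W H) :
    ∃ s : Finset (List (Fin 5)), (∀ w ∈ s, w ∈ W) ∧ ∃ C : ℝ, 0 ≤ C ∧ ∀ i, ∀ q ∈ E i, ‖q.2‖ = 1 →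
      H i q ^ 2 ≤ C * ∑ w ∈ s, Dw T b w (F.v i) q ^ 2 := by
  obtain ⟨s, hs, C, hC, h⟩ := h
  refine ⟨s, hs, C ^ 2 * s.card, by positivity, fun i q hq hu => ?_⟩
  have h1 := sq_sum_le_card_mul_sum_sq (s := s) (f := fun w => |Dw T b w (F.v i) q|)
  simp only [sq_abs] at h1
  calc H i q ^ 2 = |H i q| ^ 2 := (sq_abs _).symm
    _ ≤ (C * ∑ w ∈ s, |Dw T b w (F.v i) q|) ^ 2 :=
      pow_le_pow_left₀ (abs_nonneg _) (h i q hq hu) 2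
    _ ≤ _ := by rw [mul_pow, mul_assoc]; exact mul_le_mul_of_nonneg_left h1 (sq_nonneg _)

/-! ### Weighted integrals -/

/-- A parametrized piece of the slab on which weighted integrals are considered. -/
structure IsChart {X : Type*} [MeasurableSpace X] (μ : Measure X) (j : X → Spacetime)
    (E : Set Spacetime) : Prop where
  mem : ∀ᵐ p ∂μ, j p ∈ E
  subset : ∀ q ∈ E, q ∈ slabCone T b ∧ ‖q.2‖ = 1
  integrable : ∀ (i : ι) {s lam : ℝ} {f : Spacetime → ℝ}, 0 < s → ContinuousOn f (F.S i) →
    Integrable (fun p => F.wgt s lam i (j p) * f (j p)) μ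

lemma isChart_bulk :
    F.IsChart (slabMeasure T b) inj {q | q ∈ slabCone T b ∧ ‖q.2‖ = 1} where
  mem := by
    filter_upwards [ae_slab (T := T) (b := b)] with p hp
    exact ⟨⟨Ioo_subset_Icc_self hp.1, Ioo_subset_Icc_self hp.2, p.2.ne_zero⟩, p.2.norm⟩
  subset _ h := h
  integrable i s lam f hs hf := F.integrable_bulk hs lam hf

lemma isChart_bdry : F.IsChart (stripMeasure 0 T) (fun p => ((p.1, b), p.2))
    {q | (q ∈ slabCone T b ∧ ‖q.2‖ = 1) ∧ q.1.2 = b} where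
  mem := by
    filter_upwards [ae_strip 0 T] with p hp
    exact ⟨⟨⟨Ioo_subset_Icc_self hp, ⟨hb.out.le, le_rfl⟩, p.2.ne_zero⟩, p.2.norm⟩, rfl⟩
  subset _ h := h.1
  integrable i s lam f hs hf := F.integrable_bdry hs lam hf ⟨hb.out.le, le_rfl⟩

lemma isChart_init : F.IsChart (stripMeasure 0 b) (fun p => ((0, p.1), p.2))
    {q | (q ∈ slabCone T b ∧ ‖q.2‖ = 1) ∧ q.1.1 = 0} where
  mem := by
    filter_upwards [ae_strip 0 b] with p hp
    exact ⟨⟨⟨⟨le_rfl, hT.out.le⟩, Ioo_subset_Icc_self hp, p.2.ne_zero⟩, p.2.norm⟩, rfl⟩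
  subset _ h := h.1
  integrable i s lam f hs hf := F.integrable_init hs lam hf ⟨le_rfl, hT.out.le⟩

section chart

variable {X : Type*} [MeasurableSpace X] {μ : Measure X} {j : X → Spacetime} {E : Set Spacetime}

/-- The weighted integral over a piece of the slab. -/
def wint (μ : Measure X) (j : X → Spacetime) (s lam : ℝ) (i : ι) (f : Spacetime → ℝ) : ℝ :=
  ∫ p, F.wgt s lam i (j p) * f (j p) ∂μ

variable {F} (hj : F.IsChart μ j E) {s : ℝ} (hs : 0 < s) (lam : ℝ) {i : ι}

include hj hs in
lemma IsChart.mono {f g : Spacetime → ℝ} (hf : ContinuousOn f (F.S i))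
    (hg : ContinuousOn g (F.S i)) (h : ∀ q ∈ F.S i, q ∈ E → f q ≤ g q) :
    F.wint μ j s lam i f ≤ F.wint μ j s lam i g := by
  refine integral_mono_ae (hj.integrable i hs hf) (hj.integrable i hs hg) ?_
  filter_upwards [hj.mem] with p hp
  by_cases hS : j p ∈ F.S i
  · exact mul_le_mul_of_nonneg_left (h _ hS hp) (F.wgt_nonneg s lam i _)
  · have : F.ρ i (j p) ≤ 0 := not_lt.1 fun h => hS ⟨(hj.subset _ hp).1, h⟩
    simp [F.wgt_eq_zero hs lam (this.trans hs.le)]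

include hj hs in
lemma IsChart.sum {κ : Type*} (t : Finset κ) {f : κ → Spacetime → ℝ}
    (hf : ∀ k ∈ t, ContinuousOn (f k) (F.S i)) :
    F.wint μ j s lam i (fun q => ∑ k ∈ t, f k q) = ∑ k ∈ t, F.wint μ j s lam i (f k) := by
  unfold wint
  simp only [Finset.mul_sum]
  exact integral_finsetSum _ fun k hk => hj.integrable i hs (hf k hk)

lemma wint_const_mul (c : ℝ) (f : Spacetime → ℝ) :
    F.wint μ j s lam i (fun q => c * f q) = c * F.wint μ j s lam i f := by
  unfold wint
  rw [← integral_const_mul]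
  exact integral_congr_ae (ae_of_all _ fun p => by ring)

include hj hs in
lemma IsChart.add {f g : Spacetime → ℝ} (hf : ContinuousOn f (F.S i))
    (hg : ContinuousOn g (F.S i)) :
    F.wint μ j s lam i (fun q => f q + g q) = F.wint μ j s lam i f + F.wint μ j s lam i g := by
  unfold wint
  simp only [mul_add]
  exact integral_add (hj.integrable i hs hf) (hj.integrable i hs hg)

lemma wint_nonneg {f : Spacetime → ℝ} (hf : ∀ q, 0 ≤ f q) : 0 ≤ F.wint μ j s lam i f :=
  integral_nonneg fun _ => mul_nonneg (F.wgt_nonneg s lam i _) (hf _)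

lemma mulC_nonneg : 0 ≤ F.mulC := by have := F.one_le_Gbd; unfold mulC; linarith

lemma wgt_le_exp (hlam : 0 ≤ lam) {q : Spacetime} (hq : q ∈ slabCone T b) :
    F.wgt s lam i q ≤ Real.exp (lam * b) := by
  refine (F.wgt_le s lam i q).trans (Real.exp_le_exp.2 (mul_le_mul_of_nonneg_left ?_ hlam))
  have := mul_nonneg (mulC_nonneg (F := F)) hq.1.1
  linarith [hq.2.1.2]

include hj hs in
/-- Weighted integrals of squares that are controlled by the data. -/
lemma IsChart.le_of_lintegral (hlam : 0 ≤ lam) {f : Spacetime → ℝ} {g : X → ℝ} {K : ℝ}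
    (hK : 0 ≤ K) (hf : ContinuousOn f (F.S i)) (hfg : ∀ᵐ p ∂μ, j p ∈ F.S i → f (j p) = g p)
    (h : ∫⁻ p, ENNReal.ofReal (g p ^ 2) ∂μ ≤ ENNReal.ofReal K) :
    F.wint μ j s lam i (fun q => f q ^ 2) ≤ Real.exp (lam * b) * K := by
  rw [← ENNReal.ofReal_le_ofReal_iff (by positivity), wint, ofReal_integral_eq_lintegral_ofReal
    (hj.integrable i (f := fun q => f q ^ 2) hs (hf.pow 2))
    (ae_of_all _ fun p => mul_nonneg (F.wgt_nonneg s lam i _) (sq_nonneg _)),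
    ENNReal.ofReal_mul (Real.exp_pos _).le]
  refine le_trans ?_ (mul_le_mul_right h _)
  rw [← lintegral_const_mul' _ _ ENNReal.ofReal_ne_top]
  refine lintegral_mono_ae ?_
  filter_upwards [hj.mem, hfg] with p hp hpg
  rw [← ENNReal.ofReal_mul (Real.exp_pos _).le]
  refine ENNReal.ofReal_le_ofReal ?_
  by_cases hS : j p ∈ F.S i
  · rw [hpg hS]
    exact mul_le_mul_of_nonneg_right (F.wgt_le_exp lam hlam hS.1) (sq_nonneg _)
  · have : F.ρ i (j p) ≤ 0 := not_lt.1 fun h => hS ⟨(hj.subset _ hp).1, h⟩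
    rw [F.wgt_eq_zero hs lam (this.trans hs.le), zero_mul]
    positivity

end chart

lemma wint_init_le {w : List (Fin 5)} (hw : weight wt₂ w ≤ 2 * m + 1) {lam : ℝ} (hlam : 0 ≤ lam) :
    ∃ C : ℝ, 0 ≤ C ∧ ∀ i s, 0 < s →
      F.wint (stripMeasure 0 b) (fun p => ((0, p.1), p.2)) s lam i
        (fun q => Dw T b w (F.v i) q ^ 2) ≤ C * F.A i ^ 2 := by
  obtain ⟨-, C, hC, h⟩ := F.initBound hw
  have hl := length_le_weight isWeight_wt₂.one_le w
  refine ⟨Real.exp (lam * b) * C, by positivity, fun i s hs => ?_⟩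
  rw [mul_assoc]
  exact F.isChart_init.le_of_lintegral hs lam hlam (by positivity) (F.continuousOn_Dw (by omega) i)
    (ae_of_all _ fun _ _ => rfl) (h i)

lemma wint_bdry_le {w : List (Fin 5)} (hw : 1 ∉ w) (hl : w.length ≤ 2 * m + 2) {lam : ℝ}
    (hlam : 0 ≤ lam) : ∃ C : ℝ, 0 ≤ C ∧ ∀ i s, 0 < s →
      F.wint (stripMeasure 0 T) (fun p => ((p.1, b), p.2)) s lam i
        (fun q => Dw T b w (F.v i) q ^ 2) ≤ C * F.A i ^ 2 := by
  obtain ⟨C, hC, h⟩ := F.Ψ_bound w hl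
  refine ⟨Real.exp (lam * b) * C, by positivity, fun i s hs => ?_⟩
  rw [mul_assoc]
  refine F.isChart_bdry.le_of_lintegral hs lam hlam (by positivity) (F.continuousOn_Dw hl i)
    ?_ (h i)
  filter_upwards [ae_strip 0 T] with p hp hS
  have hR := (F.S_relOpen i).inter (relOpen_tau (T := T) (b := b))
  exact Dw_eq_of_tangent hR (Or.inr ⟨hw, rfl⟩) hl ((F.v_smooth i).mono inter_subset_left)
    ((F.Ψ_smooth i).mono inter_subset_right) (fun q hq => F.v_bdry i q hq.1.1.1 hq.1.1.2 hq.2)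
    (x := ((p.1, b), p.2)) ⟨⟨hS, hS.1, hp⟩, rfl⟩

lemma exists_uniform {κ : Type*} (t : Finset κ) {P : κ → ℝ → Prop}
    (hP : ∀ k x y, x ≤ y → P k x → P k y) (h : ∀ k ∈ t, ∃ C : ℝ, 0 ≤ C ∧ P k C) :
    ∃ C : ℝ, 0 ≤ C ∧ ∀ k ∈ t, P k C := by
  classical
  induction t using Finset.induction_on with
  | empty => exact ⟨0, le_rfl, by simp⟩
  | insert k t hk ih =>
    obtain ⟨C, hC, h1⟩ := h k (Finset.mem_insert_self _ _)
    obtain ⟨C', hC', h2⟩ := ih fun k hk => h k (Finset.mem_insert_of_mem hk)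
    refine ⟨C + C', add_nonneg hC hC', fun l hl => ?_⟩
    rcases Finset.mem_insert.1 hl with rfl | hl
    · exact hP _ _ _ (le_add_of_nonneg_right hC') h1
    · exact hP _ _ _ (le_add_of_nonneg_left hC) (h2 l hl)

end WaveFamily

end

section

variable {T b : ℝ} [hT : Fact (0 < T)] [hb : Fact (0 < b)]

namespace WaveFamily

variable {ι : Type*} {m : ℕ} (F : WaveFamily ι T b m)

/-! ### The energy estimate -/

/-- The sum of the squares of the tangential derivatives of order at most `n`. -/
def tangSq (n : ℕ) (i : ι) (q : Spacetime) : ℝ :=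
  ∑ w ∈ (words n).filter (fun w => 1 ∉ w), Dw T b w (F.v i) q ^ 2

/-- The sum of the squares of the `z`-derivatives of the tangential derivatives of order at most
`m`. -/
def normalSq (i : ι) (q : Spacetime) : ℝ :=
  ∑ w ∈ (words m).filter (fun w => 1 ∉ w), Dw T b (1 :: w) (F.v i) q ^ 2

/-- The sum of the squares of the derivatives of orders between `1` and `m + 1`. -/
def gradSq (i : ι) (q : Spacetime) : ℝ :=
  ∑ w ∈ words m, ∑ k, D T b k (Dw T b w (F.v i)) q ^ 2

lemma le_tangSq {n : ℕ} {w : List (Fin 5)} (hw : 1 ∉ w) (hl : w.length ≤ n) (i : ι)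
    (q : Spacetime) : Dw T b w (F.v i) q ^ 2 ≤ F.tangSq n i q :=
  Finset.single_le_sum (f := fun w => Dw T b w (F.v i) q ^ 2) (fun _ _ => sq_nonneg _)
    (Finset.mem_filter.2 ⟨mem_words.2 hl, hw⟩)

lemma le_normalSq {w : List (Fin 5)} (hw : 1 ∉ w) (hl : w.length ≤ m) (i : ι)
    (q : Spacetime) : Dw T b (1 :: w) (F.v i) q ^ 2 ≤ F.normalSq i q :=
  Finset.single_le_sum (f := fun w => Dw T b (1 :: w) (F.v i) q ^ 2) (fun _ _ => sq_nonneg _)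
    (Finset.mem_filter.2 ⟨mem_words.2 hl, hw⟩)

lemma le_gradSq {w : List (Fin 5)} (hl : w.length ≤ m + 1) (i : ι)
    (q : Spacetime) : Dw T b w (F.v i) q ^ 2 ≤ F.v i q ^ 2 + F.gradSq i q := by
  have h0 : ∀ w, 0 ≤ ∑ k, D T b k (Dw T b w (F.v i)) q ^ 2 := fun w =>
    Finset.sum_nonneg fun _ _ => sq_nonneg _
  cases w with
  | nil => exact le_add_of_nonneg_right (Finset.sum_nonneg fun _ _ => h0 _)
  | cons k w =>
    refine le_trans ?_ (le_add_of_nonneg_left (sq_nonneg _))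
    refine le_trans ?_ (Finset.single_le_sum (f := fun w => ∑ k, D T b k (Dw T b w (F.v i)) q ^ 2)
      (fun _ _ => h0 _) (mem_words.2 (by simpa using hl) : w ∈ words m))
    exact Finset.single_le_sum (f := fun k => D T b k (Dw T b w (F.v i)) q ^ 2)
      (fun _ _ => sq_nonneg _) (Finset.mem_univ k)

lemma D_one_sq_le_gradSq (i : ι) (q : Spacetime) : D T b 1 (F.v i) q ^ 2 ≤ F.gradSq i q := by
  refine le_trans ?_ (Finset.single_le_sum (f := fun w => ∑ k, D T b k (Dw T b w (F.v i)) q ^ 2)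
    (fun _ _ => Finset.sum_nonneg fun _ _ => sq_nonneg _)
    (mem_words.2 (Nat.zero_le _) : [] ∈ words m))
  exact Finset.single_le_sum (f := fun k => D T b k (F.v i) q ^ 2) (fun _ _ => sq_nonneg _)
    (Finset.mem_univ 1)

lemma tangSq_continuousOn {n : ℕ} (hn : n ≤ 2 * m + 2) (i : ι) :
    ContinuousOn (F.tangSq n i) (F.S i) :=
  continuousOn_finsetSum _ fun _ hw => (F.continuousOn_Dw
    ((mem_words.1 (Finset.mem_filter.1 hw).1).trans hn) i).pow 2

lemma normalSq_continuousOn (i : ι) : ContinuousOn (F.normalSq i) (F.S i) :=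
  continuousOn_finsetSum _ fun w hw => (F.continuousOn_Dw (w := 1 :: w)
    (by have := mem_words.1 (Finset.mem_filter.1 hw).1; simp; omega) i).pow 2

lemma sumSq_continuousOn {w : List (Fin 5)} (hw : w.length ≤ m) (i : ι) :
    ContinuousOn (fun q => ∑ k, D T b k (Dw T b w (F.v i)) q ^ 2) (F.S i) :=
  continuousOn_finsetSum _ fun k _ => (F.continuousOn_Dw (w := k :: w) (by simp; omega) i).pow 2

lemma gradSq_continuousOn (i : ι) : ContinuousOn (F.gradSq i) (F.S i) :=
  continuousOn_finsetSum _ fun _ hw => F.sumSq_continuousOn (mem_words.1 hw) i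

lemma sum_le_card {κ : Type*} (t : Finset κ) {f : κ → ℝ} {c : ℝ} (h : ∀ k ∈ t, f k ≤ c) :
    ∑ k ∈ t, f k ≤ t.card * c := by
  simpa using Finset.sum_le_card_nsmul t f c h

/-- The source terms are controlled by the energies. -/
lemma L_sq_le {w : List (Fin 5)} (hw : w.length ≤ m) : ∃ C : ℝ, 0 ≤ C ∧ ∀ i, ∀ q ∈ F.S i,
    ‖q.2‖ = 1 → F.L i (Dw T b w (F.v i)) q ^ 2 ≤ C * (F.v i q ^ 2 + F.gradSq i q) := by
  obtain ⟨s, hs, C, hC, h⟩ := Span.sq (F.span_L (W := {w | w.length ≤ m + 1}) isWeight_one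
    (w := w) (by omega) fun w' hw' => by
      simp only [weight_one, mem_ofPred_eq] at hw' ⊢; omega)
  refine ⟨C * s.card, by positivity, fun i q hq hu => (h i q hq hu).trans ?_⟩
  rw [mul_assoc]
  exact mul_le_mul_of_nonneg_left (sum_le_card s fun w' hw' => F.le_gradSq (hs w' hw') i q) hC

/-- The boundary fluxes. -/
lemma flux_tang : ∃ c C : ℝ, 0 < c ∧ 0 ≤ C ∧ ∀ w : List (Fin 5), 1 ∉ w → w.length ≤ m →
    ∀ i, ∀ q ∈ F.S i, ‖q.2‖ = 1 → q.1.2 = b →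
    c * Dw T b (1 :: w) (F.v i) q ^ 2 + -C * F.tangSq (m + 1) i q ≤
      F.flux i (Dw T b w (F.v i)) 1 q := by
  obtain ⟨c, C, hc, hC, h⟩ := F.energy_bdry
  refine ⟨c, C * 4, hc, by positivity, fun w hw hl i q hq hu hz => ?_⟩
  have h1 := h i q hq.1 hu hz _ (perp_D (T := T) (b := b) (Dw T b w (F.v i)) q)
  rw [← F.sum_flux] at h1
  have h2 : ∑ k, covZ k * F.flux i (Dw T b w (F.v i)) k q = F.flux i (Dw T b w (F.v i)) 1 q := by
    simp [Fin.sum_univ_five, covZ]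
  rw [h2] at h1
  refine le_trans ?_ h1
  have h3 : ∀ k : Fin 5, k ≠ 1 → D T b k (Dw T b w (F.v i)) q ^ 2 ≤ F.tangSq (m + 1) i q :=
    fun k hk => F.le_tangSq (w := k :: w) (by simp [hw, hk.symm]) (by simpa using hl) i q
  have h4 : D T b 0 (Dw T b w (F.v i)) q ^ 2 +
      ∑ k, angPart (fun k => D T b k (Dw T b w (F.v i)) q) k ^ 2 ≤ 4 * F.tangSq (m + 1) i q := by
    have h5 : ∑ k, angPart (fun k => D T b k (Dw T b w (F.v i)) q) k ^ 2 ≤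
        (Finset.univ : Finset (Fin 3)).card * F.tangSq (m + 1) i q :=
      sum_le_card _ fun k _ => h3 k.succ.succ
        (fun h => absurd (Fin.succ_injective _ h) (Fin.succ_ne_zero k))
    have := h3 0 (by norm_num)
    simp at h5
    linarith
  have := mul_le_mul_of_nonneg_left h4 hC
  simp only [Dw_cons]
  linarith

lemma flux_abs {w : List (Fin 5)} (hl : w.length ≤ m) : ∃ C : ℝ, 0 ≤ C ∧ ∀ i, ∀ q ∈ F.S i,
    ‖q.2‖ = 1 → q.1.2 = b →
    -C * (F.normalSq i q + F.tangSq (m + 1) i q) ≤ F.flux i (Dw T b w (F.v i)) 1 q := by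
  obtain ⟨C, hC, h⟩ := F.energy_bdry_abs
  have hk : ∀ k ∈ (Finset.univ : Finset (Fin 5)), ∃ C' : ℝ, 0 ≤ C' ∧ ∀ i, ∀ q ∈ F.S i, ‖q.2‖ = 1 →
      q.1.2 = b → D T b k (Dw T b w (F.v i)) q ^ 2 ≤
        C' * (F.normalSq i q + F.tangSq (m + 1) i q) := by
    intro k _
    obtain ⟨s, hs, C', hC', h'⟩ := Span.sq (F.span_bdry (w := k :: w) (by simpa using hl))
    refine ⟨C' * s.card, by positivity, fun i q hq hu hz => (h' i q ⟨hq, hz⟩ hu).trans ?_⟩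
    rw [mul_assoc]
    refine mul_le_mul_of_nonneg_left (sum_le_card s fun w' hw' => ?_) hC'
    rcases hs w' hw' with ⟨u, rfl, h1, h2⟩ | ⟨h1, h2⟩
    · exact (F.le_normalSq h1 h2 i q).trans
        (le_add_of_nonneg_right (Finset.sum_nonneg fun _ _ => sq_nonneg _))
    · exact (F.le_tangSq h1 h2 i q).trans
        (le_add_of_nonneg_left (Finset.sum_nonneg fun _ _ => sq_nonneg _))
  have h0 : ∀ i q, 0 ≤ F.normalSq i q + F.tangSq (m + 1) i q := fun i q =>
    add_nonneg (Finset.sum_nonneg fun _ _ => sq_nonneg _) (Finset.sum_nonneg fun _ _ => sq_nonneg _)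
  obtain ⟨C', hC', h'⟩ := exists_uniform _ (fun k x y hxy hx i q hq hu hz =>
    (hx i q hq hu hz).trans (mul_le_mul_of_nonneg_right hxy (h0 i q))) hk
  refine ⟨C * (5 * C'), by positivity, fun i q hq hu hz => ?_⟩
  have h1 := h i q hq.1 hu _ (perp_D (T := T) (b := b) (Dw T b w (F.v i)) q)
  rw [← F.sum_flux] at h1
  have h2 : ∑ k, covZ k * F.flux i (Dw T b w (F.v i)) k q = F.flux i (Dw T b w (F.v i)) 1 q := by
    simp [Fin.sum_univ_five, covZ]
  rw [h2] at h1
  have h3 := sum_le_card Finset.univ fun k hk => h' k hk i q hq hu hz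
  simp at h3
  have h4 := mul_le_mul_of_nonneg_left h3 hC
  have h5 := (abs_le.1 h1).1
  linarith

lemma flux_init (w : List (Fin 5)) (hl : w.length ≤ m) {lam : ℝ} (hlam : 0 ≤ lam) :
    ∃ C : ℝ, 0 ≤ C ∧ ∀ i s, 0 < s →
      F.init s lam i (F.flux i (Dw T b w (F.v i)) 0) ≤ C * F.A i ^ 2 := by
  obtain ⟨C, hC, h⟩ := F.energy_tau
  have hlen : ∀ w : List (Fin 5), weight wt₂ w ≤ 2 * w.length := by
    intro w
    induction w with
    | nil => simp
    | cons k w ih =>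
      have : wt₂ k ≤ 2 := by unfold wt₂; split_ifs <;> norm_num
      simp; omega
  have hk : ∀ k ∈ (Finset.univ : Finset (Fin 4)), ∃ C' : ℝ, 0 ≤ C' ∧ ∀ i s, 0 < s →
      F.wint (stripMeasure 0 b) (fun p => ((0, p.1), p.2)) s lam i
        (fun q => D T b k.succ (Dw T b w (F.v i)) q ^ 2) ≤ C' * F.A i ^ 2 := fun k _ =>
    F.wint_init_le (w := k.succ :: w) (by
      have := hlen w
      rw [weight_cons, isWeight_wt₂.eq_one _ (Fin.succ_ne_zero k)]; omega) hlam
  obtain ⟨C', hC', h'⟩ := exists_uniform _ (fun k x y hxy hx i s hs =>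
    (hx i s hs).trans (mul_le_mul_of_nonneg_right hxy (sq_nonneg (F.A i)))) hk
  refine ⟨C * (4 * C'), by positivity, fun i s hs => ?_⟩
  have hc : ∀ k : Fin 5, ContinuousOn (fun q => D T b k (Dw T b w (F.v i)) q ^ 2) (F.S i) :=
    fun k => (F.continuousOn_Dw (w := k :: w) (by simp; omega) i).pow 2
  have hs1 : ContinuousOn (fun q => ∑ k : Fin 4, D T b k.succ (Dw T b w (F.v i)) q ^ 2) (F.S i) :=
    continuousOn_finsetSum _ fun k _ => hc k.succ
  have h1 : F.init s lam i (F.flux i (Dw T b w (F.v i)) 0) ≤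
      F.wint (stripMeasure 0 b) (fun p => ((0, p.1), p.2)) s lam i
        (fun q => C * ∑ k : Fin 4, D T b k.succ (Dw T b w (F.v i)) q ^ 2) := by
    refine F.isChart_init.mono hs lam (F.flux_contDiffOn (F.v_smooth_Dw (by omega) i) 0).continuousOn
      (continuousOn_const.mul hs1) fun q hq hqE => ?_
    have h1 := (h i q hq.1 hqE.1.2 _ (perp_D (T := T) (b := b) (Dw T b w (F.v i)) q)).2
    rw [← F.sum_flux] at h1
    have h2 : ∑ k, covTau k * F.flux i (Dw T b w (F.v i)) k q =
        F.flux i (Dw T b w (F.v i)) 0 q := by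
      simp [Fin.sum_univ_five, covTau]
    rw [h2] at h1
    refine h1.trans (le_of_eq ?_)
    rw [Fin.sum_univ_succ (n := 3)]
    rfl
  refine h1.trans ?_
  rw [wint_const_mul, F.isChart_init.sum hs lam _ fun k _ => hc k.succ, mul_assoc]
  refine mul_le_mul_of_nonneg_left ?_ hC
  have := sum_le_card Finset.univ fun k hk => h' k hk i s hs
  simp at this
  linarith

lemma bulk_const_mul {s lam : ℝ} {i : ι} (c : ℝ) (f : Spacetime → ℝ) :
    F.bulk s lam i (fun q => c * f q) = c * F.bulk s lam i f :=
  wint_const_mul lam c f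

lemma bdry_const_mul {s lam : ℝ} {i : ι} (c : ℝ) (f : Spacetime → ℝ) :
    F.bdry s lam i (fun q => c * f q) = c * F.bdry s lam i f :=
  wint_const_mul lam c f

set_option maxHeartbeats 1000000 in
/-- The energy estimate in the weighted norms. -/
theorem energy_estimate : ∃ lam : ℝ, 0 ≤ lam ∧ ∃ C : ℝ, 0 ≤ C ∧ ∀ i s, 0 < s →
    F.bulk s lam i (fun q => F.v i q ^ 2 + F.gradSq i q) ≤ C * F.A i ^ 2 := by
  obtain ⟨c, C, hc, hC, hE⟩ := F.energy_ineq
  obtain ⟨CL, hCL, hL⟩ := exists_uniform (words m) (P := fun w C => ∀ i, ∀ q ∈ F.S i,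
    ‖q.2‖ = 1 → F.L i (Dw T b w (F.v i)) q ^ 2 ≤ C * (F.v i q ^ 2 + F.gradSq i q))
    (fun _ x y hxy hx i q hq hu => (hx i q hq hu).trans (mul_le_mul_of_nonneg_right hxy
      (add_nonneg (sq_nonneg _) (Finset.sum_nonneg fun _ _ => Finset.sum_nonneg fun _ _ =>
        sq_nonneg _)))) fun w hw => F.L_sq_le (mem_words.1 hw)
  obtain ⟨cT, CT, hcT, hCT, hT'⟩ := F.flux_tang
  have hpos : ∀ i q, 0 ≤ F.normalSq i q + F.tangSq (m + 1) i q := fun i q =>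
    add_nonneg (Finset.sum_nonneg fun _ _ => sq_nonneg _) (Finset.sum_nonneg fun _ _ => sq_nonneg _)
  obtain ⟨CN, hCN, hN⟩ := exists_uniform (words m) (P := fun w C => ∀ i, ∀ q ∈ F.S i,
    ‖q.2‖ = 1 → q.1.2 = b →
    -C * (F.normalSq i q + F.tangSq (m + 1) i q) ≤ F.flux i (Dw T b w (F.v i)) 1 q)
    (fun w x y hxy hx i q hq hu hz => (mul_le_mul_of_nonneg_right (neg_le_neg hxy) (hpos i q)).trans
      (hx i q hq hu hz)) fun w hw => F.flux_abs (mem_words.1 hw)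
  set N : ℝ := ((words m).card : ℝ) with hNdef
  have hN0 : 0 ≤ N := Nat.cast_nonneg _
  set M : ℝ := 1 + CN * N / cT with hMdef
  have hM1 : 1 ≤ M := le_add_of_nonneg_right (by positivity)
  set K : ℝ := M * CT + CN with hK
  set lam : ℝ := 1 + (C + N * C * M * CL + 2) / c + N * K + N * C * M * CL + 2 with hlamdef
  have hlam : 0 ≤ lam := by positivity
  have hlamc : C + N * C * M * CL + 2 ≤ lam * c := by
    have h1 : (C + N * C * M * CL + 2) / c ≤ lam := by
      rw [hlamdef]
      have : 0 ≤ N * K := by positivity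
      have : 0 ≤ N * C * M * CL := by positivity
      linarith
    rwa [div_le_iff₀ hc] at h1
  have hlam1 : N * C * M * CL + 2 ≤ lam - 1 := by
    have : 0 ≤ (C + N * C * M * CL + 2) / c := by positivity
    have : 0 ≤ N * K := by positivity
    rw [hlamdef]; linarith
  obtain ⟨CI, hCI, hI⟩ := exists_uniform (words m) (P := fun w C => ∀ i s, 0 < s →
      F.init s lam i (F.flux i (Dw T b w (F.v i)) 0) ≤ C * F.A i ^ 2)
    (fun w x y hxy hx i s hs => (hx i s hs).trans (mul_le_mul_of_nonneg_right hxy (sq_nonneg _)))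
    fun w hw => F.flux_init w (mem_words.1 hw) hlam
  obtain ⟨CY, hCY, hY⟩ := exists_uniform ((words (m + 1)).filter fun w => 1 ∉ w)
    (P := fun w C => ∀ i s, 0 < s → F.wint (stripMeasure 0 T) (fun p => ((p.1, b), p.2)) s lam i
        (fun q => Dw T b w (F.v i) q ^ 2) ≤ C * F.A i ^ 2)
    (fun w x y hxy hx i s hs => (hx i s hs).trans (mul_le_mul_of_nonneg_right hxy (sq_nonneg _)))
    fun w hw => F.wint_bdry_le (Finset.mem_filter.1 hw).2
      (by have := mem_words.1 (Finset.mem_filter.1 hw).1; omega) hlam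
  set N' : ℝ := (((words (m + 1)).filter fun w : List (Fin 5) => 1 ∉ w).card : ℝ) with hN'def
  have hN'0 : 0 ≤ N' := Nat.cast_nonneg _
  refine ⟨lam, hlam, (N * K + 1) * (N' * CY) + N * M * CI, by positivity, fun i s hs => ?_⟩
  have cv : ContinuousOn (fun q => F.v i q ^ 2) (F.S i) := (F.v_smooth i).continuousOn.pow 2
  have cg := F.gradSq_continuousOn i
  have ct := F.tangSq_continuousOn (n := m + 1) (by omega) i
  have cn := F.normalSq_continuousOn i
  have cD : ∀ {w : List (Fin 5)}, w.length ≤ m + 1 →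
      ContinuousOn (fun q => Dw T b w (F.v i) q ^ 2) (F.S i) := fun hw =>
    (F.continuousOn_Dw (by omega) i).pow 2
  have u2 : ∀ w ∈ words m, ContDiffOn ℝ (2 : ℕ) (Dw T b w (F.v i)) (F.S i) := fun w hw =>
    F.v_smooth_Dw (by have := mem_words.1 hw; omega) i
  set Z := F.bulk s lam i (fun q => F.v i q ^ 2) with hZ
  set Et := F.bulk s lam i (F.gradSq i) with hEt
  have hZE : F.bulk s lam i (fun q => F.v i q ^ 2 + F.gradSq i q) = Z + Et :=
    F.isChart_bulk.add hs lam cv cg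
  have hZ0 : 0 ≤ Z := F.wint_nonneg (μ := slabMeasure T b) (j := inj) lam fun q => sq_nonneg _
  have hEt0 : 0 ≤ Et := F.wint_nonneg (μ := slabMeasure T b) (j := inj) lam fun q =>
    Finset.sum_nonneg fun _ _ => Finset.sum_nonneg fun _ _ => sq_nonneg _
  set Ew : List (Fin 5) → ℝ := fun w =>
    F.bulk s lam i (fun q => ∑ k, D T b k (Dw T b w (F.v i)) q ^ 2) with hEw
  have hEsum : Et = ∑ w ∈ words m, Ew w :=
    F.isChart_bulk.sum hs lam _ fun w hw => F.sumSq_continuousOn (mem_words.1 hw) i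
  have hEw0 : ∀ w, 0 ≤ Ew w := fun w => F.wint_nonneg (μ := slabMeasure T b) (j := inj) lam
    (f := fun q => ∑ k, D T b k (Dw T b w (F.v i)) q ^ 2) fun q =>
      Finset.sum_nonneg fun _ _ => sq_nonneg _
  set Xt := F.bdry s lam i (F.normalSq i) with hXt
  set Yt := F.bdry s lam i (F.tangSq (m + 1) i) with hYt
  have hX0 : 0 ≤ Xt := F.wint_nonneg (μ := stripMeasure 0 T) (j := fun p => ((p.1, b), p.2)) lam
    fun q => Finset.sum_nonneg fun _ _ => sq_nonneg _
  have hY0 : 0 ≤ Yt := F.wint_nonneg (μ := stripMeasure 0 T) (j := fun p => ((p.1, b), p.2)) lam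
    fun q => Finset.sum_nonneg fun _ _ => sq_nonneg _
  set Bw : List (Fin 5) → ℝ := fun w => F.bdry s lam i (fun q => Dw T b (1 :: w) (F.v i) q ^ 2)
  have hXsum : Xt = ∑ w ∈ (words m).filter (fun w => 1 ∉ w), Bw w :=
    F.isChart_bdry.sum hs lam _ fun w hw => cD
      (by have := mem_words.1 (Finset.mem_filter.1 hw).1; simpa using this)
  have hYle : Yt ≤ N' * CY * F.A i ^ 2 := by
    have h1 : Yt = ∑ w ∈ (words (m + 1)).filter (fun w => 1 ∉ w),
        F.bdry s lam i (fun q => Dw T b w (F.v i) q ^ 2) :=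
      F.isChart_bdry.sum hs lam _ fun w hw => cD (mem_words.1 (Finset.mem_filter.1 hw).1)
    rw [h1, mul_assoc]
    exact sum_le_card _ fun w hw => hY w hw i s hs
  have hLw : ∀ w ∈ words m, F.bulk s lam i (fun q => F.L i (Dw T b w (F.v i)) q ^ 2) ≤
      CL * (Z + Et) := by
    intro w hw
    rw [← hZE]
    rw [← bulk_const_mul]
    exact F.isChart_bulk.mono hs lam ((F.L_continuousOn (u2 w hw)).pow 2)
      (continuousOn_const.mul (cv.add cg)) fun q hq hqE => hL w hw i q hq hqE.2
  have cf : ∀ w ∈ words m, ContinuousOn (F.flux i (Dw T b w (F.v i)) 1) (F.S i) := fun w hw =>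
    (F.flux_contDiffOn (u2 w hw) 1).continuousOn
  have hfl1 : ∀ w ∈ words m, -CN * (Xt + Yt) ≤ F.bdry s lam i (F.flux i (Dw T b w (F.v i)) 1) := by
    intro w hw
    have h1 : Xt + Yt = F.bdry s lam i (fun q => F.normalSq i q + F.tangSq (m + 1) i q) :=
      (F.isChart_bdry.add hs lam cn ct).symm
    rw [h1]
    rw [← bdry_const_mul]
    exact F.isChart_bdry.mono hs lam (continuousOn_const.mul (cn.add ct)) (cf w hw)
      fun q hq hqE => hN w hw i q hq hqE.1.2 hqE.2
  have hfl2 : ∀ w ∈ words m, 1 ∉ w → cT * Bw w + -CT * Yt ≤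
      F.bdry s lam i (F.flux i (Dw T b w (F.v i)) 1) := by
    intro w hw h1w
    have hwl := mem_words.1 hw
    have c1 := cD (w := 1 :: w) (by simpa using hwl)
    have h1 : cT * Bw w + -CT * Yt = F.bdry s lam i
        (fun q => cT * Dw T b (1 :: w) (F.v i) q ^ 2 + -CT * F.tangSq (m + 1) i q) := by
      refine Eq.trans ?_ (F.isChart_bdry.add hs lam (i := i)
        (f := fun q => cT * Dw T b (1 :: w) (F.v i) q ^ 2)
        (g := fun q => -CT * F.tangSq (m + 1) i q) (continuousOn_const.mul c1)
        (continuousOn_const.mul ct)).symm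
      exact (congrArg₂ (· + ·) (F.bdry_const_mul _ _) (F.bdry_const_mul _ _)).symm
    rw [h1]
    exact F.isChart_bdry.mono hs lam ((continuousOn_const.mul c1).add (continuousOn_const.mul ct))
      (cf w hw) fun q hq hqE => hT' w h1w hwl i q hq hqE.1.2 hqE.2
  have hlc0 : 0 ≤ lam * c - C := by
    have : 0 ≤ N * C * M * CL := by positivity
    linarith
  -- the inequality for one word
  have hone : ∀ w ∈ words m, (lam * c - C) * Ew w + (if 1 ∉ w then M * cT * Bw w else 0) -
      CN * Xt - K * Yt ≤ C * M * CL * (Z + Et) + M * CI * F.A i ^ 2 := by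
    intro w hw
    have h1 := hE i s lam _ hs hlam (u2 w hw)
    have h2 := mul_le_mul_of_nonneg_left (hLw w hw) hC
    have h3 := hI w hw i s hs
    have h4 : 0 ≤ C * CL * (Z + Et) + CI * F.A i ^ 2 := by positivity
    have h5 : 0 ≤ (lam * c - C) * Ew w := mul_nonneg hlc0 (hEw0 w)
    change (lam * c - C) * Ew w + _ ≤ _ at h1
    by_cases h1w : 1 ∉ w
    · have h6 := hfl2 w hw h1w
      rw [if_pos h1w, hK]
      have h7 : (lam * c - C) * Ew w + cT * Bw w - CT * Yt ≤
          C * CL * (Z + Et) + CI * F.A i ^ 2 := by linarith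
      have h8 := mul_le_mul_of_nonneg_left h7 (zero_le_one.trans hM1)
      have h9 := mul_le_mul_of_nonneg_right hM1 h5
      have h10 : 0 ≤ CN * Xt := by positivity
      have h11 : 0 ≤ CN * Yt := by positivity
      linarith
    · have h6 := hfl1 w hw
      rw [if_neg h1w, hK]
      have h9 := mul_le_mul_of_nonneg_right hM1 h4
      have h10 : 0 ≤ M * CT * Yt := by positivity
      linarith
  have hsum := Finset.sum_le_sum hone
  simp only [Finset.sum_sub_distrib, Finset.sum_add_distrib, Finset.sum_const, nsmul_eq_mul,
    ← Finset.mul_sum, ← hEsum, ← hNdef] at hsum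
  rw [← Finset.sum_filter, ← Finset.mul_sum, ← hXsum] at hsum
  have hXX : N * (CN * Xt) ≤ M * cT * Xt := by
    have : M * cT = cT + CN * N := by rw [hMdef]; field_simp
    rw [this]
    have := mul_nonneg hcT.le hX0
    linarith
  have hzero := F.zero_order_ineq i hs (lam := lam) (u := F.v i)
    ((F.v_smooth i).of_le (by exact_mod_cast (by omega)))
  have hz1 : F.bulk s lam i (fun q => D T b 1 (F.v i) q ^ 2) ≤ Et := by
    refine F.isChart_bulk.mono hs lam (cD (w := [1]) (by simp)) cg fun q hq hqE => ?_
    exact F.D_one_sq_le_gradSq i q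
  have hz2 : F.bdry s lam i (fun q => F.v i q ^ 2) ≤ Yt :=
    F.isChart_bdry.mono hs lam cv ct fun q hq hqE => F.le_tangSq (w := []) (by simp) (by simp) i q
  rw [hZE]
  rw [← hZ] at hzero
  have f1 : (C + N * C * M * CL + 2 - C) * Et ≤ (lam * c - C) * Et :=
    mul_le_mul_of_nonneg_right (by linarith) hEt0
  have f2 : (N * C * M * CL + 2) * Z ≤ (lam - 1) * Z := mul_le_mul_of_nonneg_right hlam1 hZ0
  have f3 : (N * K + 1) * Yt ≤ (N * K + 1) * (N' * CY * F.A i ^ 2) :=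
    mul_le_mul_of_nonneg_left hYle (by positivity)
  have f4 : 0 ≤ Z + Et := add_nonneg hZ0 hEt0
  clear_value Z Et Xt Yt N M K lam N'
  linarith

/-- The energy estimate. -/
theorem lintegral_le {w : List (Fin 5)} (hw : w.length ≤ m + 1) : ∃ C : ℝ, 0 ≤ C ∧ ∀ i,
    ∫⁻ p in {p | 0 < F.ρ i (inj p)}, ENNReal.ofReal (Dw T b w (F.v i) (inj p) ^ 2) ∂slabMeasure T b ≤
      ENNReal.ofReal (C * F.A i ^ 2) := by
  obtain ⟨lam, hlam, C, hC, h⟩ := F.energy_estimate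
  set e := Real.exp (lam * (F.mulC * T)) with he
  have he0 : 0 < e := Real.exp_pos _
  refine ⟨e * C, by positivity, fun i => ?_⟩
  have hcont := F.continuousOn_Dw (w := w) (by omega) i
  have hstep : ∀ s, 0 < s → ∫⁻ p in {p | 2 * s < F.ρ i (inj p)},
      ENNReal.ofReal (Dw T b w (F.v i) (inj p) ^ 2) ∂slabMeasure T b ≤
      ENNReal.ofReal (e * C * F.A i ^ 2) := by
    intro s hs
    have h1 : F.wint (slabMeasure T b) inj s lam i (fun q => Dw T b w (F.v i) q ^ 2) ≤
        C * F.A i ^ 2 := (F.isChart_bulk.mono hs lam (hcont.pow 2)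
      (((F.v_smooth i).continuousOn.pow 2).add (F.gradSq_continuousOn i))
      fun q _ _ => F.le_gradSq hw i q).trans (h i s hs)
    have h2 := ENNReal.ofReal_le_ofReal h1
    rw [wint, ofReal_integral_eq_lintegral_ofReal
      (F.isChart_bulk.integrable i (f := fun q => Dw T b w (F.v i) q ^ 2) hs (hcont.pow 2))
      (ae_of_all _ fun p => mul_nonneg (F.wgt_nonneg s lam i _) (sq_nonneg _))] at h2
    rw [mul_assoc, ENNReal.ofReal_mul he0.le]
    refine le_trans ?_ (mul_le_mul_right h2 _)
    rw [← lintegral_const_mul' _ _ ENNReal.ofReal_ne_top]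
    refine le_trans ?_ (setLIntegral_le_lintegral {p | 2 * s < F.ρ i (inj p)} _)
    refine lintegral_mono_ae ?_
    have hmeas : NullMeasurableSet {p | 2 * s < F.ρ i (inj p)} (slabMeasure T b) := by
      have hcρ : AEMeasurable (fun p => F.ρ i (inj p)) (slabMeasure T b) :=
        (integrable_slab (ContinuousOn.comp_inj (F.ρ_smooth i).continuousOn)).aestronglyMeasurable.aemeasurable
      exact nullMeasurableSet_lt aemeasurable_const hcρ
    filter_upwards [ae_restrict_mem₀ hmeas, ae_restrict_of_ae (ae_slab (T := T) (b := b))]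
      with p hp hpt
    rw [← ENNReal.ofReal_mul he0.le]
    refine ENNReal.ofReal_le_ofReal ?_
    rw [F.wgt_eq_exp hs lam (le_of_lt hp), ← mul_assoc]
    refine le_mul_of_one_le_left (sq_nonneg _) ?_
    rw [he, expWeight, ← Real.exp_add]
    refine Real.one_le_exp ?_
    rw [← mul_add]
    refine mul_nonneg hlam ?_
    have h3 := mul_le_mul_of_nonneg_left hpt.1.2.le (mulC_nonneg (F := F))
    have h4 := hpt.2.1.le
    change 0 ≤ F.mulC * T + (p.1.2 - F.mulC * p.1.1)
    linarith
  have hU : {p | 0 < F.ρ i (inj p)} = ⋃ n : ℕ, {p | 2 * (1 / ((n : ℝ) + 1)) < F.ρ i (inj p)} := by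
    ext p
    simp only [mem_ofPred_eq, mem_iUnion]
    constructor
    · intro hp
      obtain ⟨n, hn⟩ := exists_nat_one_div_lt (half_pos hp)
      exact ⟨n, by linarith⟩
    · rintro ⟨n, hn⟩
      exact lt_trans (by positivity) hn
  rw [hU, setLIntegral_iUnion_of_directed]
  · exact iSup_le fun n => hstep _ (by positivity)
  · refine Monotone.directed_le fun n k hnk p hp => ?_
    simp only [mem_ofPred_eq] at hp ⊢
    refine lt_of_le_of_lt ?_ hp
    gcongr

end WaveFamily

end

section

variable {T b : ℝ} [hT : Fact (0 < T)] [hb : Fact (0 < b)]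

/-! ### Homogeneous functions -/

/-- `S` is a cone, on which `f` is homogeneous of degree `0` in the second variable. -/
def Homog (S : Set Spacetime) (f : Spacetime → ℝ) : Prop :=
  ∀ q ∈ S, ∀ t : ℝ, 0 < t → (q.1, t • q.2) ∈ S ∧ f (q.1, t • q.2) = f q

/-- Scaling of the second variable. -/
def scale (t : ℝ) : Spacetime →L[ℝ] Spacetime :=
  (ContinuousLinearMap.id ℝ (ℝ × ℝ)).prodMap (t • ContinuousLinearMap.id ℝ E3)

lemma scale_apply (t : ℝ) (q : Spacetime) : scale t q = (q.1, t • q.2) := rfl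

lemma frame_scale (t : ℝ) (i : Fin 5) (q : Spacetime) : frame i (scale t q) = scale t (frame i q) := by
  simp only [frame_eq, scale_apply]
  fin_cases i <;> simp

variable {S : Set Spacetime} {f : Spacetime → ℝ}

lemma Homog.D (h : Homog S f) (hS : RelOpen T b S) (hf : ContDiffOn ℝ (1 : ℕ) f S) (i : Fin 5) :
    Homog S (D T b i f) := by
  intro q hq t ht
  have hm : MapsTo (scale t) S S := fun q hq => (h q hq t ht).1
  refine ⟨hm hq, ?_⟩
  have h1 : fderivWithin ℝ (f ∘ scale t) S q = (fderivWithin ℝ f S (scale t q)).comp (scale t) := by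
    rw [fderivWithin_comp q (hf.differentiableOn one_ne_zero _ (hm hq))
      (scale t).differentiableWithinAt hm (hS.uniqueDiffOn q hq),
      (scale t).fderivWithin (hS.uniqueDiffOn q hq)]
  have h2 : fderivWithin ℝ (f ∘ scale t) S q = fderivWithin ℝ f S q :=
    fderivWithin_congr (fun q hq => (h q hq t ht).2) (h q hq t ht).2
  unfold NullTimelike.D
  change fderivWithin ℝ f (slabCone T b) (scale t q) (frame i (scale t q)) = _
  rw [← hS.fderivWithin_eq (hm hq), ← hS.fderivWithin_eq hq, ← h2, h1, frame_scale]
  rfl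

/-- Euler's identity. -/
lemma Homog.fderivWithin_radial (h : Homog S f) (hf : DifferentiableOn ℝ f S) {q : Spacetime}
    (hq : q ∈ S) : fderivWithin ℝ f S q (0, q.2) = 0 := by
  let γ : ℝ → Spacetime := fun t => (q.1, t • q.2)
  have hγ1 : γ 1 = q := by simp [γ]
  have hγ : HasDerivWithinAt γ (0, q.2) (Ioi 0) 1 := by
    have := ((hasDerivAt_const (1 : ℝ) q.1).prodMk ((hasDerivAt_id (1 : ℝ)).smul_const q.2))
    simpa using this.hasDerivWithinAt (s := Ioi (0 : ℝ))
  have hf' : HasFDerivWithinAt f (fderivWithin ℝ f S q) S (γ 1) := by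
    rw [hγ1]; exact (hf q hq).hasFDerivWithinAt
  have h1 := hf'.comp_hasDerivWithinAt (1 : ℝ) hγ fun t ht => (h q hq t ht).1
  have h2 : HasDerivWithinAt (f ∘ γ) 0 (Ioi 0) 1 :=
    (hasDerivWithinAt_const (1 : ℝ) _ (f q)).congr (fun t ht => (h q hq t ht).2) (by simp [hγ1])
  exact UniqueDiffWithinAt.eq_deriv _ (isOpen_Ioi.uniqueDiffWithinAt (mem_Ioi.2 zero_lt_one)) h1 h2

lemma sum_inner_rotField (y ξ : E3) :
    ∑ k, inner ℝ (rotField k y) ξ • rotField k y + inner ℝ y ξ • y = (‖y‖ ^ 2) • ξ := by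
  rw [← real_inner_self_eq_norm_sq]
  ext m
  simp only [Fin.sum_univ_three, rotField_coord, PiLp.inner_apply, PiLp.add_apply, PiLp.smul_apply,
    smul_eq_mul]
  fin_cases m <;> simp <;> ring

/-- The coframe. -/
def coframe : Fin 5 → Spacetime → Spacetime →L[ℝ] ℝ :=
  ![fun _ => (ContinuousLinearMap.fst ℝ ℝ ℝ).comp (ContinuousLinearMap.fst ℝ (ℝ × ℝ) E3),
    fun _ => (ContinuousLinearMap.snd ℝ ℝ ℝ).comp (ContinuousLinearMap.fst ℝ (ℝ × ℝ) E3),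
    fun q => (‖q.2‖ ^ 2)⁻¹ • (innerSL ℝ (rotField 0 q.2)).comp (ContinuousLinearMap.snd ℝ (ℝ × ℝ) E3),
    fun q => (‖q.2‖ ^ 2)⁻¹ • (innerSL ℝ (rotField 1 q.2)).comp (ContinuousLinearMap.snd ℝ (ℝ × ℝ) E3),
    fun q => (‖q.2‖ ^ 2)⁻¹ • (innerSL ℝ (rotField 2 q.2)).comp (ContinuousLinearMap.snd ℝ (ℝ × ℝ) E3)]

lemma contDiffOn_coframe (i : Fin 5) {n : WithTop ℕ∞} :
    ContDiffOn ℝ n (coframe i) (slabCone T b) := by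
  have h : ∀ k : Fin 3, ContDiffOn ℝ n (fun q : Spacetime => (‖q.2‖ ^ 2)⁻¹ •
      (innerSL ℝ (rotField k q.2)).comp (ContinuousLinearMap.snd ℝ (ℝ × ℝ) E3)) (slabCone T b) := by
    intro k
    have h1 : ContDiffOn ℝ n (fun q : Spacetime => ‖q.2‖ ^ 2) (slabCone T b) :=
      ((contDiff_norm_sq ℝ).comp contDiff_snd).contDiffOn
    refine ContDiffOn.smul (h1.inv fun q hq => ?_) ?_
    · have : q.2 ≠ 0 := hq.2.2
      positivity
    · refine ContDiff.contDiffOn ?_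
      exact ContDiff.clm_comp ((innerSL ℝ).contDiff.comp ((rotField k).contDiff.comp contDiff_snd))
        contDiff_const
  fin_cases i
  exacts [contDiffOn_const, contDiffOn_const, h 0, h 1, h 2]

lemma eq_sum_coframe {q : Spacetime} (hq : q.2 ≠ 0) {L : Spacetime →L[ℝ] ℝ} (hL : L (0, q.2) = 0) :
    L = ∑ i, L (frame i q) • coframe i q := by
  have hn : ‖q.2‖ ^ 2 ≠ 0 := by positivity
  refine ContinuousLinearMap.ext fun ⟨⟨a, c⟩, ξ⟩ => ?_
  have h1 : ((a, c), ξ) = a • frame 0 q + c • frame 1 q +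
      (‖q.2‖ ^ 2)⁻¹ • (∑ k : Fin 3, inner ℝ (rotField k q.2) ξ • frame k.succ.succ q +
        inner ℝ q.2 ξ • (0, q.2)) := by
    have h2 := sum_inner_rotField q.2 ξ
    have h3 : ∑ k : Fin 3, inner ℝ (rotField k q.2) ξ • frame k.succ.succ q +
        inner ℝ q.2 ξ • ((0, q.2) : Spacetime) = (0, (‖q.2‖ ^ 2) • ξ) := by
      rw [← h2]
      refine Prod.ext ?_ ?_
      · simp [frame_rot, Prod.fst_sum]
      · simp [frame_rot, Prod.snd_sum]
    rw [h3, frame_zero, frame_one]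
    simp [smul_smul, inv_mul_cancel₀ hn]
  have h4 : ∀ k : Fin 3, coframe k.succ.succ q ((a, c), ξ) =
      (‖q.2‖ ^ 2)⁻¹ * inner ℝ (rotField k q.2) ξ := by
    intro k; fin_cases k <;> rfl
  have h5 : coframe 0 q ((a, c), ξ) = a := rfl
  have h6 : coframe 1 q ((a, c), ξ) = c := rfl
  conv_lhs => rw [h1]
  have h7 : ∀ F : Fin 5 → ℝ, ∑ i, F i = F 0 + F 1 + ∑ k : Fin 3, F k.succ.succ := fun F => by
    rw [Fin.sum_univ_succ, Fin.sum_univ_succ, ← add_assoc]; rfl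
  simp only [sum_apply, smul_apply, smul_eq_mul, map_add, map_smul, map_sum, hL]
  rw [h7, h5, h6, mul_zero, add_zero, Finset.mul_sum, mul_comm a, mul_comm c]
  congr 1
  refine Finset.sum_congr rfl fun k _ => ?_
  rw [h4]; ring

/-! ### Derivatives along the frame and iterated derivatives -/

variable (T b) in
/-- The slab. -/
def unitSlab : Set Spacetime := {q | q ∈ slabCone T b ∧ ‖q.2‖ = 1}

lemma isCompact_unitSlab : IsCompact (unitSlab T b) := by
  have : unitSlab T b = (Icc 0 T ×ˢ Icc 0 b) ×ˢ Metric.sphere (0 : E3) 1 := by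
    ext q
    simp only [unitSlab, slabCone, mem_ofPred_eq, mem_prod, mem_sphere_zero_iff_norm]
    constructor
    · rintro ⟨⟨h1, h2, -⟩, h3⟩; exact ⟨⟨h1, h2⟩, h3⟩
    · rintro ⟨⟨h1, h2⟩, h3⟩
      exact ⟨⟨h1, h2, by rw [← norm_ne_zero_iff, h3]; norm_num⟩, h3⟩
  rw [this]
  exact (isCompact_Icc.prod isCompact_Icc).prod (isCompact_sphere _ _)

lemma exists_bound_iteratedFDerivWithin {W : Type*} [NormedAddCommGroup W] [NormedSpace ℝ W]
    {F : Spacetime → W} {n : ℕ} (hF : ContDiffOn ℝ n F (slabCone T b)) :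
    ∃ C : ℝ, 0 ≤ C ∧ ∀ j ≤ n, ∀ q ∈ unitSlab T b,
      ‖iteratedFDerivWithin ℝ j F (slabCone T b) q‖ ≤ C := by
  have h : ∀ j ∈ Finset.range (n + 1), ∃ C : ℝ, 0 ≤ C ∧ ∀ q ∈ unitSlab T b,
      ‖iteratedFDerivWithin ℝ j F (slabCone T b) q‖ ≤ C := by
    intro j hj
    have hc : ContinuousOn (iteratedFDerivWithin ℝ j F (slabCone T b)) (unitSlab T b) :=
      (hF.continuousOn_iteratedFDerivWithin (by exact_mod_cast Finset.mem_range_succ_iff.1 hj)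
        uniqueDiffOn_slabCone).mono fun q hq => hq.1
    obtain ⟨C, hC⟩ := isCompact_unitSlab.exists_bound_of_continuousOn hc
    exact ⟨max C 0, le_max_right _ _, fun q hq => (hC q hq).trans (le_max_left _ _)⟩
  obtain ⟨C, hC, h'⟩ := WaveFamily.exists_uniform _
    (fun j x y hxy hx q hq => (hx q hq).trans hxy) h
  exact ⟨C, hC, fun j hj => h' j (Finset.mem_range_succ_iff.2 hj)⟩

lemma RelOpen.iteratedFDerivWithin_eq {W : Type*} [NormedAddCommGroup W] [NormedSpace ℝ W]
    (hS : RelOpen T b S) {q : Spacetime} (hq : q ∈ S) (F : Spacetime → W) (j : ℕ) :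
    iteratedFDerivWithin ℝ j F S q = iteratedFDerivWithin ℝ j F (slabCone T b) q := by
  obtain ⟨O, hO, rfl⟩ := hS
  exact iteratedFDerivWithin_inter_open hO hq.2

/-- Derivatives along the frame are controlled by iterated derivatives. -/
lemma abs_Dw_le (w : List (Fin 5)) : ∃ C : ℝ, 0 ≤ C ∧ ∀ (S : Set Spacetime) (f : Spacetime → ℝ),
    RelOpen T b S → ContDiffOn ℝ w.length f S → ∀ q ∈ S, ‖q.2‖ = 1 →
    |Dw T b w f q| ≤ C * ∑ j ∈ Finset.range (w.length + 1), ‖iteratedFDerivWithin ℝ j f S q‖ := by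
  induction w using List.reverseRecOn with
  | nil => exact ⟨1, zero_le_one, fun S f _ _ q _ _ => by simp⟩
  | append_singleton w i ih =>
    obtain ⟨C, hC, ih⟩ := ih
    obtain ⟨C', hC', hfr⟩ := exists_bound_iteratedFDerivWithin (T := T) (b := b) (n := w.length)
      (contDiff_frame i).contDiffOn
    set N := w.length
    refine ⟨C * ((N + 1 : ℕ) * (2 ^ N * C')), by positivity, fun S f hS hf q hq hu => ?_⟩
    rw [Dw_append]
    simp only [List.length_append, List.length_singleton] at hf ⊢
    refine (ih S _ hS (contDiffOn_D hS hf i) q hq hu).trans ?_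
    rw [mul_assoc]
    refine mul_le_mul_of_nonneg_left ?_ hC
    set J₀ := ∑ j ∈ Finset.range (N + 1 + 1), ‖iteratedFDerivWithin ℝ j f S q‖ with hJ
    have hJ0 : 0 ≤ J₀ := Finset.sum_nonneg fun _ _ => norm_nonneg _
    have hle : ∀ j ∈ Finset.range (N + 1),
        ‖iteratedFDerivWithin ℝ j (D T b i f) S q‖ ≤ 2 ^ N * C' * J₀ := by
      intro j hj
      have hj' := Finset.mem_range_succ_iff.1 hj
      have e1 : EqOn (D T b i f) (fun q => fderivWithin ℝ f S q (frame i q)) S := fun q hq => by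
        simp only [D, hS.fderivWithin_eq hq]
      rw [iteratedFDerivWithin_congr e1 hq]
      have hfd : ContDiffOn ℝ N (fderivWithin ℝ f S) S :=
        hf.fderivWithin hS.uniqueDiffOn (by exact_mod_cast le_rfl)
      refine (norm_iteratedFDerivWithin_clm_apply hfd (contDiff_frame i).contDiffOn hS.uniqueDiffOn hq
        (n := j) (by exact_mod_cast hj')).trans ?_
      have e2 : ∀ a ∈ Finset.range (j + 1), (j.choose a : ℝ) *
          ‖iteratedFDerivWithin ℝ a (fderivWithin ℝ f S) S q‖ *
            ‖iteratedFDerivWithin ℝ (j - a) (frame i) S q‖ ≤ (j.choose a : ℝ) * (C' * J₀) := by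
        intro a ha
        rw [mul_assoc]
        refine mul_le_mul_of_nonneg_left ?_ (by positivity)
        rw [norm_iteratedFDerivWithin_fderivWithin hS.uniqueDiffOn hq, mul_comm,
          hS.iteratedFDerivWithin_eq hq (frame i)]
        refine mul_le_mul (hfr _ (by omega) q ⟨hS.subset hq, hu⟩) ?_ (norm_nonneg _) hC'
        exact Finset.single_le_sum (f := fun j => ‖iteratedFDerivWithin ℝ j f S q‖)
          (fun _ _ => norm_nonneg _) (by have := Finset.mem_range_succ_iff.1 ha; simp; omega)
      refine (Finset.sum_le_sum e2).trans ?_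
      rw [← Finset.sum_mul, mul_assoc]
      refine mul_le_mul_of_nonneg_right ?_ (by positivity)
      have := Nat.sum_range_choose j
      calc (∑ a ∈ Finset.range (j + 1), (j.choose a : ℝ)) = 2 ^ j := by exact_mod_cast this
        _ ≤ 2 ^ N := pow_le_pow_right₀ (by norm_num) hj'
    have := WaveFamily.sum_le_card _ hle
    rw [Finset.card_range] at this
    rw [mul_assoc]
    exact this

/-- Iterated derivatives of homogeneous functions are controlled by derivatives along the frame. -/
lemma norm_iteratedFDerivWithin_le (n : ℕ) : ∃ C : ℝ, 0 ≤ C ∧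
    ∀ (S : Set Spacetime) (f : Spacetime → ℝ), RelOpen T b S → ContDiffOn ℝ n f S → Homog S f →
    ∀ q ∈ S, ‖q.2‖ = 1 →
    ‖iteratedFDerivWithin ℝ n f S q‖ ≤ C * ∑ w ∈ words n, |Dw T b w f q| := by
  induction n using Nat.strong_induction_on with
  | _ n ih =>
  cases n with
  | zero => exact ⟨1, zero_le_one, fun S f _ _ _ q _ _ => by simp [words]⟩
  | succ n =>
    obtain ⟨C, hC, ih⟩ := WaveFamily.exists_uniform (Finset.range (n + 1))
      (P := fun j C => ∀ (S : Set Spacetime) (f : Spacetime → ℝ), RelOpen T b S →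
        ContDiffOn ℝ j f S → Homog S f → ∀ q ∈ S, ‖q.2‖ = 1 →
        ‖iteratedFDerivWithin ℝ j f S q‖ ≤ C * ∑ w ∈ words j, |Dw T b w f q|)
      (fun j x y hxy hx S f hS hf hh q hq hu => (hx S f hS hf hh q hq hu).trans
        (mul_le_mul_of_nonneg_right hxy (Finset.sum_nonneg fun _ _ => abs_nonneg _)))
      fun j hj => ih j (Finset.mem_range.1 hj)
    obtain ⟨C', hC', hco⟩ := WaveFamily.exists_uniform (Finset.univ : Finset (Fin 5))
      (P := fun i C => ∀ j ≤ n, ∀ q ∈ unitSlab T b,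
        ‖iteratedFDerivWithin ℝ j (coframe i) (slabCone T b) q‖ ≤ C)
      (fun i x y hxy hx j hj q hq => (hx j hj q hq).trans hxy)
      fun i _ => exists_bound_iteratedFDerivWithin (contDiffOn_coframe i)
    refine ⟨5 * (2 ^ n * (C * (words n).card * C')), by positivity,
      fun S f hS hf hh q hq hu => ?_⟩
    set J₀ := ∑ w ∈ words (n + 1), |Dw T b w f q| with hJ
    have hJ0 : 0 ≤ J₀ := Finset.sum_nonneg fun _ _ => abs_nonneg _
    have hdf : DifferentiableOn ℝ f S := hf.differentiableOn (by simp)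
    have e1 : EqOn (fderivWithin ℝ f S) (fun q => ∑ i, D T b i f q • coframe i q) S := by
      intro q hq
      simp only [D, ← hS.fderivWithin_eq hq]
      exact eq_sum_coframe (hS.subset hq).2.2 (hh.fderivWithin_radial hdf hq)
    have hDi : ∀ i, ContDiffOn ℝ n (D T b i f) S := fun i => contDiffOn_D hS hf i
    have hcoS : ∀ i, ContDiffOn ℝ n (coframe i) S := fun i =>
      (contDiffOn_coframe (T := T) (b := b) i).mono hS.subset
    have e3 : iteratedFDerivWithin ℝ n (fun q => ∑ i, D T b i f q • coframe i q) S q =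
        ∑ i, iteratedFDerivWithin ℝ n (fun q => D T b i f q • coframe i q) S q := by
      refine iteratedFDerivWithin_fun_sum_apply hS.uniqueDiffOn hq fun i _ => ?_
      exact ((hDi i).smul (hcoS i)) q hq
    rw [← norm_iteratedFDerivWithin_fderivWithin hS.uniqueDiffOn hq,
      iteratedFDerivWithin_congr e1 hq, e3]
    refine (norm_sum_le _ _).trans ?_
    have hi : ∀ i ∈ (Finset.univ : Finset (Fin 5)),
        ‖iteratedFDerivWithin ℝ n (fun q => D T b i f q • coframe i q) S q‖ ≤
          2 ^ n * (C * (words n).card * C') * J₀ := by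
      intro i _
      refine (norm_iteratedFDerivWithin_smul_le (hDi i) (hcoS i) hS.uniqueDiffOn hq
        (n := n) le_rfl).trans ?_
      have e2 : ∀ a ∈ Finset.range (n + 1), (n.choose a : ℝ) *
          ‖iteratedFDerivWithin ℝ a (D T b i f) S q‖ *
            ‖iteratedFDerivWithin ℝ (n - a) (coframe i) S q‖ ≤
          (n.choose a : ℝ) * (C * (words n).card * C' * J₀) := by
        intro a ha
        have ha' := Finset.mem_range_succ_iff.1 ha
        rw [mul_assoc]
        refine mul_le_mul_of_nonneg_left ?_ (by positivity)
        rw [hS.iteratedFDerivWithin_eq hq (coframe i)]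
        have h1 := ih a ha S (D T b i f) hS ((hDi i).of_le (by exact_mod_cast ha'))
          (hh.D hS (hf.of_le (by exact_mod_cast (by omega))) i) q hq hu
        have h2 : ∑ w ∈ words a, |Dw T b w (D T b i f) q| ≤ (words n).card * J₀ := by
          refine (Finset.sum_le_sum_of_subset_of_nonneg (t := words n) (fun w hw => mem_words.2
            ((mem_words.1 hw).trans ha')) fun _ _ _ => abs_nonneg _).trans ?_
          refine WaveFamily.sum_le_card _ fun w hw => ?_
          have : Dw T b w (D T b i f) q = Dw T b (w ++ [i]) f q := by rw [Dw_append]; rfl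
          rw [this]
          refine Finset.single_le_sum (f := fun w => |Dw T b w f q|) (fun _ _ => abs_nonneg _)
            (mem_words.2 ?_)
          have := mem_words.1 hw
          simp; omega
        calc _ ≤ (C * ((words n).card * J₀)) * C' :=
              mul_le_mul (h1.trans (mul_le_mul_of_nonneg_left h2 hC))
                (hco i (Finset.mem_univ i) _ (by omega) q ⟨hS.subset hq, hu⟩) (norm_nonneg _)
                (by positivity)
          _ = _ := by ring
      refine (Finset.sum_le_sum e2).trans (le_of_eq ?_)
      have := Nat.sum_range_choose n
      have h2 : (∑ a ∈ Finset.range (n + 1), (n.choose a : ℝ)) = 2 ^ n := by exact_mod_cast this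
      rw [← Finset.sum_mul, h2]
      ring
    have := WaveFamily.sum_le_card _ hi
    simpa [mul_assoc] using this

end

section

variable {T b : ℝ} [hT : Fact (0 < T)] [hb : Fact (0 < b)]

/-! ### Uniformly bounded families -/

lemma mem_unitSlab_ne {q : Spacetime} (h : ‖q.2‖ = 1) : q.2 ≠ 0 := by
  rw [← norm_ne_zero_iff, h]; exact one_ne_zero

lemma slabCone_mem_nhds {q : Spacetime} (h1 : q.1.1 ∈ Ioo 0 T) (h2 : q.1.2 ∈ Ioo 0 b)
    (h3 : q.2 ≠ 0) : slabCone T b ∈ 𝓝 q := by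
  rw [slabCone_eq]
  exact prod_mem_nhds (prod_mem_nhds (Icc_mem_nhds h1.1 h1.2) (Icc_mem_nhds h2.1 h2.2))
    (isOpen_compl_singleton.mem_nhds h3)

lemma ub_of_Dw {ι : Type*} {S : ι → Set Spacetime} {n : ℕ} {F : ι → Spacetime → ℝ}
    (hS : ∀ i, RelOpen T b (S i)) (hF : ∀ i, ContDiffOn ℝ n (F i) (S i))
    (h : ∀ w : List (Fin 5), w.length ≤ n → ∃ C : ℝ, 0 ≤ C ∧ ∀ i, ∀ q ∈ S i, ‖q.2‖ = 1 →
      |Dw T b w (F i) q| ≤ C) : UB T b S n F := by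
  have h0 : ∀ {F : ι → Spacetime → ℝ}, (∃ C : ℝ, 0 ≤ C ∧ ∀ i, ∀ q ∈ S i, ‖q.2‖ = 1 →
      |Dw T b [] (F i) q| ≤ C) → ∃ C : ℝ, 0 ≤ C ∧ ∀ i, ∀ q ∈ S i, ‖q.2‖ = 1 →
      |F i q| ≤ C * 1 := fun h => by simpa using h
  suffices H : ∀ p, Dom T b S (fun _ => 0) (fun _ _ _ => 1) n p F from H 0
  induction n generalizing F with
  | zero => exact fun p => ⟨hF, h0 (h [] (by simp))⟩
  | succ n ih =>
    refine fun p => ⟨⟨hF, h0 (h [] (by simp))⟩, fun k => ?_⟩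
    refine ih (fun i => contDiffOn_D (hS i) (hF i) k) (fun w hw => ?_) _
    have := h (w ++ [k]) (by simpa using hw)
    simpa [Dw_append] using this

/-- Bounds on the interior extend to the boundary. -/
lemma le_of_le_interior {f : Spacetime → ℝ} (hf : ContinuousOn f (slabCone T b)) {C : ℝ}
    (h : ∀ q : Spacetime, q.1.1 ∈ Ioo 0 T → q.1.2 ∈ Ioo 0 b → ‖q.2‖ = 1 → f q ≤ C) {q : Spacetime}
    (hq : q ∈ unitSlab T b) : f q ≤ C := by
  have hcl : q.1 ∈ closure (Ioo 0 T ×ˢ Ioo 0 b) := by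
    rw [closure_prod_eq, closure_Ioo hT.out.ne, closure_Ioo hb.out.ne]
    exact ⟨hq.1.1, hq.1.2.1⟩
  have hc : ContinuousWithinAt (fun p : ℝ × ℝ => f (p, q.2)) (Ioo 0 T ×ˢ Ioo 0 b) q.1 :=
    ContinuousWithinAt.comp (t := slabCone T b) (hf q hq.1) (by fun_prop) fun p hp =>
      ⟨Ioo_subset_Icc_self hp.1, Ioo_subset_Icc_self hp.2, hq.1.2.2⟩
  exact hc.closure_le hcl continuousWithinAt_const fun p hp => h (p, q.2) hp.1 hp.2 hq.2

lemma ub_of_iteratedFDeriv {ι : Type*} {n : ℕ} {F : ι → Spacetime → ℝ} {B : ℝ}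
    (hF : ∀ i, ContDiffOn ℝ n (F i) (slabCone T b))
    (h : ∀ i, ∀ j ≤ n, ∀ q : Spacetime, q.1.1 ∈ Ioo 0 T → q.1.2 ∈ Ioo 0 b → ‖q.2‖ = 1 →
      ‖iteratedFDeriv ℝ j (F i) q‖ ≤ B) : UB T b (fun _ => slabCone T b) n F := by
  refine ub_of_Dw (fun _ => relOpen_slabCone) hF fun w hw => ?_
  obtain ⟨C, hC, hw'⟩ := abs_Dw_le (T := T) (b := b) w
  refine ⟨C * ((w.length + 1 : ℕ) * |B|), by positivity, fun i q hq hu => ?_⟩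
  have hFw : ContDiffOn ℝ w.length (F i) (slabCone T b) := (hF i).of_le (by exact_mod_cast hw)
  have hc : ContinuousOn (fun q => |Dw T b w (F i) q|) (slabCone T b) :=
    (contDiffOn_Dw (n := 0) relOpen_slabCone w (by simpa using hFw)).continuousOn.abs
  refine le_of_le_interior hc (fun q h1 h2 h3 => ?_) ⟨hq, hu⟩
  have hq : q ∈ slabCone T b := ⟨Ioo_subset_Icc_self h1, Ioo_subset_Icc_self h2, mem_unitSlab_ne h3⟩
  refine (hw' _ _ relOpen_slabCone hFw q hq h3).trans (mul_le_mul_of_nonneg_left ?_ hC)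
  have hs : ∀ j ∈ Finset.range (w.length + 1), ‖iteratedFDerivWithin ℝ j (F i) (slabCone T b) q‖ ≤ |B| := ?_
  · have := WaveFamily.sum_le_card _ hs
    rwa [Finset.card_range] at this
  intro j hj
  have hn := slabCone_mem_nhds h1 h2 (mem_unitSlab_ne h3)
  rw [iteratedFDerivWithin_eq_iteratedFDeriv uniqueDiffOn_slabCone
    (((hF i).contDiffAt hn).of_le (by exact_mod_cast (Finset.mem_range_succ_iff.1 hj).trans hw)) hq]
  exact (h i j ((Finset.mem_range_succ_iff.1 hj).trans hw) q h1 h2 h3).trans (le_abs_self B)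

/-- A single smooth function. -/
lemma ub_of_contDiffOn {ι : Type*} {n : ℕ} {f : Spacetime → ℝ}
    (hf : ContDiffOn ℝ n f (slabCone T b)) :
    UB T b (fun _ : ι => slabCone T b) n fun _ => f := by
  refine ub_of_Dw (fun _ => relOpen_slabCone) (fun _ => hf) fun w hw => ?_
  have hc : ContinuousOn (Dw T b w f) (unitSlab T b) :=
    (contDiffOn_Dw (n := 0) relOpen_slabCone w
      (hf.of_le (by exact_mod_cast (by omega)))).continuousOn.mono fun q hq => hq.1
  obtain ⟨C, hC⟩ := isCompact_unitSlab.exists_bound_of_continuousOn hc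
  exact ⟨max C 0, le_max_right _ _, fun _ q hq hu => (hC q ⟨hq, hu⟩).trans (le_max_left _ _)⟩

/-! ### The radial projection -/

lemma norm_radial {P : Type*} {q : P × E3} (hq : q.2 ≠ 0) : ‖(radial q).2‖ = 1 := by
  simp [radial, norm_smul, hq]

lemma radial_eq {P : Type*} {q : P × E3} (hq : ‖q.2‖ = 1) : radial q = q := by
  simp [radial, hq]

lemma radial_smul {P : Type*} (q : P × E3) {t : ℝ} (ht : 0 < t) :
    radial (q.1, t • q.2) = radial q := by
  simp only [radial, norm_smul, Real.norm_of_nonneg ht.le, smul_smul]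
  congr 2
  field_simp

lemma radial_mem {q : Spacetime} (hq : q ∈ slabCone T b) : radial q ∈ unitSlab T b := by
  have := norm_radial hq.2.2
  exact ⟨⟨hq.1, hq.2.1, mem_unitSlab_ne this⟩, this⟩

lemma smul_mem_slabCone {q : Spacetime} (hq : q ∈ slabCone T b) {t : ℝ} (ht : 0 < t) :
    (q.1, t • q.2) ∈ slabCone T b := ⟨hq.1, hq.2.1, smul_ne_zero ht.ne' hq.2.2⟩

lemma homog_comp_radial (f : Spacetime → ℝ) : Homog (slabCone T b) (f ∘ radial) :=
  fun _ hq _ ht => ⟨smul_mem_slabCone hq ht, congrArg f (radial_smul _ ht)⟩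

lemma contDiffOn_radial {n : WithTop ℕ∞} :
    ContDiffOn ℝ n (radial : Spacetime → Spacetime) (slabCone T b) := by
  have h : ContDiffOn ℝ n (fun q : Spacetime => ‖q.2‖) (slabCone T b) := fun q hq =>
    ((contDiffAt_norm ℝ hq.2.2).comp q contDiffAt_snd).contDiffWithinAt
  exact contDiff_fst.contDiffOn.prodMk
    ((h.inv fun q hq => norm_ne_zero_iff.2 hq.2.2).smul contDiff_snd.contDiffOn)

/-- The slab with `b = 1 / R` is the slab of the definitions. -/
lemma mem_slab_iff {R : ℝ} {q : Spacetime} : q ∈ slab T R ↔ q ∈ unitSlab T (1 / R) :=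
  ⟨fun h => ⟨⟨h.1, h.2.1, mem_unitSlab_ne h.2.2⟩, h.2.2⟩, fun h => ⟨h.1.1, h.1.2.1, h.2⟩⟩

lemma cone_slab (R : ℝ) : cone (slab T R) = slabCone T (1 / R) := by
  ext q
  exact ⟨fun h => ⟨h.2.1, h.2.2.1, h.1⟩, fun h => ⟨h.2.2, h.1, h.2.1, norm_radial h.2.2⟩⟩

lemma enorm_le_ckNorm {W : Type*} [NormedAddCommGroup W] [NormedSpace ℝ W] {n j : ℕ} (hj : j ≤ n)
    {f : Spacetime → W} {S : Set Spacetime} {B : ℝ≥0} (h : ckNorm n f S ≤ B) {q : Spacetime}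
    (hq : q ∈ S) : ‖iteratedFDeriv ℝ j (f ∘ radial) q‖ ≤ B := by
  have h1 : ‖iteratedFDeriv ℝ j (f ∘ radial) q‖ₑ ≤ B := by
    refine le_trans ?_ h
    unfold ckNorm
    refine le_trans ?_ (le_iSup₂ (f := fun j (_ : j ∈ Finset.range (n + 1)) => ⨆ q ∈ S,
      ‖iteratedFDeriv ℝ j (f ∘ radial) q‖ₑ) j (Finset.mem_range_succ_iff.2 hj))
    exact le_iSup₂ (f := fun q (_ : q ∈ S) => ‖iteratedFDeriv ℝ j (f ∘ radial) q‖ₑ) q hq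
  exact enorm_le_coe.1 h1

lemma ub_of_ckNorm {ι : Type*} {R : ℝ} [Fact (0 < 1 / R)] {n : ℕ} {f : ι → Spacetime → ℝ} {B : ℝ≥0}
    (hf : ∀ i, SmoothOn n (f i) (slab T R)) (h : ∀ i, ckNorm n (f i) (domainT T R) ≤ B) :
    UB T (1 / R) (fun _ => slabCone T (1 / R)) n fun i => f i ∘ radial := by
  refine ub_of_iteratedFDeriv (B := B) (fun i => ?_) fun i j hj q h1 h2 h3 =>
    enorm_le_ckNorm hj (h i) ⟨h1, h2, h3⟩
  have := hf i
  rwa [SmoothOn, cone_slab] at this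

lemma ckNorm_coord_le {R : ℝ} [Fact (0 < 1 / R)] {n : ℕ} {f : Spacetime → E3} {B : ℝ≥0}
    (hf : SmoothOn n f (slab T R)) (h : ckNorm n f (domainT T R) ≤ B) (k : Fin 3) :
    ckNorm n (fun q => f q k) (domainT T R) ≤ B := by
  unfold ckNorm
  refine iSup₂_le fun j hj => iSup₂_le fun q hq => enorm_le_coe.2 ?_
  have hj' := Finset.mem_range_succ_iff.1 hj
  rw [SmoothOn, cone_slab] at hf
  have hn := slabCone_mem_nhds hq.1 hq.2.1 (mem_unitSlab_ne hq.2.2)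
  have h1 := (EuclideanSpace.proj (𝕜 := ℝ) k : E3 →L[ℝ] ℝ).norm_iteratedFDeriv_comp_left
    (hf.contDiffAt hn) (n := j) (by exact_mod_cast hj')
  have h2 : ‖(EuclideanSpace.proj (𝕜 := ℝ) k : E3 →L[ℝ] ℝ)‖ ≤ 1 :=
    ContinuousLinearMap.opNorm_le_bound _ zero_le_one fun x => by
      rw [one_mul]; exact PiLp.norm_apply_le x k
  have h3 := enorm_le_ckNorm hj' h hq
  exact NNReal.coe_le_coe.1 ((h1.trans (mul_le_of_le_one_left (norm_nonneg _) h2)).trans h3)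

lemma smoothOn_coord {n : ℕ} {f : Spacetime → E3} {S : Set Spacetime} (hf : SmoothOn n f S)
    (k : Fin 3) : SmoothOn n (fun q => f q k) S :=
  (EuclideanSpace.proj (𝕜 := ℝ) k : E3 →L[ℝ] ℝ).contDiff.comp_contDiffOn hf

end

section

/-! ### The inverse metric on the tangent plane of the sphere -/

section MatrixAlgebra

open Matrix

variable {n : Type*} [Fintype n] [DecidableEq n]

/-- A positive semidefinite matrix is bounded below by its determinant, relative to its adjugate. -/
lemma dotProduct_mulVec_ge_of_adjugate {N : Matrix n n ℝ} (hN : N.PosSemidef) {C : ℝ} (hC : 0 < C)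
    {x : n → ℝ} (h : x ⬝ᵥ (N.adjugate *ᵥ x) ≤ C * (x ⬝ᵥ x)) :
    N.det / C * (x ⬝ᵥ x) ≤ x ⬝ᵥ (N *ᵥ x) := by
  have h0 := hN.dotProduct_mulVec_nonneg (x - C⁻¹ • (N.adjugate *ᵥ x))
  have hsymm : Nᵀ = N := by simpa using hN.isHermitian.eq
  have h1 : N *ᵥ (N.adjugate *ᵥ x) = N.det • x := by
    rw [mulVec_mulVec, mul_adjugate, smul_mulVec, one_mulVec]
  have h2 : (N.adjugate *ᵥ x) ⬝ᵥ (N *ᵥ x) = N.det * (x ⬝ᵥ x) := by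
    rw [dotProduct_mulVec, ← mulVec_transpose, hsymm, h1, smul_dotProduct, smul_eq_mul]
  have hd : 0 ≤ N.det := hN.det_nonneg
  simp only [star_trivial, mulVec_sub, mulVec_smul, h1, sub_dotProduct, dotProduct_sub,
    smul_dotProduct, dotProduct_smul, smul_eq_mul, h2] at h0
  rw [dotProduct_comm (N.adjugate *ᵥ x) x] at h0
  have h3 := mul_le_mul_of_nonneg_left h (show 0 ≤ C⁻¹ * (C⁻¹ * N.det) by positivity)
  have h4 : C⁻¹ * (C⁻¹ * N.det) * (C * (x ⬝ᵥ x)) = N.det / C * (x ⬝ᵥ x) := by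
    field_simp
  have h5 : C⁻¹ * (N.det * (x ⬝ᵥ x)) = N.det / C * (x ⬝ᵥ x) := by ring
  nlinarith

lemma dotProduct_adjugate_mulVec_le {N : Matrix (Fin 3) (Fin 3) ℝ} {K : ℝ}
    (hK : ∀ i j, |N i j| ≤ K) (x : Fin 3 → ℝ) :
    x ⬝ᵥ (N.adjugate *ᵥ x) ≤ 6 * K ^ 2 * (x ⬝ᵥ x) := by
  have hK0 : 0 ≤ K := (abs_nonneg _).trans (hK 0 0)
  have hp : ∀ i j k l, |N i j * N k l| ≤ K ^ 2 := fun i j k l => by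
    rw [abs_mul, sq]; exact mul_le_mul (hK _ _) (hK _ _) (abs_nonneg _) hK0
  have ha : ∀ i j, |N.adjugate i j| ≤ 2 * K ^ 2 := by
    intro i j
    have h2 : ∀ a c d e f g h l, |N a c * N d e - N f g * N h l| ≤ 2 * K ^ 2 :=
      fun a c d e f g h l => (abs_sub _ _).trans (by linarith [hp a c d e, hp f g h l])
    have h3 : ∀ a c d e f g h l, |-(N a c * N d e) + N f g * N h l| ≤ 2 * K ^ 2 :=
      fun a c d e f g h l => by rw [neg_add_eq_sub]; exact h2 _ _ _ _ _ _ _ _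
    rw [adjugate_fin_three]
    fin_cases i <;> fin_cases j <;> first | exact h2 _ _ _ _ _ _ _ _ | exact h3 _ _ _ _ _ _ _ _
  have hx : ∀ i j, x i * (N.adjugate i j * x j) ≤ K ^ 2 * (x i ^ 2 + x j ^ 2) := by
    intro i j
    have h1 : x i * (N.adjugate i j * x j) ≤ |N.adjugate i j| * (|x i| * |x j|) := by
      refine (le_abs_self _).trans (le_of_eq ?_)
      rw [abs_mul, abs_mul]; ring
    have h2 : |N.adjugate i j| * (|x i| * |x j|) ≤ 2 * K ^ 2 * (|x i| * |x j|) :=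
      mul_le_mul_of_nonneg_right (ha i j) (by positivity)
    have h3 : 2 * (|x i| * |x j|) ≤ x i ^ 2 + x j ^ 2 := by
      have := two_mul_le_add_sq |x i| |x j|
      simp only [sq_abs] at this
      linarith
    nlinarith [sq_nonneg K]
  simp only [dotProduct, mulVec, Finset.mul_sum]
  refine (Finset.sum_le_sum fun i _ => Finset.sum_le_sum fun j _ => hx i j).trans (le_of_eq ?_)
  simp only [Fin.sum_univ_three]
  ring

variable {P : Matrix (Fin 3) (Fin 3) ℝ} {y : Fin 3 → ℝ} {c : ℝ}

lemma inv_mulVec_eq (hP : P.PosDef) (hy : P *ᵥ y = y) : P⁻¹ *ᵥ y = y := by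
  conv_lhs => rw [← hy]
  rw [mulVec_mulVec, nonsing_inv_mul _ (isUnit_iff_isUnit_det _ |>.1 hP.isUnit), one_mulVec]

lemma tangentInv_mulVec_self (hP : P.PosDef) (hy : P *ᵥ y = y) (hu : y ⬝ᵥ y = 1) :
    (c • (P⁻¹ - vecMulVec y y)) *ᵥ y = 0 := by
  rw [smul_mulVec, sub_mulVec, inv_mulVec_eq hP hy, vecMulVec_mulVec, hu]
  simp

lemma tangentInv_transpose (hP : P.PosDef) :
    (c • (P⁻¹ - vecMulVec y y))ᵀ = c • (P⁻¹ - vecMulVec y y) := by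
  have : Pᵀ = P := by simpa using hP.isHermitian.eq
  rw [transpose_smul, transpose_sub, transpose_nonsing_inv, this, transpose_vecMulVec]

lemma tangentInv_posSemidef (hP : P.PosDef) (hy : P *ᵥ y = y) (hu : y ⬝ᵥ y = 1) (hc : 0 ≤ c) :
    (c • (P⁻¹ - vecMulVec y y)).PosSemidef := by
  refine PosSemidef.of_dotProduct_mulVec_nonneg ?_ fun x => ?_
  · rw [IsHermitian, conjTranspose_eq_transpose_of_trivial, tangentInv_transpose hP]
  have h0 := hP.inv.posSemidef.dotProduct_mulVec_nonneg (x - (y ⬝ᵥ x) • y)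
  have hsymm : P⁻¹ᵀ = P⁻¹ := by simpa using hP.inv.isHermitian.eq
  have h1 : y ⬝ᵥ (P⁻¹ *ᵥ x) = y ⬝ᵥ x := by
    rw [dotProduct_mulVec, ← mulVec_transpose, hsymm, inv_mulVec_eq hP hy]
  simp only [star_trivial, mulVec_sub, mulVec_smul, inv_mulVec_eq hP hy, sub_dotProduct,
    dotProduct_sub, smul_dotProduct, dotProduct_smul, smul_eq_mul, h1, hu] at h0
  rw [dotProduct_comm x y] at h0
  rw [star_trivial, smul_mulVec, sub_mulVec, vecMulVec_mulVec, dotProduct_smul, dotProduct_sub,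
    smul_eq_mul]
  refine mul_nonneg hc ?_
  simp only [op_smul_eq_smul, dotProduct_smul, smul_eq_mul]
  rw [dotProduct_comm x y]
  linarith

lemma det_tangentInv_add (hP : P.PosDef) (hy : P *ᵥ y = y) (hu : y ⬝ᵥ y = 1) (hd : P.det = 1) :
    (c • (P⁻¹ - vecMulVec y y) + vecMulVec y y).det = c ^ 2 := by
  have h1 : P⁻¹ * vecMulVec y y = vecMulVec y y := by
    rw [mul_vecMulVec, inv_mulVec_eq hP hy]
  have h2 : c • (P⁻¹ - vecMulVec y y) + vecMulVec y y =
      P⁻¹ * (c • (1 : Matrix (Fin 3) (Fin 3) ℝ) + (1 - c) • vecMulVec y y) := by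
    rw [mul_add, Matrix.mul_smul, Matrix.mul_smul, mul_one, h1]
    module
  have h3 : y 0 * y 0 + y 1 * y 1 + y 2 * y 2 = 1 := by
    simpa [dotProduct, Fin.sum_univ_three] using hu
  rw [h2, det_mul, det_nonsing_inv, hd, Ring.inverse_one, one_mul, det_fin_three]
  simp [vecMulVec_apply]
  linear_combination (c ^ 2 * (1 - c)) * h3

end MatrixAlgebra

/-! ### The inverse metric in the frame -/

namespace BondiMetric

variable (g : BondiMetric) {Λ R : ℝ} {n : ℕ}

/-- The component of the shift along a rotation field. -/
def frameU (k : Fin 3) (q : Spacetime) : ℝ := inner ℝ (rotField k q.2) (g.U q)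

/-- The components of the angular inverse metric along the rotation fields. -/
def frameA (k l : Fin 3) (q : Spacetime) : ℝ :=
  rotField k q.2 ⬝ᵥ Matrix.mulVec (g.invAng q) (rotField l q.2)

/-- The symmetric matrix with first rows `(0, 1, 0)` and `(1, w, u)` and with lower right block `a`. -/
def blockMatrix (w : ℝ) (u : Fin 3 → ℝ) (a : Fin 3 → Fin 3 → ℝ) (i j : Fin 5) : ℝ :=
  ![![0, 1, 0, 0, 0], ![1, w, u 0, u 1, u 2], ![0, u 0, a 0 0, a 0 1, a 0 2],
    ![0, u 1, a 1 0, a 1 1, a 1 2], ![0, u 2, a 2 0, a 2 1, a 2 2]] i j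

/-- The components of the inverse metric in the frame, at the points of the sphere. -/
def frameG₁ (i j : Fin 5) (q : Spacetime) : ℝ :=
  blockMatrix (g.W q) (fun k => g.frameU k q) (fun k l => g.frameA k l q) i j

lemma sum_blockMatrix (w : ℝ) (u : Fin 3 → ℝ) (a : Fin 3 → Fin 3 → ℝ) (f : Fin 5 → ℝ)
    (q : Spacetime) :
    (((f 1, f 0 + w * f 1 + ∑ k : Fin 3, u k * f k.succ.succ),
      f 1 • ∑ k, u k • rotField k q.2 +
        ∑ k, (∑ l : Fin 3, a k l * f l.succ.succ) • rotField k q.2) : Spacetime) =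
      ∑ i, (∑ j, blockMatrix w u a i j * f j) • frame i q := by
  have e : ∀ F : Fin 3 → E3, ∑ k, F k = F 0 + F 1 + F 2 := Fin.sum_univ_three
  have h2 : (Fin.succ (Fin.succ 0) : Fin 5) = 2 := rfl
  have h3 : (Fin.succ (Fin.succ 1) : Fin 5) = 3 := rfl
  have h4 : (Fin.succ (Fin.succ 2) : Fin 5) = 4 := rfl
  simp only [Fin.sum_univ_five, Fin.sum_univ_three, e, frame_eq, blockMatrix, h2, h3, h4]
  refine Prod.ext (Prod.ext ?_ ?_) ?_
  · simp
  · simp; ring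
  · simp; module

lemma blockMatrix_symm (w : ℝ) (u : Fin 3 → ℝ) {a : Fin 3 → Fin 3 → ℝ} (ha : ∀ k l, a k l = a l k)
    (i j : Fin 5) : blockMatrix w u a i j = blockMatrix w u a j i := by
  fin_cases i <;> fin_cases j <;> first | rfl | exact ha _ _

/-- The components of the inverse metric in the frame. -/
def frameG (i j : Fin 5) : Spacetime → ℝ := g.frameG₁ i j ∘ radial

lemma frameG₁_ang (k l : Fin 3) (q : Spacetime) :
    g.frameG₁ k.succ.succ l.succ.succ q = g.frameA k l q := by
  fin_cases k <;> fin_cases l <;> rfl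

variable {g} (hg : g.IsAsymptoticallyAdS Λ T R n)

lemma normSq_eq {x : E3} (h : ‖x‖ = 1) : x.ofLp ⬝ᵥ x.ofLp = 1 := by
  have := real_inner_self_eq_norm_sq x
  rw [h, EuclideanSpace.inner_eq_star_dotProduct] at this
  simpa using this

lemma inner_eq_dotProduct (x y : E3) : inner ℝ x y = x.ofLp ⬝ᵥ y.ofLp := by
  rw [EuclideanSpace.inner_eq_star_dotProduct, dotProduct_comm]; simp

namespace IsAsymptoticallyAdS

include hg

lemma mulVec_normal {q : Spacetime} (hq : q ∈ slab T R) :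
    Matrix.mulVec (g.h q + normalProj q.2) q.2.ofLp = q.2.ofLp := by
  rw [Matrix.add_mulVec, hg.tangent_h q hq, normalProj, Matrix.vecMulVec_mulVec, normSq_eq hq.2.2]
  simp

lemma invAng_mulVec_normal {q : Spacetime} (hq : q ∈ slab T R) :
    Matrix.mulVec (g.invAng q) q.2.ofLp = 0 :=
  tangentInv_mulVec_self (hg.posDef_h q hq) (hg.mulVec_normal hq) (normSq_eq hq.2.2)

lemma invAng_transpose {q : Spacetime} (hq : q ∈ slab T R) : (g.invAng q).transpose = g.invAng q :=
  tangentInv_transpose (hg.posDef_h q hq)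

lemma invAng_posSemidef {q : Spacetime} (hq : q ∈ slab T R) : (g.invAng q).PosSemidef :=
  tangentInv_posSemidef (hg.posDef_h q hq) (hg.mulVec_normal hq) (normSq_eq hq.2.2)
    (Real.exp_pos _).le

lemma det_invAng_add {q : Spacetime} (hq : q ∈ slab T R) :
    (g.invAng q + normalProj q.2).det = Real.exp (2 * g.η q) ^ 2 :=
  det_tangentInv_add (hg.posDef_h q hq) (hg.mulVec_normal hq) (normSq_eq hq.2.2) (hg.det_h q hq)

lemma dotProduct_invAng_comm {q : Spacetime} (hq : q ∈ slab T R) (x y : Fin 3 → ℝ) :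
    x ⬝ᵥ Matrix.mulVec (g.invAng q) y = Matrix.mulVec (g.invAng q) x ⬝ᵥ y := by
  rw [Matrix.dotProduct_mulVec, ← Matrix.mulVec_transpose, hg.invAng_transpose hq]

lemma frameA_symm {q : Spacetime} (hq : q ∈ slab T R) (k l : Fin 3) :
    g.frameA k l q = g.frameA l k q := by
  rw [frameA, frameA, hg.dotProduct_invAng_comm hq, dotProduct_comm]

lemma frameG₁_symm {q : Spacetime} (hq : q ∈ slab T R) (i j : Fin 5) :
    g.frameG₁ i j q = g.frameG₁ j i q := by
  exact blockMatrix_symm _ _ (fun k l => hg.frameA_symm hq k l) i j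

lemma U_eq_sum {q : Spacetime} (hq : q ∈ slab T R) :
    g.U q = ∑ k, g.frameU k q • rotField k q.2 := by
  have := sum_inner_rotField q.2 (g.U q)
  rw [hg.tangent_U q hq, hq.2.2, zero_smul, add_zero, one_pow, one_smul] at this
  exact this.symm

lemma invAng_rotField {q : Spacetime} (hq : q ∈ slab T R) (l : Fin 3) :
    WithLp.toLp 2 (Matrix.mulVec (g.invAng q) (rotField l q.2)) =
      ∑ k, g.frameA k l q • rotField k q.2 := by
  have := sum_inner_rotField q.2 (WithLp.toLp 2 (Matrix.mulVec (g.invAng q) (rotField l q.2)))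
  simp only [inner_eq_dotProduct] at this
  rw [hg.dotProduct_invAng_comm hq q.2.ofLp, hg.invAng_mulVec_normal hq, zero_dotProduct, hq.2.2,
    zero_smul, add_zero, one_pow, one_smul] at this
  exact this.symm

/-- The angular inverse metric is positive definite, uniformly. -/
lemma frameA_coercive {q : Spacetime} (hq : q ∈ slab T R) {K δ : ℝ} (hδ : 0 < δ)
    (hη : δ ≤ Real.exp (2 * g.η q)) (hK : 0 ≤ K) (hA : ∀ i j, |g.invAng q i j| ≤ K) {ξ : Fin 3 → ℝ}
    (hξ : ∑ k, q.2 k * ξ k = 0) :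
    δ ^ 2 / (6 * (K + 1) ^ 2) * ∑ k, ξ k ^ 2 ≤ ∑ k, ∑ l, g.frameA k l q * ξ k * ξ l := by
  have hu : q.2 0 * q.2 0 + q.2 1 * q.2 1 + q.2 2 * q.2 2 = 1 := by
    simpa [dotProduct, Fin.sum_univ_three] using normSq_eq hq.2.2
  set ζ : E3 := ∑ k, ξ k • rotField k q.2 with hζ
  have hζ2 : ζ.ofLp ⬝ᵥ ζ.ofLp = ∑ k, ξ k ^ 2 := by
    rw [Fin.sum_univ_three] at hξ
    simp only [hζ, dotProduct, Fin.sum_univ_three, rotField_coord, PiLp.add_apply, PiLp.smul_apply,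
      smul_eq_mul]
    simp
    linear_combination (ξ 0 ^ 2 + ξ 1 ^ 2 + ξ 2 ^ 2) * hu -
      (q.2 0 * ξ 0 + q.2 1 * ξ 1 + q.2 2 * ξ 2) * hξ
  have hζy : ζ.ofLp ⬝ᵥ q.2.ofLp = 0 := by
    simp only [hζ, dotProduct, Fin.sum_univ_three, rotField_coord, PiLp.add_apply, PiLp.smul_apply,
      smul_eq_mul]
    simp
    ring
  have hζA : ζ.ofLp ⬝ᵥ Matrix.mulVec (g.invAng q) ζ.ofLp = ∑ k, ∑ l, g.frameA k l q * ξ k * ξ l := by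
    have h1 : ζ.ofLp = ∑ k, ξ k • (rotField k q.2).ofLp := by simp [hζ]
    rw [h1, Matrix.mulVec_sum, sum_dotProduct]
    refine Finset.sum_congr rfl fun k _ => ?_
    rw [dotProduct_sum]
    refine Finset.sum_congr rfl fun l _ => ?_
    rw [Matrix.mulVec_smul, smul_dotProduct, dotProduct_smul, smul_eq_mul, smul_eq_mul, frameA]
    ring
  have hN : (g.invAng q + normalProj q.2).PosSemidef := by
    refine (hg.invAng_posSemidef hq).add ?_
    have := Matrix.posSemidef_vecMulVec_self_star (R := ℝ) q.2.ofLp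
    simpa [normalProj] using this
  have hNK : ∀ i j, |(g.invAng q + normalProj q.2) i j| ≤ K + 1 := by
    intro i j
    have h1 : ∀ i, |q.2 i| ≤ 1 := fun i => by
      have := PiLp.norm_apply_le q.2 i
      rwa [hq.2.2] at this
    have h2 : |normalProj q.2 i j| ≤ 1 := by
      rw [normalProj, Matrix.vecMulVec_apply, abs_mul]
      exact mul_le_one₀ (h1 i) (abs_nonneg _) (h1 j)
    exact (abs_add_le _ _).trans (add_le_add (hA i j) h2)
  have h1 := dotProduct_mulVec_ge_of_adjugate hN (C := 6 * (K + 1) ^ 2) (by positivity)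
    (dotProduct_adjugate_mulVec_le hNK ζ.ofLp)
  rw [hg.det_invAng_add hq, Matrix.add_mulVec, dotProduct_add, hζA, hζ2, normalProj,
    Matrix.vecMulVec_mulVec, dotProduct_comm q.2.ofLp, hζy] at h1
  simp only [MulOpposite.op_zero, zero_smul, dotProduct_zero, add_zero] at h1
  refine le_trans ?_ h1
  have : 0 ≤ ∑ k, ξ k ^ 2 := Finset.sum_nonneg fun k _ => sq_nonneg _
  gcongr

/-- The gradient in the frame. -/
lemma sharp_eq {q : Spacetime} (hq : q ∈ slab T R) (p : Covector) :
    g.sharp q p = ∑ i, (∑ j, g.frameG₁ i j q * p (frame j q)) • frame i q := by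
  set π : E3 := WithLp.toLp 2 fun i => p ((0, 0), EuclideanSpace.single i 1) with hπ
  have hp : ∀ ξ : E3, p ((0, 0), ξ) = ξ.ofLp ⬝ᵥ π.ofLp := by
    intro ξ
    have h1 : ((0, 0), ξ) = ∑ i, ξ i • (((0, 0), EuclideanSpace.single i 1) : Spacetime) := by
      refine Prod.ext ?_ ?_
      · simp [Prod.fst_sum]
      · rw [Prod.snd_sum]
        ext m
        simp [Pi.single_apply]
    rw [h1, map_sum]
    simp only [map_smul, smul_eq_mul, dotProduct, hπ]
  have hrot : ∀ k : Fin 3, p (frame k.succ.succ q) = (rotField k q.2).ofLp ⬝ᵥ π.ofLp := fun k => by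
    rw [frame_rot]; exact hp _
  have hU : p ((0, 0), g.U q) = ∑ k : Fin 3, g.frameU k q * p (frame k.succ.succ q) := by
    rw [hp, hg.U_eq_sum hq]
    simp only [hrot]
    simp [sum_dotProduct]
  have hA : WithLp.toLp 2 (Matrix.mulVec (g.invAng q) π.ofLp) =
      ∑ k : Fin 3, (∑ l : Fin 3, g.frameA k l q * p (frame l.succ.succ q)) • rotField k q.2 := by
    have := sum_inner_rotField q.2 (WithLp.toLp 2 (Matrix.mulVec (g.invAng q) π.ofLp))
    simp only [inner_eq_dotProduct] at this
    rw [hg.dotProduct_invAng_comm hq q.2.ofLp, hg.invAng_mulVec_normal hq, zero_dotProduct, hq.2.2,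
      zero_smul, add_zero, one_pow, one_smul] at this
    rw [← this]
    refine Finset.sum_congr rfl fun k _ => ?_
    congr 1
    have h2 := congrArg WithLp.ofLp (hg.invAng_rotField hq k)
    simp only at h2
    rw [hg.dotProduct_invAng_comm hq, h2]
    simp only [WithLp.ofLp_sum, WithLp.ofLp_smul, sum_dotProduct, smul_dotProduct, smul_eq_mul]
    exact Finset.sum_congr rfl fun l _ => by rw [hrot, hg.frameA_symm hq]
  have h0 : p ((1, 0), 0) = p (frame 0 q) := by rw [frame_zero]
  have h1 : p ((0, 1), 0) = p (frame 1 q) := by rw [frame_one]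
  rw [sharp, hU, h0, h1]
  have hA' := hA
  simp only [hπ] at hA'
  rw [hA', hg.U_eq_sum hq]
  exact sum_blockMatrix (g.W q) (fun k => g.frameU k q) (fun k l => g.frameA k l q)
    (fun j => p (frame j q)) q

end IsAsymptoticallyAdS

end BondiMetric

end

section

variable {T b : ℝ} [hT : Fact (0 < T)] [hb : Fact (0 < b)]

/-! ### Bounds for the coefficients of the wave operator -/

lemma contDiffOn_radial_coord (m : Fin 3) {n : WithTop ℕ∞} :
    ContDiffOn ℝ n (fun q : Spacetime => (radial q).2 m) (slabCone T b) :=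
  (EuclideanSpace.proj (𝕜 := ℝ) m : E3 →L[ℝ] ℝ).contDiff.comp_contDiffOn
    (contDiff_snd.comp_contDiffOn contDiffOn_radial)

lemma contDiffOn_rotField_radial (k m : Fin 3) {n : WithTop ℕ∞} :
    ContDiffOn ℝ n (fun q : Spacetime => rotField k (radial q).2 m) (slabCone T b) :=
  (EuclideanSpace.proj (𝕜 := ℝ) m : E3 →L[ℝ] ℝ).contDiff.comp_contDiffOn
    ((rotField k).contDiff.comp_contDiffOn (contDiff_snd.comp_contDiffOn contDiffOn_radial))

namespace BondiMetric

variable {R : ℝ} [hR : Fact (0 < 1 / R)] {n : ℕ}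

lemma radial_mem_slab {q : Spacetime} (hq : q ∈ slabCone T (1 / R)) : radial q ∈ slab T R :=
  mem_slab_iff.2 (radial_mem hq)

lemma IsAsymptoticallyAdS.smooth_invAng {g : BondiMetric} {Λ : ℝ}
    (hg : g.IsAsymptoticallyAdS Λ T R n) (i j : Fin 3) :
    SmoothOn n (fun q => g.invAng q i j) (slab T R) := by
  rw [SmoothOn, cone_slab]
  have hη : ContDiffOn ℝ n (g.η ∘ radial) (slabCone T (1 / R)) := by
    have := hg.smooth_η; rwa [SmoothOn, cone_slab] at this
  have hN : ∀ i j, ContDiffOn ℝ n (fun q : Spacetime => normalProj (radial q).2 i j)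
      (slabCone T (1 / R)) := fun i j =>
    (contDiffOn_radial_coord i).mul (contDiffOn_radial_coord j)
  have hP : ∀ i j, ContDiffOn ℝ n
      (fun q : Spacetime => (g.h (radial q) + normalProj (radial q).2) i j)
      (slabCone T (1 / R)) := fun i j => by
    have := hg.smooth_h i j
    rw [SmoothOn, cone_slab] at this
    exact this.add (hN i j)
  have hadj : ∀ i j, ContDiffOn ℝ n
      (fun q : Spacetime => (g.h (radial q) + normalProj (radial q).2).adjugate i j)
      (slabCone T (1 / R)) := by
    intro i j
    simp only [Matrix.adjugate_fin_three]
    have h1 : ∀ a c d e f g h l, ContDiffOn ℝ n _ (slabCone T (1 / R)) := fun a c d e f g h l =>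
      ((hP a c).mul (hP d e)).sub ((hP f g).mul (hP h l))
    have h2 : ∀ a c d e f g h l, ContDiffOn ℝ n _ (slabCone T (1 / R)) := fun a c d e f g h l =>
      ((hP a c).mul (hP d e)).neg.add ((hP f g).mul (hP h l))
    fin_cases i <;> fin_cases j <;> first | exact h1 _ _ _ _ _ _ _ _ | exact h2 _ _ _ _ _ _ _ _
  have h1 : ContDiffOn ℝ n (fun q : Spacetime => Real.exp (2 * (g.η ∘ radial) q) *
      ((g.h (radial q) + normalProj (radial q).2).adjugate i j - normalProj (radial q).2 i j))
      (slabCone T (1 / R)) := (contDiffOn_const.mul hη).exp.mul ((hadj i j).sub (hN i j))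
  refine h1.congr fun q hq => ?_
  simp only [Function.comp_apply, invAng, Matrix.smul_apply, Matrix.sub_apply, smul_eq_mul,
    Matrix.inv_def, hg.det_h _ (radial_mem_slab hq), Ring.inverse_one, one_mul]

variable {ι : Type*} {g : ι → BondiMetric} {Λ : ι → ℝ} {B : ℝ≥0} {δ : ℝ}

lemma ub_W (hg : ∀ i, (g i).IsAsymptoticallyAdS (Λ i) T R n)
    (hB : ∀ i, (g i).invNorm n (domainT T R) ≤ B) :
    UB T (1 / R) (fun _ => slabCone T (1 / R)) n fun i => (g i).W ∘ radial :=
  ub_of_ckNorm (fun i => (hg i).smooth_W) fun i => (le_max_left _ _).trans (hB i)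

lemma ub_U (hg : ∀ i, (g i).IsAsymptoticallyAdS (Λ i) T R n)
    (hB : ∀ i, (g i).invNorm n (domainT T R) ≤ B) (k : Fin 3) :
    UB T (1 / R) (fun _ => slabCone T (1 / R)) n fun i => (fun q => (g i).U q k) ∘ radial :=
  ub_of_ckNorm (fun i => smoothOn_coord (hg i).smooth_U k) fun i => ckNorm_coord_le (hg i).smooth_U
    (((le_max_left _ _).trans (le_max_right _ _)).trans (hB i)) k

lemma ub_invAng (hg : ∀ i, (g i).IsAsymptoticallyAdS (Λ i) T R n)
    (hB : ∀ i, (g i).invNorm n (domainT T R) ≤ B) (k l : Fin 3) :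
    UB T (1 / R) (fun _ => slabCone T (1 / R)) n
      fun i => (fun q => (g i).invAng q k l) ∘ radial :=
  ub_of_ckNorm (fun i => (hg i).smooth_invAng k l) fun i =>
    ((le_iSup₂ (f := fun k l => ckNorm n (fun q => (g i).invAng q k l) (domainT T R)) k l).trans
      ((le_max_right _ _).trans (le_max_right _ _))).trans (hB i)

lemma ub_frameU (hg : ∀ i, (g i).IsAsymptoticallyAdS (Λ i) T R n)
    (hB : ∀ i, (g i).invNorm n (domainT T R) ≤ B) (k : Fin 3) :
    UB T (1 / R) (fun _ => slabCone T (1 / R)) n fun i => (g i).frameU k ∘ radial := by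
  have hS : ∀ _ : ι, RelOpen T (1 / R) (slabCone T (1 / R)) := fun _ => relOpen_slabCone
  refine (UB.sum hS Finset.univ fun m _ => UB.mul hS
    (ub_of_contDiffOn (contDiffOn_rotField_radial k m)) (ub_U hg hB m)).congr hS fun i q _ => ?_
  simp [frameU, inner_eq_dotProduct, dotProduct]

lemma ub_frameA (hg : ∀ i, (g i).IsAsymptoticallyAdS (Λ i) T R n)
    (hB : ∀ i, (g i).invNorm n (domainT T R) ≤ B) (k l : Fin 3) :
    UB T (1 / R) (fun _ => slabCone T (1 / R)) n fun i => (g i).frameA k l ∘ radial := by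
  have hS : ∀ _ : ι, RelOpen T (1 / R) (slabCone T (1 / R)) := fun _ => relOpen_slabCone
  refine (UB.sum hS Finset.univ fun m _ => UB.mul hS
    (ub_of_contDiffOn (contDiffOn_rotField_radial k m)) (UB.sum hS Finset.univ fun m' _ =>
      UB.mul hS (ub_invAng hg hB m m')
        (ub_of_contDiffOn (contDiffOn_rotField_radial l m')))).congr hS fun i q _ => ?_
  simp [frameA, dotProduct, Matrix.mulVec]

lemma ub_frameG (hg : ∀ i, (g i).IsAsymptoticallyAdS (Λ i) T R n)
    (hB : ∀ i, (g i).invNorm n (domainT T R) ≤ B) (k l : Fin 5) :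
    UB T (1 / R) (fun _ => slabCone T (1 / R)) n fun i => (g i).frameG k l := by
  have hS : ∀ _ : ι, RelOpen T (1 / R) (slabCone T (1 / R)) := fun _ => relOpen_slabCone
  have h0 := fun c => UB.const hS n c
  have hW := ub_W hg hB
  have hU := ub_frameU hg hB
  have hA := ub_frameA hg hB
  fin_cases k <;> fin_cases l
  exacts [h0 0, h0 1, h0 0, h0 0, h0 0, h0 1, hW, hU 0, hU 1, hU 2, h0 0, hU 0, hA 0 0, hA 0 1,
    hA 0 2, h0 0, hU 1, hA 1 0, hA 1 1, hA 1 2, h0 0, hU 2, hA 2 0, hA 2 1, hA 2 2]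

lemma IsAsymptoticallyAdS.contDiffOn_η {g : BondiMetric} {Λ : ℝ}
    (hg : g.IsAsymptoticallyAdS Λ T R n) :
    ContDiffOn ℝ n (g.η ∘ radial) (slabCone T (1 / R)) := by
  have := hg.smooth_η; rwa [SmoothOn, cone_slab] at this

/-- The conformal factor is controlled by the determinant of the angular part of the metric. -/
lemma ub_D_η (hg : ∀ i, (g i).IsAsymptoticallyAdS (Λ i) T R (n + 1))
    (hB : ∀ i, (g i).invNorm (n + 1) (domainT T R) ≤ B) (hδ : 0 < δ)
    (hη : ∀ i, ∀ q ∈ slab T R, δ ≤ Real.exp (2 * (g i).η q)) (k : Fin 5) :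
    UB T (1 / R) (fun _ => slabCone T (1 / R)) n fun i => D T (1 / R) k ((g i).η ∘ radial) := by
  have hS : ∀ _ : ι, RelOpen T (1 / R) (slabCone T (1 / R)) := fun _ => relOpen_slabCone
  have hN : ∀ k l, UB T (1 / R) (fun _ => slabCone T (1 / R)) (n + 1) fun i q =>
      (((g i).invAng (radial q) + normalProj (radial q).2) k l) := fun k l =>
    UB.add hS (ub_invAng hg hB k l)
      (ub_of_contDiffOn ((contDiffOn_radial_coord k).mul (contDiffOn_radial_coord l)))
  have h3 := fun a b c d e f => UB.mul hS (UB.mul hS (hN a b) (hN c d)) (hN e f)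
  have hdet : UB T (1 / R) (fun _ => slabCone T (1 / R)) (n + 1) fun i q =>
      ((g i).invAng (radial q) + normalProj (radial q).2).det := by
    refine (UB.add hS (UB.add hS (UB.add hS (UB.add hS (UB.add hS (h3 0 0 1 1 2 2)
      (UB.const_mul hS (-1) (h3 0 0 1 2 2 1))) (UB.const_mul hS (-1) (h3 0 1 1 0 2 2)))
      (h3 0 1 1 2 2 0)) (h3 0 2 1 0 2 1)) (UB.const_mul hS (-1) (h3 0 2 1 1 2 0))).congr hS
      fun i q _ => ?_
    rw [Matrix.det_fin_three]; ring
  have hdet' : UB T (1 / R) (fun _ => slabCone T (1 / R)) (n + 1) fun i q =>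
      Real.exp (4 * ((g i).η ∘ radial) q) := hdet.congr hS fun i q hq => by
    beta_reduce
    rw [(hg i).det_invAng_add (radial_mem_slab hq), ← Real.exp_nat_mul]
    simp only [Function.comp_apply]; congr 1; push_cast; ring
  have hinv := UB.inv hS hdet' (c := δ ^ 2) (by positivity) fun i q hq => by
    have h1 := hη i _ (radial_mem_slab hq)
    have h2 : Real.exp (4 * ((g i).η ∘ radial) q) = Real.exp (2 * (g i).η (radial q)) ^ 2 := by
      rw [← Real.exp_nat_mul]; simp only [Function.comp_apply]; congr 1; push_cast; ring
    rw [h2]; gcongr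
  refine (UB.const_mul hS (1 / 4) (UB.mul hS (hinv.of_le n.le_succ) (hdet'.D k))).congr hS
    fun i q hq => ?_
  have hd : HasDerivAt (fun x : ℝ => Real.exp (4 * x)) (Real.exp (4 * ((g i).η ∘ radial) q) * 4)
      (((g i).η ∘ radial) q) := by
    simpa using ((hasDerivAt_id _).const_mul (4 : ℝ)).exp
  have h1 := D_comp hd (diffWithin_of_contDiffOn (hg i).contDiffOn_η relOpen_slabCone (by omega) hq)
    hq k
  simp only [h1]
  have := (Real.exp_pos (4 * ((g i).η ∘ radial) q)).ne'
  field_simp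

/-- The first order coefficients of the wave operator. -/
def frameβ (T R : ℝ) (g : BondiMetric) (j : Fin 5) (q : Spacetime) : ℝ :=
  ∑ i, (D T (1 / R) i (g.frameG i j) q +
    -2 * (D T (1 / R) i (g.η ∘ radial) q * g.frameG i j q))

lemma ub_frameβ (hg : ∀ i, (g i).IsAsymptoticallyAdS (Λ i) T R (n + 1))
    (hB : ∀ i, (g i).invNorm (n + 1) (domainT T R) ≤ B) (hδ : 0 < δ)
    (hη : ∀ i, ∀ q ∈ slab T R, δ ≤ Real.exp (2 * (g i).η q)) (j : Fin 5) :
    UB T (1 / R) (fun _ => slabCone T (1 / R)) n fun i => frameβ T R (g i) j := by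
  have hS : ∀ _ : ι, RelOpen T (1 / R) (slabCone T (1 / R)) := fun _ => relOpen_slabCone
  exact UB.sum hS Finset.univ fun k _ => UB.add hS ((ub_frameG hg hB k j).D k)
    (UB.const_mul hS (-2) (UB.mul hS (ub_D_η hg hB hδ hη k)
      ((ub_frameG hg hB k j).of_le n.le_succ)))

/-- Uniform ellipticity in the angular directions. -/
lemma exists_frameG_coercive (hg : ∀ i, (g i).IsAsymptoticallyAdS (Λ i) T R n)
    (hB : ∀ i, (g i).invNorm n (domainT T R) ≤ B) (hδ : 0 < δ)
    (hη : ∀ i, ∀ q ∈ slab T R, δ ≤ Real.exp (2 * (g i).η q)) :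
    ∃ c : ℝ, 0 < c ∧ ∀ i, ∀ q ∈ slabCone T (1 / R), ‖q.2‖ = 1 → ∀ ξ : Fin 3 → ℝ,
      ∑ k, q.2 k * ξ k = 0 →
        c * ∑ k, ξ k ^ 2 ≤ ∑ k, ∑ l, (g i).frameG k.succ.succ l.succ.succ q * ξ k * ξ l := by
  choose K hK hA using fun k l => (ub_invAng hg hB k l).bound
  set K' := ∑ k, ∑ l, K k l
  have hK' : 0 ≤ K' := Finset.sum_nonneg fun k _ => Finset.sum_nonneg fun l _ => hK k l
  refine ⟨δ ^ 2 / (6 * (K' + 1) ^ 2), by positivity, fun i q hq hu ξ hξ => ?_⟩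
  have hq' : q ∈ slab T R := mem_slab_iff.2 ⟨hq, hu⟩
  have := (hg i).frameA_coercive hq' hδ (hη i q hq') hK' (fun k l => ?_) hξ
  · simpa only [frameG, Function.comp_apply, frameG₁_ang, radial_eq hu] using this
  · have h1 := hA k l i q hq hu
    simp only [Function.comp_apply, radial_eq hu] at h1
    refine h1.trans ?_
    have h2 : K k l ≤ ∑ l, K k l := Finset.single_le_sum (fun l _ => hK k l) (Finset.mem_univ l)
    exact h2.trans (Finset.single_le_sum (f := fun k => ∑ l, K k l)
      (fun k _ => Finset.sum_nonneg fun l _ => hK k l) (Finset.mem_univ k))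

end BondiMetric

end

section

variable {T b : ℝ} [hT : Fact (0 < T)] [hb : Fact (0 < b)]

/-! ### The wave operator in the frame -/

lemma trace_rotField (k : Fin 3) : LinearMap.trace ℝ E3 (rotField k).toLinearMap = 0 := by
  have h : (rotField k).toLinearMap = Matrix.toLin (EuclideanSpace.basisFun (Fin 3) ℝ).toBasis
      (EuclideanSpace.basisFun (Fin 3) ℝ).toBasis (crossMatrix k) := by
    rw [← Matrix.toEuclideanLin_eq_toLin_orthonormal]; rfl
  rw [h, Matrix.trace_toLin_eq, Matrix.trace_fin_three]
  fin_cases k <;> simp [crossMatrix]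

lemma trace_frameLin (i : Fin 5) : LinearMap.trace ℝ Spacetime (frameLin i).toLinearMap = 0 := by
  have h : ∀ k : Fin 3, LinearMap.trace ℝ Spacetime ((ContinuousLinearMap.inr ℝ (ℝ × ℝ) E3).comp
      ((rotField k).comp (ContinuousLinearMap.snd ℝ (ℝ × ℝ) E3))).toLinearMap = 0 := by
    intro k
    rw [ContinuousLinearMap.toLinearMap_comp, LinearMap.trace_comp_comm', ← trace_rotField k]
    congr 1
  fin_cases i
  exacts [by simp [frameLin], by simp [frameLin], h 0, h 1, h 2]

lemma frame_radial (i : Fin 5) (q : Spacetime) :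
    frame i (radial q) = frameConst i + ‖q.2‖⁻¹ • frameLin i q := by
  simp only [frame, frameLin_eq, radial]
  fin_cases i <;> simp

lemma D_normSq (i : Fin 5) {q : Spacetime} (hq : q ∈ slabCone T b) :
    D T b i (fun q => ‖q.2‖ ^ 2) q = 0 := by
  have h : HasFDerivAt (fun q : Spacetime => ‖q.2‖ ^ 2)
      ((2 • (innerSL ℝ q.2)).comp (ContinuousLinearMap.snd ℝ (ℝ × ℝ) E3)) q :=
    (hasStrictFDerivAt_norm_sq q.2).hasFDerivAt.comp q hasFDerivAt_snd
  rw [D, h.hasFDerivWithinAt.fderivWithin (uniqueDiffOn_slabCone q hq), frame_eq]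
  fin_cases i <;> simp [rotField_coord, PiLp.inner_apply, Fin.sum_univ_three] <;> ring

lemma D_inv_norm (i : Fin 5) {q : Spacetime} (hq : q ∈ slabCone T b) :
    D T b i (fun q => ‖q.2‖⁻¹) q = 0 := by
  have h1 : (fun q : Spacetime => ‖q.2‖⁻¹) = fun q => (fun s => (Real.sqrt s)⁻¹) (‖q.2‖ ^ 2) := by
    ext q; simp
  have hpos : ‖q.2‖ ^ 2 ≠ 0 := pow_ne_zero 2 (norm_ne_zero_iff.2 hq.2.2)
  have h2 := ((Real.hasDerivAt_sqrt hpos).fun_inv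
    (Real.sqrt_ne_zero'.2 (lt_of_le_of_ne (sq_nonneg _) hpos.symm)))
  rw [h1, D_comp (f := fun q : Spacetime => ‖q.2‖ ^ 2) h2 _ hq, D_normSq i hq, mul_zero]
  exact (((contDiff_norm_sq ℝ (n := 1)).comp contDiff_snd).differentiable
    one_ne_zero).differentiableAt.differentiableWithinAt

/-- The projected frame is divergence free. -/
lemma trace_fderiv_frame_radial (i : Fin 5) {q : Spacetime} (hn : slabCone T b ∈ 𝓝 q) :
    ∃ X' : Spacetime →L[ℝ] Spacetime, HasFDerivAt (fun q => frame i (radial q)) X' q ∧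
      LinearMap.trace ℝ Spacetime X'.toLinearMap = 0 := by
  have hq : q ∈ slabCone T b := mem_of_mem_nhds hn
  have h1 : DifferentiableAt ℝ (fun q : Spacetime => ‖q.2‖⁻¹) q :=
    (differentiableAt_snd.norm ℝ hq.2.2).fun_inv (norm_ne_zero_iff.2 hq.2.2)
  have h2 := (h1.hasFDerivAt.smul (frameLin i).hasFDerivAt).const_add (frameConst i)
  refine ⟨_, h2.congr_of_eventuallyEq (.of_forall fun q => frame_radial i q), ?_⟩
  have h3 : fderiv ℝ (fun q : Spacetime => ‖q.2‖⁻¹) q (frameLin i q) = 0 := by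
    have h4 := D_inv_norm i hq
    rw [D, fderivWithin_of_mem_nhds hn, frame] at h4
    have h5 : i = 0 ∨ i = 1 ∨ frameConst i = 0 := by fin_cases i <;> simp [frameConst]
    rcases h5 with rfl | rfl | h5
    · simp [frameLin]
    · simp [frameLin]
    · rwa [h5, zero_add] at h4
  have h6 : ∀ (f : Spacetime →L[ℝ] ℝ) (x : Spacetime),
      LinearMap.trace ℝ Spacetime (f.smulRight x).toLinearMap = f x := fun f x =>
    LinearMap.trace_smulRight f.toLinearMap x
  rw [ContinuousLinearMap.toLinearMap_add, map_add, h6, h3, ContinuousLinearMap.toLinearMap_smul,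
    map_smul, trace_frameLin]
  simp

variable {S : Set Spacetime}

lemma RelOpen.subset_closure (hS : RelOpen T b S) :
    S ⊆ closure {q | q ∈ S ∧ q.1.1 ∈ Ioo 0 T ∧ q.1.2 ∈ Ioo 0 b} := by
  obtain ⟨O, hO, rfl⟩ := hS
  intro q hq
  have h1 : q ∈ closure (O ∩ interior (slabCone T b)) :=
    hO.inter_closure ⟨hq.2, slabCone_subset_closure hq.1⟩
  refine closure_mono ?_ h1
  rintro q' ⟨hO', hi⟩
  refine ⟨⟨interior_subset hi, hO'⟩, ?_⟩
  rw [slabCone_eq, interior_prod_eq, interior_prod_eq, interior_Icc, interior_Icc] at hi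
  exact hi.1

lemma radial_radial {P : Type*} (q : P × E3) : radial (radial q) = radial q := by
  by_cases h : q.2 = 0
  · simp [radial, h]
  · exact radial_eq (norm_radial h)

/-- Homogeneous functions take the same values at the projected points. -/
lemma Homog.radial {f : Spacetime → ℝ} (h : Homog S f) {q : Spacetime} (hq : q ∈ S)
    (h0 : q.2 ≠ 0) : NullTimelike.radial q ∈ S ∧ f (NullTimelike.radial q) = f q :=
  h q hq _ (inv_pos.2 (norm_pos_iff.2 h0))

namespace BondiMetric

variable {R : ℝ} [hR : Fact (0 < 1 / R)] {n : ℕ} {g : BondiMetric} {Λ : ℝ}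

lemma frameG_radial (i j : Fin 5) (q : Spacetime) :
    g.frameG i j (radial q) = g.frameG i j q := by
  rw [frameG, Function.comp_apply, radial_radial, Function.comp_apply]

/-- The wave operator is `∑ G_ij X_i X_j + ∑ β_j X_j`. -/
lemma box_eq_waveOp (hg : g.IsAsymptoticallyAdS Λ T R (n + 1))
    (hG : ∀ i j, ContDiffOn ℝ (n + 1 : ℕ) (g.frameG i j) (slabCone T (1 / R))) (hS : RelOpen T (1 / R) S)
    {v : Spacetime → ℝ} (hv : ContDiffOn ℝ (2 : ℕ) (v ∘ radial) S) (hh : Homog S (v ∘ radial))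
    {q : Spacetime} (hq : q ∈ S) (hu : ‖q.2‖ = 1) (h1 : q.1.1 ∈ Ioo 0 T)
    (h2 : q.1.2 ∈ Ioo 0 (1 / R)) :
    g.box v q = waveOp T (1 / R) g.frameG (frameβ T R g) (v ∘ radial) q := by
  set f := v ∘ radial with hf
  set K := slabCone T (1 / R)
  have hK : q ∈ K := hS.subset hq
  have hKn : K ∈ 𝓝 q := slabCone_mem_nhds h1 h2 (mem_unitSlab_ne hu)
  have hSn : S ∈ 𝓝 q := by
    have := hS.mem_nhdsWithin hq
    rwa [nhdsWithin_eq_nhds.2 hKn] at this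
  have hev : ∀ᶠ q' in 𝓝 q, q' ∈ S ∧ q'.1.1 ∈ Ioo 0 T ∧ q'.1.2 ∈ Ioo 0 (1 / R) := by
    refine (eventually_mem_set.2 hSn).and (.and ?_ ?_)
    · exact (continuous_fst.fst.tendsto q) (isOpen_Ioo.mem_nhds h1)
    · exact (continuous_fst.snd.tendsto q) (isOpen_Ioo.mem_nhds h2)
  have hD : ∀ j, Homog S (D T (1 / R) j f) := fun j =>
    hh.D hS (hv.of_le (by norm_num)) j
  let c : Fin 5 → Spacetime → ℝ := fun i q' =>
    Real.exp (-2 * (g.η ∘ radial) q') * ∑ j, g.frameG i j q' * D T (1 / R) j f q'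
  have hY : (fun q' => Real.exp (-2 * g.η q') • g.sharp q' (fderiv ℝ f q')) ∘ radial =ᶠ[𝓝 q]
      fun q' => ∑ i, c i q' • frame i (radial q') := by
    filter_upwards [hev] with q' ⟨hq', h1', h2'⟩
    have hq0 : q'.2 ≠ 0 := (hS.subset hq').2.2
    have hr : ‖(radial q').2‖ = 1 := norm_radial hq0
    have hrn : K ∈ 𝓝 (radial q') := slabCone_mem_nhds h1' h2' (mem_unitSlab_ne hr)
    simp only [Function.comp_apply, c]
    rw [hg.sharp_eq (radial_mem_slab (hS.subset hq')), Finset.smul_sum]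
    refine Finset.sum_congr rfl fun i _ => ?_
    rw [smul_smul]
    congr 2
    refine Finset.sum_congr rfl fun j _ => ?_
    have := ((hD j).radial hq' hq0).2
    rw [← this, D, fderivWithin_of_mem_nhds hrn]
    rfl
  have dη : DifferentiableWithinAt ℝ (g.η ∘ radial) K q :=
    diffWithin_of_contDiffOn hg.contDiffOn_η relOpen_slabCone (by omega) hK
  have dG : ∀ i j, DifferentiableWithinAt ℝ (g.frameG i j) K q := fun i j =>
    diffWithin_of_contDiffOn (hG i j) relOpen_slabCone (by omega) hK
  have dD : ∀ j, DifferentiableWithinAt ℝ (D T (1 / R) j f) K q := fun j =>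
    diffWithin_of_contDiffOn (n := 1) (contDiffOn_D hS hv j) hS one_ne_zero hq
  have dsum : ∀ i, DifferentiableWithinAt ℝ
      (fun q' => ∑ j, g.frameG i j q' * D T (1 / R) j f q') K q := fun i =>
    DifferentiableWithinAt.fun_sum fun j _ => (dG i j).fun_mul (dD j)
  have hexp : HasDerivAt (fun x : ℝ => Real.exp (-2 * x))
      (Real.exp (-2 * (g.η ∘ radial) q) * -2) ((g.η ∘ radial) q) := by
    simpa using ((hasDerivAt_id _).const_mul (-2 : ℝ)).exp
  have dexp : DifferentiableWithinAt ℝ (fun q' => Real.exp (-2 * (g.η ∘ radial) q')) K q :=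
    (dη.const_mul (-2)).exp
  have dc : ∀ i, DifferentiableAt ℝ (c i) q := fun i =>
    (dexp.fun_mul (dsum i)).differentiableAt hKn
  choose X' hX' hX'0 using fun i => trace_fderiv_frame_radial i hKn
  have hsum : HasFDerivAt (fun q' => ∑ i, c i q' • frame i (radial q'))
      (∑ i, (c i q • X' i + (fderiv ℝ (c i) q).smulRight (frame i (radial q)))) q :=
    HasFDerivAt.fun_sum fun i _ => (dc i).hasFDerivAt.fun_smul (hX' i)
  have htr : ∀ (f : Spacetime →L[ℝ] ℝ) (x : Spacetime),
      LinearMap.trace ℝ Spacetime (f.smulRight x).toLinearMap = f x := fun f x =>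
    LinearMap.trace_smulRight f.toLinearMap x
  have htrace : LinearMap.trace ℝ Spacetime
      (∑ i, (c i q • X' i + (fderiv ℝ (c i) q).smulRight (frame i (radial q)))).toLinearMap =
      ∑ i, D T (1 / R) i (c i) q := by
    rw [ContinuousLinearMap.toLinearMap_sum, map_sum]
    refine Finset.sum_congr rfl fun i _ => ?_
    rw [ContinuousLinearMap.toLinearMap_add, map_add, htr, ContinuousLinearMap.toLinearMap_smul,
      map_smul, hX'0, smul_zero, zero_add, radial_eq hu, D, fderivWithin_of_mem_nhds hKn]
  rw [box, (hsum.congr_of_eventuallyEq hY).fderiv, htrace]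
  have hDc : ∀ i, Real.exp (2 * g.η q) * D T (1 / R) i (c i) q =
      ∑ j, (g.frameG i j q * D T (1 / R) i (D T (1 / R) j f) q +
        (D T (1 / R) i (g.frameG i j) q +
          -2 * (D T (1 / R) i (g.η ∘ radial) q * g.frameG i j q)) * D T (1 / R) j f q) := by
    intro i
    have e1 : Real.exp (2 * g.η q) * Real.exp (-2 * (g.η ∘ radial) q) = 1 := by
      rw [Function.comp_apply, radial_eq hu, ← Real.exp_add]; simp
    simp only [c]
    rw [D_mul dexp (dsum i) hK, D_comp hexp dη hK, D_sum _ _ (fun j _ => (dG i j).fun_mul (dD j)) hK]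
    rw [mul_add, ← mul_assoc, e1, one_mul,
      show ∀ a e' d s : ℝ, a * (e' * -2 * d * s) = a * e' * (-2 * d * s) by intros; ring, e1, one_mul,
      Finset.mul_sum, ← Finset.sum_add_distrib]
    refine Finset.sum_congr rfl fun j _ => ?_
    rw [D_mul (dG i j) (dD j) hK]
    ring
  rw [Finset.mul_sum]
  simp only [hDc, waveOp, frameβ, Finset.sum_add_distrib]
  congr 1
  rw [Finset.sum_comm]
  refine Finset.sum_congr rfl fun j _ => ?_
  rw [← Finset.sum_add_distrib, Finset.sum_mul]

/-- The wave equation in the frame. -/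
lemma waveOp_eq_zero (hg : g.IsAsymptoticallyAdS Λ T R (n + 1))
    (hG : ∀ i j, ContDiffOn ℝ (n + 1 : ℕ) (g.frameG i j) (slabCone T (1 / R))) (hS : RelOpen T (1 / R) S)
    {v ω : Spacetime → ℝ} (hv : ContDiffOn ℝ (2 : ℕ) (v ∘ radial) S) (hh : Homog S (v ∘ radial))
    (hω : ContDiffOn ℝ (0 : ℕ) (ω ∘ radial) (slabCone T (1 / R)))
    (heq : ∀ q ∈ S, ‖q.2‖ = 1 → q.1.1 ∈ Ioo 0 T → q.1.2 ∈ Ioo 0 (1 / R) →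
      g.box v q + ω q * v q = 0) {q : Spacetime} (hq : q ∈ S) :
    waveOp T (1 / R) g.frameG (frameβ T R g) (v ∘ radial) q + (ω ∘ radial) q * (v ∘ radial) q = 0 := by
  set f := v ∘ radial with hf
  set K := slabCone T (1 / R)
  have hK : RelOpen T (1 / R) K := relOpen_slabCone
  have hf1 : ContDiffOn ℝ (1 : ℕ) f S := hv.of_le (by norm_num)
  have cD : ∀ j, ContDiffOn ℝ (1 : ℕ) (D T (1 / R) j f) S := fun j => contDiffOn_D hS hv j
  have cDD : ∀ i j, ContDiffOn ℝ (0 : ℕ) (D T (1 / R) i (D T (1 / R) j f)) S := fun i j =>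
    contDiffOn_D hS (cD j) i
  have cη : ContDiffOn ℝ (1 : ℕ) (g.η ∘ radial) K :=
    hg.contDiffOn_η.of_le (by exact_mod_cast (by omega))
  have cG : ∀ i j, ContDiffOn ℝ (1 : ℕ) (g.frameG i j) K := fun i j =>
    (hG i j).of_le (by exact_mod_cast (by omega))
  have cβ : ∀ j, ContinuousOn (frameβ T R g j) K := fun j =>
    continuousOn_finsetSum _ fun i _ => (contDiffOn_D hK (cG i j) i).continuousOn.add
      (continuousOn_const.mul ((contDiffOn_D hK cη i).continuousOn.mul (cG i j).continuousOn))
  have hc : ContinuousOn (fun q => waveOp T (1 / R) g.frameG (frameβ T R g) f q +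
      (ω ∘ radial) q * f q) S := by
    refine ContinuousOn.add (ContinuousOn.add ?_ ?_) ?_
    · exact continuousOn_finsetSum _ fun i _ => continuousOn_finsetSum _ fun j _ =>
        ((cG i j).continuousOn.mono hS.subset).mul (cDD i j).continuousOn
    · exact continuousOn_finsetSum _ fun j _ => ((cβ j).mono hS.subset).mul (cD j).continuousOn
    · exact (hω.continuousOn.mono hS.subset).mul hf1.continuousOn
  let s : Set Spacetime := {q | q ∈ S ∧ q.1.1 ∈ Ioo 0 T ∧ q.1.2 ∈ Ioo 0 (1 / R)}
  have hs : EqOn (fun q => waveOp T (1 / R) g.frameG (frameβ T R g) f q + (ω ∘ radial) q * f q)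
      (fun _ => 0) s := by
    rintro q ⟨hq, h1, h2⟩
    have hq0 : q.2 ≠ 0 := (hS.subset hq).2.2
    have hr : ‖(radial q).2‖ = 1 := norm_radial hq0
    have hD : ∀ j, Homog S (D T (1 / R) j f) := fun j => hh.D hS hf1 j
    have hDD : ∀ i j, Homog S (D T (1 / R) i (D T (1 / R) j f)) := fun i j => (hD j).D hS (cD j) i
    have hGh : ∀ i j, Homog K (g.frameG i j) := fun i j => homog_comp_radial _
    have e1 := box_eq_waveOp hg hG hS hv hh (hh.radial hq hq0).1 hr h1 h2
    have e2 := heq _ (hh.radial hq hq0).1 hr h1 h2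
    rw [e1] at e2
    have hβ : ∀ j, frameβ T R g j (radial q) = frameβ T R g j q := by
      intro j
      simp only [frameβ, frameG_radial]
      refine Finset.sum_congr rfl fun i _ => ?_
      rw [(((hGh i j).D hK (cG i j) i).radial (hS.subset hq) hq0).2,
        (((homog_comp_radial g.η).D hK cη i).radial (hS.subset hq) hq0).2]
    have h3 := fun j => ((hD j).radial hq hq0).2
    have h4 := fun i j => ((hDD i j).radial hq hq0).2
    simp only [waveOp, frameG_radial, hβ, ← hf, h3, h4] at e2
    exact e2
  exact Set.EqOn.of_subset_closure hs hc continuousOn_const (fun q hq => hq.1)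
    hS.subset_closure hq

end BondiMetric

end

section

variable {T b : ℝ} [hT : Fact (0 < T)] [hb : Fact (0 < b)]

/-! ### The horizon -/

/-- A function that is nonnegative initially, and increasing wherever it vanishes at a minimum, is
nonnegative. -/
lemma nonneg_of_first_time {ζ : Spacetime → ℝ} (hζ : ContDiffOn ℝ (1 : ℕ) ζ (slabCone T b))
    (h0 : ∀ x : E3, ‖x‖ = 1 → 0 ≤ ζ ((0, 0), x))
    (hstep : ∀ t ∈ Icc 0 T, (∀ y : E3, ‖y‖ = 1 → 0 ≤ ζ ((t, 0), y)) → ∀ x : E3, ‖x‖ = 1 →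
      ζ ((t, 0), x) = 0 → 0 < D T b 0 ζ ((t, 0), x)) {t : ℝ} (ht : t ∈ Icc 0 T) {x : E3}
    (hx : ‖x‖ = 1) : 0 ≤ ζ ((t, 0), x) := by
  have hmem : ∀ {s : ℝ} {y : E3}, s ∈ Icc 0 T → y ≠ 0 → (((s, 0), y) : Spacetime) ∈ slabCone T b :=
    fun hs hy => ⟨hs, ⟨le_rfl, hb.out.le⟩, hy⟩
  have hne : ∀ {y : E3}, ‖y‖ = 1 → y ≠ 0 := fun hy => by
    rw [← norm_ne_zero_iff, hy]; exact one_ne_zero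
  have hd : ∀ q ∈ slabCone T b, DifferentiableWithinAt ℝ ζ (slabCone T b) q := fun q hq =>
    diffWithin_of_contDiffOn hζ relOpen_slabCone one_ne_zero hq
  have hD : ContinuousOn (D T b 0 ζ) (slabCone T b) :=
    (contDiffOn_D (n := 0) relOpen_slabCone hζ 0).continuousOn
  let s : Set ℝ := {t | ∀ y : E3, ‖y‖ = 1 → 0 ≤ ζ ((t, 0), y)}
  suffices Icc 0 T ⊆ s from this ht x hx
  refine IsClosed.Icc_subset_of_forall_mem_nhdsWithin ?_ h0 ?_
  · refine isClosed_of_closure_subset fun t ht => ?_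
    have htI : t ∈ Icc 0 T := closure_minimal inter_subset_right isClosed_Icc ht
    refine ⟨fun y hy => ?_, htI⟩
    have hc : ContinuousWithinAt (fun t => ζ ((t, 0), y)) (s ∩ Icc 0 T) t :=
      ((hasDerivWithinAt_tau (hmem htI (hne hy)) (hd _ (hmem htI (hne hy)))).continuousWithinAt).mono
        inter_subset_right
    exact continuousWithinAt_const.closure_le ht hc fun t ht => ht.1 y hy
  rintro t ⟨hts, ht0, htT⟩
  have htI : t ∈ Icc 0 T := ⟨ht0, htT.le⟩
  have key : ∀ᶠ s' in 𝓝 t, ∀ y ∈ Metric.sphere (0 : E3) 1, ‖y‖ = 1 → s' ∈ Ioc t T → 0 ≤ ζ ((s', 0), y) := by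
    refine (isCompact_sphere (0 : E3) 1).eventually_forall_of_forall_eventually fun y hy => ?_
    have hy1 : ‖y‖ = 1 := by simpa using hy
    have hq := hmem htI (hne hy1)
    have hcont : Continuous fun p : ℝ × E3 => (((p.1, 0), p.2) : Spacetime) := by fun_prop
    have hpull : ∀ {P : Spacetime → Prop}, (∀ᶠ q in 𝓝[slabCone T b] ((t, 0), y), P q) →
        ∃ ε > 0, ∀ p ∈ Metric.ball ((t, y) : ℝ × E3) ε, ((p.1, 0), p.2) ∈ slabCone T b →
          P ((p.1, 0), p.2) := fun h => by
      have h1 := (hcont.tendsto (t, y)).eventually (eventually_nhdsWithin_iff.1 h)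
      exact Metric.eventually_nhds_iff_ball.1 h1
    rcases (hts y hy1).lt_or_eq with hpos | hzero
    · obtain ⟨ε, hε, h⟩ := hpull ((hd _ hq).continuousWithinAt.eventually (lt_mem_nhds hpos))
      filter_upwards [Metric.ball_mem_nhds _ hε] with p hp hpu hp1
      exact (h p hp (hmem ⟨ht0.trans hp1.1.le, hp1.2⟩ (hne hpu))).le
    · have hpos := hstep t htI hts y hy1 hzero.symm
      obtain ⟨ε, hε, h⟩ := hpull ((hD _ hq).eventually (lt_mem_nhds hpos))
      filter_upwards [Metric.ball_mem_nhds _ hε] with p hp hpu hp1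
      have hI : Icc t p.1 ⊆ Icc 0 T := Icc_subset_Icc ht0 hp1.2
      have hder : ∀ t' ∈ Icc t p.1, HasDerivWithinAt (fun t => ζ ((t, 0), p.2))
          (D T b 0 ζ ((t', 0), p.2)) (Icc 0 T) t' := fun t' ht' =>
        hasDerivWithinAt_tau (hmem (hI ht') (hne hpu)) (hd _ (hmem (hI ht') (hne hpu)))
      have hmono : MonotoneOn (fun t => ζ ((t, 0), p.2)) (Icc t p.1) := by
        refine monotoneOn_of_hasDerivWithinAt_nonneg (f' := fun t' => D T b 0 ζ ((t', 0), p.2))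
          (convex_Icc _ _) (fun t' ht' => ((hder t' ht').continuousWithinAt).mono hI)
          (fun t' ht' => (hder t' (interior_subset ht')).mono (interior_subset.trans hI))
          fun t' ht' => ?_
        have ht'' := interior_subset ht'
        refine (h (t', p.2) ?_ (hmem (hI ht'') (hne hpu))).le
        rw [Metric.mem_ball, Prod.dist_eq, max_lt_iff, Real.dist_eq] at hp ⊢
        refine ⟨lt_of_le_of_lt ?_ hp.1, hp.2⟩
        rw [abs_of_nonneg (sub_nonneg.2 ht''.1), abs_of_nonneg (sub_nonneg.2 hp1.1.le)]
        exact sub_le_sub_right ht''.2 _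
      exact (hts p.2 hpu).trans (hmono ⟨le_rfl, hp1.1.le⟩ ⟨hp1.1.le, le_rfl⟩ hp1.1.le)
  filter_upwards [nhdsWithin_le_nhds key, Ioc_mem_nhdsGT htT] with s' h1 h2 y hy
  exact h1 y (by simpa using hy) hy h2

namespace BondiMetric

variable {R : ℝ} [hR : Fact (0 < 1 / R)] {n : ℕ} {g : BondiMetric} {Λ : ℝ}

/-- The horizon starts at conformal infinity. -/
lemma mem_horizon_init {x : E3} (hx : ‖x‖ = 1) :
    (((0, 0), x) : Spacetime) ∈ g.horizon T R := by
  set q : Spacetime := ((0, 0), x)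
  have hq : q ∈ slab T R := ⟨⟨le_rfl, hT.out.le⟩, ⟨le_rfl, hR.out.le⟩, hx⟩
  let p : Covector := (g.W q / 2) • (ContinuousLinearMap.fst ℝ ℝ ℝ).comp
      (ContinuousLinearMap.fst ℝ (ℝ × ℝ) E3) -
    (ContinuousLinearMap.snd ℝ ℝ ℝ).comp (ContinuousLinearMap.fst ℝ (ℝ × ℝ) E3)
  refine ⟨{0}, fun _ => q, fun _ => p, x, 0, ⟨ordConnected_singleton, fun _ _ => hq, ?_, ?_⟩, rfl,
    rfl, ?_, rfl, rfl⟩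
  · rintro t rfl
    exact HasFDerivWithinAt.singleton
  · rintro t rfl
    exact HasFDerivWithinAt.singleton
  · have h : Matrix.mulVec (g.invAng q) (fun i => p ((0, 0), EuclideanSpace.single i 1)) = 0 := by
      have : (fun i => p ((0, 0), EuclideanSpace.single i 1)) = 0 := by ext i; simp [p]
      rw [this, Matrix.mulVec_zero]
    rw [sharp, h, N₂]
    simp [p]
    ring

lemma D_tau (i : Fin 5) {q : Spacetime} (hq : q ∈ slabCone T b) :
    D T b i (fun q => q.1.1) q = if i = 0 then 1 else 0 := by
  have h : HasFDerivAt (fun q : Spacetime => q.1.1) ((ContinuousLinearMap.fst ℝ ℝ ℝ).comp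
      (ContinuousLinearMap.fst ℝ (ℝ × ℝ) E3)) q :=
    ((ContinuousLinearMap.fst ℝ ℝ ℝ).comp (ContinuousLinearMap.fst ℝ (ℝ × ℝ) E3)).hasFDerivAt
  rw [D, h.hasFDerivWithinAt.fderivWithin (uniqueDiffOn_slabCone q hq), frame_eq]
  fin_cases i <;> simp

lemma D_z (i : Fin 5) {q : Spacetime} (hq : q ∈ slabCone T b) :
    D T b i (fun q => q.1.2) q = if i = 1 then 1 else 0 := by
  have h : HasFDerivAt (fun q : Spacetime => q.1.2) ((ContinuousLinearMap.snd ℝ ℝ ℝ).comp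
      (ContinuousLinearMap.fst ℝ (ℝ × ℝ) E3)) q :=
    ((ContinuousLinearMap.snd ℝ ℝ ℝ).comp (ContinuousLinearMap.fst ℝ (ℝ × ℝ) E3)).hasFDerivAt
  rw [D, h.hasFDerivWithinAt.fderivWithin (uniqueDiffOn_slabCone q hq), frame_eq]
  fin_cases i <;> simp

/-- The covectors with `ξ_z = 1`: the effect of a change of `ξ_τ`. -/
lemma frameG_quadratic (q : Spacetime) (ξ : Fin 5 → ℝ) (h1 : ξ 1 = 1) (e c : ℝ) :
    ∑ k, ∑ l, g.frameG k l q * (e * (ξ k - if k = 0 then c else 0)) *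
      (e * (ξ l - if l = 0 then c else 0)) =
      e ^ 2 * (∑ k, ∑ l, g.frameG k l q * ξ k * ξ l - 2 * c) := by
  have h : ∀ k l, g.frameG k l q = blockMatrix (g.W (radial q)) (fun k => g.frameU k (radial q))
    (fun k l => g.frameA k l (radial q)) k l := fun _ _ => rfl
  simp only [h, Fin.sum_univ_five, blockMatrix]
  simp [h1]
  ring

/-- Functions of `(τ, x)`. -/
def liftHor (Z : ℝ × E3 → ℝ) (q : Spacetime) : ℝ := (Z ∘ radial) (q.1.1, q.2)

section Lift

variable {Z : ℝ × E3 → ℝ} (hZ : SmoothOn 1 Z {a | a.1 ∈ Icc 0 T ∧ ‖a.2‖ = 1})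

include hZ

lemma contDiffOn_liftHor : ContDiffOn ℝ (1 : ℕ) (liftHor Z) (slabCone T b) :=
  ContDiffOn.comp hZ (t := cone {a | a.1 ∈ Icc 0 T ∧ ‖a.2‖ = 1})
    (f := fun q : Spacetime => (q.1.1, q.2)) (by fun_prop)
    fun q hq => ⟨hq.2.2, hq.1, norm_radial hq.2.2⟩

lemma D_liftHor (i : Fin 5) {q : Spacetime} (hq : q ∈ slabCone T b) :
    D T b i (liftHor Z) q = fderivWithin ℝ (Z ∘ radial) (cone {a | a.1 ∈ Icc 0 T ∧ ‖a.2‖ = 1})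
      (q.1.1, q.2) ((frame i q).1.1, (frame i q).2) := by
  have hm : MapsTo (fun q : Spacetime => (q.1.1, q.2)) (slabCone T b)
      (cone {a | a.1 ∈ Icc 0 T ∧ ‖a.2‖ = 1}) := fun q hq => ⟨hq.2.2, hq.1, norm_radial hq.2.2⟩
  let π : Spacetime →L[ℝ] ℝ × E3 := ((ContinuousLinearMap.fst ℝ ℝ ℝ).comp
    (ContinuousLinearMap.fst ℝ (ℝ × ℝ) E3)).prod (ContinuousLinearMap.snd ℝ (ℝ × ℝ) E3)
  have h1 := (hZ.differentiableOn (by simp) _ (hm hq)).hasFDerivWithinAt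
  have h2 := h1.comp q (π.hasFDerivWithinAt (s := slabCone T b)) hm
  rw [D]
  exact congrArg (fun L : Spacetime →L[ℝ] ℝ => L (frame i q))
    (h2.fderivWithin (uniqueDiffOn_slabCone q hq))

lemma D_liftHor_indep (i : Fin 5) {q q' : Spacetime} (hq : q ∈ slabCone T b)
    (hq' : q' ∈ slabCone T b) (h1 : q.1.1 = q'.1.1) (h2 : q.2 = q'.2) :
    D T b i (liftHor Z) q = D T b i (liftHor Z) q' := by
  rw [D_liftHor hZ i hq, D_liftHor hZ i hq', h1, h2]
  simp only [frame_eq, h2]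

lemma D_one_liftHor {q : Spacetime} (hq : q ∈ slabCone T b) : D T b 1 (liftHor Z) q = 0 := by
  rw [D_liftHor hZ 1 hq, frame_one]
  exact map_zero _

end Lift

/-- `ρ` is a defining function of the region, with causal differential. -/
structure IsDefining (T R : ℝ) (g : BondiMetric) (ρ : Spacetime → ℝ) : Prop where
  smooth : ContDiffOn ℝ (1 : ℕ) ρ (slabCone T (1 / R))
  D_z_pos : ∀ q ∈ slabCone T (1 / R), 0 < D T (1 / R) 1 ρ q
  causal : ∀ q ∈ slabCone T (1 / R), ‖q.2‖ = 1 → 0 < ρ q →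
    ∑ k, ∑ l, g.frameG k l q * D T (1 / R) k ρ q * D T (1 / R) l ρ q ≤ 0
  bot : ∀ q ∈ slabCone T (1 / R), q.1.2 = 0 → ρ q ≤ 0
  init : ∀ q ∈ slabCone T (1 / R), q.1.1 = 0 → 0 < q.1.2 → 0 < ρ q
  homog : Homog (slabCone T (1 / R)) ρ
  mem_regionBar : ∀ q ∈ slab T R, 0 < ρ q → q ∈ g.regionBar T R
  mem_region : ∀ q ∈ domainT T R, q ∈ g.region T R ↔ 0 < ρ q

/-- The points with `ρ > 0` are limits of interior points. -/
lemma mem_closure_region {ρ : Spacetime → ℝ}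
    (hρ : ContDiffOn ℝ (1 : ℕ) ρ (slabCone T (1 / R))) (hh : Homog (slabCone T (1 / R)) ρ)
    {A : Set Spacetime} (hA : ∀ q ∈ domainT T R, 0 < ρ q → q ∈ A) {q : Spacetime}
    (hq : q ∈ slab T R) (hpos : 0 < ρ q) : q ∈ closure A := by
  obtain ⟨hqK, hu⟩ := mem_slab_iff.1 hq
  obtain ⟨O, hO, hK⟩ := (continuousOn_iff'.1 hρ.continuousOn) (Ioi 0) isOpen_Ioi
  have hS : RelOpen T (1 / R) (slabCone T (1 / R) ∩ ρ ⁻¹' Ioi 0) :=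
    ⟨O, hO, by rw [inter_comm, hK, inter_comm]⟩
  have h1 := hS.subset_closure ⟨hqK, hpos⟩
  have h2 : ContinuousAt (radial : Spacetime → Spacetime) q := by
    have : q.2 ≠ 0 := hqK.2.2
    unfold radial
    exact continuousAt_fst.prodMk ((continuousAt_snd.norm.inv₀ (norm_ne_zero_iff.2 this)).smul
      continuousAt_snd)
  have h3 := mem_closure_image h2 h1
  rw [radial_eq hu] at h3
  refine closure_mono ?_ h3
  rintro _ ⟨q', ⟨⟨hqK', hpos'⟩, h4, h5⟩, rfl⟩
  have hq0 : q'.2 ≠ 0 := hqK'.2.2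
  refine hA _ ⟨h4, h5, norm_radial hq0⟩ ?_
  rw [(hh.radial hqK' hq0).2]
  exact hpos'

set_option maxHeartbeats 400000 in
/-- The region has a defining function. -/
lemma exists_defining (hΛ : Λ < 0) (hg : g.IsAsymptoticallyAdS Λ T R n)
    (hG : ∀ i j, ContDiffOn ℝ (1 : ℕ) (g.frameG i j) (slabCone T (1 / R)))
    (hreg : g.HasRegularHorizon T R) :
    ∃ ρ : Spacetime → ℝ, IsDefining T R g ρ := by
  obtain ⟨Z, hZ, hhor, hregion, hnull⟩ := hreg
  set K := slabCone T (1 / R)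
  have hζ : ContDiffOn ℝ (1 : ℕ) (liftHor Z) K := contDiffOn_liftHor hZ
  have hval : ∀ {q : Spacetime}, ‖q.2‖ = 1 → liftHor Z q = Z (q.1.1, q.2) := fun {q} h => by
    rw [liftHor, Function.comp_apply, radial_eq (q := (q.1.1, q.2)) h]
  have hdζ : ∀ q ∈ K, DifferentiableWithinAt ℝ (liftHor Z) K q := fun q hq =>
    diffWithin_of_contDiffOn hζ relOpen_slabCone one_ne_zero hq
  have hdz : ∀ q : Spacetime, DifferentiableWithinAt ℝ (fun q : Spacetime => q.1.2) K q :=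
    fun q => (by fun_prop)
  let F : Spacetime → ℝ := fun q => q.1.2 - liftHor Z q
  have hdF : ∀ q ∈ K, DifferentiableWithinAt ℝ F K q := fun q hq => (hdz q).sub (hdζ q hq)
  have hF : ContDiffOn ℝ (1 : ℕ) F K := ContDiffOn.sub (by fun_prop) hζ
  have hDF : ∀ i, ∀ q ∈ K, D T (1 / R) i F q = (if i = 1 then 1 else 0) -
      D T (1 / R) i (liftHor Z) q := fun i q hq => by
    rw [D_sub (hdz q) (hdζ q hq) hq, D_z i hq]
  have hDF1 : ∀ q ∈ K, D T (1 / R) 1 F q = 1 := fun q hq => by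
    rw [hDF 1 q hq, D_one_liftHor hZ hq]; simp
  have hchar : ∀ q ∈ slab T R, q.1.2 = liftHor Z q →
      ∑ k, ∑ l, g.frameG k l q * D T (1 / R) k F q * D T (1 / R) l F q = 0 := by
    intro q hq hz
    have hu : ‖q.2‖ = 1 := hq.2.2
    have h1 := hnull q ((hhor q hq).2 (hz.trans (hval hu))) _ rfl
    rw [hg.sharp_eq hq, map_sum] at h1
    refine Eq.trans ?_ h1
    rw [cone_slab]
    refine Finset.sum_congr rfl fun k _ => ?_
    rw [map_smul, smul_eq_mul, Finset.sum_mul]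
    refine Finset.sum_congr rfl fun l _ => ?_
    rw [frameG, Function.comp_apply, radial_eq hu]
    rw [show ∀ a b c : ℝ, a * b * c = a * c * b by intros; ring]
    rfl
  have hmem0 : ∀ {t : ℝ} {y : E3}, t ∈ Icc 0 T → ‖y‖ = 1 → (((t, 0), y) : Spacetime) ∈ slab T R :=
    fun ht hy => ⟨ht, ⟨le_rfl, hR.out.le⟩, hy⟩
  have hinit : ∀ x : E3, ‖x‖ = 1 → Z (0, x) = 0 := fun x hx =>
    ((hhor _ (hmem0 ⟨le_rfl, hT.out.le⟩ hx)).1 (mem_horizon_init hx)).symm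
  have hpos : ∀ {q : Spacetime}, q ∈ K → 0 ≤ liftHor Z q := by
    have h0 : ∀ {t : ℝ} {x : E3}, t ∈ Icc 0 T → ‖x‖ = 1 → 0 ≤ liftHor Z ((t, 0), x) := by
      intro t x ht hx
      refine nonneg_of_first_time hζ (fun x hx => ?_) ?_ ht hx
      · rw [hval (q := ((0, 0), x)) hx, hinit x hx]
      clear ht hx x
      intro t ht hmin x hx hx0
      have hqs := hmem0 ht hx
      have hq : (((t, 0), x) : Spacetime) ∈ K := (mem_slab_iff.1 hqs).1
      have hang : ∀ k : Fin 3, D T (1 / R) k.succ.succ (liftHor Z) ((t, 0), x) = 0 := by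
        intro k
        have h1 := hasDerivAt_rot k 0 hq (by rw [rotFlow_zero]; exact hdζ _ hq)
        rw [rotFlow_zero] at h1
        refine IsLocalMin.hasDerivAt_eq_zero ?_ h1
        refine .of_forall fun θ => ?_
        beta_reduce
        rw [rotFlow_zero, hx0]
        exact hmin _ (by rw [LinearIsometry.norm_map, hx])
      have h1 := hchar _ hqs hx0.symm
      have h2 : g.frameG 1 1 ((t, 0), x) = -Λ / 3 := by
        change g.W (radial ((t, 0), x)) = _
        rw [radial_eq (q := (((t, 0), x) : Spacetime)) hx, hg.W_infty _ hqs rfl]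
      have e0 := hDF 0 _ hq
      have e1 := hDF1 _ hq
      have e2 := hDF 2 _ hq
      have e3 := hDF 3 _ hq
      have e4 := hDF 4 _ hq
      rw [show D T (1 / R) 2 (liftHor Z) ((t, 0), x) = 0 from hang 0] at e2
      rw [show D T (1 / R) 3 (liftHor Z) ((t, 0), x) = 0 from hang 1] at e3
      rw [show D T (1 / R) 4 (liftHor Z) ((t, 0), x) = 0 from hang 2] at e4
      have g00 : g.frameG 0 0 ((t, 0), x) = 0 := rfl
      have g01 : g.frameG 0 1 ((t, 0), x) = 1 := rfl
      have g10 : g.frameG 1 0 ((t, 0), x) = 1 := rfl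
      simp only [Fin.sum_univ_five, e0, e1, e2, e3, e4, g00, g01, g10, h2] at h1
      simp [-one_div] at h1
      linarith
    intro q hq
    have := h0 hq.1 (norm_radial hq.2.2)
    have h1 : liftHor Z ((q.1.1, 0), (radial q).2) = liftHor Z q := congrArg Z (radial_radial (q.1.1, q.2))
    rwa [h1] at this
  have hcomp : ∀ f : Spacetime → ℝ, ContinuousOn f K → ∃ C : ℝ, 0 ≤ C ∧
      ∀ q ∈ K, ‖q.2‖ = 1 → |f q| ≤ C := fun f hf => by
    obtain ⟨C, hC⟩ := (isCompact_unitSlab (T := T) (b := 1 / R)).exists_bound_of_continuousOn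
      (hf.mono fun q hq => hq.1)
    exact ⟨max C 0, le_max_right _ _, fun q hq hu => (hC q ⟨hq, hu⟩).trans (le_max_left _ _)⟩
  choose C hC0 hC using fun k => hcomp _ (contDiffOn_D (n := 0) relOpen_slabCone hF k).continuousOn
  choose M hM0 hM using fun k l =>
    hcomp _ (contDiffOn_D (n := 0) relOpen_slabCone (hG k l) 1).continuousOn
  have hLip : ∀ k l, ∀ q ∈ K, ‖q.2‖ = 1 → 0 < F q →
      |g.frameG k l q - g.frameG k l ((q.1.1, liftHor Z q), q.2)| ≤ M k l * F q := by
    intro k l q hq hu hFq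
    have hz : liftHor Z q ∈ Icc 0 (1 / R) := ⟨hpos hq, by
      have := hq.2.1.2; simp only [F] at hFq; linarith⟩
    have hmemz : ∀ z ∈ Icc 0 (1 / R), (((q.1.1, z), q.2) : Spacetime) ∈ K := fun z hz =>
      ⟨hq.1, hz, hq.2.2⟩
    have := Convex.norm_image_sub_le_of_norm_hasDerivWithin_le (C := M k l)
      (f := fun z => g.frameG k l ((q.1.1, z), q.2))
      (fun z hz => hasDerivWithinAt_z (hmemz z hz) (diffWithin_of_contDiffOn (hG k l)
        relOpen_slabCone one_ne_zero (hmemz z hz)))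
      (fun z hz => hM k l _ (hmemz z hz) hu) (convex_Icc 0 (1 / R)) hz hq.2.1
    rwa [Real.norm_eq_abs, Real.norm_eq_abs, abs_of_pos (a := q.1.2 - _) hFq] at this
  let N : ℝ := ∑ k, ∑ l, M k l * C k * C l
  have hFcausal : ∀ q ∈ K, ‖q.2‖ = 1 → 0 < F q →
      ∑ k, ∑ l, g.frameG k l q * D T (1 / R) k F q * D T (1 / R) l F q ≤ N * F q := by
    intro q hq hu hFq
    set q0 : Spacetime := ((q.1.1, liftHor Z q), q.2)
    have hq0 : q0 ∈ K := ⟨hq.1, ⟨hpos hq, by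
      have := hq.2.1.2; simp only [F] at hFq; exact (sub_pos.1 hFq).le.trans this⟩, hq.2.2⟩
    have h0 := hchar q0 (mem_slab_iff.2 ⟨hq0, hu⟩) rfl
    have hDq : ∀ k, D T (1 / R) k F q0 = D T (1 / R) k F q := fun k => by
      rw [hDF k _ hq0, hDF k _ hq, D_liftHor_indep hZ k hq0 hq rfl rfl]
    simp only [hDq] at h0
    rw [← sub_zero (∑ k, ∑ l, g.frameG k l q * _ * _), ← h0, ← Finset.sum_sub_distrib,
      Finset.sum_mul]
    refine Finset.sum_le_sum fun k _ => ?_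
    rw [← Finset.sum_sub_distrib, Finset.sum_mul]
    refine Finset.sum_le_sum fun l _ => ?_
    rw [← sub_mul, ← sub_mul]
    refine (le_abs_self _).trans ?_
    rw [abs_mul, abs_mul]
    calc _ ≤ M k l * F q * C k * C l :=
          mul_le_mul (mul_le_mul (hLip k l q hq hu hFq) (hC k q hq hu) (abs_nonneg _)
            (mul_nonneg (hM0 k l) hFq.le)) (hC l q hq hu) (abs_nonneg _)
            (mul_nonneg (mul_nonneg (hM0 k l) hFq.le) (hC0 k))
      _ = _ := by ring
  let e : Spacetime → ℝ := fun q => Real.exp (-N * q.1.1)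
  have he : ∀ q, 0 < e q := fun q => Real.exp_pos _
  let ρ : Spacetime → ℝ := fun q => e q * F q
  have hρ : ∀ q, 0 < ρ q ↔ 0 < F q := fun q => mul_pos_iff_of_pos_left (he q)
  have hde : ∀ q, DifferentiableWithinAt ℝ e K q := fun q => by
    simp only [e]; fun_prop
  have hDρ : ∀ k, ∀ q ∈ K, D T (1 / R) k ρ q =
      e q * (D T (1 / R) k F q - if k = 0 then N * F q else 0) := by
    intro k q hq
    have hexp : HasDerivAt (fun x : ℝ => Real.exp (-N * x)) (Real.exp (-N * q.1.1) * -N) q.1.1 := by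
      simpa using ((hasDerivAt_id _).const_mul (-N)).exp
    have h1 := D_comp (T := T) (b := 1 / R) (f := fun q : Spacetime => q.1.1) hexp (by fun_prop) hq k
    rw [D_mul (hde q) (hdF q hq) hq, h1, D_tau k hq]
    simp only [e]
    split_ifs <;> ring
  have hρ1 : ContDiffOn ℝ (1 : ℕ) ρ K := ContDiffOn.mul (by simp only [e]; fun_prop) hF
  have hhom : Homog K ρ := fun q hq t ht => by
    refine ⟨smul_mem_slabCone hq ht, ?_⟩
    have h1 : liftHor Z (q.1, t • q.2) = liftHor Z q :=
      congrArg Z (radial_smul (q.1.1, q.2) ht)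
    simp only [ρ, e, F, h1]
  have hregion' : ∀ q ∈ domainT T R, q ∈ g.region T R ↔ 0 < ρ q := fun q hq => by
    rw [hregion q hq, hρ, ← hval (q := q) hq.2.2, sub_pos]
  refine ⟨ρ, hρ1, fun q hq => ?_, fun q hq hu hpos => ?_, fun q hq hz => ?_, fun q hq ht hz => ?_,
    hhom, fun q hq hpos => ⟨?_, fun h => ?_⟩, hregion'⟩
  · rw [hDρ 1 q hq, hDF1 q hq]
    simpa using he q
  · simp only [hDρ _ q hq]
    rw [frameG_quadratic q (fun k => D T (1 / R) k F q) (hDF1 q hq) (e q) (N * F q)]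
    have h1 := hFcausal q hq hu ((hρ q).1 hpos)
    have h2 : 0 ≤ N * F q := mul_nonneg (Finset.sum_nonneg fun k _ => Finset.sum_nonneg fun l _ =>
      mul_nonneg (mul_nonneg (hM0 k l) (hC0 k)) (hC0 l)) ((hρ q).1 hpos).le
    exact mul_nonpos_of_nonneg_of_nonpos (sq_nonneg _) (by linarith)
  · refine mul_nonpos_of_nonneg_of_nonpos (he q).le ?_
    simp only [F, hz]
    linarith [hpos hq]
  · rw [hρ]
    have h1 : liftHor Z q = 0 := by
      rw [liftHor, ht]; exact hinit _ (norm_radial hq.2.2)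
    simp only [F, h1]
    linarith
  · exact mem_closure_region hρ1 hhom (fun q hq => (hregion' q hq).2) hq hpos
  · have h1 := (hhor q hq).1 h
    rw [← hval (q := q) hq.2.2] at h1
    have h2 := (hρ q).1 hpos
    simp only [F, h1, sub_self, lt_irrefl] at h2

end BondiMetric

end

section

variable {T b : ℝ} [hT : Fact (0 < T)] [hb : Fact (0 < b)]

/-! ### Sobolev norms -/

lemma measurableEmbedding_prod (P : Type*) [MeasurableSpace P] :
    MeasurableEmbedding (Prod.map id Subtype.val : P × Sph → P × E3) :=
  MeasurableEmbedding.id.prodMap (MeasurableEmbedding.subtype_coe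
    Metric.isClosed_sphere.measurableSet)

lemma setLIntegral_cylMeasure {P : Type*} [MeasureSpace P] (S : Set (P × E3)) (h : P × E3 → ℝ≥0∞) :
    ∫⁻ q in S, h q ∂cylMeasure P =
      ∫⁻ p in {p : P × Sph | (p.1, (p.2 : E3)) ∈ S}, h (p.1, p.2)
        ∂((volume : Measure P).prod sphereMeasure) := by
  rw [cylMeasure, (measurableEmbedding_prod P).restrict_map,
    (measurableEmbedding_prod P).lintegral_map]
  rfl

lemma setLIntegral_cyl (a : ℝ) (h : ℝ × E3 → ℝ≥0∞) :
    ∫⁻ q in cyl a, h q ∂cylMeasure ℝ = ∫⁻ p, h (p.1, p.2) ∂stripMeasure 0 a := by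
  have h1 : {p : ℝ × Sph | (p.1, (p.2 : E3)) ∈ cyl a} = Ioo 0 a ×ˢ univ := by
    ext p; simp [cyl]
  rw [setLIntegral_cylMeasure, h1, ← Measure.prod_restrict, Measure.restrict_univ]

lemma measurableSet_inj {S : Set Spacetime} (hS : RelOpen T b S) :
    MeasurableSet {p : (ℝ × ℝ) × Sph | inj p ∈ S} := by
  obtain ⟨O, hO, rfl⟩ := hS
  rw [slabCone_eq]
  refine continuous_inj.measurable (MeasurableSet.inter ?_ hO.measurableSet)
  exact (measurableSet_Icc.prod measurableSet_Icc).prod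
    (measurableSet_singleton _).compl

lemma setLIntegral_slab {R : ℝ} [Fact (0 < 1 / R)] {S Ω : Set Spacetime}
    (hS : RelOpen T (1 / R) S) (hΩ : Ω ⊆ domainT T R) (hΩS : ∀ q ∈ domainT T R, q ∈ Ω ↔ q ∈ S)
    (h : Spacetime → ℝ≥0∞) :
    ∫⁻ q in Ω, h q ∂cylMeasure (ℝ × ℝ) =
      ∫⁻ p, {p | inj p ∈ S}.indicator (fun p => h (inj p)) p ∂slabMeasure T (1 / R) := by
  set D : Set ((ℝ × ℝ) × Sph) := (Ioo 0 T ×ˢ Ioo 0 (1 / R)) ×ˢ univ with hD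
  have h1 : {p : (ℝ × ℝ) × Sph | inj p ∈ Ω} = {p | inj p ∈ S} ∩ D := by
    ext p
    have hp : inj p ∈ domainT T R ↔ p ∈ D :=
      ⟨fun h => ⟨⟨h.1, h.2.1⟩, mem_univ _⟩, fun h => ⟨h.1.1, h.1.2, p.2.norm⟩⟩
    exact ⟨fun h => ⟨(hΩS _ (hΩ h)).1 h, hp.1 (hΩ h)⟩, fun h => (hΩS _ (hp.2 h.2)).2 h.1⟩
  have h2 : ((volume : Measure (ℝ × ℝ)).prod sphereMeasure).restrict D =
      slabMeasure T (1 / R) := by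
    rw [hD, ← Measure.prod_restrict, Measure.restrict_univ, Measure.volume_eq_prod,
      ← Measure.prod_restrict]
  rw [setLIntegral_cylMeasure]
  change ∫⁻ p in {p | inj p ∈ Ω}, h (inj p) ∂_ = _
  rw [h1, ← Measure.restrict_restrict (measurableSet_inj hS), h2,
    lintegral_indicator (measurableSet_inj hS)]

lemma eLpNorm_two_sq {X W : Type*} [MeasurableSpace X] [NormedAddCommGroup W] {μ : Measure X}
    (f : X → W) : eLpNorm f 2 μ ^ 2 = ∫⁻ x, ‖f x‖ₑ ^ 2 ∂μ := by
  have := eLpNorm_nnreal_pow_eq_lintegral (f := f) (μ := μ) (p := 2) two_ne_zero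
  simpa using this

lemma ofReal_norm_sq {W : Type*} [NormedAddCommGroup W] (x : W) :
    ENNReal.ofReal (‖x‖ ^ 2) = ‖x‖ₑ ^ 2 := by
  rw [ENNReal.ofReal_pow (norm_nonneg _), ofReal_norm]

lemma isOpen_cone_cyl (a : ℝ) : IsOpen (cone (cyl a)) := by
  have : cone (cyl a) = Ioo 0 a ×ˢ ({0}ᶜ : Set E3) := by
    ext q
    exact ⟨fun h => ⟨h.2.1, h.1⟩, fun h => ⟨h.2, h.1, norm_radial h.2⟩⟩
  rw [this]
  exact isOpen_Ioo.prod isOpen_compl_singleton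

lemma mem_cone_cyl {a : ℝ} {q : ℝ × E3} (h1 : q.1 ∈ Ioo 0 a) (h2 : q.2 ≠ 0) : q ∈ cone (cyl a) :=
  ⟨h2, h1, norm_radial h2⟩

/-- The derivatives of the data are bounded in `L²` by the Sobolev norm. -/
lemma l2Bound_data {ι : Type*} {a : ℝ} {N : ℕ} {φ : ι → ℝ × E3 → ℝ} {A : ι → ℝ}
    (hA : ∀ i, 0 ≤ A i)
    (hφ : ∀ i, SmoothOn N (φ i) (cyl a))
    (h : ∀ i, sobolevNorm N (φ i) (cyl a) ≤ ENNReal.ofReal (A i)) {j : ℕ} (hj : j ≤ N) :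
    L2Bound (stripMeasure 0 a) A
      fun i p => ‖iteratedFDeriv ℝ j (φ i ∘ radial) (p.1, (p.2 : E3))‖ := by
  refine ⟨fun i => WaveFamily.aemeasurable_strip ?_, 1, zero_le_one, fun i => ?_⟩
  · have h1 : ContinuousOn (iteratedFDeriv ℝ j (φ i ∘ radial)) (cone (cyl a)) := by
      have h2 := (hφ i).continuousOn_iteratedFDerivWithin (m := j) (by exact_mod_cast hj)
        (isOpen_cone_cyl a).uniqueDiffOn
      exact h2.congr fun q hq => (iteratedFDerivWithin_of_isOpen j (isOpen_cone_cyl a) hq).symm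
    exact h1.norm.comp (f := fun p : ℝ × Sph => (p.1, (p.2 : E3))) (by fun_prop)
      fun p hp => mem_cone_cyl hp.1 p.2.ne_zero
  · have h1 : eLpNorm (fun q => iteratedFDeriv ℝ j (φ i ∘ radial) q) 2
        ((cylMeasure ℝ).restrict (cyl a)) ≤ ENNReal.ofReal (A i) :=
      (Finset.single_le_sum (f := fun j => eLpNorm (fun q => iteratedFDeriv ℝ j (φ i ∘ radial) q) 2
        ((cylMeasure ℝ).restrict (cyl a))) (fun _ _ => zero_le)
        (Finset.mem_range_succ_iff.2 hj)).trans (h i)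
    have h2 := pow_le_pow_left₀ zero_le h1 2
    rw [eLpNorm_two_sq, setLIntegral_cyl a, ← ENNReal.ofReal_pow (hA i)] at h2
    rw [one_mul]
    simpa only [ofReal_norm_sq] using h2

lemma norm_iteratedFDerivWithin_comp_le {U : Set (ℝ × E3)} (hU : IsOpen U) {n : ℕ}
    {F : ℝ × E3 → ℝ} (hF : ContDiffOn ℝ n F U) {π : Spacetime →L[ℝ] ℝ × E3} (hπ : ‖π‖ ≤ 1)
    {S : Set Spacetime} (hS : RelOpen T b S) (hSU : MapsTo π S U) {j : ℕ} (hj : j ≤ n)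
    {q : Spacetime} (hq : q ∈ S) :
    ‖iteratedFDerivWithin ℝ j (F ∘ π) S q‖ ≤ ‖iteratedFDeriv ℝ j F (π q)‖ := by
  have hU' : IsOpen (π ⁻¹' U) := hU.preimage π.continuous
  have h1 : ContDiffAt ℝ j (F ∘ π) q :=
    ((hF.contDiffAt (hU.mem_nhds (hSU hq))).of_le (by exact_mod_cast hj)).comp q
      π.contDiff.contDiffAt
  rw [iteratedFDerivWithin_eq_iteratedFDeriv hS.uniqueDiffOn h1 hq,
    ← iteratedFDerivWithin_of_isOpen j hU' (hSU hq), π.iteratedFDerivWithin_comp_right hF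
      hU.uniqueDiffOn hU'.uniqueDiffOn (hSU hq) (by exact_mod_cast hj),
    iteratedFDerivWithin_of_isOpen j hU (hSU hq)]
  refine (ContinuousMultilinearMap.norm_compContinuousLinearMap_le _ _).trans ?_
  refine mul_le_of_le_one_right (norm_nonneg _) ?_
  exact Finset.prod_le_one (fun _ _ => norm_nonneg _) fun _ _ => hπ

/-- The derivatives of the extended data along the frame are bounded in `L²`. -/
lemma l2Bound_Dw_data {ι : Type*} {a : ℝ} {N : ℕ} {φ : ι → ℝ × E3 → ℝ} {A : ι → ℝ}
    (hA : ∀ i, 0 ≤ A i)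
    (hφ : ∀ i, SmoothOn N (φ i) (cyl a))
    (h : ∀ i, sobolevNorm N (φ i) (cyl a) ≤ ENNReal.ofReal (A i))
    {π : Spacetime →L[ℝ] ℝ × E3} (hπ : ‖π‖ ≤ 1) {S : Set Spacetime} (hS : RelOpen T b S)
    (hSU : MapsTo π S (cone (cyl a))) {σ : ℝ × Sph → Spacetime} (hσc : Continuous σ)
    (hσ : ∀ p : ℝ × Sph, p.1 ∈ Ioo 0 a → σ p ∈ S ∧ ‖(σ p).2‖ = 1 ∧ π (σ p) = (p.1, (p.2 : E3)))
    {w : List (Fin 5)} (hw : w.length ≤ N) :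
    L2Bound (stripMeasure 0 a) A fun i p => Dw T b w ((φ i ∘ radial) ∘ π) (σ p) := by
  obtain ⟨C, hC, hCw⟩ := abs_Dw_le (T := T) (b := b) w
  have hsm : ∀ i, ContDiffOn ℝ w.length ((φ i ∘ radial) ∘ π) S := fun i =>
    (ContDiffOn.comp (hφ i) π.contDiff.contDiffOn hSU).of_le (by exact_mod_cast hw)
  refine ((L2Bound.sum (Finset.range (w.length + 1)) fun j hj => l2Bound_data hA hφ h (j := j)
    ((Finset.mem_range_succ_iff.1 hj).trans hw)).const_mul C).of_abs_le (fun i => ?_) fun i => ?_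
  · refine WaveFamily.aemeasurable_strip ?_
    have hc := (contDiffOn_Dw (n := 0) hS w (by simpa using hsm i)).continuousOn
    exact hc.comp hσc.continuousOn fun p hp => (hσ p hp.1).1
  · filter_upwards [ae_strip 0 a] with p hp
    obtain ⟨h1, h2, h3⟩ := hσ p hp
    refine ((hCw S _ hS (hsm i) _ h1 h2).trans ?_).trans (le_abs_self _)
    refine mul_le_mul_of_nonneg_left (Finset.sum_le_sum fun j hj => ?_) hC
    have := norm_iteratedFDerivWithin_comp_le (isOpen_cone_cyl a) (hφ i) hπ hS hSU
      ((Finset.mem_range_succ_iff.1 hj).trans hw) h1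
    rwa [h3] at this

namespace WaveFamily

variable {ι : Type*} {m : ℕ} (F : WaveFamily ι T b m)

lemma l2Bound_indicator {w : List (Fin 5)} (hw : w.length ≤ m + 1) :
    L2Bound (slabMeasure T b) F.A fun i =>
      {p | inj p ∈ F.S i}.indicator fun p => Dw T b w (F.v i) (inj p) := by
  obtain ⟨C, hC, h⟩ := F.lintegral_le hw
  have hmeas := fun i => measurableSet_inj (F.S_relOpen i)
  refine ⟨fun i => ?_, C, hC, fun i => le_trans ?_ (h i)⟩
  · rw [aemeasurable_indicator_iff (hmeas i)]
    exact ((F.continuousOn_Dw (by omega) i).comp continuous_inj.continuousOn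
      fun p hp => hp).aemeasurable (hmeas i)
  · have h1 : ∀ p, ENNReal.ofReal (({p | inj p ∈ F.S i}.indicator
        (fun p => Dw T b w (F.v i) (inj p)) p) ^ 2) = {p | inj p ∈ F.S i}.indicator
        (fun p => ENNReal.ofReal (Dw T b w (F.v i) (inj p) ^ 2)) p := fun p => by
      by_cases hp : p ∈ {p | inj p ∈ F.S i}
      · simp only [indicator_of_mem hp]
      · simp [indicator_of_notMem hp]
    simp only [h1]
    refine (lintegral_indicator_le _ _).trans (lintegral_mono_set fun p hp => ?_)
    exact hp.2

/-- The energy estimate for the full derivatives. -/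
lemma lintegral_iteratedFDeriv_le (hF : ∀ i, Homog (F.S i) (F.v i)) {j : ℕ} (hj : j ≤ m + 1) :
    ∃ C : ℝ, 0 ≤ C ∧ ∀ i, ∫⁻ p, {p | inj p ∈ F.S i}.indicator
      (fun p => ‖iteratedFDerivWithin ℝ j (F.v i) (F.S i) (inj p)‖ₑ ^ 2) p ∂slabMeasure T b ≤
        ENNReal.ofReal (C * F.A i ^ 2) := by
  obtain ⟨K, hK, hle⟩ := norm_iteratedFDerivWithin_le (T := T) (b := b) j
  obtain ⟨-, C, hC, h⟩ := (L2Bound.sum (words j) fun w hw =>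
    (F.l2Bound_indicator ((mem_words.1 hw).trans hj)).abs).const_mul K
  refine ⟨C, hC, fun i => le_trans (lintegral_mono fun p => ?_) (h i)⟩
  by_cases hp : p ∈ {p | inj p ∈ F.S i}
  · simp only [indicator_of_mem hp]
    rw [← ofReal_norm_sq]
    refine ENNReal.ofReal_le_ofReal (pow_le_pow_left₀ (norm_nonneg _) ?_ 2)
    exact hle _ _ (F.S_relOpen i) ((F.v_smooth i).of_le (by exact_mod_cast (by omega))) (hF i) _ hp
      p.2.norm
  · simp [indicator_of_notMem hp]

end WaveFamily

end

section

/-! ### The family of all solutions -/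

/-- The solutions of the null-timelike problem, with an upper bound `A` for the norm of the data. -/
structure Datum (m : ℕ) (T R : ℝ) (B : ℝ≥0) (δ : ℝ) where
  Λ : ℝ
  g : BondiMetric
  ω : Spacetime → ℝ
  φ : ℝ × E3 → ℝ
  ψ : ℝ × E3 → ℝ
  v : Spacetime → ℝ
  A : ℝ
  Λ_neg : Λ < 0
  metric : g.IsAsymptoticallyAdS Λ T R (2 * m + 1)
  horizon : g.HasRegularHorizon T R
  ω_smooth : SmoothOn (2 * m) ω (slab T R)
  g_bound : g.invNorm (2 * m + 1) (domainT T R) ≤ B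
  ω_bound : ckNorm (2 * m) ω (domainT T R) ≤ B
  η_bound : ∀ q ∈ slab T R, δ ≤ Real.exp (2 * g.η q)
  W_bound : ∀ q ∈ slab T R, q.1.2 = 1 / R → δ ≤ g.W q
  φ_smooth : SmoothOn (2 * m + 2) φ (cyl (1 / R))
  ψ_smooth : SmoothOn (2 * m + 2) ψ (cyl T)
  solution : IsSolution g T R (2 * m + 2) ω φ ψ v
  A_nonneg : 0 ≤ A
  φ_bound : sobolevNorm (2 * m + 2) φ (cyl (1 / R)) ≤ ENNReal.ofReal A
  ψ_bound : sobolevNorm (2 * m + 2) ψ (cyl T) ≤ ENNReal.ofReal A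

/-- The projection to `(z, x)`. -/
def projZ : Spacetime →L[ℝ] ℝ × E3 :=
  ((ContinuousLinearMap.snd ℝ ℝ ℝ).comp (ContinuousLinearMap.fst ℝ (ℝ × ℝ) E3)).prod
    (ContinuousLinearMap.snd ℝ (ℝ × ℝ) E3)

/-- The projection to `(τ, x)`. -/
def projTau : Spacetime →L[ℝ] ℝ × E3 :=
  ((ContinuousLinearMap.fst ℝ ℝ ℝ).comp (ContinuousLinearMap.fst ℝ (ℝ × ℝ) E3)).prod
    (ContinuousLinearMap.snd ℝ (ℝ × ℝ) E3)

lemma norm_projZ_le : ‖projZ‖ ≤ 1 :=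
  ContinuousLinearMap.opNorm_le_bound _ zero_le_one fun q => by
    rw [one_mul]
    exact max_le ((norm_snd_le q.1).trans (norm_fst_le q)) (norm_snd_le q)

lemma norm_projTau_le : ‖projTau‖ ≤ 1 :=
  ContinuousLinearMap.opNorm_le_bound _ zero_le_one fun q => by
    rw [one_mul]
    exact max_le ((norm_fst_le q.1).trans (norm_fst_le q)) (norm_snd_le q)

namespace Datum

variable {m : ℕ} {T R : ℝ} {B : ℝ≥0} {δ : ℝ} [hT : Fact (0 < T)] [hR : Fact (0 < 1 / R)]

lemma contDiffOn_frameG (x : Datum m T R B δ) (i j : Fin 5) :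
    ContDiffOn ℝ (2 * m + 1 : ℕ) (x.g.frameG i j) (slabCone T (1 / R)) :=
  Dom.contDiffOn (BondiMetric.ub_frameG (ι := Datum m T R B δ) (fun x => x.metric)
    (fun x => x.g_bound) i j) x

lemma exists_ρ (x : Datum m T R B δ) : ∃ ρ, BondiMetric.IsDefining T R x.g ρ :=
  BondiMetric.exists_defining x.Λ_neg x.metric
  (fun i j => (x.contDiffOn_frameG i j).of_le (by exact_mod_cast (by omega))) x.horizon

/-- The defining function of the region. -/
def ρ (x : Datum m T R B δ) : Spacetime → ℝ := x.exists_ρ.choose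

lemma ρ_spec (x : Datum m T R B δ) : BondiMetric.IsDefining T R x.g x.ρ :=
  x.exists_ρ.choose_spec

/-- The cone over the region. -/
def S (x : Datum m T R B δ) : Set Spacetime := {q | q ∈ slabCone T (1 / R) ∧ 0 < x.ρ q}

lemma S_relOpen (x : Datum m T R B δ) : RelOpen T (1 / R) x.S := by
  obtain ⟨O, hO, h⟩ := (continuousOn_iff'.1 x.ρ_spec.smooth.continuousOn) (Ioi 0) isOpen_Ioi
  refine ⟨O, hO, ?_⟩
  ext q
  have := Set.ext_iff.1 h q
  simp only [mem_inter_iff, mem_preimage, mem_Ioi, S, mem_ofPred_eq] at this ⊢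
  tauto

lemma S_homog (x : Datum m T R B δ) (f : Spacetime → ℝ) : Homog x.S (f ∘ radial) := by
  intro q hq t ht
  have h := x.ρ_spec.homog q hq.1 t ht
  exact ⟨⟨h.1, h.2.symm ▸ hq.2⟩, congrArg f (radial_smul _ ht)⟩

lemma radial_mem_regionBar (x : Datum m T R B δ) {q : Spacetime} (hq : q ∈ x.S) :
    radial q ∈ x.g.regionBar T R :=
  x.ρ_spec.mem_regionBar _ (BondiMetric.radial_mem_slab hq.1)
    ((x.S_homog x.v).radial hq hq.1.2.2).1.2

lemma S_subset_cone (x : Datum m T R B δ) : x.S ⊆ cone (x.g.regionBar T R) := fun _ hq =>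
  ⟨hq.1.2.2, x.radial_mem_regionBar hq⟩

lemma contDiffOn_v (x : Datum m T R B δ) : ContDiffOn ℝ (2 * m + 2 : ℕ) (x.v ∘ radial) x.S :=
  x.solution.smooth.mono x.S_subset_cone

lemma mem_region_iff (x : Datum m T R B δ) {q : Spacetime} (hq : q ∈ domainT T R) :
    q ∈ x.g.region T R ↔ q ∈ x.S := by
  rw [x.ρ_spec.mem_region q hq]
  exact ⟨fun h => ⟨⟨Ioo_subset_Icc_self hq.1, Ioo_subset_Icc_self hq.2.1,
    mem_unitSlab_ne hq.2.2⟩, h⟩, fun h => h.2⟩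

lemma contDiffOn_ω (x : Datum m T R B δ) :
    ContDiffOn ℝ (2 * m : ℕ) (x.ω ∘ radial) (slabCone T (1 / R)) := by
  have := x.ω_smooth; rwa [SmoothOn, cone_slab] at this

variable (m T R B δ) in
/-- The family of all solutions. -/
def family (hδ : 0 < δ) : WaveFamily (Datum m T R B δ) T (1 / R) m where
  ρ := ρ
  G k l x := x.g.frameG k l
  β k x := BondiMetric.frameβ T R x.g k
  ω x := x.ω ∘ radial
  v x := x.v ∘ radial
  Φ x := (x.φ ∘ radial) ∘ projZ
  Ψ x := (x.ψ ∘ radial) ∘ projTau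
  A := A
  ρ_smooth x := x.ρ_spec.smooth
  ρ_z x q hq _ := x.ρ_spec.D_z_pos q hq
  ρ_causal x := x.ρ_spec.causal
  ρ_bot x := x.ρ_spec.bot
  ρ_init x := x.ρ_spec.init
  G_ub k l := BondiMetric.ub_frameG (fun x => x.metric) (fun x => x.g_bound) k l
  β_ub k := BondiMetric.ub_frameβ (fun x => x.metric) (fun x => x.g_bound) hδ
    (fun x => x.η_bound) k
  ω_ub := ub_of_ckNorm (fun x => x.ω_smooth) fun x => x.ω_bound
  G_symm k l x q hq := x.metric.frameG₁_symm (BondiMetric.radial_mem_slab hq) k l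
  G_zero_zero _ _ _ := rfl
  G_zero_one _ _ _ := rfl
  G_zero_ang k _ _ _ := by fin_cases k <;> rfl
  G_ang := BondiMetric.exists_frameG_coercive (fun x => x.metric) (fun x => x.g_bound) hδ
    fun x => x.η_bound
  G_bdry := ⟨δ, hδ, fun x q hq hu hz => by
    have := x.W_bound q (mem_slab_iff.2 ⟨hq, hu⟩) hz
    change δ ≤ x.g.W (radial q)
    rwa [radial_eq hu]⟩
  v_smooth x := x.contDiffOn_v
  v_eq x q hq hpos := by
    refine BondiMetric.waveOp_eq_zero (n := 2 * m) x.metric x.contDiffOn_frameG x.S_relOpen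
      (x.contDiffOn_v.of_le (by exact_mod_cast (by omega))) (x.S_homog x.v)
      (x.contDiffOn_ω.of_le (by exact_mod_cast (by omega))) (fun q hq hu h1 h2 => ?_) ⟨hq, hpos⟩
    exact x.solution.equation q ((x.mem_region_iff ⟨h1, h2, hu⟩).2 hq)
  Φ_smooth x := ContDiffOn.comp x.φ_smooth projZ.contDiff.contDiffOn
    fun q hq => mem_cone_cyl hq.2 hq.1.2.2
  Ψ_smooth x := ContDiffOn.comp x.ψ_smooth projTau.contDiff.contDiffOn
    fun q hq => mem_cone_cyl hq.2 hq.1.2.2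
  v_init x q hq hpos h0 := x.solution.initial _ (x.radial_mem_regionBar ⟨hq, hpos⟩) h0
  v_bdry x q hq hpos h0 := x.solution.boundary _ (x.radial_mem_regionBar ⟨hq, hpos⟩) h0
  Φ_bound w hw := by
    have hR' := hR.out
    exact (l2Bound_Dw_data (T := T) (b := 1 / R) (fun x : Datum m T R B δ => x.A_nonneg)
      (fun x => x.φ_smooth) (fun x => x.φ_bound) norm_projZ_le WaveFamily.relOpen_z
      (fun q hq => mem_cone_cyl hq.2 hq.1.2.2) (σ := fun p => ((0, p.1), p.2)) (by fun_prop)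
      (fun p hp => ⟨⟨⟨⟨le_rfl, hT.out.le⟩, Ioo_subset_Icc_self hp, p.2.ne_zero⟩, hp⟩, p.2.norm, rfl⟩)
      hw).2
  Ψ_bound w hw := by
    have hR' := hR.out
    exact (l2Bound_Dw_data (T := T) (b := 1 / R) (fun x : Datum m T R B δ => x.A_nonneg)
      (fun x => x.ψ_smooth) (fun x => x.ψ_bound) norm_projTau_le WaveFamily.relOpen_tau
      (fun q hq => mem_cone_cyl hq.2 hq.1.2.2) (σ := fun p => ((p.1, 1 / R), p.2)) (by fun_prop)
      (fun p hp => ⟨⟨⟨Ioo_subset_Icc_self hp, ⟨hR'.le, le_rfl⟩, p.2.ne_zero⟩, hp⟩, p.2.norm, rfl⟩)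
      hw).2

/-- The a priori estimate. -/
theorem sobolevNorm_le (m : ℕ) (T R : ℝ) (B : ℝ≥0) (δ : ℝ) [Fact (0 < T)] [Fact (0 < 1 / R)]
    (hδ : 0 < δ) : ∃ C : ℝ≥0, ∀ x : Datum m T R B δ,
      sobolevNorm (m + 1) x.v (x.g.region T R) ≤ C * ENNReal.ofReal x.A := by
  have h := fun j : Fin (m + 2) => (family m T R B δ hδ).lintegral_iteratedFDeriv_le
    (fun x => x.S_homog x.v) (j := j) (by omega)
  choose C hC h using h
  refine ⟨∑ j, (Real.sqrt (C j)).toNNReal, fun x => ?_⟩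
  rw [sobolevNorm, Finset.sum_range, ENNReal.ofNNReal_finsetSum, Finset.sum_mul]
  refine Finset.sum_le_sum fun j _ => ?_
  have h1 : eLpNorm (fun q => iteratedFDeriv ℝ j (x.v ∘ radial) q) 2
      ((cylMeasure (ℝ × ℝ)).restrict (x.g.region T R)) ^ 2 ≤
      (((Real.sqrt (C j)).toNNReal : ℝ≥0∞) * ENNReal.ofReal x.A) ^ 2 := by
    rw [eLpNorm_two_sq, setLIntegral_slab x.S_relOpen (Ω := x.g.region T R) inter_subset_right
      fun q hq => x.mem_region_iff hq]
    have h2 : (((Real.sqrt (C j)).toNNReal : ℝ≥0∞) * ENNReal.ofReal x.A) ^ 2 =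
        ENNReal.ofReal (C j * x.A ^ 2) := by
      change (ENNReal.ofReal _ * _) ^ 2 = _
      rw [← ENNReal.ofReal_mul (Real.sqrt_nonneg _),
        ← ENNReal.ofReal_pow (mul_nonneg (Real.sqrt_nonneg _) x.A_nonneg), mul_pow,
        Real.sq_sqrt (hC j)]
    rw [h2]
    refine le_trans (lintegral_mono_ae ?_) (h j x)
    filter_upwards [ae_slab (T := T) (b := 1 / R)] with p hp
    refine indicator_le_indicator' fun hpS => le_of_eq ?_
    have hpS' : inj p ∈ x.S := hpS
    have hn : x.S ∈ 𝓝 (inj p) := by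
      have h3 := x.S_relOpen.mem_nhdsWithin hpS'
      rwa [nhdsWithin_eq_nhds.2 (slabCone_mem_nhds hp.1 hp.2 p.2.ne_zero)] at h3
    have h4 := iteratedFDerivWithin_eq_iteratedFDeriv (n := j) x.S_relOpen.uniqueDiffOn
      ((x.contDiffOn_v.contDiffAt hn).of_le (by exact_mod_cast (by omega))) hpS'
    exact congrArg (fun L => ‖L‖ₑ ^ 2) h4.symm
  exact (ENNReal.pow_right_strictMono two_ne_zero).le_iff_le.1 h1

end Datum

end

end NullTimelike

end

theorem mainTheorem4 (k : ℕ) (hk : 1 ≤ k) (T R : ℝ) (hT : 0 < T) (hR : 0 < R)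
    (B : ℝ≥0) (δ : ℝ) (hδ : 0 < δ) :
    ∃ C : ℝ≥0, ∀ (Λ : ℝ) (g : NullTimelike.BondiMetric) (ω : NullTimelike.Spacetime → ℝ)
      (φ ψ : ℝ × NullTimelike.E3 → ℝ) (v : NullTimelike.Spacetime → ℝ),
      Λ < 0 →
      g.IsAsymptoticallyAdS Λ T R (2 * k - 1) →
      g.HasRegularHorizon T R →
      NullTimelike.SmoothOn (2 * k - 2) ω (NullTimelike.slab T R) →
      g.invNorm (2 * k - 1) (NullTimelike.domainT T R) ≤ B →
      NullTimelike.ckNorm (2 * k - 2) ω (NullTimelike.domainT T R) ≤ B →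
      (∀ q ∈ NullTimelike.slab T R, δ ≤ Real.exp (2 * g.η q)) →
      (∀ q ∈ NullTimelike.slab T R, q.1.2 = 1 / R → δ ≤ g.W q) →
      NullTimelike.SmoothOn (2 * k) φ (NullTimelike.cyl (1 / R)) →
      NullTimelike.SmoothOn (2 * k) ψ (NullTimelike.cyl T) →
      NullTimelike.IsSolution g T R (2 * k) ω φ ψ v →
      NullTimelike.sobolevNorm k v (g.region T R) ≤
        C * (NullTimelike.sobolevNorm (2 * k) φ (NullTimelike.cyl (1 / R)) +
          NullTimelike.sobolevNorm (2 * k) ψ (NullTimelike.cyl T)) := by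
  obtain ⟨m, rfl⟩ : ∃ m, k = m + 1 := ⟨k - 1, by omega⟩
  have e1 : 2 * (m + 1) - 1 = 2 * m + 1 := by omega
  have e2 : 2 * (m + 1) - 2 = 2 * m := by omega
  have e3 : 2 * (m + 1) = 2 * m + 2 := by omega
  have : Fact (0 < T) := ⟨hT⟩
  have : Fact (0 < 1 / R) := ⟨by positivity⟩
  obtain ⟨C, hC⟩ := NullTimelike.Datum.sobolevNorm_le m T R B δ hδ
  refine ⟨C + 1, fun Λ g ω φ ψ v hΛ hg hhor hω hgB hωB hη hW hφ hψ hv => ?_⟩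
  rw [e1] at hg hgB
  rw [e2] at hω hωB
  rw [e3] at hφ hψ hv ⊢
  set N := NullTimelike.sobolevNorm (2 * m + 2) φ (NullTimelike.cyl (1 / R)) +
    NullTimelike.sobolevNorm (2 * m + 2) ψ (NullTimelike.cyl T) with hN
  by_cases hfin : N = ⊤
  · rw [hfin, ENNReal.mul_top (by simp)]
    exact le_top
  have hA : ENNReal.ofReal N.toReal = N := ENNReal.ofReal_toReal hfin
  have h := hC
    { Λ := Λ, g := g, ω := ω, φ := φ, ψ := ψ, v := v, A := N.toReal, Λ_neg := hΛ, metric := hg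
      horizon := hhor, ω_smooth := hω, g_bound := hgB, ω_bound := hωB, η_bound := hη
      W_bound := hW, φ_smooth := hφ, ψ_smooth := hψ, solution := hv
      A_nonneg := ENNReal.toReal_nonneg, φ_bound := by rw [hA]; exact le_self_add
      ψ_bound := by rw [hA]; exact le_add_self }
  change NullTimelike.sobolevNorm (m + 1) v (g.region T R) ≤ C * ENNReal.ofReal N.toReal at h
  rw [hA] at h
  refine h.trans ?_
  gcongr
  exact_mod_cast le_self_add
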